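/- Let $e\in\mathbb R\setminus\{0\}$ (elementary charge) and $m>0$ (mass). **Conventions.** Minkowski space is $\mathbb R^4$ with $x\cdot y=x^0y^0-\vec x\cdot\vec y$; $l$ runs over nonzero future-pointing null vectors, $v$ over the hyperboloid $v\cdot v=1$, $v^0>0$, with invariant measure $d\mu(v)=d^3v/v^0$. For functions $F$ of $l$ homogeneous of degree $-2$, $\int F(l)\,d^2l$ is the integral over the unit sphere $\{l^0=1\}$. $L_{ab}=l_a\partial_b-l_b\partial_a$; a dot means $\partial/\partial s$; $t$ is the unit vector of the time axis. **Test fields.** $\mathcal V$ is the real vector space of smooth functions $V_a(s,l)$ with $V(\mu s,\mu l)=\mu^{-1}V(s,l)$ for $\mu>0$, $l\cdot V(s,l)=0$, $V(+\infty,l)=0$, $L_{[ab}V_{c]}(-\infty,l)=0$ (with a smooth limit function $V(-\infty,l)$), and such that every $L_{b_1c_1}\cdots L_{b_kc_k}\dot V_a(s,l)$ is bounded by $\mathrm{const}\,(t\cdot l)^{-2}(1+|s|/t\cdot l)^{-1-\epsilon}$ for some $\epsilon>0$. Put $$\{V_1,V_2\}=\frac1{4\pi}\int(\dot V_1\cdot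 V_2-\dot V_2\cdot V_1)(s,l)\,ds\,d^2l,\qquad \Phi_V(l)=\frac1{4\pi}\int\frac{l\cdot V(-\infty,l')}{l\cdot l'}\,d^2l',\qquad V^e(v,l)=\frac{e\,v}{v\cdot l}$$ (the first formula also for $V_2=V^e(v,\cdot)$, which does not depend on $s$). $L=\mathcal V/\!\sim$, where $V_1\sim V_2$ iff $V_2-V_1=l\,\alpha(s,l)$ with $\frac1{4\pi}\int\alpha(-\infty,l)\,d^2l\in\frac{2\pi}e\mathbb Z$; $(V)$ is the class of $V$. **Field algebra.** $\mathcal K$ is the Hilbert space of classes of functions $g(v)\in\mathbb C^4$ with scalar product $(f,g)=\int\overline{f(v)}\,\gamma\cdot v\,g(v)\,d\mu(v)$, $\overline f=f^\dagger\gamma^0$. Let $(S_\Phi g)(v)=\exp\bigl(\frac{ie}{4\pi}\int\frac{\Phi(l)}{(v\cdot l)^2}d^2l\bigr)g(v)$, $(R_xg)(v)=e^{im\,x\cdot v\,\gamma\cdot v}g(v)$, $(T_xV)(s,l)=V(s-x\cdot l,l)$, and $g_\pm=P_\pm g=\frac12(1\pm\gamma\cdot v)g$. The asymptotic field algebra $\mathcal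 F$ is the completion, in the maximal C*-norm, of the unital *-algebra generated by $W(V)$, $(V)\in L$, and $B(g)$, $g\in\mathcal K$ (antilinear in $g$), with relations $$W(V)^*=W(-V),\quad W(0)=1,\quad W(V_1)W(V_2)=e^{-\frac i2\{V_1,V_2\}}W(V_1+V_2),$$ $$[B(f),B(g)]_+=0,\quad [B(f),B(g)^*]_+=(f,g)1,\quad W(V)B(g)=B(S_{\Phi_V}g)W(V).$$ The Weyl algebra CCR and the algebra CAR are the C*-subalgebras generated by all $W(V)$, respectively all $B(g)$; *CAR is the *-algebra generated by all $B(g)$. Translations are the automorphisms $\alpha_x(W(V))=W(T_xV)$, $\alpha_x(B(g))=B(R_xg)$; $\beta_{\Phi}(B(g))=B(S_{\Phi}g)$ defines automorphisms of CAR. The observable algebra $\mathcal A\subset\mathcal F$ consists of the elements invariant under $A\mapsto W(V)AW(V)^*$ for all $V\in\mathcal V$ with $l\wedge V=0$. **Representations** are unital *-representations by bounded operators on complex Hilbert spaces. A representation $\pi$ of $\mathcal F$ (or of CCR) satisfies *Borchers' criterion* iff there is a strongly continuous unitary representation $U(x)$ of the translation group, with spectrum in the closed forward lightcone (with $U(x)=e^{ix\cdot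 P}$), such that $\pi(\alpha_xA)=U(x)\pi(A)U(-x)$ for all $A$ in $\mathcal F$ (in CCR). It is *regular* iff $\lambda\mapsto\pi(W(\lambda V))$ is strongly continuous for every $V\in\mathcal V$. It is *irreducible* iff its space is nonzero and has no closed invariant subspaces other than $0$ and the whole space. A *positive-energy Fock representation* of CAR is a representation $\pi_F$ on a Hilbert space $\mathcal H_F$ with a cyclic unit vector $\Omega_F$ such that $\pi_F(B(g_+))\Omega_F=0=\pi_F(B(g_-))^*\Omega_F$ for all $g\in\mathcal K$. Given such $\pi_F$ and a representation $\pi_r$ of CCR on $\mathcal H_r$, the *product representation* of $\pi_F$ and $\pi_r$ is the representation $\pi$ of $\mathcal F$ on $\mathcal H_F\otimes\mathcal H_r$ with $$\pi(C)=\pi_F(C)\otimes 1,\qquad \pi(W(V))\bigl[\pi_F(C)\Omega_F\otimes\varphi\bigr]=\pi_F(\beta_{\Phi_V}C)\Omega_F\otimes\pi_r(W(V))\varphi\qquad(C\in\mathrm{CAR}).$$ **Theorem.** A positive-energy Fock representation $\pi_F$ of CAR exists, and for every such $\pi_F$ the following holds. (i) A representation $\pi$ of $\mathcal F$ satisfies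 Borchers' criterion if and only if there is a representation $\pi_r$ of CCR satisfying Borchers' criterion such that $\pi$ is unitarily equivalent to a product representation of $\pi_F$ and $\pi_r$. For every $\pi_r$ satisfying Borchers' criterion the product representation exists and is unique; call it $\pi'$. In it the Gauss constraint is recovered in the von Neumann algebra $\pi'(\mathcal A)''$: for all $V\in\mathcal V$ $$\pi'(W(V))=\exp\Bigl(-i\int:\overline{b(v)}\,\gamma\cdot v\,b(v):\,\{V,V^e(v,\cdot)\}\,d\mu(v)\Bigr)\otimes\pi_r(W(V)),$$ and $\pi'(W(V))$ as well as $\exp(\dots)\otimes1$ belong to $\pi'(\mathcal A)''$. Here $\pi_F(B(g))=\int\overline{g(v)}\,\gamma\cdot v\,b(v)\,d\mu(v)$ and, for a bounded measurable real function $\theta$, $N_\theta=\int:\overline{b}\,\gamma\cdot v\,b:\theta\,d\mu$ is the operator on the domain $\pi_F({}^*\mathrm{CAR})\Omega_F$, mapping this domain into itself, given for arbitrary orthonormal bases $(e^\pm_k)$ of $P_\pm\mathcal K$ by $$N_\theta\psi=\sum_k\pi_F(B(e^+_k))^*\pi_F(B(\theta e^+_k))\psi-\sum_k\pi_F(B(\theta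 e^-_k))\pi_F(B(e^-_k))^*\psi ,$$ and $\exp(-iN_\theta)$ is the unitary operator given on this domain by the norm-convergent exponential series. Moreover, for every $\pi_r$ satisfying Borchers' criterion and every representation $\pi$ of $\mathcal F$ unitarily equivalent to the product representation $\pi'$: (ii) $\pi$ is irreducible if and only if $\pi_r$ is irreducible; (iii) $\pi$ is regular if and only if $\pi_r$ is regular. -/

import Mathlib

open Complex MeasureTheory Filter Topology
open scoped ContDiff InnerProductSpace TensorProduct

universe u v w

namespace AsymptoticQED

noncomputable section

/-! ## Minkowski space, the light cone and the velocity hyperboloid -/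

/-- Minkowski space; a vector is given by its contravariant components `x 0, x 1, x 2, x 3`. -/
abbrev Spacetime : Type := Fin 4 → ℝ

/-- The Minkowski product `x · y`, of signature `(+,-,-,-)`. -/
def mdot (x y : Spacetime) : ℝ := x 0 * y 0 - x 1 * y 1 - x 2 * y 2 - x 3 * y 3

/-- Covariant components `x_a = g_{ab} x^b`. -/
def lower (x : Spacetime) (a : Fin 4) : ℝ := if a = 0 then x a else -x a

/-- The future light cone without its apex: nonzero future-pointing null vectors. -/
abbrev NullVec : Type := {l : Spacetime // mdot l l = 0 ∧ 0 < l 0}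

/-- The future unit hyperboloid `v · v = 1`, `v⁰ > 0`. -/
abbrev Hyp : Type := {v : Spacetime // mdot v v = 1 ∧ 0 < v 0}

/-- Euclidean 3-space. -/
abbrev E3 : Type := EuclideanSpace ℝ (Fin 3)

/-- Euclidean length of the spatial part of a spacetime vector. -/
def spNorm (x : Spacetime) : ℝ := Real.sqrt (x 1 ^ 2 + x 2 ^ 2 + x 3 ^ 2)

/-- The null vector with the same spatial part as `x`. -/
def nproj (x : Spacetime) : Spacetime := ![spNorm x, x 1, x 2, x 3]

theorem spNorm_sq (x : Spacetime) : spNorm x ^ 2 = x 1 ^ 2 + x 2 ^ 2 + x 3 ^ 2 :=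
  Real.sq_sqrt (by positivity)

theorem nproj_null (x : Spacetime) (h : 0 < spNorm x) :
    mdot (nproj x) (nproj x) = 0 ∧ 0 < nproj x 0 := by
  refine ⟨?_, by simpa [nproj] using h⟩
  have := spNorm_sq x
  simp [mdot, nproj]
  nlinarith

/-- A function on the light cone, extended to spacetime vectors with nonzero spatial part so as
not to depend on the time component. -/
def coneExt (F : NullVec → ℝ) (x : Spacetime) : ℝ :=
  open Classical in if h : 0 < spNorm x then F ⟨nproj x, nproj_null x h⟩ else 0

/-- Domain of the extension `coneExt`. -/
def coneDom : Set Spacetime := {x | 0 < spNorm x}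

/-- Smoothness of a function on the light cone. -/
def SmoothOnCone (F : NullVec → ℝ) : Prop := ContDiffOn ℝ ∞ (coneExt F) coneDom

/-- Joint smoothness of a function of a real variable and of a null vector. -/
def JointSmooth (G : ℝ → NullVec → ℝ) : Prop :=
  ContDiffOn ℝ ∞ (fun p : ℝ × Spacetime => coneExt (G p.1) p.2) (Set.univ ×ˢ coneDom)

/-- The operator `L_{ab} = l_a ∂/∂l^b - l_b ∂/∂l^a` on functions on the light cone. It
differentiates in directions tangent to the cone, so the extension used is irrelevant. -/
def coneL (a b : Fin 4) (F : NullVec → ℝ) (l : NullVec) : ℝ :=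
  lower l.1 a * fderiv ℝ (coneExt F) l.1 (Pi.single b 1)
    - lower l.1 b * fderiv ℝ (coneExt F) l.1 (Pi.single a 1)

/-- Products `L_{b₁c₁} ⋯ L_{bₖcₖ}`. -/
def coneLs : List (Fin 4 × Fin 4) → (NullVec → ℝ) → NullVec → ℝ
  | [], F => F
  | p :: w, F => coneLs w (coneL p.1 p.2 F)

/-! ### Auxiliary facts on the calculus on the cone -/

theorem null_spNorm (l : NullVec) : spNorm l.1 = l.1 0 := by
  have h := l.2.1
  unfold mdot at h
  unfold spNorm
  rw [Real.sqrt_eq_iff_mul_self_eq (by positivity) l.2.2.le]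
  nlinarith

theorem nproj_self (l : NullVec) : nproj l.1 = l.1 := by
  ext i
  fin_cases i <;> simp [nproj, null_spNorm]

theorem null_mem (l : NullVec) : l.1 ∈ coneDom := by
  show 0 < spNorm l.1
  rw [null_spNorm]; exact l.2.2

theorem coneExt_null (F : NullVec → ℝ) (l : NullVec) : coneExt F l.1 = F l := by
  have h : 0 < spNorm l.1 := null_mem l
  unfold coneExt
  rw [dif_pos h]
  congr 1
  exact Subtype.ext (nproj_self l)

theorem coneExt_of_mem (F : NullVec → ℝ) {x : Spacetime} (h : x ∈ coneDom) :
    coneExt F x = F ⟨nproj x, nproj_null x h⟩ := dif_pos h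

theorem continuous_spNorm : Continuous spNorm := by unfold spNorm; fun_prop

theorem isOpen_coneDom : IsOpen coneDom := isOpen_lt continuous_const continuous_spNorm

theorem isOpen_dom : IsOpen ((Set.univ : Set ℝ) ×ˢ coneDom) := isOpen_univ.prod isOpen_coneDom

theorem contDiffOn_spNorm : ContDiffOn ℝ ∞ spNorm coneDom := by
  intro x hx
  have h : (x 1 ^ 2 + x 2 ^ 2 + x 3 ^ 2) ≠ 0 := by
    have h1 : 0 < spNorm x := hx
    rw [← spNorm_sq x]
    positivity
  have : ContDiffAt ℝ ∞ (fun x : Spacetime => x 1 ^ 2 + x 2 ^ 2 + x 3 ^ 2) x := by fun_prop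
  exact (this.sqrt h).contDiffWithinAt

theorem contDiffOn_nproj : ContDiffOn ℝ ∞ nproj coneDom := by
  rw [contDiffOn_pi]
  intro i
  fin_cases i
  · simpa [nproj] using contDiffOn_spNorm
  · simp [nproj]; fun_prop
  · simp [nproj]; fun_prop
  · simp [nproj]; fun_prop

theorem nproj_mem {x : Spacetime} (h : x ∈ coneDom) : nproj x ∈ coneDom :=
  null_mem ⟨nproj x, nproj_null x h⟩

/-- The tangent vector field of `L_{ab}`. -/
def xi (a b : Fin 4) (x : Spacetime) : Spacetime :=
  lower x a • Pi.single b 1 - lower x b • Pi.single a 1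

theorem contDiff_xi (a b : Fin 4) : ContDiff ℝ ∞ (xi a b) := by
  unfold xi lower
  split_ifs <;> fun_prop

theorem mdot_single (x : Spacetime) (a : Fin 4) : mdot x (Pi.single a 1) = lower x a := by
  fin_cases a <;> simp [mdot, lower]

theorem mdot_xi (x y : Spacetime) (a b : Fin 4) :
    mdot y (xi a b x) = lower x a * lower y b - lower x b * lower y a := by
  fin_cases a <;> fin_cases b <;> simp [mdot, lower, xi] <;> ring

/-- The joint extension of a function of `(s, l)`. -/
def ext2 (G : ℝ → NullVec → ℝ) (p : ℝ × Spacetime) : ℝ := coneExt (G p.1) p.2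

theorem ext2_null (G : ℝ → NullVec → ℝ) (s : ℝ) (l : NullVec) : ext2 G (s, l.1) = G s l :=
  coneExt_null _ _

theorem ext2_mem (G : ℝ → NullVec → ℝ) (s : ℝ) {x : Spacetime} (h : x ∈ coneDom) :
    ext2 G (s, x) = G s ⟨nproj x, nproj_null x h⟩ := dif_pos h

theorem JointSmooth.contDiffAt {G : ℝ → NullVec → ℝ} (hG : JointSmooth G) {p : ℝ × Spacetime}
    (hp : p.2 ∈ coneDom) : ContDiffAt ℝ ∞ (ext2 G) p :=
  ContDiffOn.contDiffAt hG (isOpen_dom.mem_nhds ⟨trivial, hp⟩)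

theorem JointSmooth.diffAt {G : ℝ → NullVec → ℝ} (hG : JointSmooth G) {p : ℝ × Spacetime}
    (hp : p.2 ∈ coneDom) : DifferentiableAt ℝ (ext2 G) p :=
  (hG.contDiffAt hp).differentiableAt (by simp)

theorem coneL_eq {G : ℝ → NullVec → ℝ} (hG : JointSmooth G) (a b : Fin 4) (s : ℝ) (l : NullVec) :
    coneL a b (G s) l = fderiv ℝ (ext2 G) (s, l.1) (0, xi a b l.1) := by
  have h1 : HasFDerivAt (coneExt (G s))
      ((fderiv ℝ (ext2 G) (s, l.1)).comp (ContinuousLinearMap.inr ℝ ℝ Spacetime)) l.1 := by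
    have h2 : HasFDerivAt (fun x : Spacetime => (s, x))
        (ContinuousLinearMap.inr ℝ ℝ Spacetime) l.1 := hasFDerivAt_prodMk_right s l.1
    exact HasFDerivAt.comp (f := fun x : Spacetime => (s, x)) l.1
      (hG.diffAt (p := (s, l.1)) (null_mem l)).hasFDerivAt h2
  unfold coneL
  rw [h1.fderiv]
  have : ((0 : ℝ), xi a b l.1) = lower l.1 a • ((0 : ℝ), (Pi.single b 1 : Spacetime))
      - lower l.1 b • ((0 : ℝ), (Pi.single a 1 : Spacetime)) := by
    ext <;> simp [xi]
  rw [this, map_sub, map_smul, map_smul]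
  simp

/-- Derivative with respect to `s`. -/
def sDeriv (G : ℝ → NullVec → ℝ) (s : ℝ) (l : NullVec) : ℝ := deriv (fun t => G t l) s

theorem sDeriv_eq {G : ℝ → NullVec → ℝ} (hG : JointSmooth G) (s : ℝ) (l : NullVec) :
    sDeriv G s l = fderiv ℝ (ext2 G) (s, l.1) (1, 0) := by
  have h2 : HasFDerivAt (fun t : ℝ => (t, l.1)) (ContinuousLinearMap.inl ℝ ℝ Spacetime) s :=
    hasFDerivAt_prodMk_left s l.1
  have h1 := HasFDerivAt.comp (f := fun t : ℝ => (t, l.1)) s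
    (hG.diffAt (p := (s, l.1)) (null_mem l)).hasFDerivAt h2
  have h3 : (ext2 G ∘ fun t : ℝ => (t, l.1)) = fun t => G t l := by
    funext t; exact ext2_null G t l
  rw [h3] at h1
  unfold sDeriv
  rw [h1.hasDerivAt.deriv]
  simp

theorem JointSmooth.hasDerivAt {G : ℝ → NullVec → ℝ} (hG : JointSmooth G) (s : ℝ) (l : NullVec) :
    HasDerivAt (fun t => G t l) (sDeriv G s l) s := by
  have h2 : HasFDerivAt (fun t : ℝ => (t, l.1)) (ContinuousLinearMap.inl ℝ ℝ Spacetime) s :=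
    hasFDerivAt_prodMk_left s l.1
  have h1 := HasFDerivAt.comp (f := fun t : ℝ => (t, l.1)) s
    (hG.diffAt (p := (s, l.1)) (null_mem l)).hasFDerivAt h2
  have h3 : (ext2 G ∘ fun t : ℝ => (t, l.1)) = fun t => G t l := by
    funext t; exact ext2_null G t l
  rw [h3] at h1
  exact h1.hasDerivAt.differentiableAt.hasDerivAt

theorem contDiffOn_np :
    ContDiffOn ℝ ∞ (fun p : ℝ × Spacetime => (p.1, nproj p.2)) (Set.univ ×ˢ coneDom) :=
  contDiffOn_fst.prodMk (contDiffOn_nproj.comp contDiffOn_snd fun _ h => h.2)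

theorem JointSmooth.fderiv_np {G : ℝ → NullVec → ℝ} (hG : JointSmooth G) :
    ContDiffOn ℝ ∞ (fun p : ℝ × Spacetime => fderiv ℝ (ext2 G) (p.1, nproj p.2))
      (Set.univ ×ˢ coneDom) := by
  have h : ContDiffOn ℝ ∞ (fderiv ℝ (ext2 G)) (Set.univ ×ˢ coneDom) :=
    ContDiffOn.fderiv_of_isOpen hG isOpen_dom (by simp)
  exact h.comp contDiffOn_np fun p hp => ⟨trivial, nproj_mem hp.2⟩

theorem JointSmooth.coneL {G : ℝ → NullVec → ℝ} (hG : JointSmooth G) (a b : Fin 4) :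
    JointSmooth fun s => coneL a b (G s) := by
  have h2 : ContDiffOn ℝ ∞ (fun p : ℝ × Spacetime => ((0 : ℝ), xi a b (nproj p.2)))
      (Set.univ ×ˢ coneDom) :=
    contDiffOn_const.prodMk ((contDiff_xi a b).comp_contDiffOn
      (contDiffOn_nproj.comp contDiffOn_snd fun _ h => h.2))
  refine (hG.fderiv_np.clm_apply h2).congr fun p hp => ?_
  have hp2 : p.2 ∈ coneDom := (Set.mem_prod.1 hp).2
  show coneExt _ p.2 = _
  rw [coneExt_of_mem _ hp2]
  exact coneL_eq hG a b p.1 ⟨nproj p.2, nproj_null p.2 hp2⟩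

theorem JointSmooth.sDeriv {G : ℝ → NullVec → ℝ} (hG : JointSmooth G) :
    JointSmooth (sDeriv G) := by
  have h2 : ContDiffOn ℝ ∞ (fun _ : ℝ × Spacetime => ((1 : ℝ), (0 : Spacetime)))
      (Set.univ ×ˢ coneDom) := contDiffOn_const
  refine (hG.fderiv_np.clm_apply h2).congr fun p hp => ?_
  have hp2 : p.2 ∈ coneDom := (Set.mem_prod.1 hp).2
  show coneExt _ p.2 = _
  rw [coneExt_of_mem _ hp2]
  exact sDeriv_eq hG p.1 ⟨nproj p.2, nproj_null p.2 hp2⟩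

theorem ext2_add (G H : ℝ → NullVec → ℝ) : ext2 (G + H) = ext2 G + ext2 H := by
  funext p
  by_cases h : p.2 ∈ coneDom
  · have h' : 0 < spNorm p.2 := h
    simp [ext2, coneExt, h']
  · have h' : ¬ 0 < spNorm p.2 := h
    simp [ext2, coneExt, h']

theorem ext2_smul (c : ℝ) (G : ℝ → NullVec → ℝ) : ext2 (c • G) = c • ext2 G := by
  funext p
  by_cases h : p.2 ∈ coneDom
  · have h' : 0 < spNorm p.2 := h
    simp [ext2, coneExt, h']
  · have h' : ¬ 0 < spNorm p.2 := h
    simp [ext2, coneExt, h']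

theorem JointSmooth.add {G H : ℝ → NullVec → ℝ} (hG : JointSmooth G) (hH : JointSmooth H) :
    JointSmooth (G + H) := by
  show ContDiffOn ℝ ∞ (ext2 (G + H)) _
  rw [ext2_add]; exact ContDiffOn.add hG hH

theorem JointSmooth.smul {G : ℝ → NullVec → ℝ} (c : ℝ) (hG : JointSmooth G) :
    JointSmooth (c • G) := by
  show ContDiffOn ℝ ∞ (ext2 (c • G)) _
  rw [ext2_smul]; exact ContDiffOn.const_smul c hG

theorem coneL_add {G H : ℝ → NullVec → ℝ} (hG : JointSmooth G) (hH : JointSmooth H)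
    (a b : Fin 4) :
    (fun s => coneL a b ((G + H) s)) = (fun s => coneL a b (G s)) + fun s => coneL a b (H s) := by
  funext s l
  simp only [Pi.add_apply G H]
  show coneL a b ((G + H) s) l = coneL a b (G s) l + coneL a b (H s) l
  rw [coneL_eq (hG.add hH), coneL_eq hG, coneL_eq hH, ext2_add,
    fderiv_add (hG.diffAt (null_mem l)) (hH.diffAt (null_mem l))]
  rfl

theorem coneL_smul {G : ℝ → NullVec → ℝ} (hG : JointSmooth G) (c : ℝ) (a b : Fin 4) :
    (fun s => coneL a b ((c • G) s)) = c • fun s => coneL a b (G s) := by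
  funext s l
  show coneL a b ((c • G) s) l = c * coneL a b (G s) l
  rw [coneL_eq (hG.smul c), coneL_eq hG, ext2_smul, fderiv_const_smul (hG.diffAt (null_mem l))]
  rfl

theorem JointSmooth.coneLs (w : List (Fin 4 × Fin 4)) :
    ∀ {G : ℝ → NullVec → ℝ}, JointSmooth G → JointSmooth fun s => coneLs w (G s) := by
  induction w with
  | nil => intro G h; exact h
  | cons p w ih => intro G h; exact ih (h.coneL p.1 p.2)

theorem coneLs_add (w : List (Fin 4 × Fin 4)) :
    ∀ {G H : ℝ → NullVec → ℝ}, JointSmooth G → JointSmooth H →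
    (fun s => coneLs w ((G + H) s)) = (fun s => coneLs w (G s)) + fun s => coneLs w (H s) := by
  induction w with
  | nil => intro G H _ _; rfl
  | cons p w ih =>
    intro G H hG hH
    have := ih (hG.coneL p.1 p.2) (hH.coneL p.1 p.2)
    rw [← coneL_add hG hH] at this
    exact this

theorem coneLs_smul (w : List (Fin 4 × Fin 4)) (c : ℝ) :
    ∀ {G : ℝ → NullVec → ℝ}, JointSmooth G →
    (fun s => coneLs w ((c • G) s)) = c • fun s => coneLs w (G s) := by
  induction w with
  | nil => intro G _; rfl
  | cons p w ih =>
    intro G hG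
    have := ih (hG.coneL p.1 p.2)
    rw [← coneL_smul hG] at this
    exact this

/-- Fall-off `|G(s,l)| ≤ const (t·l)⁻² (1 + |s|/t·l)^{-1-ε}` for some `ε > 0`, where `t` is the unit
vector of the time axis, `t·l = l⁰`. -/
def Decays (G : ℝ → NullVec → ℝ) : Prop :=
  ∃ C ε : ℝ, 0 < ε ∧ ∀ s l,
    |G s l| ≤ C / ((l : NullVec).1 0 ^ 2 * (1 + |s| / l.1 0) ^ (1 + ε))

/-- Homogeneity of degree `k` in `(s, l)`. -/
def Homog (k : ℤ) (G : ℝ → NullVec → ℝ) : Prop :=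
  ∀ (μ : ℝ), 0 < μ → ∀ (s : ℝ) (l l' : NullVec), l'.1 = μ • l.1 → G (μ * s) l' = μ ^ k * G s l

theorem base_pos (s : ℝ) (l : NullVec) : 1 ≤ 1 + |s| / l.1 0 := by
  have := l.2.2
  have : 0 ≤ |s| / l.1 0 := by positivity
  linarith

theorem wt_pos (s : ℝ) (l : NullVec) (ε : ℝ) :
    0 < l.1 0 ^ 2 * (1 + |s| / l.1 0) ^ (1 + ε) := by
  have h0 := l.2.2
  have := base_pos s l
  have h1 : (0 : ℝ) < 1 + |s| / l.1 0 := by linarith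
  positivity

theorem wt_mono (s : ℝ) (l : NullVec) {ε ε' : ℝ} (h : ε ≤ ε') :
    l.1 0 ^ 2 * (1 + |s| / l.1 0) ^ (1 + ε) ≤ l.1 0 ^ 2 * (1 + |s| / l.1 0) ^ (1 + ε') := by
  have h0 := l.2.2
  gcongr
  exact base_pos s l

theorem Decays.of_le {G H : ℝ → NullVec → ℝ} (hG : Decays G) (c : ℝ)
    (h : ∀ s l, |H s l| ≤ c * |G s l|) : Decays H := by
  obtain ⟨C, ε, hε, hC⟩ := hG
  refine ⟨|c| * C, ε, hε, fun s l => (h s l).trans ?_⟩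
  rw [mul_div_assoc]
  calc c * |G s l| ≤ |c| * |G s l| := by gcongr; exact le_abs_self c
    _ ≤ _ := by gcongr; exact hC s l

theorem Decays.add {G H : ℝ → NullVec → ℝ} (hG : Decays G) (hH : Decays H) : Decays (G + H) := by
  obtain ⟨C, ε, hε, hC⟩ := hG
  obtain ⟨C', ε', hε', hC'⟩ := hH
  refine ⟨|C| + |C'|, min ε ε', lt_min hε hε', fun s l => ?_⟩
  have key : ∀ (D δ : ℝ), min ε ε' ≤ δ → D / (l.1 0 ^ 2 * (1 + |s| / l.1 0) ^ (1 + δ))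
      ≤ |D| / (l.1 0 ^ 2 * (1 + |s| / l.1 0) ^ (1 + min ε ε')) := by
    intro D δ hδ
    exact div_le_div₀ (abs_nonneg _) (le_abs_self _) (wt_pos _ _ _) (wt_mono s l hδ)
  rw [add_div]
  calc |(G + H) s l| ≤ |G s l| + |H s l| := abs_add_le _ _
    _ ≤ _ := add_le_add ((hC s l).trans (key C ε (min_le_left _ _)))
        ((hC' s l).trans (key C' ε' (min_le_right _ _)))

theorem Decays.smul {G : ℝ → NullVec → ℝ} (hG : Decays G) (c : ℝ) : Decays (c • G) :=
  hG.of_le |c| fun s l => (abs_mul c (G s l)).le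

theorem Decays.abs {G : ℝ → NullVec → ℝ} (hG : Decays G) : Decays fun s l => |G s l| :=
  hG.of_le 1 fun s l => by simp

/-- Size of a spacetime vector, used in bounds only. -/
def size (x : Spacetime) : ℝ := |x 0| + |x 1| + |x 2| + |x 3|

theorem size_nonneg (x : Spacetime) : 0 ≤ size x := by unfold size; positivity

theorem comp_le (l : NullVec) (i : Fin 4) : |l.1 i| ≤ l.1 0 := by
  have h := l.2.1
  have h0 := l.2.2
  unfold mdot at h
  apply abs_le_of_sq_le_sq _ h0.le
  fin_cases i <;> simp <;> nlinarith [sq_nonneg (l.1 1), sq_nonneg (l.1 2), sq_nonneg (l.1 3)]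

theorem mdot_le (x : Spacetime) (l : NullVec) : |mdot x l.1| ≤ size x * l.1 0 := by
  have h : ∀ i, |x i * l.1 i| ≤ |x i| * l.1 0 := fun i => by
    rw [abs_mul]; gcongr; exact comp_le l i
  unfold mdot size
  have a0 := abs_le.1 (h 0)
  have a1 := abs_le.1 (h 1)
  have a2 := abs_le.1 (h 2)
  have a3 := abs_le.1 (h 3)
  rw [abs_le]
  constructor <;> nlinarith

/-- Translation `s ↦ s - x·l` of the argument. -/
def shift (x : Spacetime) (G : ℝ → NullVec → ℝ) : ℝ → NullVec → ℝ :=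
  fun s l => G (s - mdot x l.1) l

theorem Decays.shift {G : ℝ → NullVec → ℝ} (hG : Decays G) (x : Spacetime) :
    Decays (shift x G) := by
  obtain ⟨C, ε, hε, hC⟩ := hG
  refine ⟨|C| * (1 + size x) ^ (1 + ε), ε, hε, fun s l => (hC _ l).trans ?_⟩
  have h0 := l.2.2
  have hs := size_nonneg x
  have h1 : 1 + |s| / l.1 0 ≤ (1 + size x) * (1 + |s - mdot x l.1| / l.1 0) := by
    have h2 : |s| ≤ |s - mdot x l.1| + size x * l.1 0 := by
      have h3 := mdot_le x l
      have h4 : |s| ≤ |s - mdot x l.1| + |mdot x l.1| := by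
        simpa using abs_add_le (s - mdot x l.1) (mdot x l.1)
      linarith
    have h5 : |s| / l.1 0 ≤ |s - mdot x l.1| / l.1 0 + size x := by
      rw [div_add' _ _ _ h0.ne']; gcongr
    have h6 : 0 ≤ size x * (|s - mdot x l.1| / l.1 0) := by positivity
    nlinarith
  have hb := base_pos s l
  have hb' := base_pos (s - mdot x l.1) l
  have h7 : (1 + |s| / l.1 0) ^ (1 + ε)
      ≤ (1 + size x) ^ (1 + ε) * (1 + |s - mdot x l.1| / l.1 0) ^ (1 + ε) := by
    rw [← Real.mul_rpow (by linarith) (by linarith)]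
    exact Real.rpow_le_rpow (by linarith) h1 (by linarith)
  rw [div_le_div_iff₀ (wt_pos _ _ _) (wt_pos _ _ _)]
  calc C * (l.1 0 ^ 2 * (1 + |s| / l.1 0) ^ (1 + ε))
      ≤ |C| * (l.1 0 ^ 2 * ((1 + size x) ^ (1 + ε)
          * (1 + |s - mdot x l.1| / l.1 0) ^ (1 + ε))) := by
        gcongr
        exact le_abs_self C
    _ = _ := by ring

/-- `mdot y` as a continuous linear map. -/
def mdotL (y : Spacetime) : Spacetime →L[ℝ] ℝ :=
  y 0 • ContinuousLinearMap.proj 0 - y 1 • ContinuousLinearMap.proj 1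
    - y 2 • ContinuousLinearMap.proj 2 - y 3 • ContinuousLinearMap.proj 3

theorem mdotL_apply (y x : Spacetime) : mdotL y x = mdot y x := rfl

theorem mdot_self_xi (l : NullVec) (a b : Fin 4) : mdot l.1 (xi a b l.1) = 0 := by
  rw [mdot_xi]; ring

theorem fderiv_nproj (l : NullVec) (z : Spacetime) (hz : mdot l.1 z = 0) :
    fderiv ℝ nproj l.1 z = z := by
  have hd : DifferentiableAt ℝ nproj l.1 :=
    (contDiffOn_nproj.contDiffAt (isOpen_coneDom.mem_nhds (null_mem l))).differentiableAt (by simp)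
  have hN : DifferentiableAt ℝ spNorm l.1 :=
    (contDiffOn_spNorm.contDiffAt (isOpen_coneDom.mem_nhds (null_mem l))).differentiableAt (by simp)
  have hcomp : ∀ i, fderiv ℝ nproj l.1 z i = fderiv ℝ (fun x => nproj x i) l.1 z := by
    intro i
    have := (hasFDerivAt_pi'.1 hd.hasFDerivAt) i
    rw [this.fderiv]; rfl
  have hp : ∀ i : Fin 4, fderiv ℝ (fun x : Spacetime => x i) l.1 z = z i := by
    intro i
    have : HasFDerivAt (fun x : Spacetime => x i)
      (ContinuousLinearMap.proj (R := ℝ) (φ := fun _ : Fin 4 => ℝ) i) l.1 := hasFDerivAt_apply i l.1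
    rw [this.fderiv]; rfl
  have h0 : fderiv ℝ spNorm l.1 z = z 0 := by
    have e : (fun x : Spacetime => spNorm x * spNorm x)
        = fun x : Spacetime => x 1 * x 1 + x 2 * x 2 + x 3 * x 3 := by
      funext x; have := spNorm_sq x; nlinarith
    have e1 := hN.hasFDerivAt.mul hN.hasFDerivAt
    have q : ∀ i : Fin 4, HasFDerivAt (fun x : Spacetime => x i)
      (ContinuousLinearMap.proj (R := ℝ) (φ := fun _ : Fin 4 => ℝ) i) l.1 :=
      fun i => hasFDerivAt_apply i l.1
    have e2 := (((q 1).mul (q 1)).add ((q 2).mul (q 2))).add ((q 3).mul (q 3))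
    have e3 := e1.unique (by
      have : (spNorm * spNorm : Spacetime → ℝ)
        = fun x : Spacetime => x 1 * x 1 + x 2 * x 2 + x 3 * x 3 := e
      rw [this]; exact e2)
    have e4 := congrArg (fun T => T z) e3
    simp only [_root_.add_apply, _root_.smul_apply, smul_eq_mul,
      ContinuousLinearMap.proj_apply, null_spNorm] at e4
    have h := l.2.2
    unfold mdot at hz
    have : l.1 0 * (fderiv ℝ spNorm l.1 z - z 0) = 0 := by nlinarith
    rcases mul_eq_zero.1 this with h' | h'
    · exact absurd h' h.ne'
    · linarith
  funext i
  rw [hcomp]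
  fin_cases i
  · exact h0
  · exact hp 1
  · exact hp 2
  · exact hp 3

theorem hasFDerivAt_nproj (l : NullVec) :
    HasFDerivAt nproj (fderiv ℝ nproj l.1) l.1 :=
  ((contDiffOn_nproj.contDiffAt (isOpen_coneDom.mem_nhds (null_mem l))).differentiableAt
    (by simp)).hasFDerivAt

theorem hasFDerivAt_nproj2 (s : ℝ) (l : NullVec) :
    HasFDerivAt (fun p : ℝ × Spacetime => nproj p.2)
      ((fderiv ℝ nproj l.1).comp (ContinuousLinearMap.snd ℝ ℝ Spacetime)) (s, l.1) :=
  HasFDerivAt.comp (f := fun p : ℝ × Spacetime => p.2) (s, l.1) (hasFDerivAt_nproj l)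
    hasFDerivAt_snd

theorem dom_nhds (s : ℝ) (l : NullVec) : (Set.univ : Set ℝ) ×ˢ coneDom ∈ 𝓝 (s, l.1) :=
  isOpen_dom.mem_nhds ⟨trivial, null_mem l⟩

/-- Multiplication by the function `y·l`. -/
def mulLin (y : Spacetime) (G : ℝ → NullVec → ℝ) : ℝ → NullVec → ℝ := fun s l => mdot y l.1 * G s l

theorem ext2_mulLin (y : Spacetime) (G : ℝ → NullVec → ℝ) :
    Set.EqOn (ext2 (mulLin y G)) (fun p => mdotL y (nproj p.2) * ext2 G p)
      (Set.univ ×ˢ coneDom) := by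
  rintro ⟨s, x⟩ hp
  have hx : x ∈ coneDom := (Set.mem_prod.1 hp).2
  show ext2 _ (s, x) = _ * ext2 G (s, x)
  rw [ext2_mem _ _ hx, ext2_mem _ _ hx]
  rfl

theorem JointSmooth.mulLin {G : ℝ → NullVec → ℝ} (hG : JointSmooth G) (y : Spacetime) :
    JointSmooth (mulLin y G) := by
  refine ContDiffOn.congr ?_ (ext2_mulLin y G)
  exact ((mdotL y).contDiff.comp_contDiffOn
    (contDiffOn_nproj.comp contDiffOn_snd fun _ h => (Set.mem_prod.1 h).2)).mul hG

theorem coneL_mulLin {G : ℝ → NullVec → ℝ} (hG : JointSmooth G) (y : Spacetime) (a b : Fin 4)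
    (s : ℝ) (l : NullVec) :
    coneL a b (mulLin y G s) l = mdot y (xi a b l.1) * G s l + mdot y l.1 * coneL a b (G s) l := by
  rw [coneL_eq (hG.mulLin y), coneL_eq hG,
    ((ext2_mulLin y G).eventuallyEq_of_mem (dom_nhds s l)).fderiv_eq]
  have h1 : HasFDerivAt (fun p : ℝ × Spacetime => mdotL y (nproj p.2)) _ (s, l.1) :=
    (mdotL y).hasFDerivAt.comp (s, l.1) (hasFDerivAt_nproj2 s l)
  have h2 := h1.mul (hG.diffAt (p := (s, l.1)) (null_mem l)).hasFDerivAt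
  have h3 : fderiv ℝ (fun p : ℝ × Spacetime => mdotL y (nproj p.2) * ext2 G p) (s, l.1) = _ :=
    h2.fderiv
  rw [h3]
  simp [ext2_null, nproj_self, fderiv_nproj l _ (mdot_self_xi l a b), mdotL_apply]
  ring

/-- The vector `z` with `L_{ab}(y·l) = z·l`. -/
def linL (a b : Fin 4) (y : Spacetime) : Spacetime :=
  lower y b • Pi.single a 1 - lower y a • Pi.single b 1

theorem mdot_comm (x y : Spacetime) : mdot x y = mdot y x := by unfold mdot; ring

theorem mdot_linL (a b : Fin 4) (y x : Spacetime) :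
    mdot (linL a b y) x = mdot y (xi a b x) := by
  rw [mdot_xi, mdot_comm]
  have h := mdotL_apply x (linL a b y)
  rw [← h]
  unfold linL
  rw [map_sub, map_smul, map_smul, mdotL_apply, mdotL_apply, mdot_single, mdot_single]
  simp only [smul_eq_mul]; ring

theorem coneL_mulLin' {G : ℝ → NullVec → ℝ} (hG : JointSmooth G) (y : Spacetime) (a b : Fin 4) :
    (fun s => coneL a b (mulLin y G s))
      = mulLin (linL a b y) G + mulLin y (fun s => coneL a b (G s)) := by
  funext s l
  rw [coneL_mulLin hG, ← mdot_linL]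
  rfl

theorem ext2_shift (x : Spacetime) (G : ℝ → NullVec → ℝ) :
    Set.EqOn (ext2 (shift x G)) (fun p => ext2 G (p.1 - mdotL x (nproj p.2), p.2))
      (Set.univ ×ˢ coneDom) := by
  rintro ⟨s, y⟩ hp
  have hy : y ∈ coneDom := (Set.mem_prod.1 hp).2
  show ext2 _ (s, y) = ext2 G (_, y)
  rw [ext2_mem _ _ hy, ext2_mem _ _ hy]
  rfl

theorem JointSmooth.shift {G : ℝ → NullVec → ℝ} (hG : JointSmooth G) (x : Spacetime) :
    JointSmooth (shift x G) := by
  refine ContDiffOn.congr ?_ (ext2_shift x G)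
  have h : ContDiffOn ℝ ∞ (fun p : ℝ × Spacetime => (p.1 - mdotL x (nproj p.2), p.2))
      (Set.univ ×ˢ coneDom) :=
    (contDiffOn_fst.sub ((mdotL x).contDiff.comp_contDiffOn
    (contDiffOn_nproj.comp contDiffOn_snd fun _ h => (Set.mem_prod.1 h).2))).prodMk contDiffOn_snd
  exact ContDiffOn.comp hG h fun p hp => ⟨trivial, (Set.mem_prod.1 hp).2⟩

theorem coneL_shift {G : ℝ → NullVec → ℝ} (hG : JointSmooth G) (x : Spacetime) (a b : Fin 4) :
    (fun s => coneL a b (shift x G s)) = shift x (fun s => coneL a b (G s))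
      + (-1 : ℝ) • shift x (mulLin (linL a b x) (sDeriv G)) := by
  funext s l
  show coneL a b (shift x G s) l = coneL a b (G (s - mdot x l.1)) l
    + (-1 : ℝ) * (mdot (linL a b x) l.1 * sDeriv G (s - mdot x l.1) l)
  rw [coneL_eq (hG.shift x), coneL_eq hG, sDeriv_eq hG, mdot_linL,
    ((ext2_shift x G).eventuallyEq_of_mem (dom_nhds s l)).fderiv_eq]
  have h1 : HasFDerivAt (fun p : ℝ × Spacetime => mdotL x (nproj p.2)) _ (s, l.1) :=
    (mdotL x).hasFDerivAt.comp (s, l.1) (hasFDerivAt_nproj2 s l)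
  have h2 := (hasFDerivAt_fst (𝕜 := ℝ) (p := (s, l.1))).sub h1
  have h3 := h2.prodMk (hasFDerivAt_snd (𝕜 := ℝ) (p := (s, l.1)))
  have hpt : ((s, l.1).1 - mdotL x (nproj (s, l.1).2), (s, l.1).2) = (s - mdot x l.1, l.1) := by
    simp [nproj_self, mdotL_apply]
  have h4 : HasFDerivAt (ext2 G) (fderiv ℝ (ext2 G) (s - mdot x l.1, l.1))
      ((s, l.1).1 - mdotL x (nproj (s, l.1).2), (s, l.1).2) := by
    rw [hpt]; exact (hG.diffAt (p := (s - mdot x l.1, l.1)) (null_mem l)).hasFDerivAt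
  have h5 : HasFDerivAt (fun p : ℝ × Spacetime => ext2 G (p.1 - mdotL x (nproj p.2), p.2)) _
      (s, l.1) := HasFDerivAt.comp (f := fun p : ℝ × Spacetime =>
        (p.1 - mdotL x (nproj p.2), p.2)) (s, l.1) h4 h3
  rw [h5.fderiv]
  have e : ((-mdot x (xi a b l.1) : ℝ), xi a b l.1)
      = ((0 : ℝ), xi a b l.1) + (-mdot x (xi a b l.1)) • ((1 : ℝ), (0 : Spacetime)) := by
    ext <;> simp
  simp only [ContinuousLinearMap.comp_apply, ContinuousLinearMap.prod_apply,
    _root_.sub_apply, ContinuousLinearMap.coe_fst', ContinuousLinearMap.coe_snd',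
    fderiv_nproj l _ (mdot_self_xi l a b), mdotL_apply, zero_sub]
  rw [e, map_add, map_smul, smul_eq_mul]
  ring

theorem sDeriv_coneL {G : ℝ → NullVec → ℝ} (hG : JointSmooth G) (a b : Fin 4) :
    (fun s => coneL a b (sDeriv G s)) = sDeriv fun s => coneL a b (G s) := by
  funext s l
  have hsm := hG.contDiffAt (p := (s, l.1)) (null_mem l)
  have hD : DifferentiableAt ℝ (fderiv ℝ (ext2 G)) (s, l.1) :=
    (hsm.fderiv_right (m := 1) (by norm_cast)).differentiableAt (by simp)
  have hsymm : IsSymmSndFDerivAt ℝ (ext2 G) (s, l.1) :=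
    hsm.isSymmSndFDerivAt (by simp only [minSmoothness_of_isRCLikeNormedField]; exact WithTop.coe_le_coe.2 (le_top : (2 : ℕ∞) ≤ ⊤))
  have hpt : ((s, l.1).1, nproj (s, l.1).2) = (s, l.1) := by simp [nproj_self]
  rw [coneL_eq hG.sDeriv]
  have e1 : ext2 (sDeriv G) =ᶠ[𝓝 (s, l.1)]
      fun p => fderiv ℝ (ext2 G) (p.1, nproj p.2) (1, 0) := by
    filter_upwards [dom_nhds s l] with p hp
    have hp2 : p.2 ∈ coneDom := (Set.mem_prod.1 hp).2
    show coneExt _ p.2 = _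
    rw [coneExt_of_mem _ hp2]
    exact sDeriv_eq hG p.1 ⟨nproj p.2, nproj_null p.2 hp2⟩
  rw [e1.fderiv_eq]
  have h3 := (hasFDerivAt_fst (𝕜 := ℝ) (p := (s, l.1))).prodMk (hasFDerivAt_nproj2 s l)
  have h4 : HasFDerivAt (fderiv ℝ (ext2 G)) (fderiv ℝ (fderiv ℝ (ext2 G)) (s, l.1))
      ((s, l.1).1, nproj (s, l.1).2) := by rw [hpt]; exact hD.hasFDerivAt
  have h5 := HasFDerivAt.comp (f := fun p : ℝ × Spacetime => (p.1, nproj p.2)) (s, l.1) h4 h3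
  have h6 : HasFDerivAt (fun p : ℝ × Spacetime => fderiv ℝ (ext2 G) (p.1, nproj p.2) (1, 0)) _
      (s, l.1) := h5.clm_apply (hasFDerivAt_const ((1 : ℝ), (0 : Spacetime)) (s, l.1))
  rw [h6.fderiv]
  have h7 : HasFDerivAt (fun t : ℝ => (t, l.1)) (ContinuousLinearMap.inl ℝ ℝ Spacetime) s :=
    hasFDerivAt_prodMk_left s l.1
  have h8 := HasFDerivAt.comp (f := fun t : ℝ => (t, l.1)) s hD.hasFDerivAt h7
  have h9 : HasFDerivAt (fun t : ℝ => fderiv ℝ (ext2 G) (t, l.1) (0, xi a b l.1)) _ s :=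
    h8.clm_apply (hasFDerivAt_const ((0 : ℝ), xi a b l.1) s)
  unfold sDeriv
  rw [show (fun t => coneL a b (G t) l) = fun t => fderiv ℝ (ext2 G) (t, l.1) (0, xi a b l.1) from
    funext fun t => coneL_eq hG a b t l, h9.hasDerivAt.deriv]
  simp [fderiv_nproj l _ (mdot_self_xi l a b)]
  exact hsymm.eq _ _

theorem homog_fderiv {G : ℝ → NullVec → ℝ} {k : ℤ} (hh : Homog k G) (hG : JointSmooth G) {μ : ℝ}
    (hμ : 0 < μ) (s : ℝ) (l l' : NullVec) (e : l'.1 = μ • l.1) (z : ℝ × Spacetime) :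
    fderiv ℝ (ext2 G) (μ * s, l'.1) (μ • z) = μ ^ k * fderiv ℝ (ext2 G) (s, l.1) z := by
  have h1 : (fun p : ℝ × Spacetime => ext2 G (μ • p)) =ᶠ[𝓝 (s, l.1)]
      fun p => μ ^ k * ext2 G p := by
    filter_upwards [dom_nhds s l] with p hp
    have hp2 : p.2 ∈ coneDom := (Set.mem_prod.1 hp).2
    have hN : spNorm (μ • p.2) = μ * spNorm p.2 := by
      unfold spNorm
      rw [show (μ • p.2) 1 ^ 2 + (μ • p.2) 2 ^ 2 + (μ • p.2) 3 ^ 2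
        = μ ^ 2 * (p.2 1 ^ 2 + p.2 2 ^ 2 + p.2 3 ^ 2) by simp; ring, Real.sqrt_mul (by positivity),
        Real.sqrt_sq hμ.le]
    have hp3 : μ • p.2 ∈ coneDom := by
      show 0 < spNorm (μ • p.2)
      rw [hN]; exact mul_pos hμ hp2
    show ext2 G (μ • p.1, μ • p.2) = μ ^ k * ext2 G (p.1, p.2)
    rw [ext2_mem _ _ hp2, ext2_mem _ _ hp3]
    refine hh μ hμ _ _ _ ?_
    ext i
    fin_cases i <;> simp [nproj, hN]
  have h2 := h1.fderiv_eq (𝕜 := ℝ)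
  have hpt : μ • (s, l.1) = (μ * s, l'.1) := by rw [e]; rfl
  have h3 : HasFDerivAt (ext2 G) (fderiv ℝ (ext2 G) (μ * s, l'.1)) (μ • (s, l.1)) := by
    rw [hpt]; exact (hG.diffAt (p := (μ * s, l'.1)) (null_mem l')).hasFDerivAt
  have h4 := HasFDerivAt.comp (f := fun p : ℝ × Spacetime => μ • p) (s, l.1) h3
    ((hasFDerivAt_id (s, l.1)).const_smul μ)
  have h5 : HasFDerivAt (fun p : ℝ × Spacetime => ext2 G (μ • p)) _ (s, l.1) := h4
  rw [h5.fderiv] at h2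
  have hd := hG.diffAt (p := (s, l.1)) (null_mem l)
  have h6 : fderiv ℝ (fun p => μ ^ k * ext2 G p) (s, l.1)
      = μ ^ k • fderiv ℝ (ext2 G) (s, l.1) := fderiv_const_mul hd (μ ^ k)
  rw [h6] at h2
  have h7 := congrArg (fun T => T z) h2
  simpa using h7

theorem Homog.coneL {G : ℝ → NullVec → ℝ} {k : ℤ} (hh : Homog k G) (hG : JointSmooth G)
    (a b : Fin 4) : Homog k fun s => coneL a b (G s) := by
  intro μ hμ s l l' e
  show AsymptoticQED.coneL a b (G (μ * s)) l' = μ ^ k * AsymptoticQED.coneL a b (G s) l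
  rw [coneL_eq hG, coneL_eq hG, ← homog_fderiv hh hG hμ s l l' e]
  congr 1
  ext i
  · simp
  · fin_cases i <;> simp [xi, lower, e] <;> split_ifs <;> simp <;> ring

theorem Homog.sDeriv {G : ℝ → NullVec → ℝ} {k : ℤ} (hh : Homog k G) (hG : JointSmooth G) :
    Homog (k - 1) (sDeriv G) := by
  intro μ hμ s l l' e
  rw [sDeriv_eq hG, sDeriv_eq hG, zpow_sub_one₀ hμ.ne']
  have h := homog_fderiv hh hG hμ s l l' e (1, 0)
  have h1 : μ • ((1 : ℝ), (0 : Spacetime)) = μ • ((1 : ℝ), (0 : Spacetime)) := rfl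
  rw [map_smul, smul_eq_mul] at h
  field_simp
  linarith

theorem Homog.mulLin {G : ℝ → NullVec → ℝ} {k : ℤ} (hh : Homog k G) (y : Spacetime) :
    Homog (k + 1) (mulLin y G) := by
  intro μ hμ s l l' e
  show mdot y l'.1 * G (μ * s) l' = μ ^ (k + 1) * (mdot y l.1 * G s l)
  rw [hh μ hμ s l l' e, e, zpow_add_one₀ hμ.ne', ← mdotL_apply, ← mdotL_apply, map_smul,
    smul_eq_mul]
  ring

theorem Homog.shift {G : ℝ → NullVec → ℝ} {k : ℤ} (hh : Homog k G) (x : Spacetime) :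
    Homog k (shift x G) := by
  intro μ hμ s l l' e
  show G (μ * s - mdot x l'.1) l' = μ ^ k * G (s - mdot x l.1) l
  rw [← hh μ hμ _ l l' e]
  congr 1
  rw [e, ← mdotL_apply, ← mdotL_apply, map_smul, smul_eq_mul]
  ring

/-- Smooth functions of `(s,l)`, homogeneous of degree `-2`, with all the required bounds. -/
structure Tame (G : ℝ → NullVec → ℝ) : Prop where
  smooth : JointSmooth G
  homog : Homog (-2) G
  decay : ∀ w, Decays fun s => coneLs w (G s)

theorem Tame.coneL {G : ℝ → NullVec → ℝ} (h : Tame G) (a b : Fin 4) :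
    Tame fun s => coneL a b (G s) :=
  ⟨h.smooth.coneL a b, h.homog.coneL h.smooth a b, fun w => h.decay ((a, b) :: w)⟩

theorem euler_bound {G : ℝ → NullVec → ℝ} (hh : Homog (-2) G) (hG : JointSmooth G) (s : ℝ)
    (l : NullVec) : |s * sDeriv G s l| ≤ 2 * |G s l| + |coneL 0 1 (G s) l| + |coneL 0 2 (G s) l|
      + |coneL 0 3 (G s) l| := by
  have h0 := l.2.2
  have hd := (hG.diffAt (p := (s, l.1)) (null_mem l)).hasFDerivAt
  have hpt : (1 : ℝ) • (s, l.1) = (s, l.1) := one_smul _ _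
  have h1 : HasDerivAt (fun μ : ℝ => μ • (s, l.1)) ((1 : ℝ) • (s, l.1)) 1 :=
    (hasDerivAt_id (1 : ℝ)).smul_const (s, l.1)
  have h2 : HasDerivAt (fun μ : ℝ => ext2 G (μ • (s, l.1)))
      (fderiv ℝ (ext2 G) (s, l.1) ((1 : ℝ) • (s, l.1))) 1 := by
    have hd' : HasFDerivAt (ext2 G) (fderiv ℝ (ext2 G) (s, l.1)) ((1 : ℝ) • (s, l.1)) := by
      rw [hpt]; exact hd
    exact hd'.comp_hasDerivAt (1 : ℝ) h1
  have h3 : (fun μ : ℝ => ext2 G (μ • (s, l.1))) =ᶠ[𝓝 1] fun μ => μ ^ (-2 : ℤ) * G s l := by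
    filter_upwards [lt_mem_nhds (zero_lt_one : (0 : ℝ) < 1)] with μ hμ
    have hl : mdot (μ • l.1) (μ • l.1) = 0 ∧ 0 < (μ • l.1) 0 := by
      refine ⟨?_, by simpa using mul_pos hμ h0⟩
      have := l.2.1
      unfold mdot at this ⊢
      simp only [Pi.smul_apply, smul_eq_mul]
      linear_combination μ ^ 2 * this
    have := hh μ hμ s l ⟨μ • l.1, hl⟩ rfl
    rw [← this]
    exact ext2_null G (μ * s) ⟨μ • l.1, hl⟩
  have h4 : HasDerivAt (fun μ : ℝ => μ ^ (-2 : ℤ) * G s l) (-2 * G s l) 1 := by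
    have := (hasDerivAt_zpow (-2) (1 : ℝ) (Or.inl one_ne_zero)).mul_const (G s l)
    simpa using this
  have h5 := (h2.congr_of_eventuallyEq h3.symm).unique h4
  rw [hpt] at h5
  have h6 : (s, l.1) = s • ((1 : ℝ), (0 : Spacetime))
      + ((l.1 1 / l.1 0) • ((0 : ℝ), xi 0 1 l.1) + (l.1 2 / l.1 0) • ((0 : ℝ), xi 0 2 l.1)
      + (l.1 3 / l.1 0) • ((0 : ℝ), xi 0 3 l.1)) := by
    have hn := l.2.1
    unfold mdot at hn
    ext i
    · simp
    · fin_cases i <;> simp [xi, lower] <;> field_simp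
      nlinarith
  have hb : ∀ i, |l.1 i / l.1 0| ≤ 1 := fun i => by
    rw [abs_div, abs_of_pos h0, div_le_one h0]; exact comp_le l i
  have h7 := congrArg (fderiv ℝ (ext2 G) (s, l.1)) h6
  simp only [map_add, map_smul, smul_eq_mul] at h7
  rw [h5, ← sDeriv_eq hG, ← coneL_eq hG, ← coneL_eq hG, ← coneL_eq hG] at h7
  have hm : ∀ (i : Fin 4) (X : ℝ), |l.1 i / l.1 0 * X| ≤ |X| := fun i X => by
    rw [abs_mul]
    exact mul_le_of_le_one_left (abs_nonneg _) (hb i)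
  have e : s * sDeriv G s l = -2 * G s l - l.1 1 / l.1 0 * coneL 0 1 (G s) l
      - l.1 2 / l.1 0 * coneL 0 2 (G s) l
      - l.1 3 / l.1 0 * coneL 0 3 (G s) l := by linarith
  have b1 := abs_le.1 (hm 1 (coneL 0 1 (G s) l))
  have b2 := abs_le.1 (hm 2 (coneL 0 2 (G s) l))
  have b3 := abs_le.1 (hm 3 (coneL 0 3 (G s) l))
  have b0 := abs_le.1 (le_refl |G s l|)
  rw [e, abs_le]
  constructor <;> linarith

/-- The compact set of pairs `(s, l)` with `|s| ≤ 1`, `l⁰ = 1`. -/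
def refSet : Set (ℝ × Spacetime) :=
  Set.Icc (-1) 1 ×ˢ {l | mdot l l = 0 ∧ l 0 = 1}

theorem isCompact_refSet : IsCompact refSet := by
  refine isCompact_Icc.prod ?_
  refine Metric.isCompact_of_isClosed_isBounded ?_ ?_
  · refine IsClosed.inter (isClosed_eq ?_ continuous_const) (isClosed_eq ?_ continuous_const)
    · unfold mdot; fun_prop
    · fun_prop
  · refine (Metric.isBounded_closedBall (x := (0 : Spacetime)) (r := 1)).subset ?_
    rintro l ⟨h1, h2⟩
    rw [mem_closedBall_zero_iff, pi_norm_le_iff_of_nonneg zero_le_one]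
    intro i
    have := comp_le ⟨l, h1, by rw [h2]; exact one_pos⟩ i
    rw [Real.norm_eq_abs]
    simpa [h2] using this

theorem Tame.decay_sDeriv {G : ℝ → NullVec → ℝ} (h : Tame G) (y : Spacetime) :
    Decays (mulLin y (AsymptoticQED.sDeriv G)) := by
  have hsm := h.smooth.sDeriv
  have hho := h.homog.sDeriv h.smooth
  -- bound near the apex direction
  obtain ⟨M, hM⟩ : ∃ M, ∀ p ∈ refSet, ‖ext2 (AsymptoticQED.sDeriv G) p‖ ≤ M := by
    refine isCompact_refSet.exists_bound_of_continuousOn ?_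
    refine (ContDiffOn.continuousOn hsm).mono ?_
    rintro ⟨s, l⟩ ⟨-, h1, h2⟩
    have h2' : l 0 = 1 := h2
    exact ⟨trivial, null_mem ⟨l, h1, by rw [h2']; exact one_pos⟩⟩
  have hM' : ∀ s (l : NullVec), |s| ≤ l.1 0 →
      |l.1 0 * AsymptoticQED.sDeriv G s l| ≤ M / l.1 0 ^ 2 := by
    intro s l hs
    have h0 := l.2.2
    have hn : mdot ((l.1 0)⁻¹ • l.1) ((l.1 0)⁻¹ • l.1) = 0 := by
      have := l.2.1
      unfold mdot at this ⊢
      simp only [Pi.smul_apply, smul_eq_mul]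
      linear_combination ((l.1 0)⁻¹) ^ 2 * this
    have hn0 : ((l.1 0)⁻¹ • l.1) 0 = 1 := by simp [h0.ne']
    let l1 : NullVec := ⟨(l.1 0)⁻¹ • l.1, hn, by rw [hn0]; exact one_pos⟩
    have e1 : l.1 = l.1 0 • l1.1 := by
      show l.1 = l.1 0 • ((l.1 0)⁻¹ • l.1)
      rw [smul_smul, mul_inv_cancel₀ h0.ne', one_smul]
    have e2 := hho (l.1 0) h0 (s / l.1 0) l1 l e1
    rw [mul_div_cancel₀ _ h0.ne'] at e2
    have hmem : (s / l.1 0, l1.1) ∈ refSet := by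
      refine ⟨?_, hn, hn0⟩
      have := abs_le.1 hs
      constructor
      · rw [le_div_iff₀ h0]; linarith
      · rw [div_le_iff₀ h0]; linarith
    have e3 := hM _ hmem
    rw [ext2_null, Real.norm_eq_abs] at e3
    rw [e2, show ((-2 : ℤ) - 1) = -3 by norm_num, ← mul_assoc, abs_mul, le_div_iff₀ (by positivity)]
    have e4 : |l.1 0 * l.1 0 ^ (-3 : ℤ)| = (l.1 0 ^ 2)⁻¹ := by
      rw [abs_of_pos (by positivity)]
      rw [zpow_neg]
      field_simp
    rw [e4]
    field_simp
    exact e3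
  have hM0 : 0 ≤ M := by
    let l : NullVec := ⟨![1, 1, 0, 0], by simp [mdot], by simp⟩
    have := hM' 0 l (by simp [l])
    have e := (abs_nonneg _).trans this
    simpa [l] using e
  -- the bound for large `s`
  have hL : Decays ((fun s l => |(2 : ℝ) • G s l|) + (fun s l => |AsymptoticQED.coneL 0 1 (G s) l|)
      + (fun s l => |AsymptoticQED.coneL 0 2 (G s) l|)
      + (fun s l => |AsymptoticQED.coneL 0 3 (G s) l|)) :=
    ((((h.decay []).smul 2).abs.add (h.decay [(0, 1)]).abs).add (h.decay [(0, 2)]).abs).add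
      (h.decay [(0, 3)]).abs
  obtain ⟨C, ε, hε, hC⟩ := hL
  have key : Decays fun s l => l.1 0 * AsymptoticQED.sDeriv G s l := by
    refine ⟨|C| + M * 2 ^ (1 + ε), ε, hε, fun s l => ?_⟩
    have h0 := l.2.2
    have hw := wt_pos s l ε
    rcases le_total |s| (l.1 0) with hs | hs
    · refine (hM' s l hs).trans ?_
      rw [div_le_div_iff₀ (by positivity) hw]
      have h1 : (1 + |s| / l.1 0) ^ (1 + ε) ≤ 2 ^ (1 + ε) := by
        have hb := base_pos s l
        refine Real.rpow_le_rpow (by linarith) ?_ (by linarith)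
        have : |s| / l.1 0 ≤ 1 := by rw [div_le_one h0]; exact hs
        linarith
      calc M * (l.1 0 ^ 2 * (1 + |s| / l.1 0) ^ (1 + ε))
          ≤ M * (l.1 0 ^ 2 * 2 ^ (1 + ε)) := by gcongr
        _ = (0 + M * 2 ^ (1 + ε)) * l.1 0 ^ 2 := by ring
        _ ≤ _ := by gcongr; exact abs_nonneg C
    · have h1 : |l.1 0 * AsymptoticQED.sDeriv G s l| ≤ |s * AsymptoticQED.sDeriv G s l| := by
        rw [abs_mul, abs_mul, abs_of_pos h0]; gcongr
      have h2 := euler_bound h.homog h.smooth s l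
      have h3 := (le_abs_self _).trans (hC s l)
      simp only [Pi.add_apply, smul_eq_mul, abs_mul, abs_two] at h3
      refine (h1.trans (h2.trans h3)).trans ?_
      gcongr
      have : 0 ≤ M * 2 ^ (1 + ε) := by positivity
      linarith [le_abs_self C]
  refine key.of_le (size y) fun s l => ?_
  show |mdot y l.1 * _| ≤ _
  rw [abs_mul, abs_mul, ← mul_assoc, abs_of_pos l.2.2]
  gcongr
  exact mdot_le y l

theorem Tame.decay_mulLin_sDeriv (w : List (Fin 4 × Fin 4)) :
    ∀ {G : ℝ → NullVec → ℝ}, Tame G → ∀ y : Spacetime,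
      Decays fun s => coneLs w (mulLin y (AsymptoticQED.sDeriv G) s) := by
  induction w with
  | nil => intro G h y; exact h.decay_sDeriv y
  | cons p w ih =>
    intro G h y
    have h1 := coneL_mulLin' h.smooth.sDeriv y p.1 p.2
    have h2 := sDeriv_coneL h.smooth p.1 p.2
    rw [h2] at h1
    show Decays fun s => coneLs w (AsymptoticQED.coneL p.1 p.2 (mulLin y (AsymptoticQED.sDeriv G) s))
    have h3 : (fun s => coneLs w
          (AsymptoticQED.coneL p.1 p.2 (mulLin y (AsymptoticQED.sDeriv G) s)))
        = fun s => coneLs w ((fun s => AsymptoticQED.coneL p.1 p.2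
          (mulLin y (AsymptoticQED.sDeriv G) s)) s) := rfl
    rw [h3, h1, coneLs_add w (h.smooth.sDeriv.mulLin _)
      ((h.smooth.coneL p.1 p.2).sDeriv.mulLin _)]
    exact (ih h _).add (ih (h.coneL p.1 p.2) y)

theorem Tame.mulLin_sDeriv {G : ℝ → NullVec → ℝ} (h : Tame G) (y : Spacetime) :
    Tame (mulLin y (AsymptoticQED.sDeriv G)) :=
  ⟨h.smooth.sDeriv.mulLin y, by simpa using (h.homog.sDeriv h.smooth).mulLin y,
    fun w => Tame.decay_mulLin_sDeriv w h y⟩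

theorem Tame.decay_shift (w : List (Fin 4 × Fin 4)) :
    ∀ {G : ℝ → NullVec → ℝ}, Tame G → ∀ x : Spacetime,
      Decays fun s => coneLs w (AsymptoticQED.shift x G s) := by
  induction w with
  | nil => intro G h x; exact Decays.shift (h.decay []) x
  | cons p w ih =>
    intro G h x
    have h1 := coneL_shift h.smooth x p.1 p.2
    have h3 : (fun s => coneLs (p :: w) (AsymptoticQED.shift x G s))
        = fun s => coneLs w ((fun s => AsymptoticQED.coneL p.1 p.2
          (AsymptoticQED.shift x G s)) s) := rfl
    have hm := h.mulLin_sDeriv (linL p.1 p.2 x)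
    rw [h3, h1, coneLs_add w ((h.smooth.coneL p.1 p.2).shift x) ((hm.smooth.shift x).smul (-1)),
      coneLs_smul w (-1) (hm.smooth.shift x)]
    exact (ih (h.coneL p.1 p.2) x).add ((ih hm x).smul (-1))

theorem Tame.shift {G : ℝ → NullVec → ℝ} (h : Tame G) (x : Spacetime) :
    Tame (AsymptoticQED.shift x G) :=
  ⟨h.smooth.shift x, h.homog.shift x, fun w => Tame.decay_shift w h x⟩

/-! ## Test fields -/

/-- The test fields `V^a(s,l)`: smooth functions, homogeneous of degree `-1`, with `l·V(s,l) = 0`,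
fall-off of `∂V/∂s` and all its cone derivatives, `V(+∞,l) = 0` and `L_{[ab}V_{c]}(-∞,l) = 0`. -/
structure IsTestField (V : ℝ → NullVec → Spacetime) : Prop where
  homog : ∀ (μ : ℝ), 0 < μ → ∀ (s : ℝ) (l l' : NullVec), l'.1 = μ • l.1 →
    V (μ * s) l' = μ⁻¹ • V s l
  smooth : ∀ a, JointSmooth fun s l => V s l a
  transverse : ∀ s (l : NullVec), mdot l.1 (V s l) = 0
  decay : ∀ a w, Decays fun s => coneLs w (sDeriv (fun s l => V s l a) s)
  future : ∀ l, Tendsto (fun s => V s l) atTop (𝓝 0)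
  past : ∃ Vm : NullVec → Spacetime, (∀ a, SmoothOnCone fun l => Vm l a) ∧
    (∀ l, Tendsto (fun s => V s l) atBot (𝓝 (Vm l))) ∧
    ∀ a b c l, coneL a b (fun l => lower (Vm l) c) l + coneL b c (fun l => lower (Vm l) a) l
      + coneL c a (fun l => lower (Vm l) b) l = 0

/-- The limit function `V(-∞, l)`. -/
def pastLimit (V : ℝ → NullVec → Spacetime) (l : NullVec) : Spacetime :=
  limUnder atBot fun s => V s l

theorem SmoothOnCone.joint {F : NullVec → ℝ} (h : SmoothOnCone F) : JointSmooth fun _ => F :=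
  ContDiffOn.comp h contDiffOn_snd fun _ hp => (Set.mem_prod.1 hp).2

theorem SmoothOnCone.add {F G : NullVec → ℝ} (hF : SmoothOnCone F) (hG : SmoothOnCone G) :
    SmoothOnCone (F + G) := by
  have : coneExt (F + G) = coneExt F + coneExt G := by
    funext x
    by_cases h : 0 < spNorm x <;> simp [coneExt, h]
  unfold SmoothOnCone
  rw [this]
  exact ContDiffOn.add hF hG

theorem SmoothOnCone.smul {F : NullVec → ℝ} (c : ℝ) (hF : SmoothOnCone F) :
    SmoothOnCone (c • F) := by
  have : coneExt (c • F) = c • coneExt F := by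
    funext x
    by_cases h : 0 < spNorm x <;> simp [coneExt, h]
  unfold SmoothOnCone
  rw [this]
  exact ContDiffOn.const_smul c hF

theorem SmoothOnCone.lower {F : NullVec → Spacetime} (h : ∀ a, SmoothOnCone fun l => F l a)
    (a : Fin 4) : SmoothOnCone fun l => lower (F l) a := by
  unfold AsymptoticQED.lower
  split_ifs
  · exact h a
  · have := (h a).smul (-1)
    convert this using 1
    funext l; simp

theorem coneL_add' {F G : NullVec → ℝ} (hF : SmoothOnCone F) (hG : SmoothOnCone G) (a b : Fin 4)
    (l : NullVec) : coneL a b (F + G) l = coneL a b F l + coneL a b G l :=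
  congrFun (congrFun (coneL_add hF.joint hG.joint a b) 0) l

theorem coneL_smul' {F : NullVec → ℝ} (hF : SmoothOnCone F) (c : ℝ) (a b : Fin 4)
    (l : NullVec) : coneL a b (c • F) l = c * coneL a b F l :=
  congrFun (congrFun (coneL_smul hF.joint c a b) 0) l

theorem sDeriv_add {G H : ℝ → NullVec → ℝ} (hG : JointSmooth G) (hH : JointSmooth H) :
    sDeriv (G + H) = sDeriv G + sDeriv H := by
  funext s l
  exact ((hG.hasDerivAt s l).add (hH.hasDerivAt s l)).deriv

theorem sDeriv_smul {G : ℝ → NullVec → ℝ} (hG : JointSmooth G) (c : ℝ) :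
    sDeriv (c • G) = c • sDeriv G := by
  funext s l
  exact ((hG.hasDerivAt s l).const_mul c).deriv

theorem lower_add (x y : Spacetime) (a : Fin 4) : lower (x + y) a = lower x a + lower y a := by
  unfold lower; split_ifs <;> simp; ring

theorem lower_smul (c : ℝ) (x : Spacetime) (a : Fin 4) : lower (c • x) a = c * lower x a := by
  unfold lower; split_ifs <;> simp

theorem IsTestField.zero : IsTestField 0 := by
  have hz : SmoothOnCone (fun _ => (0 : ℝ)) := by
    have : coneExt (fun _ => (0 : ℝ)) = fun _ => 0 := by
      funext x; unfold coneExt; split_ifs <;> rfl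
    unfold SmoothOnCone
    rw [this]; exact contDiffOn_const
  have hd : sDeriv (0 : ℝ → NullVec → ℝ) = 0 := by
    funext s l; exact deriv_const s (0 : ℝ)
  have hw : ∀ w, coneLs w (0 : NullVec → ℝ) = 0 := by
    intro w
    have := coneLs_smul w 0 hz.joint
    have h2 := congrFun this 0
    simpa using h2
  have hl : ∀ c, (fun l : NullVec => lower ((0 : NullVec → Spacetime) l) c) = 0 := by
    intro c; funext l; simp [lower]
  refine ⟨fun _ _ _ _ _ _ => by simp, fun a => hz.joint, fun s l => by simp [mdot], fun a w => ?_,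
    fun l => tendsto_const_nhds, 0, fun a => hz, fun l => tendsto_const_nhds, fun a b c l => ?_⟩
  · refine ⟨0, 1, one_pos, fun s l => ?_⟩
    show |coneLs w (sDeriv (0 : ℝ → NullVec → ℝ) s) l| ≤ _
    rw [hd]
    show |coneLs w (0 : NullVec → ℝ) l| ≤ _
    rw [hw]; simp
  · have h0 : ∀ a b, coneL a b (0 : NullVec → ℝ) l = 0 := fun a b => congrFun (hw [(a, b)]) l
    simp only [hl, h0, add_zero]

theorem IsTestField.add {V W : ℝ → NullVec → Spacetime} (hV : IsTestField V)
    (hW : IsTestField W) : IsTestField (V + W) := by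
  obtain ⟨Vm, hVs, hVt, hVL⟩ := hV.past
  obtain ⟨Wm, hWs, hWt, hWL⟩ := hW.past
  refine ⟨fun μ hμ s l l' e => ?_, fun a => (hV.smooth a).add (hW.smooth a), fun s l => ?_,
    fun a w => ?_, fun l => ?_, Vm + Wm, fun a => (hVs a).add (hWs a),
    fun l => (hVt l).add (hWt l), fun a b c l => ?_⟩
  · show V (μ * s) l' + W (μ * s) l' = μ⁻¹ • (V s l + W s l)
    rw [hV.homog μ hμ s l l' e, hW.homog μ hμ s l l' e, smul_add]
  · have h1 := hV.transverse s l
    have h2 := hW.transverse s l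
    rw [← mdotL_apply] at *
    show mdotL l.1 (V s l + W s l) = 0
    rw [map_add, h1, h2, add_zero]
  · have h := (hV.decay a w).add (hW.decay a w)
    rw [← coneLs_add w (hV.smooth a).sDeriv (hW.smooth a).sDeriv,
      ← sDeriv_add (hV.smooth a) (hW.smooth a)] at h
    exact h
  · simpa using (hV.future l).add (hW.future l)
  · have e : ∀ c, (fun l => lower ((Vm + Wm) l) c)
        = (fun l => lower (Vm l) c) + fun l => lower (Wm l) c := by
      intro c; funext l; exact lower_add _ _ _
    simp only [e]
    rw [coneL_add' (SmoothOnCone.lower hVs _) (SmoothOnCone.lower hWs _),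
      coneL_add' (SmoothOnCone.lower hVs _) (SmoothOnCone.lower hWs _),
      coneL_add' (SmoothOnCone.lower hVs _) (SmoothOnCone.lower hWs _)]
    linarith [hVL a b c l, hWL a b c l]

theorem IsTestField.smul {V : ℝ → NullVec → Spacetime} (c : ℝ) (hV : IsTestField V) :
    IsTestField (c • V) := by
  obtain ⟨Vm, hVs, hVt, hVL⟩ := hV.past
  refine ⟨fun μ hμ s l l' e => ?_, fun a => (hV.smooth a).smul c, fun s l => ?_,
    fun a w => ?_, fun l => ?_, c • Vm, fun a => (hVs a).smul c,
    fun l => (hVt l).const_smul c, fun a b d l => ?_⟩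
  · show c • V (μ * s) l' = μ⁻¹ • (c • V s l)
    rw [hV.homog μ hμ s l l' e, smul_comm]
  · have h1 := hV.transverse s l
    rw [← mdotL_apply] at *
    show mdotL l.1 (c • V s l) = 0
    rw [map_smul, h1, smul_zero]
  · have h := (hV.decay a w).smul c
    rw [← coneLs_smul w c (hV.smooth a).sDeriv, ← sDeriv_smul (hV.smooth a)] at h
    exact h
  · simpa using (hV.future l).const_smul c
  · have e : ∀ d, (fun l => lower ((c • Vm) l) d) = c • fun l => lower (Vm l) d := by
      intro d; funext l; exact lower_smul _ _ _
    simp only [e]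
    rw [coneL_smul' (SmoothOnCone.lower hVs _), coneL_smul' (SmoothOnCone.lower hVs _),
      coneL_smul' (SmoothOnCone.lower hVs _)]
    linear_combination c * hVL a b d l

theorem IsTestField.tendsto_pastLimit {V : ℝ → NullVec → Spacetime} (hV : IsTestField V)
    (l : NullVec) : Tendsto (fun s => V s l) atBot (𝓝 (pastLimit V l)) := by
  obtain ⟨Vm, -, hVt, -⟩ := hV.past
  exact tendsto_nhds_limUnder ⟨_, hVt l⟩

theorem IsTestField.smooth_pastLimit {V : ℝ → NullVec → Spacetime} (hV : IsTestField V)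
    (a : Fin 4) : SmoothOnCone fun l => pastLimit V l a := by
  obtain ⟨Vm, hs, hVt, -⟩ := hV.past
  have : pastLimit V = Vm := funext fun l => (hVt l).limUnder_eq
  rw [this]; exact hs a

/-- Action of the translation by `x` on fields: `[T_x V](s,l) = V(s - x·l, l)`. -/
def translate (x : Spacetime) (V : ℝ → NullVec → Spacetime) : ℝ → NullVec → Spacetime :=
  fun s l => V (s - mdot x l.1) l

theorem sDeriv_shift (x : Spacetime) (G : ℝ → NullVec → ℝ) :
    sDeriv (shift x G) = shift x (sDeriv G) := by
  funext s l
  exact deriv_comp_sub_const (f := fun t => G t l) (mdot x l.1) s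

theorem tendsto_translate_atBot {V : ℝ → NullVec → Spacetime} (x : Spacetime) {l : NullVec}
    {y : Spacetime} (h : Tendsto (fun s => V s l) atBot (𝓝 y)) :
    Tendsto (fun s => translate x V s l) atBot (𝓝 y) := by
  have h2 : Tendsto (fun s : ℝ => s - mdot x l.1) atBot atBot := by
    simpa only [sub_eq_add_neg, id] using tendsto_atBot_add_const_right atBot (-mdot x l.1) tendsto_id
  exact h.comp h2

theorem IsTestField.translate {V : ℝ → NullVec → Spacetime} (hV : IsTestField V)
    (x : Spacetime) : IsTestField (translate x V) := by
  obtain ⟨Vm, hVs, hVt, hVL⟩ := hV.past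
  have hh : ∀ a, Homog (-1) fun s l => V s l a := by
    intro a μ hμ s l l' e
    show V (μ * s) l' a = μ ^ (-1 : ℤ) * V s l a
    rw [hV.homog μ hμ s l l' e, zpow_neg_one]; rfl
  have ht : ∀ a, Tame (sDeriv fun s l => V s l a) := fun a =>
    ⟨(hV.smooth a).sDeriv, by simpa using (hh a).sDeriv (hV.smooth a), hV.decay a⟩
  refine ⟨fun μ hμ s l l' e => ?_, fun a => (hV.smooth a).shift x,
    fun s l => hV.transverse _ l, fun a w => ?_, fun l => ?_, Vm, hVs,
    fun l => tendsto_translate_atBot x (hVt l), hVL⟩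
  · show V (μ * s - mdot x l'.1) l' = μ⁻¹ • V (s - mdot x l.1) l
    rw [← hV.homog μ hμ _ l l' e]
    congr 1
    rw [e, ← mdotL_apply, ← mdotL_apply, map_smul, smul_eq_mul]; ring
  · have := ((ht a).shift x).decay w
    rw [← sDeriv_shift] at this
    exact this
  · have h2 : Tendsto (fun s : ℝ => s - mdot x l.1) atTop atTop := by
      simpa only [sub_eq_add_neg, id] using
        tendsto_atTop_add_const_right atTop (-mdot x l.1) tendsto_id
    exact (hV.future l).comp h2

/-- The real vector space `𝓥` of test fields. -/
def testFields : Submodule ℝ (ℝ → NullVec → Spacetime) where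
  carrier := {V | IsTestField V}
  zero_mem' := IsTestField.zero
  add_mem' := fun h h' => h.add h'
  smul_mem' := fun c _ h => h.smul c

/-- The field of test functions translated by `x`, as an additive map on test fields. -/
def translateHom (x : Spacetime) : testFields →+ testFields where
  toFun V := ⟨translate x V.1, V.2.translate x⟩
  map_zero' := rfl
  map_add' _ _ := rfl

/-! ## Integration over null directions, the symplectic form and the phase variable -/

/-- The null vector `(1, n)`. -/
def nullOf (n : Metric.sphere (0 : E3) 1) : NullVec :=
  ⟨![1, n.1 0, n.1 1, n.1 2], by
    have h : ‖n.1‖ = 1 := by simp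
    rw [EuclideanSpace.norm_eq, Real.sqrt_eq_one, Fin.sum_univ_three] at h
    simp only [Real.norm_eq_abs, sq_abs] at h
    refine ⟨?_, by simp⟩
    simp [mdot]
    linarith⟩

/-- The invariant integral `∫ F(l) d²l` of a function homogeneous of degree `-2`: the integral
with respect to the spherical angle measure over the section `l⁰ = 1`. -/
def nullIntegral (F : NullVec → ℝ) : ℝ :=
  ∫ n, F (nullOf n) ∂((volume : Measure E3).toSphere)

/-- The symplectic form
`{V₁,V₂} = (4π)⁻¹ ∫ (V̇₁·V₂ - V̇₂·V₁)(s,l) ds d²l`. -/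
def symp (V₁ V₂ : ℝ → NullVec → Spacetime) : ℝ :=
  1 / (4 * Real.pi) * nullIntegral fun l =>
    ∫ s, (mdot (deriv (fun t => V₁ t l) s) (V₂ s l) - mdot (deriv (fun t => V₂ t l) s) (V₁ s l))

/-- The null asymptotic `V^e(v,l) = e v / v·l` of the Coulomb field of a particle with charge `e`
and four-velocity `v`. -/
def coulomb (e : ℝ) (v : Hyp) : ℝ → NullVec → Spacetime := fun _ l => (e / mdot v.1 l.1) • v.1

/-- The phase variable `Φ_V(l) = (4π)⁻¹ ∫ l·V(-∞,l') / l·l' d²l'`. -/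
def phi (V : ℝ → NullVec → Spacetime) (l : NullVec) : ℝ :=
  1 / (4 * Real.pi) * nullIntegral fun l' => mdot l.1 (pastLimit V l') / mdot l.1 l'.1

/-- The function `(e/4π) ∫ Φ_V(l) / (v·l)² d²l` on the hyperboloid. -/
def coulombPhase (e : ℝ) (V : ℝ → NullVec → Spacetime) (v : Hyp) : ℝ :=
  e / (4 * Real.pi) * nullIntegral fun l => phi V l / mdot v.1 l.1 ^ 2

theorem continuous_nullOf : Continuous nullOf := by
  refine Continuous.subtype_mk ?_ _
  refine continuous_pi fun i => ?_
  fin_cases i <;> simp <;> fun_prop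

theorem SmoothOnCone.continuous_nullOf {F : NullVec → ℝ} (h : SmoothOnCone F) :
    Continuous fun n => F (nullOf n) := by
  have h1 : Continuous fun n => coneExt F (nullOf n).1 :=
    (ContDiffOn.continuousOn h).comp_continuous
      (continuous_subtype_val.comp AsymptoticQED.continuous_nullOf) fun n => null_mem _
  simpa only [coneExt_null] using h1

theorem symp_translate (x : Spacetime) (V₁ V₂ : ℝ → NullVec → Spacetime) :
    symp (translate x V₁) (translate x V₂) = symp V₁ V₂ := by
  unfold symp
  congr 2
  funext l
  have h : ∀ V : ℝ → NullVec → Spacetime, ∀ s, deriv (fun t => translate x V t l) s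
      = deriv (fun t => V t l) (s - mdot x l.1) := fun V s =>
    deriv_comp_sub_const (f := fun t => V t l) (mdot x l.1) s
  simp only [h]
  exact integral_sub_right_eq_self (μ := volume) (fun s : ℝ => mdot (deriv (fun t => V₁ t l) s)
    (V₂ s l) - mdot (deriv (fun t => V₂ t l) s) (V₁ s l)) (mdot x l.1)

theorem phi_translate (x : Spacetime) (V : testFields) : phi (translate x V.1) = phi V.1 := by
  have : pastLimit (translate x V.1) = pastLimit V.1 := funext fun l =>
    (tendsto_translate_atBot x (V.2.tendsto_pastLimit l)).limUnder_eq
  unfold phi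
  rw [this]

theorem measurable_mdot_left (y : Spacetime) : Measurable fun x => mdot x y := by
  unfold mdot; fun_prop

theorem measurable_coulombPhase (e : ℝ) (V : testFields) : Measurable (coulombPhase e V.1) := by
  have hm : Measurable fun n => pastLimit V.1 (nullOf n) :=
    measurable_pi_iff.2 fun a => (V.2.smooth_pastLimit a).continuous_nullOf.measurable
  have hN : Measurable fun n => (nullOf n).1 :=
    (continuous_subtype_val.comp continuous_nullOf).measurable
  have hd : Measurable fun p : Spacetime × Spacetime => mdot p.1 p.2 := by
    unfold mdot; fun_prop
  have h1 : StronglyMeasurable fun n => phi V.1 (nullOf n) := by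
    refine StronglyMeasurable.const_mul ?_ _
    refine StronglyMeasurable.integral_prod_right (f := fun n n' =>
      mdot (nullOf n).1 (pastLimit V.1 (nullOf n')) / mdot (nullOf n).1 (nullOf n').1) ?_
    refine Measurable.stronglyMeasurable ?_
    exact (hd.comp ((hN.comp measurable_fst).prodMk (hm.comp measurable_snd))).div
      (hd.comp ((hN.comp measurable_fst).prodMk (hN.comp measurable_snd)))
  have h2 : StronglyMeasurable fun v : Hyp => nullIntegral fun l => phi V.1 l / mdot v.1 l.1 ^ 2 := by
    refine StronglyMeasurable.integral_prod_right (f := fun (v : Hyp) n =>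
      phi V.1 (nullOf n) / mdot v.1 (nullOf n).1 ^ 2) ?_
    refine Measurable.stronglyMeasurable ?_
    exact (h1.measurable.comp measurable_snd).div ((hd.comp
      ((measurable_subtype_coe.comp measurable_fst).prodMk (hN.comp measurable_snd))).pow_const 2)
  exact (h2.measurable).const_mul _

/-- The test fields equivalent to zero: pure gauges `V = l α(s,l)` with
`(4π)⁻¹ ∫ α(-∞,l) d²l ∈ (2π/e) ℤ`. -/
def trivialFields (e : ℝ) : AddSubgroup testFields where
  carrier := {V | ∃ (α : ℝ → NullVec → ℝ) (αm : NullVec → ℝ) (n : ℤ),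
    (∀ s l, V.1 s l = α s l • l.1) ∧ (∀ l, Tendsto (fun s => α s l) atBot (𝓝 (αm l))) ∧
    1 / (4 * Real.pi) * nullIntegral αm = n * (2 * Real.pi / e)}
  zero_mem' := ⟨0, 0, 0, fun s l => by simp, fun l => tendsto_const_nhds, by simp [nullIntegral]⟩
  add_mem' := by
    rintro V W ⟨α, αm, n, h1, h2, h3⟩ ⟨β, βm, k, g1, g2, g3⟩
    refine ⟨α + β, αm + βm, n + k, fun s l => ?_, fun l => (h2 l).add (g2 l), ?_⟩
    · show V.1 s l + W.1 s l = (α s l + β s l) • l.1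
      rw [h1, g1, add_smul]
    · have key : ∀ (V : testFields) (α : ℝ → NullVec → ℝ) (αm : NullVec → ℝ),
          (∀ s l, V.1 s l = α s l • l.1) → (∀ l, Tendsto (fun s => α s l) atBot (𝓝 (αm l))) →
          Integrable (fun n => αm (nullOf n)) ((volume : Measure E3).toSphere) := by
        intro V α αm h1 h2
        have e1 : ∀ n, αm (nullOf n) = pastLimit V.1 (nullOf n) 0 := by
          intro n
          have t1 := tendsto_pi_nhds.1 (V.2.tendsto_pastLimit (nullOf n)) 0
          have t2 : (fun s => V.1 s (nullOf n) 0) = fun s => α s (nullOf n) := by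
            funext s; rw [h1]; simp [nullOf]
          rw [t2] at t1
          exact tendsto_nhds_unique (h2 _) t1
        simp only [e1]
        exact (V.2.smooth_pastLimit 0).continuous_nullOf.integrable_of_hasCompactSupport
          (HasCompactSupport.of_compactSpace _)
      have : nullIntegral (αm + βm) = nullIntegral αm + nullIntegral βm :=
        integral_add (key V α αm h1 h2) (key W β βm g1 g2)
      rw [this, mul_add, h3, g3]
      push_cast; ring
  neg_mem' := by
    rintro V ⟨α, αm, n, h1, h2, h3⟩
    refine ⟨-α, -αm, -n, fun s l => ?_, fun l => (h2 l).neg, ?_⟩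
    · show -V.1 s l = (-α s l) • l.1
      rw [h1, neg_smul]
    · have : nullIntegral (-αm) = -nullIntegral αm := integral_neg _
      rw [this, mul_neg, h3]
      push_cast; ring

/-- The Abelian group `L` of test fields modulo equivalence. -/
abbrev GaugeClass (e : ℝ) : Type := testFields ⧸ trivialFields e

theorem translate_mem_trivial (e : ℝ) (x : Spacetime) :
    trivialFields e ≤ (trivialFields e).comap (translateHom x) := by
  rintro V ⟨α, αm, n, h1, h2, h3⟩
  refine ⟨shift x α, αm, n, fun s l => h1 _ l, fun l => ?_, h3⟩
  have h4 : Tendsto (fun s : ℝ => s - mdot x l.1) atBot atBot := by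
    simpa only [sub_eq_add_neg, id] using tendsto_atBot_add_const_right atBot (-mdot x l.1) tendsto_id
  exact (h2 l).comp h4

/-! ## The one-particle Hilbert space of Dirac wave functions on the hyperboloid -/

/-- The Dirac matrices `γ^a` (Dirac representation). -/
def gammaM : Fin 4 → Matrix (Fin 4) (Fin 4) ℂ := ![
  !![1, 0, 0, 0; 0, 1, 0, 0; 0, 0, -1, 0; 0, 0, 0, -1],
  !![0, 0, 0, 1; 0, 0, 1, 0; 0, -1, 0, 0; -1, 0, 0, 0],
  !![0, 0, 0, -I; 0, 0, I, 0; 0, I, 0, 0; -I, 0, 0, 0],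
  !![0, 0, 1, 0; 0, 0, 0, -1; -1, 0, 0, 0; 0, 1, 0, 0]]

/-- `γ·v = γ^a v_a`. -/
def gslash (v : Spacetime) : Matrix (Fin 4) (Fin 4) ℂ := ∑ a, (lower v a : ℂ) • gammaM a

/-- The sesquilinear form `z̄ γ·v w`, where `z̄ = z† γ⁰` is the Dirac conjugate. -/
def diracForm (v : Spacetime) (z w : Fin 4 → ℂ) : ℂ :=
  star z ⬝ᵥ ((gammaM 0 * gslash v).mulVec w)

/-- The point of the hyperboloid with spatial part `u`. -/
def hypOf (u : E3) : Hyp :=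
  ⟨![Real.sqrt (1 + ‖u‖ ^ 2), u 0, u 1, u 2], by
    have h : ‖u‖ ^ 2 = u 0 ^ 2 + u 1 ^ 2 + u 2 ^ 2 := by
      rw [EuclideanSpace.norm_sq_eq, Fin.sum_univ_three]
      simp only [Real.norm_eq_abs, sq_abs]
    have h2 : Real.sqrt (1 + ‖u‖ ^ 2) * Real.sqrt (1 + ‖u‖ ^ 2) = 1 + ‖u‖ ^ 2 :=
      Real.mul_self_sqrt (by positivity)
    refine ⟨?_, ?_⟩
    · simp [mdot, h2]
      linarith
    · simp
      positivity⟩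

/-- The invariant measure `dμ(v) = d³v / v⁰` on the hyperboloid. -/
def hypMeasure : Measure Hyp :=
  ((volume : Measure E3).withDensity fun u => ENNReal.ofReal (1 / Real.sqrt (1 + ‖u‖ ^ 2))).map
    hypOf

theorem gslash_eq (v : Spacetime) : gslash v =
    !![(v 0 : ℂ), 0, -v 3, -v 1 + I * v 2; 0, (v 0 : ℂ), -v 1 - I * v 2, v 3;
      (v 3 : ℂ), v 1 - I * v 2, -v 0, 0; v 1 + I * v 2, -v 3, 0, -v 0] := by
  ext i j
  simp only [gslash, Fin.sum_univ_four, lower, gammaM]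
  fin_cases i <;> fin_cases j <;> simp <;> ring

theorem gslash_sq (v : Spacetime) : gslash v * gslash v = (mdot v v : ℂ) • 1 := by
  rw [gslash_eq]
  ext i j
  have hI : (I : ℂ) ^ 2 = -1 := I_sq
  fin_cases i <;> fin_cases j <;> simp [Matrix.mul_apply, Fin.sum_univ_four, mdot] <;>
    ring_nf <;> simp [hI] <;> ring

theorem g0_gslash (v : Spacetime) : gammaM 0 * gslash v =
    !![(v 0 : ℂ), 0, -v 3, -v 1 + I * v 2; 0, (v 0 : ℂ), -v 1 - I * v 2, v 3;
      -(v 3 : ℂ), -(v 1 - I * v 2), v 0, 0; -(v 1 + I * v 2), v 3, 0, v 0] := by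
  rw [gslash_eq]
  ext i j
  simp only [gammaM]
  fin_cases i <;> fin_cases j <;> simp [Matrix.mul_apply, Fin.sum_univ_four]

theorem dens_conjTranspose (v : Spacetime) :
    (gammaM 0 * gslash v).conjTranspose = gammaM 0 * gslash v := by
  rw [g0_gslash]
  ext i j
  fin_cases i <;> fin_cases j <;> simp [Matrix.conjTranspose_apply] <;> ring

theorem diracForm_conj (v : Spacetime) (z w : Fin 4 → ℂ) :
    star (diracForm v z w) = diracForm v w z := by
  unfold diracForm
  rw [← Matrix.star_dotProduct_star, star_star, Matrix.star_mulVec, dens_conjTranspose,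
    ← Matrix.dotProduct_mulVec]

/-- `γ·v` is symmetric with respect to the form. -/
theorem diracForm_gslash (v : Spacetime) (z w : Fin 4 → ℂ) :
    diracForm v ((gslash v).mulVec z) w = diracForm v z ((gslash v).mulVec w) := by
  have h : (gslash v).conjTranspose * (gammaM 0 * gslash v)
      = (gammaM 0 * gslash v) * gslash v := by
    rw [g0_gslash, gslash_eq]
    ext i j
    fin_cases i <;> fin_cases j <;>
      simp [Matrix.mul_apply, Fin.sum_univ_four, Matrix.conjTranspose_apply] <;>
      first | ring1 | (ring_nf; simp)
  unfold diracForm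
  rw [Matrix.star_mulVec, ← Matrix.dotProduct_mulVec, Matrix.mulVec_mulVec, h,
    Matrix.mulVec_mulVec]

theorem diracForm_nonneg (v : Hyp) (z : Fin 4 → ℂ) : 0 ≤ (diracForm v.1 z z).re := by
  have hv := v.2.1
  have h0 := v.2.2
  set A := gammaM 0 * gslash v.1 with hA
  have hAA : A * A = (2 * v.1 0 : ℂ) • A - 1 := by
    have h1 : A * A = !![(v.1 0 : ℂ) ^ 2 + v.1 1 ^ 2 + v.1 2 ^ 2 + v.1 3 ^ 2, 0,
        -2 * v.1 0 * v.1 3, 2 * v.1 0 * (-v.1 1 + I * v.1 2);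
        0, (v.1 0 : ℂ) ^ 2 + v.1 1 ^ 2 + v.1 2 ^ 2 + v.1 3 ^ 2,
        2 * v.1 0 * (-v.1 1 - I * v.1 2), 2 * v.1 0 * v.1 3;
        -2 * v.1 0 * v.1 3, -2 * v.1 0 * (v.1 1 - I * v.1 2),
        (v.1 0 : ℂ) ^ 2 + v.1 1 ^ 2 + v.1 2 ^ 2 + v.1 3 ^ 2, 0;
        -2 * v.1 0 * (v.1 1 + I * v.1 2), 2 * v.1 0 * v.1 3, 0,
        (v.1 0 : ℂ) ^ 2 + v.1 1 ^ 2 + v.1 2 ^ 2 + v.1 3 ^ 2] := by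
      rw [hA, g0_gslash]
      have hI : (I : ℂ) ^ 2 = -1 := I_sq
      ext i j
      fin_cases i <;> fin_cases j <;> simp [Matrix.mul_apply, Fin.sum_univ_four] <;>
        ring_nf <;> simp [hI]
    have h2 : (v.1 0 : ℂ) ^ 2 + v.1 1 ^ 2 + v.1 2 ^ 2 + v.1 3 ^ 2 = 2 * v.1 0 * v.1 0 - 1 := by
      unfold mdot at hv
      have : v.1 0 ^ 2 + v.1 1 ^ 2 + v.1 2 ^ 2 + v.1 3 ^ 2 = 2 * v.1 0 * v.1 0 - 1 := by
        nlinarith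
      exact_mod_cast this
    rw [h1, h2, hA, g0_gslash]
    ext i j
    fin_cases i <;> fin_cases j <;> simp <;> ring
  have hB : (1 + A).conjTranspose * (1 + A) = (2 * (v.1 0 + 1) : ℂ) • A := by
    rw [Matrix.conjTranspose_add, Matrix.conjTranspose_one, hA, dens_conjTranspose, ← hA,
      mul_add, add_mul, add_mul, hAA]
    ext i j
    simp
    ring
  have h3 : star ((1 + A).mulVec z) ⬝ᵥ (1 + A).mulVec z
      = (2 * (v.1 0 + 1) : ℂ) * diracForm v.1 z z := by
    unfold diracForm
    rw [Matrix.star_mulVec, ← Matrix.dotProduct_mulVec, Matrix.mulVec_mulVec, hB,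
      Matrix.smul_mulVec, dotProduct_smul, smul_eq_mul]
  have h4 : 0 ≤ (star ((1 + A).mulVec z) ⬝ᵥ (1 + A).mulVec z).re := by
    simp only [dotProduct, Complex.re_sum]
    refine Finset.sum_nonneg fun i _ => ?_
    simp [Complex.mul_re]
    nlinarith [mul_self_nonneg ((1 + A).mulVec z i).re, mul_self_nonneg ((1 + A).mulVec z i).im]
  rw [h3] at h4
  have h5 : ((2 * (v.1 0 + 1) : ℂ) * diracForm v.1 z z).re
      = (2 * (v.1 0 + 1)) * (diracForm v.1 z z).re := by
    have : (2 * (v.1 0 + 1) : ℂ) = ((2 * (v.1 0 + 1) : ℝ) : ℂ) := by push_cast; ring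
    rw [this, Complex.re_ofReal_mul]
  rw [h5] at h4
  exact nonneg_of_mul_nonneg_right h4 (by linarith)

theorem diracForm_add_left (v : Spacetime) (z z' w : Fin 4 → ℂ) :
    diracForm v (z + z') w = diracForm v z w + diracForm v z' w := by
  simp [diracForm, add_dotProduct]

theorem diracForm_add_right (v : Spacetime) (z w w' : Fin 4 → ℂ) :
    diracForm v z (w + w') = diracForm v z w + diracForm v z w' := by
  simp [diracForm, Matrix.mulVec_add, dotProduct_add]

theorem diracForm_smul_left (v : Spacetime) (c : ℂ) (z w : Fin 4 → ℂ) :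
    diracForm v (c • z) w = star c * diracForm v z w := by
  simp [diracForm, smul_dotProduct]

theorem diracForm_smul_right (v : Spacetime) (c : ℂ) (z w : Fin 4 → ℂ) :
    diracForm v z (c • w) = c * diracForm v z w := by
  simp [diracForm, Matrix.mulVec_smul, dotProduct_smul]

theorem diracForm_self_im (v : Spacetime) (z : Fin 4 → ℂ) : (diracForm v z z).im = 0 :=
  Complex.conj_eq_iff_im.1 (diracForm_conj v z z)

/-- Pointwise Cauchy-Schwarz type bound. -/
theorem diracForm_bound (v : Hyp) (z w : Fin 4 → ℂ) :
    2 * ‖diracForm v.1 z w‖ ≤ (diracForm v.1 z z).re + (diracForm v.1 w w).re := by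
  by_cases h : diracForm v.1 z w = 0
  · rw [h]
    have := diracForm_nonneg v z
    have := diracForm_nonneg v w
    simp; linarith
  set c := diracForm v.1 z w with hc
  have hn : (‖c‖ : ℂ) ≠ 0 := by simpa using h
  set u : ℂ := -(starRingEnd ℂ c) / ‖c‖ with hu
  have h1 := diracForm_nonneg v (z + u • w)
  have huu : star u * u = 1 := by
    rw [hu]
    simp only [RCLike.star_def, map_div₀, map_neg, Complex.conj_conj, Complex.conj_ofReal]
    field_simp
    rw [Complex.mul_conj, Complex.normSq_eq_norm_sq]; push_cast; ring
  have huc : u * c = -‖c‖ := by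
    rw [hu]
    field_simp
    rw [mul_comm, Complex.mul_conj, Complex.normSq_eq_norm_sq]; push_cast; ring
  have huc' : star u * star c = -‖c‖ := by
    have := congrArg star huc
    simpa [mul_comm] using this
  rw [diracForm_add_left, diracForm_add_right, diracForm_add_right, diracForm_smul_left,
    diracForm_smul_right, diracForm_smul_right, ← diracForm_conj v.1 z w, ← hc, huc,
    diracForm_smul_left, mul_left_comm, ← mul_assoc (star u) u, huu, one_mul, huc'] at h1
  simp at h1
  linarith

theorem diracForm_parallelogram (v : Hyp) (z w : Fin 4 → ℂ) :
    (diracForm v.1 (z + w) (z + w)).re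
      ≤ 2 * (diracForm v.1 z z).re + 2 * (diracForm v.1 w w).re := by
  have h := diracForm_bound v z w
  have h1 := Complex.re_le_norm (diracForm v.1 z w)
  have h2 : (diracForm v.1 w z).re = (diracForm v.1 z w).re := by
    rw [← diracForm_conj]; simp
  rw [diracForm_add_left, diracForm_add_right, diracForm_add_right]
  simp only [Complex.add_re, h2]
  linarith

theorem measurable_diracForm {f g : Hyp → Fin 4 → ℂ} (hf : Measurable f) (hg : Measurable g) :
    Measurable fun v => diracForm v.1 (f v) (g v) := by
  have hf' : ∀ i, Measurable fun v => f v i := fun i => (measurable_pi_apply i).comp hf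
  have hg' : ∀ i, Measurable fun v => g v i := fun i => (measurable_pi_apply i).comp hg
  have hv : ∀ i, Measurable fun v : Hyp => ((v.1 i : ℝ) : ℂ) := fun i =>
    Complex.measurable_ofReal.comp ((measurable_pi_apply i).comp measurable_subtype_coe)
  have hs : ∀ i, Measurable fun v => (starRingEnd ℂ) (f v i) := fun i =>
    Complex.continuous_conj.measurable.comp (hf' i)
  unfold diracForm
  simp only [g0_gslash, dotProduct, Matrix.mulVec, Fin.sum_univ_four, Pi.star_apply,
    RCLike.star_def]
  simp
  fun_prop

/-- Measurable `ℂ⁴`-valued functions `g` on the hyperboloid with `∫ ḡ γ·v g dμ < ∞`. -/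
def waveFunctions : Submodule ℂ (Hyp → Fin 4 → ℂ) where
  carrier := {g | Measurable g ∧ Integrable (fun v => (diracForm v.1 (g v) (g v)).re) hypMeasure}
  zero_mem' := by
    refine ⟨measurable_const, ?_⟩
    simp [diracForm]
  add_mem' := by
    rintro f g ⟨hf, hf'⟩ ⟨hg, hg'⟩
    refine ⟨hf.add hg, ((hf'.const_mul 2).add (hg'.const_mul 2)).mono'
      (Complex.measurable_re.comp (measurable_diracForm (hf.add hg)
        (hf.add hg))).aestronglyMeasurable (ae_of_all _ fun v => ?_)⟩
    rw [Real.norm_eq_abs, abs_of_nonneg (diracForm_nonneg v _)]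
    exact diracForm_parallelogram v (f v) (g v)
  smul_mem' := by
    rintro c g ⟨hg, hg'⟩
    refine ⟨hg.const_smul c, (hg'.const_mul (‖c‖ ^ 2)).congr (ae_of_all _ fun v => ?_)⟩
    show _ = (diracForm v.1 (c • g v) (c • g v)).re
    rw [diracForm_smul_left, diracForm_smul_right, ← mul_assoc]
    have : star c * c = ((‖c‖ ^ 2 : ℝ) : ℂ) := by
      rw [mul_comm, RCLike.star_def, Complex.mul_conj, Complex.normSq_eq_norm_sq]
    rw [this, Complex.re_ofReal_mul]

/-- The pre-Hilbert space of wave functions with the scalar product `∫ f̄ γ·v g dμ(v)`. -/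
def PreK : Type := waveFunctions

instance : AddCommGroup PreK := inferInstanceAs (AddCommGroup waveFunctions)
instance : Module ℂ PreK := inferInstanceAs (Module ℂ waveFunctions)

/-- The function underlying an element of the pre-Hilbert space. -/
def PreK.fn (g : PreK) : Hyp → Fin 4 → ℂ := Subtype.val (p := fun f => f ∈ waveFunctions) g

theorem PreK.integrable (f g : PreK) :
    Integrable (fun v => diracForm v.1 (f.fn v) (g.fn v)) hypMeasure := by
  have hf : f.fn ∈ waveFunctions := Subtype.property (p := fun f => f ∈ waveFunctions) f
  have hg : g.fn ∈ waveFunctions := Subtype.property (p := fun f => f ∈ waveFunctions) g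
  refine (hf.2.add hg.2).mono' (measurable_diracForm hf.1 hg.1).aestronglyMeasurable
    (ae_of_all _ fun v => ?_)
  have h := diracForm_bound v (f.fn v) (g.fn v)
  have := norm_nonneg (diracForm v.1 (f.fn v) (g.fn v))
  show _ ≤ (diracForm v.1 (f.fn v) (f.fn v)).re + (diracForm v.1 (g.fn v) (g.fn v)).re
  linarith

/-- The scalar product `(f,g) = ∫ f̄ γ·v g dμ(v)`. -/
abbrev preCore : PreInnerProductSpace.Core ℂ PreK where
  inner f g := ∫ v, diracForm v.1 (f.fn v) (g.fn v) ∂hypMeasure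
  conj_inner_symm f g := by
    rw [← integral_conj]
    congr 1
    funext v
    exact diracForm_conj _ _ _
  re_inner_nonneg f := by
    show 0 ≤ (∫ v, diracForm v.1 (f.fn v) (f.fn v) ∂hypMeasure).re
    have : (∫ v, diracForm v.1 (f.fn v) (f.fn v) ∂hypMeasure).re
        = ∫ v, (diracForm v.1 (f.fn v) (f.fn v)).re ∂hypMeasure :=
      (integral_re (f.integrable f)).symm
    rw [this]
    exact integral_nonneg fun v => diracForm_nonneg v _
  add_left f g h := by
    rw [← integral_add (f.integrable h) (g.integrable h)]
    congr 1
    funext v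
    exact diracForm_add_left _ _ _ _
  smul_left f g c := by
    rw [← integral_const_mul]
    congr 1
    funext v
    exact diracForm_smul_left _ _ _ _

instance : SeminormedAddCommGroup PreK := 
  @InnerProductSpace.Core.toSeminormedAddCommGroup ℂ PreK _ _ _ preCore
instance : InnerProductSpace ℂ PreK := InnerProductSpace.ofCore preCore

/-- The Hilbert space `𝓚` of (classes of) wave functions. -/
abbrev K : Type := UniformSpace.Completion PreK

theorem PreK.inner_def (f g : PreK) :
    inner ℂ f g = ∫ v, diracForm v.1 (f.fn v) (g.fn v) ∂hypMeasure := rfl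

theorem PreK.norm_sq (f : PreK) :
    ‖f‖ ^ 2 = ∫ v, (diracForm v.1 (f.fn v) (f.fn v)).re ∂hypMeasure := by
  rw [norm_sq_eq_re_inner (𝕜 := ℂ), PreK.inner_def]
  exact (integral_re (f.integrable f)).symm

/-- A matrix-valued function acting boundedly on wave functions by pointwise multiplication. -/
structure IsMultiplier (M : Hyp → Matrix (Fin 4) (Fin 4) ℂ) : Prop where
  meas : ∀ i j, Measurable fun v => M v i j
  bound : ∃ C : ℝ, ∀ v z, (diracForm v.1 ((M v).mulVec z) ((M v).mulVec z)).re
    ≤ C * (diracForm v.1 z z).re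

theorem IsMultiplier.mem {M : Hyp → Matrix (Fin 4) (Fin 4) ℂ} (h : IsMultiplier M) (g : PreK) :
    (fun v => (M v).mulVec (g.fn v)) ∈ waveFunctions := by
  have hg : g.fn ∈ waveFunctions := Subtype.property (p := fun f => f ∈ waveFunctions) g
  obtain ⟨C, hC⟩ := h.bound
  have hm : Measurable fun v => (M v).mulVec (g.fn v) := by
    refine measurable_pi_iff.2 fun i => ?_
    simp only [Matrix.mulVec, dotProduct]
    exact Finset.measurable_sum _ fun j _ =>
      (h.meas i j).mul ((measurable_pi_apply j).comp hg.1)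
  refine ⟨hm, (hg.2.const_mul C).mono'
    (Complex.measurable_re.comp (measurable_diracForm hm hm)).aestronglyMeasurable
    (ae_of_all _ fun v => ?_)⟩
  rw [Real.norm_eq_abs, abs_of_nonneg (diracForm_nonneg v _)]
  exact hC v _

/-- Pointwise multiplication on the pre-Hilbert space. -/
def preMul {M : Hyp → Matrix (Fin 4) (Fin 4) ℂ} (h : IsMultiplier M) : PreK →ₗ[ℂ] PreK where
  toFun g := ⟨fun v => (M v).mulVec (g.fn v), h.mem g⟩
  map_add' f g := Subtype.ext (funext fun v => Matrix.mulVec_add (M v) (f.fn v) (g.fn v))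
  map_smul' c g := Subtype.ext (funext fun v => Matrix.mulVec_smul (M v) c (g.fn v))

theorem preMul_bound {M : Hyp → Matrix (Fin 4) (Fin 4) ℂ} (h : IsMultiplier M) :
    ∃ C, ∀ g : PreK, ‖preMul h g‖ ≤ C * ‖g‖ := by
  obtain ⟨C, hC⟩ := h.bound
  refine ⟨Real.sqrt |C|, fun g => ?_⟩
  have h1 : ‖preMul h g‖ ^ 2 ≤ |C| * ‖g‖ ^ 2 := by
    rw [PreK.norm_sq, PreK.norm_sq, ← integral_const_mul]
    refine integral_mono ((preMul h g).integrable (preMul h g)).re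
      (((g.integrable g).re).const_mul _) fun v => (hC v (g.fn v)).trans ?_
    exact mul_le_mul_of_nonneg_right (le_abs_self C) (diracForm_nonneg v _)
  refine le_of_sq_le_sq ?_ (by positivity)
  rw [mul_pow, Real.sq_sqrt (abs_nonneg _)]
  exact h1

/-- The bounded operator on `𝓚` of multiplication by a matrix-valued function `M` (zero if `M` does
not act boundedly). -/
def mulOp (M : Hyp → Matrix (Fin 4) (Fin 4) ℂ) : K →L[ℂ] K :=
  open Classical in
  if h : IsMultiplier M then
    ((preMul h).mkContinuousOfExistsBound (preMul_bound h)).completion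
  else 0

theorem mulOp_coe {M : Hyp → Matrix (Fin 4) (Fin 4) ℂ} (h : IsMultiplier M) (g : PreK) :
    mulOp M (g : K) = (preMul h g : K) := by
  unfold mulOp
  rw [dif_pos h]
  exact ContinuousLinearMap.completion_apply_coe _ g

theorem IsMultiplier.mul {M N : Hyp → Matrix (Fin 4) (Fin 4) ℂ} (hM : IsMultiplier M)
    (hN : IsMultiplier N) : IsMultiplier (fun v => M v * N v) := by
  refine ⟨fun i j => ?_, ?_⟩
  · simp only [Matrix.mul_apply]
    exact Finset.measurable_sum _ fun k _ => (hM.meas i k).mul (hN.meas k j)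
  · obtain ⟨C, hC⟩ := hM.bound
    obtain ⟨D, hD⟩ := hN.bound
    refine ⟨|C| * |D|, fun v z => ?_⟩
    rw [← Matrix.mulVec_mulVec]
    calc _ ≤ C * _ := hC v _
      _ ≤ |C| * _ := mul_le_mul_of_nonneg_right (le_abs_self C) (diracForm_nonneg v _)
      _ ≤ |C| * (|D| * (diracForm v.1 z z).re) := by
        gcongr
        exact (hD v z).trans (mul_le_mul_of_nonneg_right (le_abs_self D) (diracForm_nonneg v _))
      _ = _ := by ring

theorem mulOp_mul {M N : Hyp → Matrix (Fin 4) (Fin 4) ℂ} (hM : IsMultiplier M)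
    (hN : IsMultiplier N) (g : K) : mulOp M (mulOp N g) = mulOp (fun v => M v * N v) g := by
  induction g using UniformSpace.Completion.induction_on with
  | hp => exact isClosed_eq (by fun_prop) (by fun_prop)
  | ih g =>
    rw [mulOp_coe hN, mulOp_coe hM, mulOp_coe (hM.mul hN)]
    congr 1
    exact Subtype.ext (funext fun v => Matrix.mulVec_mulVec (g.fn v) (M v) (N v))

theorem inner_mulOp {M : Hyp → Matrix (Fin 4) (Fin 4) ℂ} (hM : IsMultiplier M)
    (h : ∀ (v : Hyp) z w, diracForm v.1 ((M v).mulVec z) ((M v).mulVec w) = diracForm v.1 z w)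
    (f g : K) : inner ℂ (mulOp M f) (mulOp M g) = inner ℂ f g := by
  induction f, g using UniformSpace.Completion.induction_on₂ with
  | hp => exact isClosed_eq (by fun_prop) (by fun_prop)
  | ih f g =>
    rw [mulOp_coe hM, mulOp_coe hM, UniformSpace.Completion.inner_coe,
      UniformSpace.Completion.inner_coe, PreK.inner_def, PreK.inner_def]
    congr 1
    funext v
    exact h v _ _

/-- Multiplication by the phase `exp(i θ(v))`. -/
def phaseMat (θ : Hyp → ℝ) (v : Hyp) : Matrix (Fin 4) (Fin 4) ℂ := Complex.exp (I * θ v) • 1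

/-- The matrix function `exp(i m x·v γ·v) = cos(m x·v) + i sin(m x·v) γ·v`; note `(γ·v)² = 1`. -/
def translMat (m : ℝ) (x : Spacetime) (v : Hyp) : Matrix (Fin 4) (Fin 4) ℂ :=
  (Real.cos (m * mdot x v.1) : ℂ) • 1 + (I * Real.sin (m * mdot x v.1)) • gslash v.1

theorem phaseMat_form (θ : Hyp → ℝ) (v : Hyp) (z w : Fin 4 → ℂ) :
    diracForm v.1 ((phaseMat θ v).mulVec z) ((phaseMat θ v).mulVec w) = diracForm v.1 z w := by
  unfold phaseMat
  rw [Matrix.smul_mulVec, Matrix.smul_mulVec, Matrix.one_mulVec, Matrix.one_mulVec,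
    diracForm_smul_left, diracForm_smul_right, ← mul_assoc, RCLike.star_def, ← Complex.exp_conj,
    ← Complex.exp_add]
  simp

theorem translMat_form (m : ℝ) (x : Spacetime) (v : Hyp) (z w : Fin 4 → ℂ) :
    diracForm v.1 ((translMat m x v).mulVec z) ((translMat m x v).mulVec w)
      = diracForm v.1 z w := by
  unfold translMat
  have h2 : (gslash v.1).mulVec ((gslash v.1).mulVec w) = w := by
    rw [Matrix.mulVec_mulVec, gslash_sq, v.2.1]; simp
  simp only [Matrix.add_mulVec, Matrix.smul_mulVec, Matrix.one_mulVec, diracForm_add_left,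
    diracForm_add_right, diracForm_smul_left, diracForm_smul_right, diracForm_gslash, h2]
  simp only [RCLike.star_def, map_mul, Complex.conj_ofReal, Complex.conj_I]
  have h3 : (Real.cos (m * mdot x v.1) : ℂ) ^ 2 + (Real.sin (m * mdot x v.1) : ℂ) ^ 2 = 1 := by
    exact_mod_cast Real.cos_sq_add_sin_sq _
  have hI : I ^ 2 = -1 := I_sq
  linear_combination (diracForm v.1 z w) * h3
    - (Real.sin (m * mdot x v.1) : ℂ) ^ 2 * (diracForm v.1 z w) * hI

theorem measurable_gslash (i j : Fin 4) : Measurable fun v : Hyp => gslash v.1 i j := by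
  have hv : ∀ i, Measurable fun v : Hyp => ((v.1 i : ℝ) : ℂ) := fun i =>
    Complex.measurable_ofReal.comp ((measurable_pi_apply i).comp measurable_subtype_coe)
  simp only [gslash_eq]
  fin_cases i <;> fin_cases j <;> simp <;> fun_prop

theorem isMultiplier_phase {θ : Hyp → ℝ} (h : Measurable θ) : IsMultiplier (phaseMat θ) := by
  refine ⟨fun i j => ?_, 1, fun v z => by rw [phaseMat_form, one_mul]⟩
  simp only [phaseMat, Matrix.smul_apply, smul_eq_mul]
  fun_prop

theorem isMultiplier_transl (m : ℝ) (x : Spacetime) : IsMultiplier (translMat m x) := by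
  refine ⟨fun i j => ?_, 1, fun v z => by rw [translMat_form, one_mul]⟩
  have h1 : Measurable fun v : Hyp => mdot x v.1 :=
    (mdotL x).continuous.measurable.comp measurable_subtype_coe
  have h2 := measurable_gslash i j
  simp only [translMat, Matrix.add_apply, Matrix.smul_apply, smul_eq_mul]
  fun_prop

/-- The unitary operator `S_{Φ_V}` of multiplication by `exp(i (e/4π) ∫ Φ_V(l)/(v·l)² d²l)`. -/
def S (e : ℝ) (V : testFields) : K →L[ℂ] K := mulOp (phaseMat (coulombPhase e V.1))

/-- The unitary operator `R_x` of translation: `[R_x g](v) = exp(i m x·v γ·v) g(v)`. -/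
def R (m : ℝ) (x : Spacetime) : K →L[ℂ] K := mulOp (translMat m x)

/-- The projections `P_± g(v) = ½(1 ± γ·v) g(v)` on positive (`true`) and negative (`false`)
frequencies. -/
def freqProj (σ : Bool) : K →L[ℂ] K :=
  mulOp fun v => (1 / 2 : ℂ) • (if σ then 1 + gslash v.1 else 1 - gslash v.1)

/-- The subspaces `P_± 𝓚`. -/
def freqSpace (σ : Bool) : Submodule ℂ K := LinearMap.range (freqProj σ).toLinearMap

/-- Multiplication by a (bounded measurable) real function. -/
def scalarOp (θ : Hyp → ℝ) : K →L[ℂ] K := mulOp fun v => (θ v : ℂ) • 1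

theorem inner_S (e : ℝ) (V : testFields) (f g : K) : inner ℂ (S e V f) (S e V g) = inner ℂ f g :=
  inner_mulOp (isMultiplier_phase (measurable_coulombPhase e V)) (phaseMat_form _) f g

theorem inner_R (m : ℝ) (x : Spacetime) (f g : K) : inner ℂ (R m x f) (R m x g) = inner ℂ f g :=
  inner_mulOp (isMultiplier_transl m x) (translMat_form m x) f g

theorem S_comm (e : ℝ) (V W : testFields) (g : K) : S e V (S e W g) = S e W (S e V g) := by
  have h1 := isMultiplier_phase (measurable_coulombPhase e V)
  have h2 := isMultiplier_phase (measurable_coulombPhase e W)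
  unfold S
  rw [mulOp_mul h1 h2, mulOp_mul h2 h1]
  congr 2
  funext v
  simp only [phaseMat, smul_mul_assoc, one_mul, smul_smul, mul_comm]

theorem R_S (m : ℝ) (x : Spacetime) (e : ℝ) (V : testFields) (g : K) :
    R m x (S e V g) = S e (translateHom x V) (R m x g) := by
  have h1 := isMultiplier_phase (measurable_coulombPhase e V)
  have h2 := isMultiplier_transl m x
  have h3 : S e (translateHom x V) = S e V := by
    unfold S coulombPhase
    rw [show phi (translateHom x V).1 = phi V.1 from phi_translate x V]
  rw [h3]
  unfold S R
  rw [mulOp_mul h1 h2, mulOp_mul h2 h1]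
  congr 2
  funext v
  simp [phaseMat]

/-! ## The field algebra -/

/-- Generators of the *-algebra: `W((V))`, `B(g)` and `B(g)^*`. -/
inductive Gen (e : ℝ) : Type
  | W (x : GaugeClass e) : Gen e
  | B (g : K) : Gen e
  | Bs (g : K) : Gen e

/-- The involution on generators: `W(x)^* = W(-x)`, `B(g)` and `B(g)^*` are exchanged. -/
def Gen.adj {e : ℝ} : Gen e → Gen e
  | .W x => .W (-x)
  | .B g => .Bs g
  | .Bs g => .B g

/-- The free complex algebra over the generators, made into a free *-algebra below. -/
def FreeAlg (e : ℝ) : Type := FreeAlgebra ℂ (Gen e)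

instance (e : ℝ) : Ring (FreeAlg e) := inferInstanceAs (Ring (FreeAlgebra ℂ (Gen e)))
instance (e : ℝ) : Algebra ℂ (FreeAlg e) := inferInstanceAs (Algebra ℂ (FreeAlgebra ℂ (Gen e)))

/-- A generator as an element of the free algebra. -/
def FreeAlg.of {e : ℝ} (x : Gen e) : FreeAlg e := FreeAlgebra.ι ℂ x

/-- Algebra homomorphisms out of the free algebra. -/
def FreeAlg.lift {e : ℝ} {A : Type*} [Ring A] [Algebra ℂ A] (f : Gen e → A) :
    FreeAlg e →ₐ[ℂ] A := FreeAlgebra.lift ℂ f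

theorem FreeAlg.lift_of {e : ℝ} {A : Type*} [Ring A] [Algebra ℂ A] (f : Gen e → A) (x : Gen e) :
    FreeAlg.lift f (FreeAlg.of x) = f x := FreeAlgebra.lift_ι_apply f x

theorem FreeAlg.induction {e : ℝ} {P : FreeAlg e → Prop} (h1 : ∀ c, P (algebraMap ℂ _ c))
    (h2 : ∀ x, P (FreeAlg.of x)) (h3 : ∀ a b, P a → P b → P (a * b))
    (h4 : ∀ a b, P a → P b → P (a + b)) (a : FreeAlg e) : P a :=
  FreeAlgebra.induction ℂ (Gen e) h1 h2 h3 h4 a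

/-- The opposite algebra with complex conjugate scalars. -/
abbrev conjOpAlgebra (A : Type*) [Ring A] [Algebra ℂ A] : Algebra ℂ Aᵐᵒᵖ :=
  ((algebraMap ℂ Aᵐᵒᵖ).comp (starRingEnd ℂ)).toAlgebra' fun c x => Algebra.commutes (starRingEnd ℂ c) x

/-- The antilinear antihomomorphism extending the involution of the generators. -/
def FreeAlg.starHom (e : ℝ) : FreeAlg e →+* (FreeAlg e)ᵐᵒᵖ :=
  letI := conjOpAlgebra (FreeAlg e)
  (FreeAlg.lift (e := e) (A := (FreeAlg e)ᵐᵒᵖ) fun x => MulOpposite.op (FreeAlg.of x.adj)).toRingHom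

theorem FreeAlg.starHom_of {e : ℝ} (x : Gen e) :
    FreeAlg.starHom e (FreeAlg.of x) = MulOpposite.op (FreeAlg.of x.adj) :=
  letI := conjOpAlgebra (FreeAlg e)
  FreeAlg.lift_of (A := (FreeAlg e)ᵐᵒᵖ) _ x

theorem FreeAlg.starHom_algebraMap {e : ℝ} (c : ℂ) :
    FreeAlg.starHom e (algebraMap ℂ _ c)
      = MulOpposite.op (algebraMap ℂ (FreeAlg e) (starRingEnd ℂ c)) :=
  letI := conjOpAlgebra (FreeAlg e)
  (FreeAlg.lift (e := e) (A := (FreeAlg e)ᵐᵒᵖ)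
    fun x => MulOpposite.op (FreeAlg.of x.adj)).commutes c

theorem Gen.adj_adj {e : ℝ} (x : Gen e) : x.adj.adj = x := by
  cases x <;> simp [Gen.adj]

instance (e : ℝ) : StarRing (FreeAlg e) where
  star a := (FreeAlg.starHom e a).unop
  star_involutive a := by
    induction a using FreeAlg.induction with
    | h1 c => simp [FreeAlg.starHom_algebraMap]
    | h2 x => simp [FreeAlg.starHom_of, Gen.adj_adj]
    | h3 a b ha hb => simp [ha, hb]
    | h4 a b ha hb => simp [ha, hb]
  star_mul a b := by simp
  star_add a b := by simp

theorem FreeAlg.star_of {e : ℝ} (x : Gen e) : star (FreeAlg.of x) = FreeAlg.of x.adj := by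
  show (FreeAlg.starHom e _).unop = _
  rw [FreeAlg.starHom_of]; rfl

theorem FreeAlg.star_algebraMap {e : ℝ} (c : ℂ) :
    star (algebraMap ℂ (FreeAlg e) c) = algebraMap ℂ (FreeAlg e) (star c) := by
  show (FreeAlg.starHom e _).unop = _
  rw [FreeAlg.starHom_algebraMap]; rfl

/-- The class `(V)` of a test field. -/
def cls (e : ℝ) (V : testFields) : GaugeClass e := QuotientAddGroup.mk V

/-- The defining relations of the *-algebra. -/
inductive Rel (e : ℝ) : FreeAlg e → FreeAlg e → Prop
  | W_zero : Rel e (.of (.W 0)) 1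
  | W_mul (V₁ V₂ : testFields) : Rel e (.of (.W (cls e V₁)) * .of (.W (cls e V₂)))
      (Complex.exp (-(I / 2) * symp V₁.1 V₂.1) • .of (.W (cls e (V₁ + V₂))))
  | B_add (f g : K) : Rel e (.of (.B (f + g))) (.of (.B f) + .of (.B g))
  | B_smul (c : ℂ) (g : K) : Rel e (.of (.B (c • g))) (star c • .of (.B g))
  | B_B (f g : K) : Rel e (.of (.B f) * .of (.B g) + .of (.B g) * .of (.B f)) 0
  | B_Bs (f g : K) : Rel e (.of (.B f) * .of (.Bs g) + .of (.Bs g) * .of (.B f))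
      (algebraMap ℂ _ (inner ℂ f g))
  | W_B (V : testFields) (g : K) : Rel e (.of (.W (cls e V)) * .of (.B g))
      (.of (.B (S e V g)) * .of (.W (cls e V)))
  | adj {a b : FreeAlg e} : Rel e a b → Rel e (star a) (star b)

/-- The *-algebra generated by `W(V)`, `B(g)` with the Weyl relations, the anticommutation
relations and `W(V) B(g) = B(S_{Φ_V} g) W(V)`. -/
def PreField (e : ℝ) : Type := RingQuot (Rel e)

namespace PreField

variable (e : ℝ)

instance : Ring (PreField e) := inferInstanceAs (Ring (RingQuot (Rel e)))
instance : Algebra ℂ (PreField e) := inferInstanceAs (Algebra ℂ (RingQuot (Rel e)))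
instance : StarRing (PreField e) := RingQuot.starRing (Rel e) fun _ _ h => h.adj

/-- The quotient map from the free *-algebra. -/
def mk : FreeAlg e →ₐ[ℂ] PreField e := RingQuot.mkAlgHom ℂ (Rel e)

theorem mk_surjective : Function.Surjective (mk e) := RingQuot.mkAlgHom_surjective ℂ (Rel e)

variable {e}

theorem mk_rel {a b : FreeAlg e} (h : Rel e a b) : mk e a = mk e b := RingQuot.mkAlgHom_rel ℂ h

theorem star_mk (a : FreeAlg e) : star (mk e a) = mk e (star a) := by
  have h : ∀ a, mk e a = RingQuot.mkRingHom (Rel e) a := fun a =>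
    RingHom.congr_fun (RingQuot.mkAlgHom_coe ℂ (Rel e)) a
  rw [h, h]
  simp only [RingQuot.mkRingHom_def]
  rfl

instance : StarModule ℂ (PreField e) where
  star_smul c a := by
    obtain ⟨a, rfl⟩ := mk_surjective e a
    rw [← map_smul, star_mk, star_mk, ← map_smul, Algebra.smul_def, star_mul,
      FreeAlg.star_algebraMap, Algebra.smul_def, Algebra.commutes]

/-- The generator `W((V))`. -/
def w (x : GaugeClass e) : PreField e := mk e (.of (.W x))

/-- The generator `B(g)`. -/
def b (g : K) : PreField e := mk e (.of (.B g))

theorem star_w (x : GaugeClass e) : star (w x) = w (-x) := by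
  unfold w; rw [star_mk, FreeAlg.star_of]; rfl

theorem mk_Bs (g : K) : mk e (.of (.Bs g)) = star (b g) := by
  unfold b; rw [star_mk, FreeAlg.star_of]; rfl

theorem induction {P : PreField e → Prop} (h1 : ∀ c, P (algebraMap ℂ _ c))
    (hw : ∀ x, P (w x)) (hb : ∀ g, P (b g)) (hs : ∀ a, P a → P (star a))
    (h3 : ∀ a b, P a → P b → P (a * b)) (h4 : ∀ a b, P a → P b → P (a + b)) (a : PreField e) :
    P a := by
  obtain ⟨a, rfl⟩ := mk_surjective e a
  induction a using FreeAlg.induction with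
  | h1 c => rw [AlgHom.commutes]; exact h1 c
  | h2 x =>
    cases x with
    | W x => exact hw x
    | B g => exact hb g
    | Bs g => rw [mk_Bs]; exact hs _ (hb g)
  | h3 a b ha hb => rw [map_mul]; exact h3 _ _ ha hb
  | h4 a b ha hb => rw [map_add]; exact h4 _ _ ha hb

/-- Elements of a *-algebra satisfying the defining relations. -/
structure Relations {A : Type*} [Ring A] [Algebra ℂ A] [StarRing A] (W : GaugeClass e → A)
    (B : K → A) : Prop where
  W_star : ∀ x, star (W x) = W (-x)
  W_zero : W 0 = 1
  W_mul : ∀ V₁ V₂, W (cls e V₁) * W (cls e V₂)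
    = Complex.exp (-(I / 2) * symp V₁.1 V₂.1) • W (cls e (V₁ + V₂))
  B_add : ∀ f g, B (f + g) = B f + B g
  B_smul : ∀ (c : ℂ) g, B (c • g) = star c • B g
  B_B : ∀ f g, B f * B g + B g * B f = 0
  B_Bs : ∀ f g, B f * star (B g) + star (B g) * B f = algebraMap ℂ A (inner ℂ f g)
  W_B : ∀ V g, W (cls e V) * B g = B (S e V g) * W (cls e V)

theorem relations : Relations (e := e) (A := PreField e) w b where
  W_star := star_w
  W_zero := by
    have := mk_rel (Rel.W_zero (e := e)); rwa [map_one] at this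
  W_mul V₁ V₂ := by
    have := mk_rel (Rel.W_mul (e := e) V₁ V₂); rwa [map_mul, map_smul] at this
  B_add f g := by
    have := mk_rel (Rel.B_add (e := e) f g); rwa [map_add] at this
  B_smul c g := by
    have := mk_rel (Rel.B_smul (e := e) c g); rwa [map_smul] at this
  B_B f g := by
    have := mk_rel (Rel.B_B (e := e) f g); rwa [map_add, map_mul, map_mul, map_zero] at this
  B_Bs f g := by
    have := mk_rel (Rel.B_Bs (e := e) f g)
    rwa [map_add, map_mul, map_mul, AlgHom.commutes, mk_Bs] at this
  W_B V g := by
    have := mk_rel (Rel.W_B (e := e) V g); rwa [map_mul, map_mul] at this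

section Lift

variable {A : Type*} [Ring A] [Algebra ℂ A] [StarRing A] [StarModule ℂ A]
  {W : GaugeClass e → A} {B : K → A}

/-- The homomorphism on the free algebra determined by images of generators. -/
def preLift (W : GaugeClass e → A) (B : K → A) : FreeAlg e →ₐ[ℂ] A :=
  FreeAlg.lift fun
    | .W x => W x
    | .B g => B g
    | .Bs g => star (B g)

theorem preLift_star (h : Relations W B) (a : FreeAlg e) :
    preLift W B (star a) = star (preLift W B a) := by
  induction a using FreeAlg.induction with
  | h1 c =>
    rw [FreeAlg.star_algebraMap, AlgHom.commutes, AlgHom.commutes, algebraMap_star_comm]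
  | h2 x =>
    rw [FreeAlg.star_of]
    unfold preLift
    rw [FreeAlg.lift_of, FreeAlg.lift_of]
    cases x with
    | W x => exact (h.W_star x).symm
    | B g => rfl
    | Bs g => exact (star_star _).symm
  | h3 a b ha hb => rw [star_mul, map_mul, map_mul, star_mul, ha, hb]
  | h4 a b ha hb => rw [star_add, map_add, map_add, star_add, ha, hb]

theorem preLift_rel (h : Relations W B) {x y : FreeAlg e} (r : Rel e x y) :
    preLift W B x = preLift W B y := by
  have e1 : ∀ x, preLift W B (.of (.W x)) = W x := fun x => FreeAlg.lift_of _ _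
  have e2 : ∀ x, preLift W B (.of (.B x)) = B x := fun x => FreeAlg.lift_of _ _
  have e3 : ∀ x, preLift W B (.of (.Bs x)) = star (B x) := fun x => FreeAlg.lift_of _ _
  induction r with
  | W_zero => rw [e1, map_one, h.W_zero]
  | W_mul V₁ V₂ => rw [map_mul, map_smul, e1, e1, e1, h.W_mul]
  | B_add f g => rw [map_add, e2, e2, e2, h.B_add]
  | B_smul c g => rw [map_smul, e2, e2, h.B_smul]
  | B_B f g => rw [map_add, map_mul, map_mul, e2, e2, map_zero, h.B_B]
  | B_Bs f g => rw [map_add, map_mul, map_mul, e2, e3, AlgHom.commutes, h.B_Bs]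
  | W_B V g => rw [map_mul, map_mul, e1, e2, e2, h.W_B]
  | adj _ ih => rw [preLift_star h, preLift_star h, ih]

/-- The *-homomorphism determined by elements satisfying the defining relations. -/
def lift (h : Relations W B) : PreField e →⋆ₐ[ℂ] A :=
  { RingQuot.liftAlgHom ℂ (s := Rel e) ⟨preLift W B, fun _ _ r => preLift_rel h r⟩ with
    map_star' := fun a => by
      obtain ⟨a, rfl⟩ := mk_surjective e a
      rw [star_mk]
      have key : ∀ a, RingQuot.liftAlgHom ℂ (s := Rel e)
          ⟨preLift W B, fun _ _ r => preLift_rel h r⟩ (mk e a) = preLift W B a := fun a =>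
        RingQuot.liftAlgHom_mkAlgHom_apply ℂ _ _ a
      show RingQuot.liftAlgHom ℂ (s := Rel e)
          ⟨preLift W B, fun _ _ r => preLift_rel h r⟩ (mk e (star a)) = star (
          RingQuot.liftAlgHom ℂ (s := Rel e)
          ⟨preLift W B, fun _ _ r => preLift_rel h r⟩ (mk e a))
      rw [key, key, preLift_star h] }

theorem lift_mk (h : Relations W B) (a : FreeAlg e) : lift h (mk e a) = preLift W B a :=
  RingQuot.liftAlgHom_mkAlgHom_apply ℂ _ _ a

theorem lift_w (h : Relations W B) (x : GaugeClass e) : lift h (w x) = W x :=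
  (lift_mk h _).trans (FreeAlg.lift_of _ _)

theorem lift_b (h : Relations W B) (g : K) : lift h (b g) = B g :=
  (lift_mk h _).trans (FreeAlg.lift_of _ _)

end Lift

/-! ### The maximal C*-norm -/

/-- C*-seminorms on the *-algebra. -/
structure IsCStarSeminorm (p : Seminorm ℂ (PreField e)) : Prop where
  mul_le : ∀ a b, p (a * b) ≤ p a * p b
  star_mul : ∀ a, p (star a * a) = p a ^ 2

theorem IsCStarSeminorm.star_eq {p : Seminorm ℂ (PreField e)} (hp : IsCStarSeminorm p)
    (a : PreField e) : p (star a) = p a := by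
  have key : ∀ a, p a ≤ p (star a) := by
    intro a
    have h1 := hp.star_mul a
    have h2 := hp.mul_le (star a) a
    rcases (apply_nonneg p a).eq_or_lt with h | h
    · rw [← h]; exact apply_nonneg p _
    · nlinarith
  refine le_antisymm ?_ (key a)
  simpa using key (star a)

theorem IsCStarSeminorm.one_le {p : Seminorm ℂ (PreField e)} (hp : IsCStarSeminorm p) :
    p 1 ≤ 1 := by
  have h := hp.star_mul 1
  rw [star_one, one_mul] at h
  nlinarith [apply_nonneg p (1 : PreField e)]

theorem IsCStarSeminorm.w_le {p : Seminorm ℂ (PreField e)} (hp : IsCStarSeminorm p)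
    (x : GaugeClass e) : p (w x) ≤ 1 := by
  obtain ⟨V, rfl⟩ : ∃ V, cls e V = x := QuotientAddGroup.mk_surjective x
  have h := hp.star_mul (w (cls e V))
  have h1 : star (w (cls e V)) * w (cls e V)
      = Complex.exp (-(I / 2) * symp (-V).1 V.1) • (1 : PreField e) := by
    rw [star_w, show -cls e V = cls e (-V) from rfl, relations.W_mul, neg_add_cancel]
    congr 1
    exact relations.W_zero
  rw [h1, map_smul_eq_mul] at h
  have h2 : ‖Complex.exp (-(I / 2) * symp (-V).1 V.1)‖ = 1 := by
    rw [Complex.norm_exp]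
    simp
  rw [h2, one_mul] at h
  have h3 := hp.one_le
  nlinarith [apply_nonneg p (w (cls e V))]

theorem IsCStarSeminorm.b_le {p : Seminorm ℂ (PreField e)} (hp : IsCStarSeminorm p) (g : K) :
    p (b g) ^ 2 ≤ ‖g‖ ^ 2 := by
  set a : PreField e := b g with ha
  have h0 : a * a = 0 := by
    have h := relations.B_B (e := e) g g
    have h2 : (2 : ℂ) • (a * a) = 0 := by rw [two_smul]; exact h
    exact (smul_eq_zero.1 h2).resolve_left two_ne_zero
  have h1 : a * star a + star a * a = ((‖g‖ ^ 2 : ℝ) : ℂ) • (1 : PreField e) := by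
    have h := relations.B_Bs (e := e) g g
    rw [inner_self_eq_norm_sq_to_K, Algebra.algebraMap_eq_smul_one] at h
    rw [h]; norm_cast
  have h2 : star (star a * a) * (star a * a) = ((‖g‖ ^ 2 : ℝ) : ℂ) • (star a * a) := by
    rw [StarMul.star_mul, star_star]
    have : a * star a = ((‖g‖ ^ 2 : ℝ) : ℂ) • (1 : PreField e) - star a * a :=
      eq_sub_of_add_eq h1
    calc star a * a * (star a * a) = star a * (a * star a) * a := by noncomm_ring
      _ = star a * (((‖g‖ ^ 2 : ℝ) : ℂ) • (1 : PreField e) - star a * a) * a := by rw [this]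
      _ = ((‖g‖ ^ 2 : ℝ) : ℂ) • (star a * a) - star a * star a * (a * a) := by
        rw [mul_sub, sub_mul, mul_smul_comm, mul_one, smul_mul_assoc]
        noncomm_ring
      _ = _ := by rw [h0, mul_zero, sub_zero]
  have h3 := hp.star_mul (star a * a)
  rw [h2, map_smul_eq_mul, Complex.norm_real, Real.norm_of_nonneg (by positivity)] at h3
  rw [hp.star_mul] at h3
  rcases (sq_nonneg (p a)).eq_or_lt with h | h
  · rw [← h]; positivity
  · nlinarith

theorem seminorm_bound (a : PreField e) :
    ∃ C : ℝ, ∀ p : Seminorm ℂ (PreField e), IsCStarSeminorm p → p a ≤ C := by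
  induction a using PreField.induction with
  | h1 c =>
    refine ⟨‖c‖, fun p hp => ?_⟩
    rw [Algebra.algebraMap_eq_smul_one, map_smul_eq_mul]
    exact mul_le_of_le_one_right (norm_nonneg _) hp.one_le
  | hw x => exact ⟨1, fun p hp => hp.w_le x⟩
  | hb g =>
    exact ⟨‖g‖, fun p hp => le_of_sq_le_sq (hp.b_le g) (norm_nonneg _)⟩
  | hs a h =>
    obtain ⟨C, hC⟩ := h
    exact ⟨C, fun p hp => (hp.star_eq a).le.trans (hC p hp)⟩
  | h3 a b ha hb =>
    obtain ⟨C, hC⟩ := ha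
    obtain ⟨D, hD⟩ := hb
    refine ⟨|C| * |D|, fun p hp => (hp.mul_le a b).trans ?_⟩
    exact mul_le_mul ((hC p hp).trans (le_abs_self C)) ((hD p hp).trans (le_abs_self D))
      (apply_nonneg p b) (abs_nonneg C)
  | h4 a b ha hb =>
    obtain ⟨C, hC⟩ := ha
    obtain ⟨D, hD⟩ := hb
    exact ⟨C + D, fun p hp => (map_add_le_add p a b).trans (add_le_add (hC p hp) (hD p hp))⟩

/-- The type of C*-seminorms. -/
abbrev CStarSeminorms (e : ℝ) : Type := {p : Seminorm ℂ (PreField e) // IsCStarSeminorm p}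

instance : Nonempty (CStarSeminorms e) :=
  ⟨0, fun a b => by simp, fun a => by simp⟩

/-- The maximal C*-(semi)norm `‖A‖ = sup_p p(A)`. -/
def maxNorm (a : PreField e) : ℝ := ⨆ p : CStarSeminorms e, p.1 a

theorem bddAbove (a : PreField e) : BddAbove (Set.range fun p : CStarSeminorms e => p.1 a) := by
  obtain ⟨C, hC⟩ := seminorm_bound a
  exact ⟨C, by rintro _ ⟨p, rfl⟩; exact hC p.1 p.2⟩

theorem le_maxNorm (p : CStarSeminorms e) (a : PreField e) : p.1 a ≤ maxNorm a :=
  le_ciSup (bddAbove a) p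

theorem maxNorm_nonneg (a : PreField e) : 0 ≤ maxNorm a :=
  (apply_nonneg (Classical.arbitrary (CStarSeminorms e)).1 a).trans (le_maxNorm _ a)

theorem maxNorm_mul_le (a b : PreField e) : maxNorm (a * b) ≤ maxNorm a * maxNorm b :=
  ciSup_le fun p => (p.2.mul_le a b).trans
    (mul_le_mul (le_maxNorm p a) (le_maxNorm p b) (apply_nonneg _ _) (maxNorm_nonneg a))

theorem maxNorm_star (a : PreField e) : maxNorm (star a) = maxNorm a := by
  unfold maxNorm
  congr 1
  funext p
  exact p.2.star_eq a

theorem maxNorm_sq_le (a : PreField e) : maxNorm a * maxNorm a ≤ maxNorm (star a * a) := by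
  have h : maxNorm a ≤ √(maxNorm (star a * a)) := by
    refine ciSup_le fun p => Real.le_sqrt_of_sq_le ?_
    rw [← p.2.star_mul]
    exact le_maxNorm p _
  calc maxNorm a * maxNorm a ≤ √(maxNorm (star a * a)) * √(maxNorm (star a * a)) :=
        mul_le_mul h h (maxNorm_nonneg a) (Real.sqrt_nonneg _)
    _ = _ := Real.mul_self_sqrt (maxNorm_nonneg _)

theorem maxNorm_smul (c : ℂ) (a : PreField e) : maxNorm (c • a) = ‖c‖ * maxNorm a := by
  unfold maxNorm
  rw [Real.mul_iSup_of_nonneg (norm_nonneg c)]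
  congr 1
  funext p
  exact map_smul_eq_mul p.1 c a

instance : SeminormedRing (PreField e) :=
  { (inferInstance : Ring (PreField e)),
    AddGroupSeminorm.toSeminormedAddCommGroup
      { toFun := maxNorm (e := e)
        map_zero' := by
          have := maxNorm_smul (e := e) 0 0
          simpa using this
        add_le' := fun a b => ciSup_le fun p => (map_add_le_add p.1 a b).trans
          (add_le_add (le_maxNorm p a) (le_maxNorm p b))
        neg' := fun a => by
          have := maxNorm_smul (e := e) (-1) a
          simpa using this } with
    norm_mul_le := maxNorm_mul_le }

theorem norm_def (a : PreField e) : ‖a‖ = maxNorm a := rfl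

instance : NormedAlgebra ℂ (PreField e) where
  norm_smul_le c a := (maxNorm_smul c a).le

theorem isometry_star : Isometry (star : PreField e → PreField e) :=
  AddMonoidHomClass.isometry_of_norm (starAddEquiv : PreField e ≃+ PreField e) maxNorm_star

end PreField

/-- The asymptotic field algebra `𝓕`: the C*-completion of the *-algebra in its maximal norm. -/
abbrev FieldAlg (e : ℝ) : Type := UniformSpace.Completion (PreField e)

namespace FieldAlg

open UniformSpace

variable {e : ℝ}

instance : NormedAlgebra ℂ (FieldAlg e) where
  norm_smul_le := norm_smul_le

instance : Star (FieldAlg e) := ⟨Completion.map star⟩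

theorem star_coe (a : PreField e) : star (a : FieldAlg e) = ((star a : PreField e) : FieldAlg e) :=
  Completion.map_coe PreField.isometry_star.uniformContinuous a

theorem continuous_star : Continuous (star : FieldAlg e → FieldAlg e) := Completion.continuous_map

instance : StarRing (FieldAlg e) where
  star_involutive a := by
    induction a using Completion.induction_on with
    | hp => exact isClosed_eq (continuous_star.comp continuous_star) continuous_id
    | ih a => rw [star_coe, star_coe, star_star]
  star_mul a b := by
    induction a, b using Completion.induction_on₂ with
    | hp =>
      exact isClosed_eq (continuous_star.comp (continuous_fst.mul continuous_snd))
        ((continuous_star.comp continuous_snd).mul (continuous_star.comp continuous_fst))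
    | ih a b => rw [← Completion.coe_mul, star_coe, star_coe, star_coe, star_mul, Completion.coe_mul]
  star_add a b := by
    induction a, b using Completion.induction_on₂ with
    | hp =>
      exact isClosed_eq (continuous_star.comp (continuous_fst.add continuous_snd))
        ((continuous_star.comp continuous_fst).add (continuous_star.comp continuous_snd))
    | ih a b => rw [← Completion.coe_add, star_coe, star_coe, star_coe, star_add, Completion.coe_add]

instance : StarModule ℂ (FieldAlg e) where
  star_smul c a := by
    induction a using Completion.induction_on with
    | hp =>
      exact isClosed_eq (continuous_star.comp (continuous_const_smul c))
        (continuous_star.const_smul (star c))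
    | ih a => rw [← Completion.coe_smul, star_coe, star_coe, star_smul, Completion.coe_smul]

instance : CStarRing (FieldAlg e) where
  norm_mul_self_le a := by
    induction a using Completion.induction_on with
    | hp =>
      exact isClosed_le (continuous_norm.mul continuous_norm)
        (continuous_norm.comp (continuous_star.mul continuous_id))
    | ih a =>
      rw [star_coe, ← Completion.coe_mul, Completion.norm_coe, Completion.norm_coe]
      exact PreField.maxNorm_sq_le a

instance : CStarAlgebra (FieldAlg e) where

/-- The Weyl elements `W((V))` of the field algebra. -/
def W (e : ℝ) (V : testFields) : FieldAlg e := ((PreField.w (cls e V) : PreField e) : FieldAlg e)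

/-- The Fermi field elements `B(g)` of the field algebra. -/
def B (e : ℝ) (g : K) : FieldAlg e := ((PreField.b g : PreField e) : FieldAlg e)

theorem contractive (φ : PreField e →⋆ₐ[ℂ] PreField e) (a : PreField e) : ‖φ a‖ ≤ ‖a‖ := by
  refine ciSup_le fun p => ?_
  let q : Seminorm ℂ (PreField e) := p.1.comp φ.toAlgHom.toLinearMap
  have hq : PreField.IsCStarSeminorm q := by
    refine ⟨fun a b => ?_, fun a => ?_⟩
    · show p.1 (φ (a * b)) ≤ p.1 (φ a) * p.1 (φ b)
      rw [map_mul]; exact p.2.mul_le _ _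
    · show p.1 (φ (star a * a)) = p.1 (φ a) ^ 2
      rw [map_mul, map_star]; exact p.2.star_mul _
  exact PreField.le_maxNorm ⟨q, hq⟩ a

/-- Extension of *-endomorphisms of the *-algebra to ring endomorphisms of the field algebra. -/
def extendRing (φ : PreField e →⋆ₐ[ℂ] PreField e) : FieldAlg e →+* FieldAlg e :=
  Completion.mapRingHom ((φ : PreField e →ₐ[ℂ] PreField e) : PreField e →+* PreField e)
    (AddMonoidHomClass.continuous_of_bound
      ((φ : PreField e →ₐ[ℂ] PreField e) : PreField e →+* PreField e) 1 fun a => by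
      rw [one_mul]; exact contractive φ a)

theorem extendRing_coe (φ : PreField e →⋆ₐ[ℂ] PreField e) (a : PreField e) :
    extendRing φ (a : FieldAlg e) = ((φ a : PreField e) : FieldAlg e) :=
  Completion.mapRingHom_coe _ a

theorem continuous_extendRing (φ : PreField e →⋆ₐ[ℂ] PreField e) : Continuous (extendRing φ) :=
  Completion.continuous_map

/-- Extension of *-endomorphisms of the *-algebra to the field algebra. -/
def extend (φ : PreField e →⋆ₐ[ℂ] PreField e) : FieldAlg e →⋆ₐ[ℂ] FieldAlg e :=
  { extendRing φ with
    commutes' := fun c => by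
      show extendRing φ ((algebraMap ℂ (PreField e) c : PreField e) : FieldAlg e) = _
      rw [extendRing_coe, AlgHomClass.commutes φ c]
      rfl
    map_star' := fun a => by
      show extendRing φ (star a) = star (extendRing φ a)
      induction a using Completion.induction_on with
      | hp =>
        exact isClosed_eq ((continuous_extendRing φ).comp continuous_star)
          (continuous_star.comp (continuous_extendRing φ))
      | ih a => rw [star_coe, extendRing_coe, extendRing_coe, star_coe, map_star] }

theorem extend_coe (φ : PreField e →⋆ₐ[ℂ] PreField e) (a : PreField e) :
    extend φ (a : FieldAlg e) = ((φ a : PreField e) : FieldAlg e) :=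
  extendRing_coe φ a

theorem continuous_extend (φ : PreField e →⋆ₐ[ℂ] PreField e) : Continuous (extend φ) :=
  continuous_extendRing φ

end FieldAlg

/-! ## Translations, subalgebras -/

namespace FieldAlg

variable {e : ℝ}

theorem B_add (f g : K) : B e (f + g) = B e f + B e g := by
  unfold B; rw [PreField.relations.B_add]; exact UniformSpace.Completion.coe_add _ _

theorem B_smul (c : ℂ) (g : K) : B e (c • g) = star c • B e g := by
  unfold B; rw [PreField.relations.B_smul]; exact UniformSpace.Completion.coe_smul _ _

end FieldAlg

/-- Images of the generators under a Bogoliubov transformation satisfy the defining relations. -/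
theorem bogoliubov_relations {e : ℝ} (T : GaugeClass e →+ GaugeClass e) (τ : testFields →+ testFields)
    (hT : ∀ V, T (cls e V) = cls e (τ V))
    (hτ : ∀ V₁ V₂ : testFields, symp (τ V₁).1 (τ V₂).1 = symp V₁.1 V₂.1) (Q : K →L[ℂ] K)
    (hQ : ∀ f g, inner ℂ (Q f) (Q g) = inner ℂ f g)
    (hQS : ∀ V g, Q (S e V g) = S e (τ V) (Q g)) :
    PreField.Relations (e := e) (A := PreField e) (fun x => PreField.w (T x))
      (fun g => PreField.b (Q g)) where
  W_star x := by rw [PreField.star_w, map_neg]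
  W_zero := by rw [map_zero]; exact PreField.relations.W_zero
  W_mul V₁ V₂ := by
    rw [hT, hT, hT, PreField.relations.W_mul, hτ, map_add]
  B_add f g := by rw [map_add, PreField.relations.B_add]
  B_smul c g := by rw [map_smul, PreField.relations.B_smul]
  B_B f g := PreField.relations.B_B _ _
  B_Bs f g := by rw [PreField.relations.B_Bs, hQ]
  W_B V g := by rw [hT, PreField.relations.W_B, hQS]

/-- The translation `T_x` on the group of classes of test fields. -/
def translateClass (e : ℝ) (x : Spacetime) : GaugeClass e →+ GaugeClass e :=
  QuotientAddGroup.map _ _ (translateHom x) (translate_mem_trivial e x)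

theorem alpha_relations (e m : ℝ) (x : Spacetime) :
    PreField.Relations (e := e) (A := PreField e) (fun c => PreField.w (translateClass e x c))
      (fun g => PreField.b (R m x g)) :=
  bogoliubov_relations (translateClass e x) (translateHom x) (fun _ => rfl)
    (fun V₁ V₂ => symp_translate x V₁.1 V₂.1) (R m x) (inner_R m x) (R_S m x e)

/-- The translation automorphism `α_x` of the field algebra: `α_x(W(V)) = W(T_x V)` and
`α_x(B(g)) = B(R_x g)`. -/
def alpha (e m : ℝ) (x : Spacetime) : FieldAlg e →⋆ₐ[ℂ] FieldAlg e :=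
  FieldAlg.extend (PreField.lift (alpha_relations e m x))

theorem alpha_W (e m : ℝ) (x : Spacetime) (V : testFields) :
    alpha e m x (FieldAlg.W e V) = FieldAlg.W e (translateHom x V) := by
  unfold alpha FieldAlg.W
  rw [FieldAlg.extend_coe, PreField.lift_w]; rfl

theorem alpha_B (e m : ℝ) (x : Spacetime) (g : K) :
    alpha e m x (FieldAlg.B e g) = FieldAlg.B e (R m x g) := by
  unfold alpha FieldAlg.B
  rw [FieldAlg.extend_coe, PreField.lift_b]

theorem beta_relations (e : ℝ) (V : testFields) :
    PreField.Relations (e := e) (A := PreField e) (fun c => PreField.w c)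
      (fun g => PreField.b (S e V g)) :=
  bogoliubov_relations (AddMonoidHom.id _) (AddMonoidHom.id _) (fun _ => rfl)
    (fun _ _ => rfl) (S e V) (inner_S e V) (fun V' g => S_comm e V V' g)

/-- The automorphism `β_{Φ_V}`: `β_{Φ_V}(B(g)) = B(S_{Φ_V} g)` (and the identity on the Weyl
elements). -/
def beta (e : ℝ) (V : testFields) : FieldAlg e →⋆ₐ[ℂ] FieldAlg e :=
  FieldAlg.extend (PreField.lift (beta_relations e V))

theorem beta_B (e : ℝ) (V : testFields) (g : K) :
    beta e V (FieldAlg.B e g) = FieldAlg.B e (S e V g) := by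
  unfold beta FieldAlg.B
  rw [FieldAlg.extend_coe, PreField.lift_b]

/-- The Weyl (CCR) algebra: the C*-subalgebra generated by the elements `W(V)`. -/
def CCR (e : ℝ) : StarSubalgebra ℂ (FieldAlg e) :=
  (StarAlgebra.adjoin ℂ (Set.range (FieldAlg.W e))).topologicalClosure

/-- The *-algebra generated by the elements `B(g)`. -/
def starCAR (e : ℝ) : StarSubalgebra ℂ (FieldAlg e) :=
  StarAlgebra.adjoin ℂ (Set.range (FieldAlg.B e))

/-- The CAR algebra: the C*-subalgebra generated by the elements `B(g)`. -/
def CAR (e : ℝ) : StarSubalgebra ℂ (FieldAlg e) := (starCAR e).topologicalClosure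

theorem starCAR_le (e : ℝ) : starCAR e ≤ CAR e := StarSubalgebra.le_topologicalClosure _

theorem W_mem (e : ℝ) (V : testFields) : FieldAlg.W e V ∈ CCR e :=
  StarSubalgebra.le_topologicalClosure _ (StarAlgebra.subset_adjoin ℂ _ ⟨V, rfl⟩)

theorem B_mem_starCAR (e : ℝ) (g : K) : FieldAlg.B e g ∈ starCAR e :=
  StarAlgebra.subset_adjoin ℂ _ ⟨g, rfl⟩

theorem B_mem (e : ℝ) (g : K) : FieldAlg.B e g ∈ CAR e := starCAR_le e (B_mem_starCAR e g)

theorem extend_mem_closure {e : ℝ} (φ : FieldAlg e →⋆ₐ[ℂ] FieldAlg e) (hφ : Continuous φ)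
    (s : Set (FieldAlg e)) (hs : ∀ a ∈ s, φ a ∈ s) {A : FieldAlg e}
    (hA : A ∈ (StarAlgebra.adjoin ℂ s).topologicalClosure) :
    φ A ∈ (StarAlgebra.adjoin ℂ s).topologicalClosure := by
  have h1 : StarAlgebra.adjoin ℂ s ≤ (StarAlgebra.adjoin ℂ s).comap φ :=
    StarAlgebra.adjoin_le fun a ha => StarAlgebra.subset_adjoin ℂ s (hs a ha)
  have h2 : Set.MapsTo φ (StarAlgebra.adjoin ℂ s : Set (FieldAlg e))
    (StarAlgebra.adjoin ℂ s : Set (FieldAlg e)) := fun a ha => h1 ha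
  exact h2.closure hφ hA

theorem alpha_mem_CCR (e m : ℝ) (x : Spacetime) {A : FieldAlg e} (hA : A ∈ CCR e) :
    alpha e m x A ∈ CCR e := by
  refine extend_mem_closure _ (FieldAlg.continuous_extend _) _ ?_ hA
  rintro _ ⟨V, rfl⟩
  exact ⟨translateHom x V, (alpha_W e m x V).symm⟩

theorem beta_mem_CAR (e : ℝ) (V : testFields) {A : FieldAlg e} (hA : A ∈ CAR e) :
    beta e V A ∈ CAR e := by
  refine extend_mem_closure _ (FieldAlg.continuous_extend _) _ ?_ hA
  rintro _ ⟨g, rfl⟩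
  exact ⟨S e V g, (beta_B e V g).symm⟩

/-- Test fields with `l ∧ V = 0`; their classes are the elements `(0, c mod 2π/e)`. -/
def IsPureGauge (V : testFields) : Prop :=
  ∀ s (l : NullVec) a b, l.1 a * V.1 s l b = l.1 b * V.1 s l a

/-- The algebra of observables: the elements invariant under the gauge transformations
`A ↦ W(V) A W(V)^*`, `l ∧ V = 0`. -/
def observables (e : ℝ) : Set (FieldAlg e) :=
  {A | ∀ V, IsPureGauge V → FieldAlg.W e V * A * star (FieldAlg.W e V) = A}

/-! ## Representations -/

/-- A strongly continuous unitary representation of the translation group. -/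
structure TranslationRep (H : Type u) [NormedAddCommGroup H] [InnerProductSpace ℂ H]
    [CompleteSpace H] where
  U : Spacetime → H →L[ℂ] H
  unitary : ∀ x, U x ∈ unitary (H →L[ℂ] H)
  map_zero : U 0 = 1
  map_add : ∀ x y, U (x + y) = U x * U y
  continuous : ∀ ψ, Continuous fun x => U x ψ

/-- The closed forward lightcone. -/
def forwardCone : Set Spacetime := {p | 0 ≤ mdot p p ∧ 0 ≤ p 0}

/-- The joint spectrum of the generators `P` in `U(x) = exp(i x·P)` is contained in the closed
forward lightcone: `∫ f(x) U(x) d⁴x = 0` for all Schwartz functions `f` for which the transform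
`∫ f(x) exp(i x·p) d⁴x` vanishes on the cone. -/
def TranslationRep.SpectrumInForwardCone {H : Type u} [NormedAddCommGroup H]
    [InnerProductSpace ℂ H] [CompleteSpace H] (U : TranslationRep H) : Prop :=
  ∀ f : SchwartzMap Spacetime ℂ,
    (∀ p ∈ forwardCone, ∫ x, f x * Complex.exp (I * mdot x p) = 0) →
    ∀ ψ : H, ∫ x, f x • U.U x ψ = 0

section Reps

variable {e : ℝ} {H : Type u} [NormedAddCommGroup H] [InnerProductSpace ℂ H] [CompleteSpace H]

/-- Borchers' criterion for representations of the field algebra. -/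
def Borchers (m : ℝ) (π : FieldAlg e →⋆ₐ[ℂ] (H →L[ℂ] H)) : Prop :=
  ∃ U : TranslationRep H, U.SpectrumInForwardCone ∧
    ∀ x A, π (alpha e m x A) = U.U x * π A * U.U (-x)

/-- Borchers' criterion for representations of the Weyl algebra. -/
def BorchersCCR (m : ℝ) (π : CCR e →⋆ₐ[ℂ] (H →L[ℂ] H)) : Prop :=
  ∃ U : TranslationRep H, U.SpectrumInForwardCone ∧
    ∀ x (A : CCR e), π ⟨alpha e m x A.1, alpha_mem_CCR e m x A.2⟩ = U.U x * π A * U.U (-x)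

/-- Irreducibility of a representation: the space is nonzero and there are no nontrivial closed
invariant subspaces. -/
def IsIrreducibleRep {A : Type w} (π : A → H →L[ℂ] H) : Prop :=
  Nontrivial H ∧ ∀ M : Submodule ℂ H, IsClosed (M : Set H) → (∀ a, ∀ ψ ∈ M, π a ψ ∈ M) →
    M = ⊥ ∨ M = ⊤

/-- Regularity of a representation, in terms of the images `W V` of the Weyl elements: strong
continuity of all the groups `λ ↦ W(λ V)`. (The representatives `V` of a class exhaust the choices
of a representative of `Φ_V` modulo `2π/e`.) -/
def IsRegularRep (W : testFields → H →L[ℂ] H) : Prop :=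
  ∀ (V : testFields) (ψ : H), Continuous fun t : ℝ => W (t • V) ψ

/-- Unitary equivalence of representations. -/
def UnitarilyEquiv {H' : Type v} [NormedAddCommGroup H'] [InnerProductSpace ℂ H']
    [CompleteSpace H'] (π : FieldAlg e →⋆ₐ[ℂ] (H →L[ℂ] H))
    (π' : FieldAlg e →⋆ₐ[ℂ] (H' →L[ℂ] H')) : Prop :=
  ∃ T : H ≃ₗᵢ[ℂ] H', ∀ A ψ, T (π A ψ) = π' A (T ψ)

end Reps

/-- A positive energy Fock representation of the CAR algebra: a cyclic representation whose cyclic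
vector is annihilated by `B(g₊)` and `B(g₋)^*`, where `g_± = P_± g`. -/
structure FockRep (e : ℝ) (HF : Type v) [NormedAddCommGroup HF] [InnerProductSpace ℂ HF]
    [CompleteSpace HF] where
  π : CAR e →⋆ₐ[ℂ] (HF →L[ℂ] HF)
  Ω : HF
  norm_Ω : ‖Ω‖ = 1
  cyclic : Dense (Set.range fun C => π C Ω)
  annihilate_pos : ∀ g, π ⟨FieldAlg.B e (freqProj true g), B_mem e _⟩ Ω = 0
  annihilate_neg : ∀ g, star (π ⟨FieldAlg.B e (freqProj false g), B_mem e _⟩) Ω = 0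

namespace FockRep

variable {e : ℝ} {HF : Type v} [NormedAddCommGroup HF] [InnerProductSpace ℂ HF] [CompleteSpace HF]
  (F : FockRep e HF)

/-- The represented field `π_F(B(g)) = ∫ \bar g(v) γ·v b(v) dμ(v)`. -/
def field (g : K) : HF →L[ℂ] HF := F.π ⟨FieldAlg.B e g, B_mem e g⟩

/-- The domain `π_F(*CAR) Ω` of vectors created from the vacuum by polynomials in the fields. -/
def domain : Submodule ℂ HF where
  carrier := {ψ | ∃ C : starCAR e, F.π ⟨C.1, starCAR_le e C.2⟩ F.Ω = ψ}
  zero_mem' := ⟨0, by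
    have h : (⟨(0 : starCAR e).1, starCAR_le e (0 : starCAR e).2⟩ : CAR e) = 0 := rfl
    rw [h, _root_.map_zero, _root_.zero_apply]⟩
  add_mem' := by
    rintro _ _ ⟨C, rfl⟩ ⟨D, rfl⟩
    refine ⟨C + D, ?_⟩
    have h : (⟨(C + D).1, starCAR_le e (C + D).2⟩ : CAR e)
      = ⟨C.1, starCAR_le e C.2⟩ + ⟨D.1, starCAR_le e D.2⟩ := rfl
    rw [h, _root_.map_add, _root_.add_apply]
  smul_mem' := by
    rintro c _ ⟨C, rfl⟩
    refine ⟨c • C, ?_⟩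
    have h : (⟨(c • C).1, starCAR_le e (c • C).2⟩ : CAR e) = c • ⟨C.1, starCAR_le e C.2⟩ := rfl
    rw [h, map_smul, _root_.smul_apply]

/-- `N = ∫ :\bar b(v) γ·v b(v): θ(v) dμ(v)` as an operator on the domain above: for all orthonormal
bases `(e⁺_k)`, `(e⁻_k)` of the positive and negative frequency subspaces,
`N ψ = ∑_k B(e⁺_k)^* B(θ e⁺_k) ψ - ∑_k B(θ e⁻_k) B(e⁻_k)^* ψ`
with the fields in the Fock representation. -/
def IsNormalOrderedDensity (θ : Hyp → ℝ) (N : F.domain →ₗ[ℂ] F.domain) : Prop :=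
  ∀ (ι κ : Type) (ep : HilbertBasis ι ℂ (freqSpace true)) (en : HilbertBasis κ ℂ (freqSpace false))
    (ψ : F.domain), ∃ χp χn : HF,
      HasSum (fun k => star (F.field (ep k)) (F.field (scalarOp θ (ep k)) ψ)) χp ∧
      HasSum (fun k => F.field (scalarOp θ (en k)) (star (F.field (en k)) ψ)) χn ∧
      (N ψ : HF) = χp - χn

/-- `E = exp(-i N)`: `E` is unitary and given by the exponential series on the domain above. -/
def IsExpNegI (N : F.domain →ₗ[ℂ] F.domain) (E : HF →L[ℂ] HF) : Prop :=
  E ∈ unitary (HF →L[ℂ] HF) ∧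
    ∀ ψ : F.domain, HasSum (fun n : ℕ => ((-I) ^ n / (n.factorial : ℂ)) • (((N ^ n) ψ : F.domain) : HF))
      (E ψ)

end FockRep

/-- The Hilbert space tensor product. -/
abbrev HTensor (HF : Type v) (Hr : Type u) [NormedAddCommGroup HF] [InnerProductSpace ℂ HF]
    [NormedAddCommGroup Hr] [InnerProductSpace ℂ Hr] : Type (max v u) :=
  UniformSpace.Completion (HF ⊗[ℂ] Hr)

/-- Elementary tensors. -/
def htmul {HF : Type v} {Hr : Type u} [NormedAddCommGroup HF] [InnerProductSpace ℂ HF]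
    [NormedAddCommGroup Hr] [InnerProductSpace ℂ Hr] (ψ : HF) (φ : Hr) : HTensor HF Hr :=
  ((ψ ⊗ₜ[ℂ] φ : HF ⊗[ℂ] Hr) : HTensor HF Hr)

section TypeRepf

variable {e : ℝ} {HF : Type v} [NormedAddCommGroup HF] [InnerProductSpace ℂ HF] [CompleteSpace HF]
  {Hr : Type u} [NormedAddCommGroup Hr] [InnerProductSpace ℂ Hr] [CompleteSpace Hr]

/-- The Weyl operators in a representation of the field algebra. -/
def weylOp {H : Type w} [NormedAddCommGroup H] [InnerProductSpace ℂ H] [CompleteSpace H]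
    (π : FieldAlg e →⋆ₐ[ℂ] (H →L[ℂ] H)) (V : testFields) : H →L[ℂ] H := π (FieldAlg.W e V)

/-- The Weyl operators in a representation of the Weyl algebra. -/
def weylOpCCR (πr : CCR e →⋆ₐ[ℂ] (Hr →L[ℂ] Hr)) (V : testFields) : Hr →L[ℂ] Hr :=
  πr ⟨FieldAlg.W e V, W_mem e V⟩

/-- The representation `π` of the field algebra on `H_F ⊗ H_r` built from the Fock representation
`π_F` and a representation `π_r` of the Weyl algebra: `π(C) = π_F(C) ⊗ 1` for `C` in the CAR
algebra and `π(W(V)) (π_F(C) Ω ⊗ φ) = π_F(β_{Φ_V} C) Ω ⊗ π_r(W(V)) φ`. -/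
structure IsProductRep (F : FockRep e HF) (πr : CCR e →⋆ₐ[ℂ] (Hr →L[ℂ] Hr))
    (π : FieldAlg e →⋆ₐ[ℂ] (HTensor HF Hr →L[ℂ] HTensor HF Hr)) : Prop where
  car : ∀ (C : CAR e) ψ φ, π C.1 (htmul ψ φ) = htmul (F.π C ψ) φ
  weyl : ∀ V (C : CAR e) φ, weylOp π V (htmul (F.π C F.Ω) φ)
    = htmul (F.π ⟨beta e V C.1, beta_mem_CAR e V C.2⟩ F.Ω) (weylOpCCR πr V φ)

/-- The von Neumann algebra `π(𝓐)''` generated by the observables. -/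
def observableVN {H : Type w} [NormedAddCommGroup H] [InnerProductSpace ℂ H] [CompleteSpace H]
    (π : FieldAlg e →⋆ₐ[ℂ] (H →L[ℂ] H)) : Set (H →L[ℂ] H) :=
  Set.centralizer (Set.centralizer (π '' observables e))

/-- The Gauss constraint in the von Neumann algebra `π(𝓐)''`:
`π(W(V)) = exp(-i ∫ :\bar b(v) γ·v b(v): {V, V^e(v,.)} dμ(v)) ⊗ π_r(W(V))`,
where the operator on the left and the operator `exp(…) ⊗ 1` belong to `π(𝓐)''`. -/
def GaussConstraint (F : FockRep e HF) (πr : CCR e →⋆ₐ[ℂ] (Hr →L[ℂ] Hr))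
    (π : FieldAlg e →⋆ₐ[ℂ] (HTensor HF Hr →L[ℂ] HTensor HF Hr)) : Prop :=
  ∀ V : testFields, weylOp π V ∈ observableVN π ∧
    ∃ (N : F.domain →ₗ[ℂ] F.domain) (E : HF →L[ℂ] HF),
      F.IsNormalOrderedDensity (fun v => symp V.1 (coulomb e v)) N ∧ F.IsExpNegI N E ∧
      (∀ ψ φ, weylOp π V (htmul ψ φ) = htmul (E ψ) (weylOpCCR πr V φ)) ∧
      ∃ T ∈ observableVN π, ∀ (ψ : HF) (φ : Hr), T (htmul ψ φ) = htmul (E ψ) φ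

end TypeRepf

end

end AsymptoticQED

open AsymptoticQED

namespace AsymptoticQED

noncomputable section

/-! ## Multiplication operators on the one-particle space -/

theorem tendsto_of_dense_of_bounded {ι E F : Type*} [NormedAddCommGroup E] [NormedSpace ℂ E]
    [NormedAddCommGroup F] [NormedSpace ℂ F] {l : Filter ι} {T : ι → E →L[ℂ] F} {T' : E →L[ℂ] F}
    {C : ℝ} (hT : ∀ i x, ‖T i x‖ ≤ C * ‖x‖) {s : Set E} (hs : Dense s)
    (h : ∀ x ∈ s, Tendsto (fun i => T i x) l (𝓝 (T' x))) (x : E) :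
    Tendsto (fun i => T i x) l (𝓝 (T' x)) := by
  rw [Metric.tendsto_nhds]
  intro ε hε
  set D := |C| + ‖T'‖ + 1 with hD
  have hD0 : 0 < D := by positivity
  obtain ⟨y, hy, hxy⟩ := Metric.dense_iff.1 hs x (ε / (2 * D)) (by positivity)
  rw [Metric.mem_ball, dist_comm, dist_eq_norm] at hy
  filter_upwards [Metric.tendsto_nhds.1 (h y hxy) (ε / 2) (by positivity)] with i hi
  rw [dist_eq_norm] at hi ⊢
  have e : T i x - T' x = T i (x - y) - T' (x - y) + (T i y - T' y) := by
    simp only [map_sub]; abel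
  have h1 : ‖T i (x - y)‖ ≤ |C| * ‖x - y‖ :=
    (hT i _).trans (mul_le_mul_of_nonneg_right (le_abs_self C) (norm_nonneg _))
  have h2 := T'.le_opNorm (x - y)
  have h3 : (|C| + ‖T'‖) * ‖x - y‖ ≤ D * ‖x - y‖ := by gcongr; linarith
  have h4 : D * ‖x - y‖ < ε / 2 := by
    rw [lt_div_iff₀ (by positivity)] at hy
    linarith
  calc ‖T i x - T' x‖ ≤ ‖T i (x - y)‖ + ‖T' (x - y)‖ + ‖T i y - T' y‖ := by
        rw [e]; exact (norm_add_le _ _).trans (add_le_add (norm_sub_le _ _) le_rfl)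
    _ < ε := by nlinarith

theorem IsMultiplier.add {M N : Hyp → Matrix (Fin 4) (Fin 4) ℂ} (hM : IsMultiplier M)
    (hN : IsMultiplier N) : IsMultiplier (fun v => M v + N v) := by
  obtain ⟨C, hC⟩ := hM.bound
  obtain ⟨D, hD⟩ := hN.bound
  refine ⟨fun i j => (hM.meas i j).add (hN.meas i j), 2 * C + 2 * D, fun v z => ?_⟩
  rw [Matrix.add_mulVec]
  have := diracForm_parallelogram v ((M v).mulVec z) ((N v).mulVec z)
  linarith [hC v z, hD v z]

theorem mulOp_add {M N : Hyp → Matrix (Fin 4) (Fin 4) ℂ} (hM : IsMultiplier M)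
    (hN : IsMultiplier N) (g : K) : mulOp (fun v => M v + N v) g = mulOp M g + mulOp N g := by
  induction g using UniformSpace.Completion.induction_on with
  | hp => exact isClosed_eq (by fun_prop) (by fun_prop)
  | ih g =>
    rw [mulOp_coe hN, mulOp_coe hM, mulOp_coe (hM.add hN), ← UniformSpace.Completion.coe_add]
    congr 1
    exact Subtype.ext (funext fun v => Matrix.add_mulVec (M v) (N v) (g.fn v))

theorem mulOp_inner_left {M N : Hyp → Matrix (Fin 4) (Fin 4) ℂ} (hM : IsMultiplier M)
    (hN : IsMultiplier N)
    (h : ∀ (v : Hyp) z w, diracForm v.1 ((M v).mulVec z) w = diracForm v.1 z ((N v).mulVec w))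
    (f g : K) : inner ℂ (mulOp M f) g = inner ℂ f (mulOp N g) := by
  induction f, g using UniformSpace.Completion.induction_on₂ with
  | hp => exact isClosed_eq (by fun_prop) (by fun_prop)
  | ih f g =>
    rw [mulOp_coe hM, mulOp_coe hN, UniformSpace.Completion.inner_coe,
      UniformSpace.Completion.inner_coe, PreK.inner_def, PreK.inner_def]
    congr 1
    funext v
    exact h v _ _

theorem mulOp_one (g : K) : mulOp (fun _ => 1) g = g := by
  have h : IsMultiplier (fun _ => 1) :=
    ⟨fun i j => measurable_const, 1, fun v z => by rw [Matrix.one_mulVec, one_mul]⟩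
  induction g using UniformSpace.Completion.induction_on with
  | hp => exact isClosed_eq (by fun_prop) (by fun_prop)
  | ih g =>
    rw [mulOp_coe h]
    congr 1
    exact Subtype.ext (funext fun v => Matrix.one_mulVec (g.fn v))

/-- Bounded measurable complex functions on the hyperboloid. -/
def BddMeas (θ : Hyp → ℂ) : Prop := Measurable θ ∧ ∃ C, ∀ v, ‖θ v‖ ≤ C

/-- Multiplication by a (bounded measurable) complex function. -/
def cop (θ : Hyp → ℂ) : K →L[ℂ] K := mulOp fun v => θ v • 1

theorem diracForm_smul_self (v : Hyp) (c : ℂ) (z : Fin 4 → ℂ) :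
    (diracForm v.1 (c • z) (c • z)).re = ‖c‖ ^ 2 * (diracForm v.1 z z).re := by
  rw [diracForm_smul_left, diracForm_smul_right, ← mul_assoc]
  have : star c * c = ((‖c‖ ^ 2 : ℝ) : ℂ) := by
    rw [mul_comm, RCLike.star_def, Complex.mul_conj, Complex.normSq_eq_norm_sq]
  rw [this, Complex.re_ofReal_mul]

theorem BddMeas.isMultiplier {θ : Hyp → ℂ} (h : BddMeas θ) :
    IsMultiplier fun v => θ v • (1 : Matrix (Fin 4) (Fin 4) ℂ) := by
  obtain ⟨h1, C, hC⟩ := h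
  refine ⟨fun i j => ?_, C ^ 2, fun v z => ?_⟩
  · simp only [Matrix.smul_apply, smul_eq_mul]
    exact h1.mul_const _
  · rw [Matrix.smul_mulVec, Matrix.one_mulVec, diracForm_smul_self]
    exact mul_le_mul_of_nonneg_right (pow_le_pow_left₀ (norm_nonneg _) (hC v) 2)
      (diracForm_nonneg v z)

theorem BddMeas.mul {θ η : Hyp → ℂ} (h : BddMeas θ) (h' : BddMeas η) :
    BddMeas fun v => θ v * η v := by
  obtain ⟨h1, C, hC⟩ := h
  obtain ⟨h2, D, hD⟩ := h'
  refine ⟨h1.mul h2, C * D, fun v => ?_⟩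
  rw [norm_mul]
  exact mul_le_mul (hC v) (hD v) (norm_nonneg _) ((norm_nonneg _).trans (hC v))

theorem BddMeas.add {θ η : Hyp → ℂ} (h : BddMeas θ) (h' : BddMeas η) :
    BddMeas fun v => θ v + η v := by
  obtain ⟨h1, C, hC⟩ := h
  obtain ⟨h2, D, hD⟩ := h'
  exact ⟨h1.add h2, C + D, fun v => (norm_add_le _ _).trans (add_le_add (hC v) (hD v))⟩

theorem BddMeas.const (c : ℂ) : BddMeas fun _ => c := ⟨measurable_const, ‖c‖, fun _ => le_rfl⟩

theorem BddMeas.conj {θ : Hyp → ℂ} (h : BddMeas θ) : BddMeas fun v => star (θ v) := by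
  obtain ⟨h1, C, hC⟩ := h
  exact ⟨Complex.continuous_conj.measurable.comp h1, C, fun v => by rw [norm_star]; exact hC v⟩

theorem BddMeas.pow {θ : Hyp → ℂ} (h : BddMeas θ) (n : ℕ) : BddMeas fun v => θ v ^ n := by
  induction n with
  | zero => simpa using BddMeas.const 1
  | succ n ih => simpa only [pow_succ] using ih.mul h

theorem BddMeas.phase {θ : Hyp → ℝ} (h : Measurable θ) :
    BddMeas fun v => Complex.exp (I * θ v) := by
  refine ⟨by fun_prop, 1, fun v => ?_⟩
  show ‖Complex.exp (I * θ v)‖ ≤ 1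
  rw [mul_comm, Complex.norm_exp_ofReal_mul_I]

theorem cop_cop {θ η : Hyp → ℂ} (h : BddMeas θ) (h' : BddMeas η) (g : K) :
    cop θ (cop η g) = cop (fun v => θ v * η v) g := by
  unfold cop
  rw [mulOp_mul h.isMultiplier h'.isMultiplier]
  congr 2
  funext v
  rw [smul_mul_smul_comm, one_mul]

theorem cop_add {θ η : Hyp → ℂ} (h : BddMeas θ) (h' : BddMeas η) (g : K) :
    cop (fun v => θ v + η v) g = cop θ g + cop η g := by
  unfold cop
  rw [← mulOp_add h.isMultiplier h'.isMultiplier]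
  congr 2
  funext v
  rw [add_smul]

theorem cop_inner_left {θ : Hyp → ℂ} (h : BddMeas θ) (f g : K) :
    inner ℂ (cop θ f) g = inner ℂ f (cop (fun v => star (θ v)) g) := by
  refine mulOp_inner_left h.isMultiplier h.conj.isMultiplier (fun v z w => ?_) f g
  simp only [Matrix.smul_mulVec, Matrix.one_mulVec, diracForm_smul_left, diracForm_smul_right]

theorem cop_one (g : K) : cop (fun _ => 1) g = g := by
  unfold cop
  simpa using mulOp_one g

theorem cop_const (c : ℂ) (g : K) : cop (fun _ => c) g = c • g := by
  induction g using UniformSpace.Completion.induction_on with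
  | hp => exact isClosed_eq (cop _).continuous (c • ContinuousLinearMap.id ℂ K).continuous
  | ih g =>
    unfold cop
    rw [mulOp_coe (BddMeas.const c).isMultiplier, ← UniformSpace.Completion.coe_smul]
    congr 1
    refine Subtype.ext (funext fun v => ?_)
    show (c • (1 : Matrix (Fin 4) (Fin 4) ℂ)).mulVec (g.fn v) = c • g.fn v
    rw [Matrix.smul_mulVec, Matrix.one_mulVec]

theorem cop_smul {θ : Hyp → ℂ} (h : BddMeas θ) (c : ℂ) (g : K) :
    cop (fun v => c * θ v) g = c • cop θ g := by
  rw [← cop_cop (BddMeas.const c) h, cop_const]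

theorem norm_cop_le {θ : Hyp → ℂ} (h : Measurable θ) {C : ℝ} (hC : ∀ v, ‖θ v‖ ≤ C) (g : K) :
    ‖cop θ g‖ ≤ C * ‖g‖ := by
  have hb : BddMeas θ := ⟨h, C, hC⟩
  have hC0 : 0 ≤ C := (norm_nonneg _).trans (hC (hypOf 0))
  induction g using UniformSpace.Completion.induction_on with
  | hp => exact isClosed_le (by fun_prop) (by fun_prop)
  | ih g =>
    unfold cop
    rw [mulOp_coe hb.isMultiplier, UniformSpace.Completion.norm_coe,
      UniformSpace.Completion.norm_coe]
    refine le_of_sq_le_sq ?_ (by positivity)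
    rw [PreK.norm_sq, mul_pow, PreK.norm_sq, ← integral_const_mul]
    refine integral_mono ((preMul hb.isMultiplier g).integrable (preMul hb.isMultiplier g)).re
      (((g.integrable g).re).const_mul _) fun v => ?_
    show (diracForm v.1 ((θ v • (1 : Matrix (Fin 4) (Fin 4) ℂ)).mulVec (g.fn v))
      ((θ v • (1 : Matrix (Fin 4) (Fin 4) ℂ)).mulVec (g.fn v))).re ≤ _
    rw [Matrix.smul_mulVec, Matrix.one_mulVec, diracForm_smul_self]
    exact mul_le_mul_of_nonneg_right (pow_le_pow_left₀ (norm_nonneg _) (hC v) 2)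
      (diracForm_nonneg v _)

/-- Dominated convergence for multiplication operators. -/
theorem tendsto_cop {ι : Type*} {l : Filter ι} [l.IsCountablyGenerated] {θ : ι → Hyp → ℂ}
    {θ' : Hyp → ℂ} {C : ℝ} (hm : ∀ i, Measurable (θ i)) (hm' : Measurable θ')
    (hC : ∀ i v, ‖θ i v‖ ≤ C) (hC' : ∀ v, ‖θ' v‖ ≤ C)
    (h : ∀ v, Tendsto (fun i => θ i v) l (𝓝 (θ' v))) (g : K) :
    Tendsto (fun i => cop (θ i) g) l (𝓝 (cop θ' g)) := by
  refine tendsto_of_dense_of_bounded (C := C) (fun i x => norm_cop_le (hm i) (hC i) x)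
    (UniformSpace.Completion.denseRange_coe (α := PreK)) ?_ g
  rintro _ ⟨g, rfl⟩
  rw [tendsto_iff_norm_sub_tendsto_zero]
  have hb : ∀ i, BddMeas (θ i) := fun i => ⟨hm i, C, hC i⟩
  have hb' : BddMeas θ' := ⟨hm', C, hC'⟩
  have e : ∀ i, ‖cop (θ i) (g : K) - cop θ' (g : K)‖ ^ 2
      = ∫ v, ‖θ i v - θ' v‖ ^ 2 * (diracForm v.1 (g.fn v) (g.fn v)).re ∂hypMeasure := by
    intro i
    unfold cop
    rw [mulOp_coe (hb i).isMultiplier, mulOp_coe hb'.isMultiplier,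
      ← UniformSpace.Completion.coe_sub, UniformSpace.Completion.norm_coe, PreK.norm_sq]
    congr 1
    funext v
    rw [← diracForm_smul_self]
    have : (preMul (hb i).isMultiplier g - preMul hb'.isMultiplier g).fn v
        = (θ i v - θ' v) • g.fn v := by
      show (θ i v • (1 : Matrix (Fin 4) (Fin 4) ℂ)).mulVec (g.fn v)
        - (θ' v • (1 : Matrix (Fin 4) (Fin 4) ℂ)).mulVec (g.fn v) = _
      rw [Matrix.smul_mulVec, Matrix.smul_mulVec, Matrix.one_mulVec, sub_smul]
    rw [this]
  have hsq : Tendsto (fun i => ‖cop (θ i) (g : K) - cop θ' (g : K)‖ ^ 2) l (𝓝 0) := by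
    simp only [e]
    have hi := (g.integrable g).re
    have h0 : ∫ v : Hyp, (0 : ℝ) ∂hypMeasure = 0 := by simp
    have key : Tendsto (fun i => ∫ v : Hyp, ‖θ i v - θ' v‖ ^ 2
        * (diracForm v.1 (g.fn v) (g.fn v)).re ∂hypMeasure) l
        (𝓝 (∫ v : Hyp, (0 : ℝ) ∂hypMeasure)) := by
      refine tendsto_integral_filter_of_dominated_convergence
        (fun v => (2 * C) ^ 2 * (diracForm v.1 (g.fn v) (g.fn v)).re) ?_ ?_ (hi.const_mul _) ?_
      · exact Eventually.of_forall fun i => AEStronglyMeasurable.mul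
          (((hm i).sub hm').norm.pow_const 2).aestronglyMeasurable hi.aestronglyMeasurable
      · refine Eventually.of_forall fun i => ae_of_all _ fun v => ?_
        have h0 := diracForm_nonneg v (g.fn v)
        rw [Real.norm_of_nonneg (by positivity)]
        refine mul_le_mul_of_nonneg_right (pow_le_pow_left₀ (norm_nonneg _) ?_ 2) h0
        exact (norm_sub_le _ _).trans (by linarith [hC i v, hC' v])
      · refine ae_of_all _ fun v => ?_
        have h1 := (tendsto_iff_norm_sub_tendsto_zero.1 (h v)).pow 2
        simpa using h1.mul_const (diracForm v.1 (g.fn v) (g.fn v)).re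
    rwa [h0] at key
  have := hsq.sqrt
  simpa using this

/-! ### Frequency projections -/

theorem diracForm_gslash_gslash (v : Hyp) (z w : Fin 4 → ℂ) :
    diracForm v.1 ((gslash v.1).mulVec z) ((gslash v.1).mulVec w) = diracForm v.1 z w := by
  rw [diracForm_gslash, Matrix.mulVec_mulVec, gslash_sq, v.2.1]
  simp

/-- The matrix of `P_±`. -/
def freqMat (σ : Bool) (v : Hyp) : Matrix (Fin 4) (Fin 4) ℂ :=
  (1 / 2 : ℂ) • (if σ then 1 + gslash v.1 else 1 - gslash v.1)

theorem freqProj_eq (σ : Bool) : freqProj σ = mulOp (freqMat σ) := rfl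

theorem isMultiplier_freqMat (σ : Bool) : IsMultiplier (freqMat σ) := by
  refine ⟨fun i j => ?_, 1, fun v z => ?_⟩
  · have h := measurable_gslash i j
    unfold freqMat
    cases σ <;> simp <;> fun_prop
  · have h1 := diracForm_parallelogram v z ((gslash v.1).mulVec z)
    have h2 := diracForm_parallelogram v z ((-1 : ℂ) • (gslash v.1).mulVec z)
    rw [diracForm_smul_self v (-1)] at h2
    rw [diracForm_gslash_gslash] at h1 h2
    unfold freqMat
    rw [Matrix.smul_mulVec, diracForm_smul_self]
    cases σ
    · simp only [Bool.false_eq_true, if_false, Matrix.sub_mulVec, Matrix.one_mulVec]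
      rw [sub_eq_add_neg, ← neg_one_smul ℂ ((gslash v.1).mulVec z)]
      norm_num at h2 ⊢
      linarith
    · simp only [if_true, Matrix.add_mulVec, Matrix.one_mulVec]
      norm_num
      linarith

theorem freqMat_mul_self (σ : Bool) (v : Hyp) : freqMat σ v * freqMat σ v = freqMat σ v := by
  have h : gslash v.1 * gslash v.1 = 1 := by rw [gslash_sq, v.2.1]; simp
  unfold freqMat
  cases σ <;> simp only [Bool.false_eq_true, if_false, if_true, smul_mul_smul_comm, mul_add,
    add_mul, mul_sub, sub_mul, h, one_mul, mul_one]
  · rw [show (1 : Matrix (Fin 4) (Fin 4) ℂ) - gslash v.1 - (gslash v.1 - 1)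
      = (2 : ℂ) • (1 - gslash v.1) by rw [two_smul]; abel, smul_smul]
    norm_num
  · rw [show (1 : Matrix (Fin 4) (Fin 4) ℂ) + gslash v.1 + (gslash v.1 + 1)
      = (2 : ℂ) • (1 + gslash v.1) by rw [two_smul]; abel, smul_smul]
    norm_num

theorem freqMat_mul_not (σ : Bool) (v : Hyp) : freqMat σ v * freqMat (!σ) v = 0 := by
  have h : gslash v.1 * gslash v.1 = 1 := by rw [gslash_sq, v.2.1]; simp
  unfold freqMat
  cases σ <;> simp [mul_add, add_mul, mul_sub, sub_mul, h] <;> module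

theorem freqMat_add (σ : Bool) (v : Hyp) : freqMat σ v + freqMat (!σ) v = 1 := by
  unfold freqMat
  cases σ <;> simp only [Bool.not_false, Bool.not_true, Bool.false_eq_true, if_false, if_true,
    ← smul_add]
  · rw [show (1 : Matrix (Fin 4) (Fin 4) ℂ) - gslash v.1 + (1 + gslash v.1)
      = (2 : ℂ) • 1 by rw [two_smul]; abel, smul_smul]
    norm_num
  · rw [show (1 : Matrix (Fin 4) (Fin 4) ℂ) + gslash v.1 + (1 - gslash v.1)
      = (2 : ℂ) • 1 by rw [two_smul]; abel, smul_smul]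
    norm_num

theorem freqProj_freqProj (σ : Bool) (g : K) : freqProj σ (freqProj σ g) = freqProj σ g := by
  rw [freqProj_eq, mulOp_mul (isMultiplier_freqMat σ) (isMultiplier_freqMat σ)]
  simp only [freqMat_mul_self]

theorem freqProj_not (σ : Bool) (g : K) : freqProj σ (freqProj (!σ) g) = 0 := by
  rw [freqProj_eq, freqProj_eq, mulOp_mul (isMultiplier_freqMat σ) (isMultiplier_freqMat _)]
  simp only [freqMat_mul_not]
  have := cop_const 0 g
  unfold cop at this
  simpa using this

theorem freqProj_add (σ : Bool) (g : K) : freqProj σ g + freqProj (!σ) g = g := by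
  rw [freqProj_eq, freqProj_eq, ← mulOp_add (isMultiplier_freqMat σ) (isMultiplier_freqMat _)]
  simp only [freqMat_add]
  exact mulOp_one g

theorem freqProj_inner_left (σ : Bool) (f g : K) :
    inner ℂ (freqProj σ f) g = inner ℂ f (freqProj σ g) := by
  refine mulOp_inner_left (isMultiplier_freqMat σ) (isMultiplier_freqMat σ) (fun v z w => ?_) f g
  unfold freqMat
  simp only [Matrix.smul_mulVec, diracForm_smul_left, diracForm_smul_right]
  have e : diracForm v.1 ((gslash v.1).mulVec z) w = diracForm v.1 z ((gslash v.1).mulVec w) :=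
    diracForm_gslash v.1 z w
  have e2 : ∀ x y : Fin 4 → ℂ, x - y = x + (-1 : ℂ) • y := fun x y => by simp [sub_eq_add_neg]
  cases σ <;> simp [Matrix.add_mulVec, Matrix.sub_mulVec, e2, diracForm_add_left,
    diracForm_add_right, diracForm_smul_left, diracForm_smul_right, e, -neg_smul, -one_smul]

theorem freqProj_cop (σ : Bool) {θ : Hyp → ℂ} (h : BddMeas θ) (g : K) :
    freqProj σ (cop θ g) = cop θ (freqProj σ g) := by
  unfold cop
  rw [freqProj_eq, mulOp_mul (isMultiplier_freqMat σ) h.isMultiplier,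
    mulOp_mul h.isMultiplier (isMultiplier_freqMat σ)]
  congr 2
  funext v
  simp

theorem freqProj_ortho (σ : Bool) (f g : K) :
    inner ℂ (freqProj σ f) (freqProj (!σ) g) = 0 := by
  rw [freqProj_inner_left, freqProj_not, inner_zero_right]

theorem mem_freqSpace {σ : Bool} {g : K} : g ∈ freqSpace σ ↔ freqProj σ g = g := by
  refine ⟨?_, fun h => ⟨g, h⟩⟩
  rintro ⟨f, rfl⟩
  exact freqProj_freqProj σ f

theorem freqProj_mem (σ : Bool) (g : K) : freqProj σ g ∈ freqSpace σ := ⟨g, rfl⟩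

theorem isClosed_freqSpace (σ : Bool) : IsClosed (freqSpace σ : Set K) := by
  have : (freqSpace σ : Set K) = {g | freqProj σ g = g} := by
    ext g; exact mem_freqSpace
  rw [this]
  exact isClosed_eq (by fun_prop) (by fun_prop)

instance (σ : Bool) : CompleteSpace (freqSpace σ) := (isClosed_freqSpace σ).completeSpace_coe

theorem S_eq (e : ℝ) (V : testFields) :
    S e V = cop fun v => Complex.exp (I * coulombPhase e V.1 v) := rfl

theorem freqProj_S (e : ℝ) (V : testFields) (σ : Bool) (g : K) :
    freqProj σ (S e V g) = S e V (freqProj σ g) :=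
  freqProj_cop σ (BddMeas.phase (measurable_coulombPhase e V)) g

/-- The sign of a frequency. -/
def freqSign (σ : Bool) : ℝ := if σ then 1 else -1

theorem measurable_mdot_right (x : Spacetime) : Measurable fun v : Hyp => mdot x v.1 :=
  (mdotL x).continuous.measurable.comp measurable_subtype_coe

theorem R_freqProj (m : ℝ) (x : Spacetime) (σ : Bool) (g : K) :
    R m x (freqProj σ g)
      = cop (fun v => Complex.exp (I * (freqSign σ * (m * mdot x v.1) : ℝ))) (freqProj σ g) := by
  have hm : Measurable fun v : Hyp => freqSign σ * (m * mdot x v.1) :=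
    ((measurable_mdot_right x).const_mul m).const_mul _
  unfold R cop
  rw [freqProj_eq, mulOp_mul (isMultiplier_transl m x) (isMultiplier_freqMat σ),
    mulOp_mul (BddMeas.phase hm).isMultiplier (isMultiplier_freqMat σ)]
  congr 2
  funext v
  have h : gslash v.1 * gslash v.1 = 1 := by rw [gslash_sq, v.2.1]; simp
  have hexp : Complex.exp (I * (freqSign σ * (m * mdot x v.1) : ℝ))
      = (Real.cos (m * mdot x v.1) : ℂ) + freqSign σ * (I * Real.sin (m * mdot x v.1)) := by
    rw [mul_comm, Complex.exp_mul_I, ← Complex.ofReal_cos, ← Complex.ofReal_sin]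
    cases σ <;> simp [freqSign] <;> ring
  have hg : gslash v.1 * freqMat σ v = (freqSign σ : ℂ) • freqMat σ v := by
    unfold freqMat freqSign
    cases σ <;> simp [mul_add, mul_sub, h]
    all_goals module
  rw [hexp]
  unfold translMat
  rw [add_mul, smul_mul_assoc, one_mul, smul_mul_assoc, hg, smul_mul_assoc, one_mul, add_smul,
    smul_smul]
  congr 2
  ring

theorem freqProj_R (m : ℝ) (x : Spacetime) (σ : Bool) (g : K) :
    freqProj σ (R m x g) = R m x (freqProj σ g) := by
  unfold R
  rw [freqProj_eq, mulOp_mul (isMultiplier_freqMat σ) (isMultiplier_transl m x),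
    mulOp_mul (isMultiplier_transl m x) (isMultiplier_freqMat σ)]
  congr 2
  funext v
  unfold freqMat translMat
  cases σ <;> simp [mul_add, add_mul, mul_sub, sub_mul, smul_add, smul_sub] <;> module

theorem R_add (m : ℝ) (x y : Spacetime) (g : K) : R m (x + y) g = R m x (R m y g) := by
  have key : ∀ σ, R m (x + y) (freqProj σ g) = R m x (R m y (freqProj σ g)) := by
    intro σ
    have hm : ∀ x, BddMeas fun v : Hyp => Complex.exp (I * (freqSign σ * (m * mdot x v.1) : ℝ)) :=
      fun x => BddMeas.phase (((measurable_mdot_right x).const_mul m).const_mul _)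
    rw [R_freqProj, R_freqProj m y, ← freqProj_cop σ (hm y), R_freqProj, freqProj_cop σ (hm y),
      cop_cop (hm x) (hm y)]
    congr 2
    funext v
    rw [← Complex.exp_add]
    congr 1
    have : mdot (x + y) v.1 = mdot x v.1 + mdot y v.1 := by simp [mdot]; ring
    rw [this]; push_cast; ring
  have := congrArg₂ (· + ·) (key true) (key false)
  simp only [← map_add] at this
  rwa [show freqProj true g + freqProj false g = g from freqProj_add true g] at this

theorem R_zero (m : ℝ) (g : K) : R m 0 g = g := by
  unfold R
  have : translMat m 0 = fun _ => 1 := by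
    funext v; simp [translMat, mdot]
  rw [this, mulOp_one]

theorem continuous_R (m : ℝ) (g : K) : Continuous fun x => R m x g := by
  have key : ∀ σ, Continuous fun x => R m x (freqProj σ g) := by
    intro σ
    simp only [R_freqProj]
    refine continuous_iff_continuousAt.2 fun x => ?_
    refine tendsto_cop (C := 1)
      (fun x => (BddMeas.phase (((measurable_mdot_right x).const_mul m).const_mul _)).1)
      (BddMeas.phase (((measurable_mdot_right x).const_mul m).const_mul _)).1
      (fun x v => ?_) (fun v => ?_) (fun v => ?_) _
    · rw [mul_comm, Complex.norm_exp_ofReal_mul_I]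
    · rw [mul_comm, Complex.norm_exp_ofReal_mul_I]
    · have : Continuous fun x => Complex.exp (I * (freqSign σ * (m * mdot x v.1) : ℝ)) := by
        unfold mdot; fun_prop
      exact this.tendsto x
  have e : ∀ x, R m x (freqProj true g) + R m x (freqProj false g) = R m x g := fun x => by
    rw [← map_add, show freqProj true g + freqProj false g = g from freqProj_add true g]
  exact ((key true).add (key false)).congr e

set_option linter.unusedSectionVars false

/-! ## Representations of the anticommutation relations -/

section HilbertTools

variable {H₁ H₂ : Type*} [NormedAddCommGroup H₁] [InnerProductSpace ℂ H₁] [CompleteSpace H₁]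
  [NormedAddCommGroup H₂] [InnerProductSpace ℂ H₂] [CompleteSpace H₂]

/-- Two families of vectors with the same Gram matrix are related by an isometry, if the first one
is total. -/
theorem exists_isometry_of_gram {X : Type*} (x : X → H₁) (y : X → H₂)
    (h : ∀ i j, inner ℂ (x i) (x j) = inner ℂ (y i) (y j))
    (hx : Dense (Submodule.span ℂ (Set.range x) : Set H₁)) :
    ∃ T : H₁ →ₗᵢ[ℂ] H₂, ∀ i, T (x i) = y i := by
  let L₁ : (X →₀ ℂ) →ₗ[ℂ] H₁ := Finsupp.linearCombination ℂ x
  let L₂ : (X →₀ ℂ) →ₗ[ℂ] H₂ := Finsupp.linearCombination ℂ y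
  have hin : ∀ u v, inner ℂ (L₁ u) (L₁ v) = inner ℂ (L₂ u) (L₂ v) := by
    intro u v
    simp only [L₁, L₂, Finsupp.linearCombination_apply, Finsupp.sum, sum_inner, inner_sum,
      inner_smul_left, inner_smul_right, h]
  have hn : ∀ u, ‖L₁ u‖ = ‖L₂ u‖ := by
    intro u
    have := hin u u
    rw [inner_self_eq_norm_sq_to_K, inner_self_eq_norm_sq_to_K] at this
    have h2 : ‖L₁ u‖ ^ 2 = ‖L₂ u‖ ^ 2 := by exact_mod_cast this
    exact (pow_left_inj₀ (norm_nonneg _) (norm_nonneg _) two_ne_zero).1 h2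
  have hk : LinearMap.ker L₁ ≤ LinearMap.ker L₂ := by
    intro u hu
    rw [LinearMap.mem_ker] at hu ⊢
    rw [← norm_eq_zero, ← hn, hu, norm_zero]
  let f : LinearMap.range L₁ →ₗ[ℂ] H₂ :=
    ((LinearMap.ker L₁).liftQ L₂ hk).comp (L₁.quotKerEquivRange.symm.toLinearMap)
  have hf : ∀ u, f ⟨L₁ u, u, rfl⟩ = L₂ u := by
    intro u
    show (LinearMap.ker L₁).liftQ L₂ hk (L₁.quotKerEquivRange.symm ⟨L₁ u, u, rfl⟩) = L₂ u
    have : L₁.quotKerEquivRange.symm ⟨L₁ u, u, rfl⟩ = (LinearMap.ker L₁).mkQ u := by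
      rw [LinearEquiv.symm_apply_eq]; rfl
    rw [this, Submodule.mkQ_apply, Submodule.liftQ_apply]
  have hfn : ∀ z, ‖f z‖ = ‖z‖ := by
    rintro ⟨_, u, rfl⟩
    rw [hf, ← hn]; rfl
  let fi : LinearMap.range L₁ →ₗᵢ[ℂ] H₂ := ⟨f, hfn⟩
  have hr : (LinearMap.range L₁ : Set H₁) = Submodule.span ℂ (Set.range x) := by
    rw [Finsupp.range_linearCombination]
  have hd : DenseRange (LinearMap.range L₁).subtypeL := by
    rw [DenseRange]
    have : Set.range (LinearMap.range L₁).subtypeL = (LinearMap.range L₁ : Set H₁) :=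
      Subtype.range_coe
    rw [this, hr]
    exact hx
  have hui : IsUniformInducing (LinearMap.range L₁).subtypeL :=
    (LinearMap.range L₁).subtypeₗᵢ.isometry.isUniformInducing
  let T : H₁ →L[ℂ] H₂ := fi.toContinuousLinearMap.extend (LinearMap.range L₁).subtypeL
  have hT : ∀ z : LinearMap.range L₁, T z = f z := fun z =>
    ContinuousLinearMap.extend_eq _ hd hui z
  have hTn : ∀ z, ‖T z‖ = ‖z‖ := by
    intro z
    induction z using hd.induction_on with
    | hp => exact isClosed_eq (by fun_prop) (by fun_prop)
    | ih z => rw [Submodule.subtypeL_apply, hT, hfn]; rfl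
  refine ⟨⟨T.toLinearMap, hTn⟩, fun i => ?_⟩
  have e1 : L₁ (Finsupp.single i 1) = x i := by simp [L₁]
  have e2 : L₂ (Finsupp.single i 1) = y i := by simp [L₂]
  show T (x i) = y i
  rw [← e1, ← e2, ← hf]
  exact hT ⟨L₁ (Finsupp.single i 1), _, rfl⟩

theorem clm_ext_of_total {E F : Type*} [NormedAddCommGroup E] [NormedSpace ℂ E]
    [NormedAddCommGroup F] [NormedSpace ℂ F] {X : Type*} {x : X → E}
    (hx : Dense (Submodule.span ℂ (Set.range x) : Set E)) {A B : E →L[ℂ] F}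
    (h : ∀ i, A (x i) = B (x i)) : A = B := by
  refine ContinuousLinearMap.ext_on hx ?_
  rintro _ ⟨i, rfl⟩
  exact h i

theorem eq_of_inner_total {X : Type*} {x : X → H₁}
    (hx : Dense (Submodule.span ℂ (Set.range x) : Set H₁)) {u v : H₁}
    (h : ∀ i, inner ℂ (x i) u = inner ℂ (x i) v) : u = v := by
  have : (innerSL ℂ u) = innerSL ℂ v := by
    refine clm_ext_of_total hx fun i => ?_
    rw [innerSL_apply_apply, innerSL_apply_apply, ← inner_conj_symm, h, inner_conj_symm]
  have h2 := congrArg (fun T => T (u - v)) this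
  simp only [innerSL_apply_apply] at h2
  rw [← sub_eq_zero, ← inner_sub_left, inner_self_eq_zero, sub_eq_zero] at h2
  exact h2

theorem total_of_orthogonal {X : Type*} {x : X → H₁}
    (h : ∀ u, (∀ i, inner ℂ (x i) u = 0) → u = 0) :
    Dense (Submodule.span ℂ (Set.range x) : Set H₁) := by
  rw [Submodule.dense_iff_topologicalClosure_eq_top, Submodule.topologicalClosure_eq_top_iff,
    Submodule.eq_bot_iff]
  intro u hu
  exact h u fun i => hu _ (Submodule.subset_span ⟨i, rfl⟩)

end HilbertTools

section CAR

variable {H : Type*} [NormedAddCommGroup H] [InnerProductSpace ℂ H] [CompleteSpace H]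

/-- A representation `g ↦ b(g)` of the canonical anticommutation relations. -/
structure IsCAR (b : K → H →L[ℂ] H) : Prop where
  add : ∀ f g, b (f + g) = b f + b g
  smul : ∀ (c : ℂ) g, b (c • g) = star c • b g
  anti : ∀ f g, b f * b g + b g * b f = 0
  anti_star : ∀ f g, b f * star (b g) + star (b g) * b f = (inner ℂ f g : ℂ) • 1

namespace IsCAR

variable {b : K → H →L[ℂ] H}

theorem neg (h : IsCAR b) (g : K) : b (-g) = -b g := by
  have := h.smul (-1) g
  simpa using this

theorem sub (h : IsCAR b) (f g : K) : b (f - g) = b f - b g := by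
  rw [sub_eq_add_neg, h.add, h.neg, sub_eq_add_neg]

theorem norm_le (h : IsCAR b) (g : K) : ‖b g‖ ≤ ‖g‖ := by
  refine ContinuousLinearMap.opNorm_le_bound _ (norm_nonneg _) fun ψ => ?_
  refine le_of_sq_le_sq ?_ (by positivity)
  have h1 := congrArg (fun T => inner ℂ ψ (T ψ)) (h.anti_star g g)
  simp only [_root_.add_apply, _root_.smul_apply, mul_apply_eq_comp, inner_add_right,
    ContinuousLinearMap.star_eq_adjoint, ContinuousLinearMap.adjoint_inner_right,
    one_apply_eq_self, inner_smul_right] at h1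
  rw [← ContinuousLinearMap.adjoint_inner_left, inner_self_eq_norm_sq_to_K,
    inner_self_eq_norm_sq_to_K, inner_self_eq_norm_sq_to_K, inner_self_eq_norm_sq_to_K] at h1
  have h2 : ‖ContinuousLinearMap.adjoint (b g) ψ‖ ^ 2 + ‖b g ψ‖ ^ 2 = ‖g‖ ^ 2 * ‖ψ‖ ^ 2 := by
    exact_mod_cast h1
  nlinarith [sq_nonneg ‖ContinuousLinearMap.adjoint (b g) ψ‖]

theorem continuous (h : IsCAR b) : Continuous b := by
  refine continuous_iff_continuousAt.2 fun g => ?_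
  rw [ContinuousAt, tendsto_iff_norm_sub_tendsto_zero]
  refine squeeze_zero (fun _ => norm_nonneg _) (fun f => ?_)
    (tendsto_iff_norm_sub_tendsto_zero.1 (tendsto_id (x := 𝓝 g)))
  rw [← h.sub]
  exact h.norm_le _

end IsCAR

/-- Labels of the creation operators: a frequency sign and a wave function. -/
abbrev Mode : Type := Bool × K

/-- The creation operators `b(g₊)^*` and `b(g₋)`. -/
def cr (b : K → H →L[ℂ] H) (i : Mode) : H →L[ℂ] H :=
  if i.1 then star (b (freqProj true i.2)) else b (freqProj false i.2)

/-- The anticommutators of annihilation and creation operators. -/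
def modeForm (i j : Mode) : ℂ :=
  if i.1 = j.1 then
    if i.1 then inner ℂ (freqProj true i.2) (freqProj true j.2)
    else inner ℂ (freqProj false j.2) (freqProj false i.2)
  else 0

/-- Products of creation operators. -/
def crWord (b : K → H →L[ℂ] H) (w : List Mode) : H →L[ℂ] H := (w.map (cr b)).prod

@[simp] theorem crWord_nil (b : K → H →L[ℂ] H) : crWord b [] = 1 := rfl

@[simp] theorem crWord_cons (b : K → H →L[ℂ] H) (i : Mode) (w : List Mode) :
    crWord b (i :: w) = cr b i * crWord b w := by simp [crWord]

@[simp] theorem crWord_append (b : K → H →L[ℂ] H) (w w' : List Mode) :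
    crWord b (w ++ w') = crWord b w * crWord b w' := by simp [crWord]

/-- Vectors annihilated by all annihilation operators. -/
def IsVac (b : K → H →L[ℂ] H) (φ : H) : Prop := ∀ i, star (cr b i) φ = 0

variable {b : K → H →L[ℂ] H}

theorem isVac_iff {φ : H} : IsVac b φ ↔
    (∀ g, b (freqProj true g) φ = 0) ∧ ∀ g, star (b (freqProj false g)) φ = 0 := by
  refine ⟨fun h => ⟨fun g => ?_, fun g => ?_⟩, fun h i => ?_⟩
  · simpa [cr] using h (true, g)
  · simpa [cr] using h (false, g)
  · rcases i with ⟨σ, g⟩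
    cases σ
    · simpa [cr] using h.2 g
    · simpa [cr] using h.1 g

theorem IsCAR.cr_anti (h : IsCAR b) (i j : Mode) :
    star (cr b i) * cr b j + cr b j * star (cr b i) = modeForm i j • 1 := by
  rcases i with ⟨σ, f⟩
  rcases j with ⟨τ, g⟩
  cases σ <;> cases τ
  · have := h.anti_star (freqProj false g) (freqProj false f)
    simp only [cr, modeForm, Bool.false_eq_true, if_false, if_true]
    rw [← this, add_comm]
  · have := congrArg star (h.anti (freqProj true g) (freqProj false f))
    simp only [star_add, star_mul, star_zero] at this
    simpa [cr, modeForm] using this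
  · simpa [cr, modeForm] using h.anti (freqProj true f) (freqProj false g)
  · simpa [cr, modeForm] using h.anti_star (freqProj true f) (freqProj true g)

theorem IsCAR.eq_cr (h : IsCAR b) (g : K) : b g = star (cr b (true, g)) + cr b (false, g) := by
  simp only [cr, if_true, Bool.false_eq_true, if_false, star_star]
  rw [← h.add, show freqProj true g + freqProj false g = g from freqProj_add true g]

theorem IsCAR.continuous_cr (h : IsCAR b) (σ : Bool) : Continuous fun g => cr b (σ, g) := by
  cases σ
  · simp only [cr, Bool.false_eq_true, if_false]
    exact h.continuous.comp (by fun_prop)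
  · simp only [cr, if_true]
    exact (h.continuous.comp (by fun_prop)).star

/-- Moving an annihilation operator through a product of creation operators. -/
theorem IsCAR.ann_cr_apply (h : IsCAR b) (i j : Mode) (ψ : H) :
    star (cr b i) (cr b j ψ) = modeForm i j • ψ - cr b j (star (cr b i) ψ) := by
  have := congrArg (fun T => T ψ) (h.cr_anti i j)
  simp only [_root_.add_apply, _root_.smul_apply, mul_apply_eq_comp,
    one_apply_eq_self] at this
  rw [← this]; abel

theorem gram_eq {H' : Type*} [NormedAddCommGroup H'] [InnerProductSpace ℂ H'] [CompleteSpace H']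
    {b' : K → H' →L[ℂ] H'} (h : IsCAR b) (h' : IsCAR b') (ρ : Mode → Mode)
    (hρ : ∀ i j, modeForm (ρ i) (ρ j) = modeForm i j) {φ χ : H} {φ' χ' : H'}
    (hφ : IsVac b φ) (hχ : IsVac b χ) (hφ' : IsVac b' φ') (hχ' : IsVac b' χ')
    (hin : inner ℂ φ χ = inner ℂ φ' χ') (w : List Mode) : ∀ u,
    inner ℂ (crWord b w φ) (crWord b u χ)
      = inner ℂ (crWord b' (w.map ρ) φ') (crWord b' (u.map ρ) χ') := by
  induction w with
  | nil =>
    intro u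
    cases u with
    | nil => simpa using hin
    | cons j u =>
      have e1 : inner ℂ φ (cr b j (crWord b u χ)) = 0 := by
        rw [← ContinuousLinearMap.adjoint_inner_left]
        have := hφ j
        rw [ContinuousLinearMap.star_eq_adjoint] at this
        rw [this, inner_zero_left]
      have e2 : inner ℂ φ' (cr b' (ρ j) (crWord b' (u.map ρ) χ')) = 0 := by
        rw [← ContinuousLinearMap.adjoint_inner_left]
        have := hφ' (ρ j)
        rw [ContinuousLinearMap.star_eq_adjoint] at this
        rw [this, inner_zero_left]
      simp [e1, e2]
  | cons i w ih =>
    intro u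
    have key : ∀ u t, inner ℂ (crWord b w φ) (crWord b t (star (cr b i) (crWord b u χ)))
        = inner ℂ (crWord b' (w.map ρ) φ')
          (crWord b' (t.map ρ) (star (cr b' (ρ i)) (crWord b' (u.map ρ) χ'))) := by
      intro u
      induction u with
      | nil => intro t; simp [hχ i, hχ' (ρ i)]
      | cons j u ih2 =>
        intro t
        have e1 := ih2 (t ++ [j])
        have e2 := ih (t ++ u)
        simp only [List.map_cons, List.map_nil, List.map_append, crWord_cons, crWord_append,
          mul_apply_eq_comp, crWord_nil, one_apply_eq_self] at e1 e2 ⊢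
        rw [h.ann_cr_apply, h'.ann_cr_apply, map_sub, map_sub, inner_sub_right, inner_sub_right,
          e1, map_smul, map_smul, inner_smul_right, inner_smul_right, e2, hρ]
    have := key u []
    simp only [List.map_nil, crWord_nil, one_apply_eq_self,
      ContinuousLinearMap.star_eq_adjoint, ContinuousLinearMap.adjoint_inner_right] at this
    simpa using this

theorem ann_mem_span (h : IsCAR b) {X : Type*} {φ : X → H} (hφ : ∀ x, IsVac b (φ x)) (i : Mode)
    {ψ : H} (hψ : ψ ∈ Submodule.span ℂ (Set.range fun p : List Mode × X => crWord b p.1 (φ p.2))) :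
    star (cr b i) ψ ∈ Submodule.span ℂ (Set.range fun p : List Mode × X => crWord b p.1 (φ p.2)) ∧
    cr b i ψ ∈ Submodule.span ℂ (Set.range fun p : List Mode × X => crWord b p.1 (φ p.2)) := by
  set M := Submodule.span ℂ (Set.range fun p : List Mode × X => crWord b p.1 (φ p.2)) with hM
  have hcr : ∀ j, ∀ ψ ∈ M, cr b j ψ ∈ M := by
    intro j ψ hψ
    induction hψ using Submodule.span_induction with
    | mem ψ hψ =>
      obtain ⟨⟨w, x⟩, rfl⟩ := hψ
      exact Submodule.subset_span ⟨(j :: w, x), by simp⟩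
    | zero => rw [_root_.map_zero]; exact M.zero_mem
    | add a b _ _ ha hb => rw [_root_.map_add]; exact M.add_mem ha hb
    | smul c a _ ha => rw [map_smul]; exact M.smul_mem c ha
  refine ⟨?_, hcr i ψ hψ⟩
  induction hψ using Submodule.span_induction with
  | mem ψ hψ =>
    obtain ⟨⟨w, x⟩, rfl⟩ := hψ
    dsimp only
    induction w with
    | nil => simp [hφ x i]
    | cons j w ih =>
      rw [crWord_cons, mul_apply_eq_comp, h.ann_cr_apply]
      exact M.sub_mem (M.smul_mem _ (Submodule.subset_span ⟨(w, x), rfl⟩)) (hcr j _ ih)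
  | zero => rw [_root_.map_zero]; exact M.zero_mem
  | add a b _ _ ha hb => rw [_root_.map_add]; exact M.add_mem ha hb
  | smul c a _ ha => rw [map_smul]; exact M.smul_mem c ha

theorem field_mem_span (h : IsCAR b) {X : Type*} {φ : X → H} (hφ : ∀ x, IsVac b (φ x)) (g : K)
    {ψ : H} (hψ : ψ ∈ Submodule.span ℂ (Set.range fun p : List Mode × X => crWord b p.1 (φ p.2))) :
    b g ψ ∈ Submodule.span ℂ (Set.range fun p : List Mode × X => crWord b p.1 (φ p.2)) ∧
    star (b g) ψ ∈ Submodule.span ℂ (Set.range fun p : List Mode × X => crWord b p.1 (φ p.2)) := by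
  rw [h.eq_cr, star_add, star_star]
  exact ⟨Submodule.add_mem _ (ann_mem_span h hφ _ hψ).1 (ann_mem_span h hφ _ hψ).2,
    Submodule.add_mem _ (ann_mem_span h hφ _ hψ).2 (ann_mem_span h hφ _ hψ).1⟩

end CAR

/-! ### Fock representations and second quantization -/

/-- A Fock representation of the anticommutation relations. -/
structure IsFock {H : Type*} [NormedAddCommGroup H] [InnerProductSpace ℂ H] [CompleteSpace H]
    (b : K → H →L[ℂ] H) (Ω : H) : Prop where
  car : IsCAR b
  vac : IsVac b Ω
  norm_vac : ‖Ω‖ = 1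
  total : Dense (Submodule.span ℂ (Set.range fun w => crWord b w Ω) : Set H)

/-- Bogoliubov transformations preserving the vacuum. -/
structure IsBog (Q : K →L[ℂ] K) : Prop where
  inner : ∀ f g, inner ℂ (Q f) (Q g) = inner ℂ f g
  comm : ∀ σ g, freqProj σ (Q g) = Q (freqProj σ g)
  surj : Function.Surjective Q

/-- Action on labels. -/
def modeMap (Q : K → K) (i : Mode) : Mode := (i.1, Q i.2)

theorem IsBog.modeForm {Q : K →L[ℂ] K} (hQ : IsBog Q) (i j : Mode) :
    modeForm (modeMap Q i) (modeMap Q j) = modeForm i j := by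
  simp only [AsymptoticQED.modeForm, modeMap, hQ.comm, hQ.inner]

theorem IsBog.comp {Q Q' : K →L[ℂ] K} (hQ : IsBog Q) (hQ' : IsBog Q') : IsBog (Q ∘L Q') where
  inner f g := by simp [hQ.inner, hQ'.inner]
  comm σ g := by simp [hQ.comm, hQ'.comm]
  surj := hQ.surj.comp hQ'.surj

namespace IsFock

variable {H : Type*} [NormedAddCommGroup H] [InnerProductSpace ℂ H] [CompleteSpace H]
  {b : K → H →L[ℂ] H} {Ω : H} {Q : K →L[ℂ] K}

theorem exists_implementer (h : IsFock b Ω) (hQ : IsBog Q) :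
    ∃ T : H →ₗᵢ[ℂ] H, ∀ w, T (crWord b w Ω) = crWord b (w.map (modeMap Q)) Ω :=
  exists_isometry_of_gram _ _ (fun w u => gram_eq h.car h.car (modeMap Q) hQ.modeForm h.vac h.vac
    h.vac h.vac rfl w u) h.total

/-- The second quantization of a Bogoliubov transformation preserving the vacuum. -/
def Γ (h : IsFock b Ω) (hQ : IsBog Q) : H →ₗᵢ[ℂ] H := (h.exists_implementer hQ).choose

theorem Γ_word (h : IsFock b Ω) (hQ : IsBog Q) (w : List Mode) :
    h.Γ hQ (crWord b w Ω) = crWord b (w.map (modeMap Q)) Ω :=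
  (h.exists_implementer hQ).choose_spec w

theorem Γ_vac (h : IsFock b Ω) (hQ : IsBog Q) : h.Γ hQ Ω = Ω := by simpa using h.Γ_word hQ []

theorem ext (h : IsFock b Ω) {E : Type*} [NormedAddCommGroup E] [NormedSpace ℂ E]
    {A B : H →L[ℂ] E} (hAB : ∀ w, A (crWord b w Ω) = B (crWord b w Ω)) (ψ : H) : A ψ = B ψ :=
  congrArg (fun T => T ψ) (clm_ext_of_total h.total hAB)

theorem Γ_comp (h : IsFock b Ω) (hQ : IsBog Q) {Q' Q'' : K →L[ℂ] K} (hQ' : IsBog Q')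
    (hQ'' : IsBog Q'') (e : ∀ g, Q (Q' g) = Q'' g) (ψ : H) :
    h.Γ hQ (h.Γ hQ' ψ) = h.Γ hQ'' ψ := by
  refine h.ext (A := (h.Γ hQ).toContinuousLinearMap ∘L (h.Γ hQ').toContinuousLinearMap)
    (B := (h.Γ hQ'').toContinuousLinearMap) (fun w => ?_) ψ
  show h.Γ hQ (h.Γ hQ' _) = h.Γ hQ'' _
  rw [Γ_word, Γ_word, Γ_word, List.map_map]
  congr 3
  funext i
  simp [modeMap, e]

theorem Γ_id (h : IsFock b Ω) (hQ : IsBog Q) (e : ∀ g, Q g = g) (ψ : H) : h.Γ hQ ψ = ψ := by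
  refine h.ext (A := (h.Γ hQ).toContinuousLinearMap) (B := .id ℂ H) (fun w => ?_) ψ
  show h.Γ hQ _ = crWord b w Ω
  rw [Γ_word]
  congr 2
  have : modeMap Q = _root_.id := funext fun i => by simp [modeMap, e]
  rw [this, List.map_id]

theorem Γ_surjective (h : IsFock b Ω) (hQ : IsBog Q) : Function.Surjective (h.Γ hQ) := by
  have h1 : IsClosed (Set.range (h.Γ hQ)) := (h.Γ hQ).isometry.isClosedEmbedding.isClosed_range
  have h2 : (Submodule.span ℂ (Set.range fun w => crWord b w Ω) : Set H)
      ⊆ Set.range (h.Γ hQ) := by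
    have : Submodule.span ℂ (Set.range fun w => crWord b w Ω)
        ≤ LinearMap.range (h.Γ hQ).toLinearMap := by
      rw [Submodule.span_le]
      rintro _ ⟨w, rfl⟩
      refine ⟨crWord b (w.map (modeMap (Function.surjInv hQ.surj))) Ω, ?_⟩
      show h.Γ hQ _ = _
      rw [Γ_word, List.map_map]
      have : modeMap Q ∘ modeMap (Function.surjInv hQ.surj) = _root_.id := funext fun i => by
        simp [modeMap, Function.surjInv_eq hQ.surj]
      rw [this, List.map_id]
    exact this
  rw [← Set.range_eq_univ, ← h1.closure_eq]
  exact (h.total.mono h2).closure_eq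

theorem Γ_cr (h : IsFock b Ω) (hQ : IsBog Q) (i : Mode) (ψ : H) :
    h.Γ hQ (cr b i ψ) = cr b (modeMap Q i) (h.Γ hQ ψ) := by
  refine h.ext (A := (h.Γ hQ).toContinuousLinearMap ∘L cr b i)
    (B := cr b (modeMap Q i) ∘L (h.Γ hQ).toContinuousLinearMap) (fun w => ?_) ψ
  have := h.Γ_word hQ (i :: w)
  show h.Γ hQ (cr b i _) = cr b _ (h.Γ hQ _)
  rw [Γ_word]
  simpa using this

theorem Γ_ann (h : IsFock b Ω) (hQ : IsBog Q) (i : Mode) (ψ : H) :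
    h.Γ hQ (star (cr b i) ψ) = star (cr b (modeMap Q i)) (h.Γ hQ ψ) := by
  refine ext_inner_left ℂ fun v => ?_
  obtain ⟨u, rfl⟩ := h.Γ_surjective hQ v
  rw [LinearIsometry.inner_map_map, ContinuousLinearMap.star_eq_adjoint,
    ContinuousLinearMap.star_eq_adjoint, ContinuousLinearMap.adjoint_inner_right,
    ContinuousLinearMap.adjoint_inner_right, ← Γ_cr, LinearIsometry.inner_map_map]

theorem Γ_field (h : IsFock b Ω) (hQ : IsBog Q) (g : K) (ψ : H) :
    h.Γ hQ (b g ψ) = b (Q g) (h.Γ hQ ψ) := by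
  rw [h.car.eq_cr g, h.car.eq_cr (Q g)]
  simp only [_root_.add_apply, _root_.map_add, Γ_cr, Γ_ann]
  rfl

theorem continuous_Γ (h : IsFock b Ω) {X : Type*} [TopologicalSpace X] [FirstCountableTopology X]
    {Q : X → K →L[ℂ] K} (hQ : ∀ x, IsBog (Q x)) (hc : ∀ g, Continuous fun x => Q x g) (ψ : H) :
    Continuous fun x => h.Γ (hQ x) ψ := by
  have hw : ∀ w : List Mode, Continuous fun x => crWord b (w.map (modeMap (Q x))) := by
    intro w
    induction w with
    | nil => simpa using continuous_const
    | cons i w ih =>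
      simp only [List.map_cons, crWord_cons]
      exact ((h.car.continuous_cr i.1).comp (hc i.2)).mul ih
  refine continuous_iff_continuousAt.2 fun x => ?_
  refine tendsto_of_dense_of_bounded (C := 1) (T := fun x => (h.Γ (hQ x)).toContinuousLinearMap)
    (T' := (h.Γ (hQ x)).toContinuousLinearMap) (fun x ψ => ?_) h.total ?_ ψ
  · rw [one_mul]; exact ((h.Γ (hQ x)).norm_map ψ).le
  · intro ψ hψ
    induction hψ using Submodule.span_induction with
    | mem ψ hψ =>
      obtain ⟨w, rfl⟩ := hψ
      show Tendsto (fun x => h.Γ (hQ x) (crWord b w Ω)) _ (𝓝 (h.Γ (hQ x) (crWord b w Ω)))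
      simp only [Γ_word]
      exact ((hw w).clm_apply continuous_const).tendsto x
    | zero => simp
    | add a b _ _ ha hb => simpa using ha.add hb
    | smul c a _ ha => simpa using ha.const_smul c

end IsFock

set_option linter.unusedSectionVars false

/-! ## Operators on the Hilbert space tensor product -/

section Tensor

variable {HF : Type v} [NormedAddCommGroup HF] [InnerProductSpace ℂ HF] [CompleteSpace HF]
  {Hr : Type u} [NormedAddCommGroup Hr] [InnerProductSpace ℂ Hr] [CompleteSpace Hr]

theorem inner_htmul (ψ ψ' : HF) (φ φ' : Hr) :
    inner ℂ (htmul ψ φ) (htmul ψ' φ') = inner ℂ ψ ψ' * inner ℂ φ φ' := by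
  unfold htmul
  rw [UniformSpace.Completion.inner_coe, TensorProduct.inner_tmul]

theorem norm_htmul (ψ : HF) (φ : Hr) : ‖htmul ψ φ‖ = ‖ψ‖ * ‖φ‖ := by
  unfold htmul
  rw [UniformSpace.Completion.norm_coe, TensorProduct.norm_tmul]

variable (HF Hr) in
/-- Elementary tensors as a bilinear map. -/
def htmulL : HF →ₗ[ℂ] Hr →ₗ[ℂ] HTensor HF Hr :=
  (TensorProduct.mk ℂ HF Hr).compr₂
    (UniformSpace.Completion.toComplL (𝕜 := ℂ) (E := HF ⊗[ℂ] Hr)).toLinearMap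

theorem htmulL_apply (ψ : HF) (φ : Hr) : htmulL HF Hr ψ φ = htmul ψ φ := rfl

theorem htmul_add_left (ψ ψ' : HF) (φ : Hr) : htmul (ψ + ψ') φ = htmul ψ φ + htmul ψ' φ := by
  exact LinearMap.map_add₂ (htmulL HF Hr) ψ ψ' φ

theorem htmul_sub_left (ψ ψ' : HF) (φ : Hr) : htmul (ψ - ψ') φ = htmul ψ φ - htmul ψ' φ := by
  exact LinearMap.map_sub₂ (htmulL HF Hr) ψ ψ' φ

theorem htmul_smul_left (c : ℂ) (ψ : HF) (φ : Hr) : htmul (c • ψ) φ = c • htmul ψ φ := by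
  exact LinearMap.map_smul₂ (htmulL HF Hr) c ψ φ

theorem htmul_zero_left (φ : Hr) : htmul (0 : HF) φ = 0 := by
  exact LinearMap.map_zero₂ (htmulL HF Hr) φ

theorem htmul_smul_right (c : ℂ) (ψ : HF) (φ : Hr) : htmul ψ (c • φ) = c • htmul ψ φ := by
  simp only [← htmulL_apply, map_smul]

theorem htmul_zero_right (ψ : HF) : htmul ψ (0 : Hr) = 0 := by
  simp only [← htmulL_apply, _root_.map_zero]

/-- `φ ↦ ψ ⊗ φ`. -/
def htmulR (Hr : Type u) [NormedAddCommGroup Hr] [InnerProductSpace ℂ Hr] [CompleteSpace Hr] (ψ : HF) :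
    Hr →L[ℂ] HTensor HF Hr :=
  (htmulL HF Hr ψ).mkContinuous ‖ψ‖ fun φ => (norm_htmul ψ φ).le

theorem htmulR_apply (ψ : HF) (φ : Hr) : htmulR Hr ψ φ = htmul ψ φ := rfl

/-- `ψ ↦ ψ ⊗ φ`. -/
def htmulLeft (HF : Type v) [NormedAddCommGroup HF] [InnerProductSpace ℂ HF] [CompleteSpace HF] (φ : Hr) :
    HF →L[ℂ] HTensor HF Hr :=
  ((htmulL HF Hr).flip φ).mkContinuous ‖φ‖ fun ψ =>
    ((norm_htmul ψ φ).trans (mul_comm _ _)).le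

theorem htmul_total : Dense (Submodule.span ℂ
    (Set.range fun p : HF × Hr => htmul p.1 p.2) : Set (HTensor HF Hr)) := by
  have h : ∀ z : HF ⊗[ℂ] Hr, (z : HTensor HF Hr) ∈ Submodule.span ℂ
      (Set.range fun p : HF × Hr => htmul p.1 p.2) := by
    intro z
    induction z with
    | zero => rw [UniformSpace.Completion.coe_zero]; exact Submodule.zero_mem _
    | tmul x y => exact Submodule.subset_span ⟨(x, y), rfl⟩
    | add x y hx hy => rw [UniformSpace.Completion.coe_add]; exact Submodule.add_mem _ hx hy
  refine (UniformSpace.Completion.denseRange_coe (α := HF ⊗[ℂ] Hr)).mono ?_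
  rintro _ ⟨z, rfl⟩
  exact h z

theorem htmul_total_of_total {X : Type*} {x : X → HF}
    (hx : Dense (Submodule.span ℂ (Set.range x) : Set HF)) :
    Dense (Submodule.span ℂ
      (Set.range fun p : X × Hr => htmul (x p.1) p.2) : Set (HTensor HF Hr)) := by
  refine total_of_orthogonal fun u hu => ?_
  refine eq_of_inner_total htmul_total fun p => ?_
  rw [inner_zero_right]
  have : (innerSL ℂ u) ∘L htmulLeft HF p.2 = 0 := by
    refine clm_ext_of_total hx fun i => ?_
    show inner ℂ u (htmul (x i) p.2) = 0
    rw [← inner_conj_symm, hu (i, p.2), _root_.map_zero]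
  have h2 := congrArg (fun T => T p.1) this
  have h3 : inner ℂ u (htmul p.1 p.2) = 0 := h2
  rw [← inner_conj_symm, h3, _root_.map_zero]

theorem tensor_ext {E : Type*} [NormedAddCommGroup E] [NormedSpace ℂ E]
    {A B : HTensor HF Hr →L[ℂ] E} (h : ∀ ψ φ, A (htmul ψ φ) = B (htmul ψ φ)) : A = B :=
  clm_ext_of_total htmul_total fun p => h p.1 p.2

theorem exists_tensor_isometry (A : HF →ₗᵢ[ℂ] HF) (B : Hr →ₗᵢ[ℂ] Hr) :
    ∃ T : HTensor HF Hr →ₗᵢ[ℂ] HTensor HF Hr, ∀ ψ φ, T (htmul ψ φ) = htmul (A ψ) (B φ) := by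
  obtain ⟨T, hT⟩ := exists_isometry_of_gram (fun p : HF × Hr => htmul p.1 p.2)
    (fun p : HF × Hr => htmul (A p.1) (B p.2))
    (fun p q => by simp [inner_htmul]) htmul_total
  exact ⟨T, fun ψ φ => hT (ψ, φ)⟩

/-- The tensor product of isometries. -/
def tensorIso (A : HF →ₗᵢ[ℂ] HF) (B : Hr →ₗᵢ[ℂ] Hr) : HTensor HF Hr →ₗᵢ[ℂ] HTensor HF Hr :=
  (exists_tensor_isometry A B).choose

theorem tensorIso_htmul (A : HF →ₗᵢ[ℂ] HF) (B : Hr →ₗᵢ[ℂ] Hr) (ψ : HF) (φ : Hr) :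
    tensorIso A B (htmul ψ φ) = htmul (A ψ) (B φ) :=
  (exists_tensor_isometry A B).choose_spec ψ φ

/-- The isometry given by an element `A` of a C*-algebra of operators with `A^* A = 1`. -/
def isoOf {H : Type*} [NormedAddCommGroup H] [InnerProductSpace ℂ H] [CompleteSpace H]
    (A : H →L[ℂ] H) (h : star A * A = 1) : H →ₗᵢ[ℂ] H :=
  ⟨A.toLinearMap, fun ψ => by
    have e : inner ℂ (A ψ) (A ψ) = inner ℂ ψ ψ := by
      rw [← ContinuousLinearMap.adjoint_inner_right, ← ContinuousLinearMap.star_eq_adjoint,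
        ← mul_apply_eq_comp, h, one_apply_eq_self]
    rw [inner_self_eq_norm_sq_to_K, inner_self_eq_norm_sq_to_K] at e
    have h2 : ‖A ψ‖ ^ 2 = ‖ψ‖ ^ 2 := by exact_mod_cast e
    exact (pow_left_inj₀ (norm_nonneg _) (norm_nonneg _) two_ne_zero).1 h2⟩

theorem exists_amp (A : HF →L[ℂ] HF) :
    ∃ T : HTensor HF Hr →L[ℂ] HTensor HF Hr, ∀ ψ φ, T (htmul ψ φ) = htmul (A ψ) φ := by
  have hA : A ∈ Submodule.span ℂ (unitary (HF →L[ℂ] HF) : Set (HF →L[ℂ] HF)) := by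
    rw [CStarAlgebra.span_unitary]; trivial
  induction hA using Submodule.span_induction with
  | mem A hA =>
    refine ⟨(tensorIso (isoOf A (Unitary.mem_iff.1 hA).1) .id).toContinuousLinearMap,
      fun ψ φ => tensorIso_htmul _ _ ψ φ⟩
  | zero => exact ⟨0, fun ψ φ => by simp [htmul_zero_left]⟩
  | add A A' _ _ h h' =>
    obtain ⟨T, hT⟩ := h
    obtain ⟨T', hT'⟩ := h'
    exact ⟨T + T', fun ψ φ => by simp [htmul_add_left, hT, hT']⟩
  | smul c A _ h =>
    obtain ⟨T, hT⟩ := h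
    exact ⟨c • T, fun ψ φ => by simp [htmul_smul_left, hT]⟩

/-- The operator `A ⊗ 1`. -/
def ampFun (Hr : Type u) [NormedAddCommGroup Hr] [InnerProductSpace ℂ Hr] [CompleteSpace Hr]
    (A : HF →L[ℂ] HF) : HTensor HF Hr →L[ℂ] HTensor HF Hr := (exists_amp A).choose

theorem ampFun_htmul (A : HF →L[ℂ] HF) (ψ : HF) (φ : Hr) :
    ampFun Hr A (htmul ψ φ) = htmul (A ψ) φ := (exists_amp A).choose_spec ψ φ

/-- The representation `A ↦ A ⊗ 1`. -/
def amp (Hr : Type u) [NormedAddCommGroup Hr] [InnerProductSpace ℂ Hr] [CompleteSpace Hr] :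
    (HF →L[ℂ] HF) →⋆ₐ[ℂ] (HTensor HF Hr →L[ℂ] HTensor HF Hr) where
  toFun := ampFun Hr
  map_one' := tensor_ext fun ψ φ => by simp [ampFun_htmul]
  map_zero' := tensor_ext fun ψ φ => by simp [ampFun_htmul, htmul_zero_left]
  map_add' A B := tensor_ext fun ψ φ => by simp [ampFun_htmul, htmul_add_left]
  map_mul' A B := tensor_ext fun ψ φ => by simp [ampFun_htmul]
  commutes' c := tensor_ext fun ψ φ => by
    simp [ampFun_htmul, Algebra.algebraMap_eq_smul_one, htmul_smul_left]
  map_star' A := tensor_ext fun ψ φ => by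
    refine eq_of_inner_total htmul_total fun p => ?_
    rw [ContinuousLinearMap.star_eq_adjoint, ContinuousLinearMap.star_eq_adjoint,
      ContinuousLinearMap.adjoint_inner_right, ampFun_htmul, ampFun_htmul, inner_htmul,
      inner_htmul, ContinuousLinearMap.adjoint_inner_right]

theorem amp_htmul (A : HF →L[ℂ] HF) (ψ : HF) (φ : Hr) :
    amp Hr A (htmul ψ φ) = htmul (A ψ) φ := ampFun_htmul A ψ φ

theorem IsCAR.map {H H' : Type*} [NormedAddCommGroup H] [InnerProductSpace ℂ H] [CompleteSpace H]
    [NormedAddCommGroup H'] [InnerProductSpace ℂ H'] [CompleteSpace H'] {b : K → H →L[ℂ] H}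
    (h : IsCAR b) (π : (H →L[ℂ] H) →⋆ₐ[ℂ] (H' →L[ℂ] H')) : IsCAR fun g => π (b g) where
  add f g := by rw [h.add, _root_.map_add]
  smul c g := by rw [h.smul, map_smul]
  anti f g := by rw [← map_mul, ← map_mul, ← _root_.map_add, h.anti, _root_.map_zero]
  anti_star f g := by
    rw [← map_star, ← map_mul, ← map_mul, ← _root_.map_add, h.anti_star, map_smul, map_one]

theorem cr_map {H H' : Type*} [NormedAddCommGroup H] [InnerProductSpace ℂ H] [CompleteSpace H]
    [NormedAddCommGroup H'] [InnerProductSpace ℂ H'] [CompleteSpace H'] (b : K → H →L[ℂ] H)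
    (π : (H →L[ℂ] H) →⋆ₐ[ℂ] (H' →L[ℂ] H')) (i : Mode) :
    cr (fun g => π (b g)) i = π (cr b i) := by
  unfold cr
  split_ifs
  · rw [map_star]
  · rfl

theorem crWord_map {H H' : Type*} [NormedAddCommGroup H] [InnerProductSpace ℂ H] [CompleteSpace H]
    [NormedAddCommGroup H'] [InnerProductSpace ℂ H'] [CompleteSpace H'] (b : K → H →L[ℂ] H)
    (π : (H →L[ℂ] H) →⋆ₐ[ℂ] (H' →L[ℂ] H')) (w : List Mode) :
    crWord (fun g => π (b g)) w = π (crWord b w) := by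
  induction w with
  | nil => simp
  | cons i w ih => rw [crWord_cons, crWord_cons, map_mul, ih, cr_map]

theorem IsFock.total_tensor {b : K → HF →L[ℂ] HF} {Ω : HF} (h : IsFock b Ω) :
    Dense (Submodule.span ℂ (Set.range fun p : List Mode × Hr =>
      crWord (fun g => amp Hr (b g)) p.1 (htmul Ω p.2)) : Set (HTensor HF Hr)) := by
  have e : (fun p : List Mode × Hr => crWord (fun g => amp Hr (b g)) p.1 (htmul Ω p.2))
      = fun p => htmul (crWord b p.1 Ω) p.2 := by
    funext p
    rw [crWord_map, amp_htmul]
  rw [e]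
  exact htmul_total_of_total (x := fun w => crWord b w Ω) h.total

theorem IsFock.vac_tensor {b : K → HF →L[ℂ] HF} {Ω : HF} (h : IsFock b Ω) (φ : Hr) :
    IsVac (fun g => amp Hr (b g)) (htmul Ω φ) := by
  intro i
  rw [cr_map, ← map_star, amp_htmul, h.vac i, htmul_zero_left]

/-- Vacuum vectors in the tensor product. -/
theorem IsFock.eq_of_vac_tensor {b : K → HF →L[ℂ] HF} {Ω : HF} (h : IsFock b Ω)
    {ξ : HTensor HF Hr} (hξ : IsVac (fun g => amp Hr (b g)) ξ) : ∃ φ : Hr, ξ = htmul Ω φ := by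
  refine ⟨ContinuousLinearMap.adjoint (htmulR Hr Ω) ξ, ?_⟩
  refine eq_of_inner_total h.total_tensor fun p => ?_
  rcases p with ⟨w, φ⟩
  cases w with
  | nil =>
    simp only [crWord_nil, one_apply_eq_self]
    rw [inner_htmul, ContinuousLinearMap.adjoint_inner_right, htmulR_apply,
      inner_self_eq_norm_sq_to_K, h.norm_vac]
    simp
  | cons i w =>
    have hv := h.vac_tensor (ContinuousLinearMap.adjoint (htmulR Hr Ω) ξ) i
    have hx := hξ i
    rw [ContinuousLinearMap.star_eq_adjoint] at hv hx
    simp only [crWord_cons, mul_apply_eq_comp]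
    refine Eq.trans (b := 0) ?_ (Eq.symm ?_)
    · rw [← ContinuousLinearMap.adjoint_inner_right, hx, inner_zero_right]
    · rw [← ContinuousLinearMap.adjoint_inner_right, hv, inner_zero_right]

end Tensor

/-! ## Lorentz invariance of integrals over null directions -/

/-- The spherical angle measure. -/
abbrev sphereMeasure : Measure (Metric.sphere (0 : E3) 1) := (volume : Measure E3).toSphere

/-- The null vector with a given spatial part. -/
def lightVec (x : E3) : Spacetime := ![‖x‖, x 0, x 1, x 2]

/-- The spatial part of a vector. -/
def spatial (y : Spacetime) : E3 := !₂[y 1, y 2, y 3]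

theorem continuous_lightVec : Continuous lightVec := by
  refine continuous_pi fun i => ?_
  fin_cases i <;> simp [lightVec] <;> fun_prop

theorem continuous_spatial : Continuous spatial := by
  unfold spatial
  fun_prop

theorem E3_norm_sq (x : E3) : ‖x‖ ^ 2 = x 0 ^ 2 + x 1 ^ 2 + x 2 ^ 2 := by
  rw [EuclideanSpace.norm_sq_eq, Fin.sum_univ_three]
  simp only [Real.norm_eq_abs, sq_abs]

theorem lightVec_null (x : E3) : mdot (lightVec x) (lightVec x) = 0 := by
  have := E3_norm_sq x
  simp [mdot, lightVec]
  linarith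

theorem lightVec_spatial {y : Spacetime} (h : mdot y y = 0) (h0 : 0 ≤ y 0) :
    lightVec (spatial y) = y := by
  have h1 : ‖spatial y‖ = y 0 := by
    rw [← sq_eq_sq₀ (norm_nonneg _) h0, E3_norm_sq]
    simp [spatial]
    unfold mdot at h
    linarith
  ext i
  fin_cases i <;> simp [lightVec, h1] <;> simp [spatial]

theorem spatial_lightVec (x : E3) : spatial (lightVec x) = x := by
  ext i
  fin_cases i <;> simp [lightVec, spatial]

theorem lightVec_smul (n : Metric.sphere (0 : E3) 1) {r : ℝ} (hr : 0 < r) :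
    lightVec (r • n.1) = r • (nullOf n).1 := by
  have h : ‖n.1‖ = 1 := by simp
  ext i
  fin_cases i <;> simp [lightVec, nullOf, norm_smul, abs_of_pos hr]

theorem lintegral_polar {f : E3 → ENNReal} (hf : Measurable f) :
    ∫⁻ x, f x = ∫⁻ n, (∫⁻ r in Set.Ioi (0 : ℝ), ENNReal.ofReal (r ^ 2) * f (r • n.1))
      ∂sphereMeasure := by
  have h0 := (volume : Measure E3).measurePreserving_homeomorphUnitSphereProd
  have hs : ∫⁻ x, f x = ∫⁻ x : ({0}ᶜ : Set E3), f x.1 ∂((volume : Measure E3).comap (↑)) := by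
    rw [lintegral_subtype_comap (measurableSet_singleton _).compl, restrict_compl_singleton]
  have hg : Measurable fun p : Metric.sphere (0 : E3) 1 × Set.Ioi (0 : ℝ) => f (p.2.1 • p.1.1) := by
    refine hf.comp ?_
    fun_prop
  have h1 := h0.lintegral_comp hg
  have h2 : ∀ x : ({0}ᶜ : Set E3), f ((homeomorphUnitSphereProd E3 x).2.1 •
      (homeomorphUnitSphereProd E3 x).1.1) = f x.1 := by
    intro x
    congr 1
    have : ‖x.1‖ ≠ 0 := norm_ne_zero_iff.2 x.2
    simp [smul_smul, this]
  simp only [h2] at h1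
  rw [hs, h1, lintegral_prod _ hg.aemeasurable]
  refine lintegral_congr fun n => ?_
  have hd : Module.finrank ℝ E3 - 1 = 2 := by simp
  rw [hd, Measure.volumeIoiPow, lintegral_withDensity_eq_lintegral_mul _ (by fun_prop)
    (by fun_prop), ← lintegral_subtype_comap measurableSet_Ioi]
  rfl

/-- Homogeneity of degree `-2`, for functions on spacetime with values in `[0, ∞]`. -/
def HomogNegTwo (G : Spacetime → ENNReal) : Prop :=
  ∀ r : ℝ, 0 < r → ∀ x, G (r • x) = ENNReal.ofReal (r ^ 2)⁻¹ * G x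

theorem mdot_smul_right (x y : Spacetime) (r : ℝ) : mdot x (r • y) = r * mdot x y := by
  simp [mdot]; ring

theorem mdot_add_right (x y z : Spacetime) : mdot x (y + z) = mdot x y + mdot x z := by
  simp [mdot]; ring

theorem mdot_sub_right (x y z : Spacetime) : mdot x (y - z) = mdot x y - mdot x z := by
  simp [mdot]; ring

theorem mdot_smul_left (x y : Spacetime) (r : ℝ) : mdot (r • x) y = r * mdot x y := by
  simp [mdot]; ring

theorem mdot_add_left (x y z : Spacetime) : mdot (x + y) z = mdot x z + mdot y z := by
  simp [mdot]; ring

theorem mdot_sub_left (x y z : Spacetime) : mdot (x - y) z = mdot x z - mdot y z := by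
  simp [mdot]; ring

theorem mdot_hyp_null_pos (v : Hyp) (l : NullVec) : 0 < mdot v.1 l.1 := by
  obtain ⟨v, h1, h0⟩ := v
  obtain ⟨l, h2, h3⟩ := l
  show 0 < mdot v l
  simp only [mdot] at *
  have a : (v 1 * l 1 + v 2 * l 2 + v 3 * l 3) ^ 2
      ≤ (v 1 ^ 2 + v 2 ^ 2 + v 3 ^ 2) * (l 1 ^ 2 + l 2 ^ 2 + l 3 ^ 2) := by
    nlinarith [sq_nonneg (v 1 * l 2 - v 2 * l 1), sq_nonneg (v 1 * l 3 - v 3 * l 1),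
      sq_nonneg (v 2 * l 3 - v 3 * l 2)]
  have b : l 1 ^ 2 + l 2 ^ 2 + l 3 ^ 2 = l 0 ^ 2 := by linarith
  have c : v 1 ^ 2 + v 2 ^ 2 + v 3 ^ 2 = v 0 ^ 2 - 1 := by linarith
  rw [b, c] at a
  have d : (v 1 * l 1 + v 2 * l 2 + v 3 * l 3) ^ 2 < (v 0 * l 0) ^ 2 := by nlinarith [pow_pos h3 2]
  have := abs_lt_of_sq_lt_sq d (by positivity)
  have := (abs_lt.1 this).2
  linarith

theorem lintegral_exp_weight {a : ℝ} (ha : 0 < a) :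
    ∫⁻ r in Set.Ioi (0 : ℝ), ENNReal.ofReal (a * Real.exp (-(a * r))) = 1 := by
  have h1 : IntegrableOn (fun r => a * Real.exp (-a * r)) (Set.Ioi 0) :=
    (integrableOn_exp_mul_Ioi (neg_lt_zero.2 ha) 0).const_mul a
  have h2 : ∫ r in Set.Ioi (0 : ℝ), a * Real.exp (-a * r) = 1 := by
    rw [integral_const_mul, integral_exp_mul_Ioi (neg_lt_zero.2 ha)]
    simp [ha.ne']
  have h3 := ofReal_integral_eq_lintegral_ofReal h1 (ae_of_all _ fun r => by positivity)
  rw [h2, ENNReal.ofReal_one] at h3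
  rw [h3]
  simp

theorem lintegral_cone {G : Spacetime → ENNReal} (hG : Measurable G) (hh : HomogNegTwo G)
    (w : Hyp) : ∫⁻ x : E3, G (lightVec x) * ENNReal.ofReal
      (mdot w.1 (lightVec x) * Real.exp (-mdot w.1 (lightVec x)) / ‖x‖)
      = ∫⁻ n, G (nullOf n).1 ∂sphereMeasure := by
  have hl := continuous_lightVec.measurable
  have hw : Measurable fun x : Spacetime => mdot w.1 x := by unfold mdot; fun_prop
  rw [lintegral_polar (by fun_prop)]
  refine lintegral_congr fun n => ?_
  have h1 : ∀ r ∈ Set.Ioi (0 : ℝ), ENNReal.ofReal (r ^ 2) * (G (lightVec (r • n.1)) *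
      ENNReal.ofReal (mdot w.1 (lightVec (r • n.1)) * Real.exp (-mdot w.1 (lightVec (r • n.1)))
        / ‖r • n.1‖))
      = G (nullOf n).1 * ENNReal.ofReal (mdot w.1 (nullOf n).1
        * Real.exp (-(mdot w.1 (nullOf n).1 * r))) := by
    intro r hr
    have hr' : 0 < r := hr
    have hp := mdot_hyp_null_pos w (nullOf n)
    rw [lightVec_smul n hr', hh r hr', mdot_smul_right, norm_smul]
    have h : ‖n.1‖ = 1 := by simp
    rw [h, Real.norm_eq_abs, abs_of_pos hr', mul_one, mul_comm r (mdot _ _), ← mul_assoc,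
      ← mul_assoc, ← ENNReal.ofReal_mul (by positivity), mul_inv_cancel₀ (by positivity),
      ENNReal.ofReal_one, one_mul]
    congr 2
    field_simp
  rw [setLIntegral_congr_fun measurableSet_Ioi h1, lintegral_const_mul _ (by fun_prop), lintegral_exp_weight (mdot_hyp_null_pos w (nullOf n)), mul_one]

/-- The reflection `y ↦ y - 2 (y·V)/(V·V) V`. -/
def refl (V y : Spacetime) : Spacetime := y - (2 * mdot y V / mdot V V) • V

theorem mdot_refl {V : Spacetime} (hV : mdot V V < 0) (x y : Spacetime) :
    mdot (refl V x) (refl V y) = mdot x y := by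
  unfold refl
  simp only [mdot_sub_left, mdot_sub_right, mdot_smul_left, mdot_smul_right]
  have : mdot V V ≠ 0 := hV.ne
  field_simp
  rw [mdot_comm V y]
  ring

theorem refl_refl {V : Spacetime} (hV : mdot V V < 0) (y : Spacetime) :
    refl V (refl V y) = y := by
  have : mdot V V ≠ 0 := hV.ne
  unfold refl
  simp only [mdot_sub_left, mdot_smul_left]
  ext i
  simp
  field_simp
  ring

theorem refl_smul (V y : Spacetime) (r : ℝ) : refl V (r • y) = r • refl V y := by
  unfold refl
  rw [mdot_smul_left]
  ext i; simp; ring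

/-- The time axis. -/
def timeAxis : Hyp := ⟨Pi.single 0 1, by simp [mdot], by simp⟩

theorem mdot_timeAxis (x : Spacetime) : mdot timeAxis.1 x = x 0 := by simp [timeAxis, mdot]

theorem refl_hyp {V : Spacetime} (hV : mdot V V < 0) :
    mdot (refl V timeAxis.1) (refl V timeAxis.1) = 1 ∧ 0 < refl V timeAxis.1 0 := by
  refine ⟨by rw [mdot_refl hV]; exact timeAxis.2.1, ?_⟩
  unfold refl
  rw [mdot_timeAxis]
  simp [timeAxis]
  have : 2 * V 0 / mdot V V * V 0 ≤ 0 := by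
    rw [div_mul_eq_mul_div]
    exact div_nonpos_of_nonneg_of_nonpos (by nlinarith [sq_nonneg (V 0)]) hV.le
  linarith

theorem refl_zero_eq {V : Spacetime} (hV : mdot V V < 0) (y : Spacetime) :
    refl V y 0 = mdot (refl V timeAxis.1) y := by
  rw [← mdot_timeAxis (refl V y), ← mdot_refl hV, refl_refl hV]

theorem refl_null {V : Spacetime} (hV : mdot V V < 0) (l : NullVec) :
    mdot (refl V l.1) (refl V l.1) = 0 ∧ 0 < refl V l.1 0 := by
  refine ⟨by rw [mdot_refl hV]; exact l.2.1, ?_⟩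
  rw [refl_zero_eq hV]
  exact mdot_hyp_null_pos ⟨_, refl_hyp hV⟩ l

theorem lightVec_isNull {x : E3} (hx : x ≠ 0) :
    mdot (lightVec x) (lightVec x) = 0 ∧ 0 < lightVec x 0 :=
  ⟨lightVec_null x, by simpa [lightVec] using hx⟩

/-- The action of the reflection on spatial parts of null vectors. -/
def reflS (V : Spacetime) (x : E3) : E3 := spatial (refl V (lightVec x))

theorem lightVec_reflS {V : Spacetime} (hV : mdot V V < 0) {x : E3} (hx : x ≠ 0) :
    lightVec (reflS V x) = refl V (lightVec x) := by
  have := refl_null hV ⟨_, lightVec_isNull hx⟩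
  exact lightVec_spatial this.1 this.2.le

theorem reflS_ne {V : Spacetime} (hV : mdot V V < 0) {x : E3} (hx : x ≠ 0) : reflS V x ≠ 0 := by
  intro h
  have h1 := lightVec_reflS hV hx
  have h2 := (refl_null hV ⟨_, lightVec_isNull hx⟩).2
  rw [← h1, h] at h2
  simp [lightVec] at h2

theorem reflS_reflS {V : Spacetime} (hV : mdot V V < 0) {x : E3} (hx : x ≠ 0) :
    reflS V (reflS V x) = x := by
  rw [reflS, lightVec_reflS hV hx, refl_refl hV, spatial_lightVec]

/-- The derivative of the coefficient in the reflection. -/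
def reflD (V : Spacetime) (x : E3) : E3 →L[ℝ] ℝ :=
  (-(2 / mdot V V)) • ((V 0 * ‖x‖⁻¹) • innerSL ℝ x - innerSL ℝ (spatial V))

theorem reflS_eq (V : Spacetime) (x : E3) :
    reflS V x = x + (-(2 / mdot V V) * (V 0 * ‖x‖ - inner ℝ (spatial V) x)) • spatial V := by
  ext i
  fin_cases i <;> simp [reflS, spatial, refl, lightVec, mdot, PiLp.inner_apply, Fin.sum_univ_three]
    <;> ring

theorem hasFDerivAt_reflS (V : Spacetime) {x : E3} (hx : x ≠ 0) :
    HasFDerivAt (reflS V) (ContinuousLinearMap.id ℝ E3 + (reflD V x).smulRight (spatial V)) x := by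
  have h1 : HasFDerivAt (fun x : E3 => ‖x‖) (‖x‖⁻¹ • innerSL ℝ x) x := by
    have h := (hasStrictFDerivAt_norm_sq x).hasFDerivAt.sqrt
      (pow_ne_zero 2 (norm_ne_zero_iff.2 hx))
    simp only [Real.sqrt_sq (norm_nonneg _)] at h
    refine h.congr_fderiv ?_
    have h0 : ‖x‖ ≠ 0 := norm_ne_zero_iff.2 hx
    refine ContinuousLinearMap.ext fun y => ?_
    simp
    field_simp
  have h2 : HasFDerivAt (fun x : E3 => inner ℝ (spatial V) x) (innerSL ℝ (spatial V)) x :=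
    (innerSL ℝ (spatial V)).hasFDerivAt
  have h3 := ((h1.const_mul (V 0)).sub h2).const_mul (-(2 / mdot V V))
  have h4 := (hasFDerivAt_id x).add (h3.smul_const (spatial V))
  have : reflS V = fun x => x + (-(2 / mdot V V) * (V 0 * ‖x‖ - inner ℝ (spatial V) x)) • spatial V :=
    funext (reflS_eq V)
  rw [this]
  refine h4.congr_fderiv (ContinuousLinearMap.ext fun y => ?_)
  simp [reflD, mul_assoc]

theorem det_reflS {V : Spacetime} (hV : mdot V V < 0) {x : E3} (hx : x ≠ 0) :
    (ContinuousLinearMap.id ℝ E3 + (reflD V x).smulRight (spatial V)).det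
      = -(‖reflS V x‖ / ‖x‖) := by
  have h0 : ‖x‖ ≠ 0 := norm_ne_zero_iff.2 hx
  have h1 : ((ContinuousLinearMap.id ℝ E3 + (reflD V x).smulRight (spatial V) : E3 →L[ℝ] E3) :
      E3 →ₗ[ℝ] E3) = LinearMap.transvection (reflD V x).toLinearMap (spatial V) := by
    ext y; simp [LinearMap.transvection]
  rw [ContinuousLinearMap.det, h1, LinearMap.transvection.det]
  have h2 : ‖reflS V x‖ = refl V (lightVec x) 0 := by
    have := congrFun (lightVec_reflS hV hx) 0
    simpa [lightVec] using this
  rw [h2]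
  have hne : mdot V V ≠ 0 := hV.ne
  have h3 : inner ℝ (spatial V) (spatial V) = V 0 ^ 2 - mdot V V := by
    rw [real_inner_self_eq_norm_sq, E3_norm_sq]
    simp [spatial, mdot]; ring
  have h4 : mdot (lightVec x) V = V 0 * ‖x‖ - inner ℝ x (spatial V) := by
    simp [spatial, mdot, lightVec, PiLp.inner_apply, Fin.sum_univ_three]; ring
  have h5 : reflD V x (spatial V) = -(2 / mdot V V) * (V 0 * ‖x‖⁻¹ * inner ℝ x (spatial V)
      - inner ℝ (spatial V) (spatial V)) := by
    simp [reflD]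
  rw [ContinuousLinearMap.coe_coe, h5, h3]
  unfold refl
  rw [h4]
  simp [lightVec]
  field_simp
  ring

theorem lintegral_refl {V : Spacetime} (hV : mdot V V < 0) {G : Spacetime → ENNReal}
    (hG : Measurable G) (hh : HomogNegTwo G) :
    ∫⁻ n, G (refl V (nullOf n).1) ∂sphereMeasure = ∫⁻ n, G (nullOf n).1 ∂sphereMeasure := by
  have hr : Measurable (refl V) := by unfold refl mdot; fun_prop
  have e1 := lintegral_cone (hG.comp hr) (fun r hr x => by
    show G _ = _; rw [refl_smul, hh r hr]; rfl) ⟨_, refl_hyp hV⟩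
  simp only [Function.comp_apply] at e1
  rw [← e1, ← lintegral_cone hG hh timeAxis]
  rw [← lintegral_add_compl (μ := volume) _ (measurableSet_singleton (0 : E3)),
    ← lintegral_add_compl (μ := volume) (fun x => G (lightVec x) * _)
      (measurableSet_singleton (0 : E3))]
  simp only [Measure.restrict_singleton, measure_singleton, zero_smul, lintegral_zero_measure,
    zero_add]
  have him : reflS V '' ({0}ᶜ : Set E3) = {0}ᶜ := by
    ext y
    constructor
    · rintro ⟨x, hx, rfl⟩; exact reflS_ne hV hx
    · intro hy; exact ⟨reflS V y, reflS_ne hV hy, reflS_reflS hV hy⟩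
  conv_rhs => rw [← him]
  rw [lintegral_image_eq_lintegral_abs_det_fderiv_mul volume (measurableSet_singleton _).compl
    (fun x hx => (hasFDerivAt_reflS V hx).hasFDerivWithinAt) (fun x hx y hy h => by
      rw [← reflS_reflS hV hx, h, reflS_reflS hV hy])]
  refine setLIntegral_congr_fun (measurableSet_singleton _).compl fun x hx => ?_
  have hx' : x ≠ 0 := hx
  have h0 : 0 < ‖x‖ := norm_pos_iff.2 hx
  have h1 : 0 < ‖reflS V x‖ := norm_pos_iff.2 (reflS_ne hV hx)
  have h2 : ‖reflS V x‖ = refl V (lightVec x) 0 := by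
    have := congrFun (lightVec_reflS hV hx) 0
    simpa [lightVec] using this
  simp only [det_reflS hV hx', lightVec_reflS hV hx', mdot_timeAxis,
    ← refl_zero_eq hV]
  rw [mul_left_comm, ← ENNReal.ofReal_mul (abs_nonneg _), abs_neg, abs_of_pos (by positivity),
    ← h2]
  congr 2
  field_simp

theorem sphereMeasure_univ : sphereMeasure Set.univ = ENNReal.ofReal (4 * Real.pi) := by
  rw [Measure.toSphere_apply_univ, InnerProductSpace.volume_ball_of_dim_odd (k := 1) (by simp)]
  norm_num
  rw [← ENNReal.ofReal_ofNat, ← ENNReal.ofReal_ofNat, ← ENNReal.ofReal_mul (by norm_num),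
    ← ENNReal.ofReal_mul (by norm_num)]
  congr 1; ring

theorem measurable_mdot_right' (y : Spacetime) : Measurable fun x => mdot y x := by
  unfold mdot; fun_prop

theorem lintegral_inv_sq (v : Hyp) :
    ∫⁻ n, ENNReal.ofReal (mdot v.1 (nullOf n).1 ^ 2)⁻¹ ∂sphereMeasure
      = ENNReal.ofReal (4 * Real.pi) := by
  rw [← sphereMeasure_univ]
  by_cases hv : v = timeAxis
  · subst hv
    simp [mdot_timeAxis, nullOf]
  have h0 : 1 < v.1 0 := by
    by_contra! hc
    apply hv
    have h1 := v.2.1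
    have h2 := v.2.2
    unfold mdot at h1
    have h3 : v.1 1 ^ 2 + v.1 2 ^ 2 + v.1 3 ^ 2 ≤ 0 := by nlinarith
    have a1 : v.1 1 = 0 := by nlinarith [sq_nonneg (v.1 1), sq_nonneg (v.1 2), sq_nonneg (v.1 3)]
    have a2 : v.1 2 = 0 := by nlinarith [sq_nonneg (v.1 1), sq_nonneg (v.1 2), sq_nonneg (v.1 3)]
    have a3 : v.1 3 = 0 := by nlinarith [sq_nonneg (v.1 1), sq_nonneg (v.1 2), sq_nonneg (v.1 3)]
    have a0 : v.1 0 = 1 := by rw [a1, a2, a3] at h1; nlinarith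
    ext i
    fin_cases i <;> simp [timeAxis, a0, a1, a2, a3]
  have hVV : mdot (v.1 - timeAxis.1) (v.1 - timeAxis.1) = 2 * (1 - v.1 0) := by
    rw [mdot_sub_left, mdot_sub_right, mdot_sub_right, v.2.1, mdot_comm v.1, mdot_timeAxis,
      timeAxis.2.1]; ring
  have hV : mdot (v.1 - timeAxis.1) (v.1 - timeAxis.1) < 0 := by rw [hVV]; linarith
  have hr : refl (v.1 - timeAxis.1) v.1 = timeAxis.1 := by
    unfold refl
    rw [hVV, mdot_sub_right, v.2.1, mdot_comm v.1, mdot_timeAxis]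
    have : 2 * (1 - v.1 0) / (2 * (1 - v.1 0)) = 1 := div_self (by linarith)
    rw [this, one_smul]; abel
  have hm : Measurable fun l : Spacetime => ENNReal.ofReal (mdot v.1 l ^ 2)⁻¹ := by
    have := measurable_mdot_right' v.1
    fun_prop
  have hh : HomogNegTwo fun l : Spacetime => ENNReal.ofReal (mdot v.1 l ^ 2)⁻¹ := by
    intro r hr x
    dsimp only
    rw [mdot_smul_right, ← ENNReal.ofReal_mul (by positivity), mul_pow, mul_inv]
  rw [← lintegral_refl hV hm hh]
  have : ∀ n, mdot v.1 (refl (v.1 - timeAxis.1) (nullOf n).1) = 1 := by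
    intro n
    rw [← mdot_refl hV, refl_refl hV, hr, mdot_timeAxis]; simp [nullOf]
  simp [this]

theorem mdot_nullOf (n n' : Metric.sphere (0 : E3) 1) :
    mdot (nullOf n).1 (nullOf n').1 = ‖n.1 - n'.1‖ ^ 2 / 2 := by
  have h : ‖n.1‖ = 1 := by simp
  have h' : ‖n'.1‖ = 1 := by simp
  rw [norm_sub_sq_real, h, h']
  simp [mdot, nullOf, PiLp.inner_apply, Fin.sum_univ_three]
  ring

theorem mdot_nullOf_nonneg (n n' : Metric.sphere (0 : E3) 1) :
    0 ≤ mdot (nullOf n).1 (nullOf n').1 := by rw [mdot_nullOf]; positivity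

theorem integrable_axis : Integrable (Set.indicator (Metric.ball (0 : E3) 1)
    fun x : E3 => (Real.sqrt |x 1|)⁻¹ * (Real.sqrt |x 2|)⁻¹) := by
  have h1 : IntegrableOn (fun x : ℝ => (Real.sqrt |x|)⁻¹) (Metric.ball 0 1) := by
    refine (integrableOn_fun_norm_addHaar volume (f := fun y : ℝ => (Real.sqrt y)⁻¹)).2 ?_
    have h := intervalIntegral.intervalIntegrable_rpow' (a := 0) (b := 1) (r := -(1 / 2))
      (by norm_num)
    rw [intervalIntegrable_iff_integrableOn_Ioo_of_le zero_le_one] at h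
    refine h.congr_fun (fun y hy => ?_) measurableSet_Ioo
    have hy : 0 < y := hy.1
    simp only [Module.finrank_self, Nat.sub_self, pow_zero, one_smul]
    rw [Real.rpow_neg hy.le, Real.sqrt_eq_rpow]
  have h2 := (integrable_indicator_iff Metric.isOpen_ball.measurableSet).2 h1
  have h3 : Integrable (Set.indicator (Metric.ball (0 : ℝ) 1) fun _ => (1 : ℝ)) :=
    (integrable_indicator_iff Metric.isOpen_ball.measurableSet).2
      (integrableOn_const measure_ball_lt_top.ne)
  have h4 := Integrable.fintype_prod (μ := fun _ : Fin 3 => (volume : Measure ℝ))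
    (f := fun i => if i = 0 then Set.indicator (Metric.ball (0 : ℝ) 1) fun _ => (1 : ℝ) else
      Set.indicator (Metric.ball (0 : ℝ) 1) fun x : ℝ => (Real.sqrt |x|)⁻¹)
    (fun i => by split_ifs <;> assumption)
  have h5 := (PiLp.volume_preserving_ofLp (Fin 3)).integrable_comp_of_integrable h4
  refine h5.mono' ?_ (ae_of_all _ fun x => ?_)
  · refine Measurable.aestronglyMeasurable ?_
    refine Measurable.indicator ?_ Metric.isOpen_ball.measurableSet
    fun_prop
  · by_cases hx : x ∈ Metric.ball (0 : E3) 1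
    · have hi : ∀ i, x i ∈ Metric.ball (0 : ℝ) 1 := by
        intro i
        rw [mem_ball_zero_iff] at hx ⊢
        exact (PiLp.norm_apply_le x i).trans_lt hx
      rw [Set.indicator_of_mem hx]
      simp [Fin.prod_univ_three, Set.indicator_of_mem (hi _), abs_of_nonneg (Real.sqrt_nonneg _)]
    · rw [Set.indicator_of_notMem hx, norm_zero]
      refine Finset.prod_nonneg fun i _ => ?_
      split_ifs <;> exact Set.indicator_nonneg (fun y _ => by positivity) _

theorem lintegral_axis : ∫⁻ n : Metric.sphere (0 : E3) 1,
    ENNReal.ofReal ((Real.sqrt |n.1 1|)⁻¹ * (Real.sqrt |n.1 2|)⁻¹) ∂sphereMeasure < ⊤ := by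
  have h := integrable_axis.lintegral_lt_top
  have hm : Measurable fun x : E3 => ENNReal.ofReal (Set.indicator (Metric.ball (0 : E3) 1)
      (fun x : E3 => (Real.sqrt |x 1|)⁻¹ * (Real.sqrt |x 2|)⁻¹) x) := by
    refine ENNReal.measurable_ofReal.comp ?_
    refine Measurable.indicator ?_ Metric.isOpen_ball.measurableSet
    fun_prop
  rw [lintegral_polar hm] at h
  have e : ∀ n : Metric.sphere (0 : E3) 1, ∫⁻ r in Set.Ioi (0 : ℝ), ENNReal.ofReal (r ^ 2) *
      ENNReal.ofReal (Set.indicator (Metric.ball (0 : E3) 1)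
        (fun x : E3 => (Real.sqrt |x 1|)⁻¹ * (Real.sqrt |x 2|)⁻¹) (r • n.1))
      = ENNReal.ofReal ((Real.sqrt |n.1 1|)⁻¹ * (Real.sqrt |n.1 2|)⁻¹)
        * ENNReal.ofReal (1 / 2) := by
    intro n
    have hn : ‖n.1‖ = 1 := by simp
    have e1 : ∀ r ∈ Set.Ioi (0 : ℝ), ENNReal.ofReal (r ^ 2) *
      ENNReal.ofReal (Set.indicator (Metric.ball (0 : E3) 1)
        (fun x : E3 => (Real.sqrt |x 1|)⁻¹ * (Real.sqrt |x 2|)⁻¹) (r • n.1))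
        = Set.indicator (Set.Ioo (0 : ℝ) 1)
        (fun r => ENNReal.ofReal ((Real.sqrt |n.1 1|)⁻¹ * (Real.sqrt |n.1 2|)⁻¹)
          * ENNReal.ofReal r) r := by
      intro r hr
      have hr : 0 < r := hr
      by_cases h1 : r < 1
      · rw [Set.indicator_of_mem (by
          rw [mem_ball_zero_iff, norm_smul, hn, mul_one, Real.norm_eq_abs, abs_of_pos hr]
          exact h1), Set.indicator_of_mem (by exact ⟨hr, h1⟩),
          ← ENNReal.ofReal_mul (by positivity), ← ENNReal.ofReal_mul (by positivity)]
        congr 1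
        simp only [PiLp.smul_apply, smul_eq_mul, abs_mul, abs_of_pos hr, Real.sqrt_mul hr.le,
          mul_inv]
        have : Real.sqrt r * Real.sqrt r = r := Real.mul_self_sqrt hr.le
        have h2 : Real.sqrt r ≠ 0 := (Real.sqrt_pos.2 hr).ne'
        field_simp
        rw [pow_two, this]
      · rw [Set.indicator_of_notMem (by
          rw [mem_ball_zero_iff, norm_smul, hn, mul_one, Real.norm_eq_abs, abs_of_pos hr]
          exact h1), Set.indicator_of_notMem (fun hc => h1 hc.2)]
        simp
    rw [setLIntegral_congr_fun measurableSet_Ioi e1, setLIntegral_indicator measurableSet_Ioo,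
      Set.inter_eq_left.2 (fun r hr => hr.1), lintegral_const_mul _ (by fun_prop)]
    congr 1
    rw [← ofReal_integral_eq_lintegral_ofReal]
    · rw [← integral_Ioc_eq_integral_Ioo, ← intervalIntegral.integral_of_le zero_le_one]
      simp
    · exact (intervalIntegrable_iff_integrableOn_Ioo_of_le zero_le_one).1 (by simp)
    · filter_upwards [ae_restrict_mem measurableSet_Ioo] with r hr using hr.1.le
  simp only [e] at h
  rw [lintegral_mul_const' _ _ ENNReal.ofReal_ne_top] at h
  by_contra hc
  rw [not_lt, top_le_iff] at hc
  rw [hc, ENNReal.top_mul (by simp)] at h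
  exact lt_irrefl _ h

theorem sphereMeasure_submodule {p : Submodule ℝ E3} (hp : p ≠ ⊤) :
    sphereMeasure {n | n.1 ∈ p} = 0 := by
  have hc : IsClosed (p : Set E3) := p.closed_of_finiteDimensional
  have hm : MeasurableSet {n : Metric.sphere (0 : E3) 1 | n.1 ∈ p} :=
    (hc.preimage continuous_subtype_val).measurableSet
  rw [Measure.toSphere_apply' _ hm]
  refine mul_eq_zero_of_right _ (measure_mono_null ?_ (Measure.addHaar_submodule volume p hp))
  rintro _ ⟨r, -, _, ⟨n, hn, rfl⟩, rfl⟩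
  exact p.smul_mem r hn

theorem ae_coord_ne (i : Fin 3) : ∀ᵐ n : Metric.sphere (0 : E3) 1 ∂sphereMeasure, n.1 i ≠ 0 := by
  let p : Submodule ℝ E3 :=
    { carrier := {x | x i = 0}
      zero_mem' := rfl
      add_mem' := fun {x y} hx hy => by
        show x i + y i = 0
        rw [show x i = 0 from hx, show y i = 0 from hy, add_zero]
      smul_mem' := fun c x hx => by
        show c * x i = 0
        rw [show x i = 0 from hx, mul_zero] }
  have h := sphereMeasure_submodule (p := p) (fun h => by
      have : EuclideanSpace.single i (1 : ℝ) ∈ p := by rw [h]; trivial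
      have h2 : (EuclideanSpace.single i (1 : ℝ) : E3) i = 0 := this
      simp at h2)
  rw [ae_iff]
  simp only [ne_eq, not_not]
  exact h

theorem ae_ne (n' : Metric.sphere (0 : E3) 1) : ∀ᵐ n ∂sphereMeasure, n ≠ n' := by
  have h := sphereMeasure_submodule (p := Submodule.span ℝ {n'.1}) (fun h => by
    have h1 := finrank_span_singleton (K := ℝ) (v := n'.1) (fun h0 => by
      have : ‖n'.1‖ = 1 := by simp
      rw [h0, norm_zero] at this; exact zero_ne_one this)
    rw [h, finrank_top] at h1
    simp at h1)
  rw [ae_iff]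
  refine measure_mono_null ?_ h
  rintro n hn
  rw [not_not.1 hn]
  exact Submodule.mem_span_singleton_self _

/-- Uniform integrability of `(l·l')^{-1/2}`. -/
theorem exists_lintegral_inv_sqrt_le : ∃ C : ℝ, 0 ≤ C ∧ ∀ n' : Metric.sphere (0 : E3) 1,
    ∫⁻ n, ENNReal.ofReal (Real.sqrt (mdot (nullOf n').1 (nullOf n).1))⁻¹ ∂sphereMeasure
      ≤ ENNReal.ofReal C := by
  let e0 : Metric.sphere (0 : E3) 1 := ⟨EuclideanSpace.single 0 1, by simp⟩
  refine ⟨(∫⁻ n : Metric.sphere (0 : E3) 1, ENNReal.ofReal ((Real.sqrt |n.1 1|)⁻¹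
    * (Real.sqrt |n.1 2|)⁻¹) ∂sphereMeasure).toReal, ENNReal.toReal_nonneg, fun n' => ?_⟩
  rw [ENNReal.ofReal_toReal lintegral_axis.ne]
  have hb : ∫⁻ n, ENNReal.ofReal (Real.sqrt (mdot (nullOf e0).1 (nullOf n).1))⁻¹ ∂sphereMeasure
      ≤ ∫⁻ n : Metric.sphere (0 : E3) 1, ENNReal.ofReal ((Real.sqrt |n.1 1|)⁻¹
    * (Real.sqrt |n.1 2|)⁻¹) ∂sphereMeasure := by
    refine lintegral_mono_ae ?_
    filter_upwards [ae_coord_ne 1, ae_coord_ne 2] with n h1 h2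
    refine ENNReal.ofReal_le_ofReal ?_
    have h1' := abs_pos.2 h1
    have h2' := abs_pos.2 h2
    rw [← mul_inv, ← Real.sqrt_mul h1'.le]
    refine inv_anti₀ (Real.sqrt_pos.2 (mul_pos h1' h2')) (Real.sqrt_le_sqrt ?_)
    have hn : ‖n.1‖ = 1 := by simp
    have h3 := E3_norm_sq n.1
    rw [hn] at h3
    have h4 : mdot (nullOf e0).1 (nullOf n).1 = 1 - n.1 0 := by simp [mdot, nullOf, e0]
    rw [h4]
    have h5 : n.1 0 ≤ 1 := by nlinarith [sq_nonneg (n.1 1), sq_nonneg (n.1 2)]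
    nlinarith [sq_nonneg (|n.1 1| - |n.1 2|), sq_abs (n.1 1), sq_abs (n.1 2)]
  refine le_trans (le_of_eq ?_) hb
  by_cases hn : n' = e0
  · rw [hn]
  set V : Spacetime := (nullOf n').1 - (nullOf e0).1 with hVdef
  have hpos : 0 < mdot (nullOf e0).1 (nullOf n').1 := by
    rw [mdot_nullOf]
    have : e0.1 - n'.1 ≠ 0 := fun h => hn (Subtype.ext (sub_eq_zero.1 h).symm)
    have := norm_pos_iff.2 this
    positivity
  have hVV : mdot V V = -2 * mdot (nullOf e0).1 (nullOf n').1 := by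
    rw [hVdef, mdot_sub_left, mdot_sub_right, mdot_sub_right, (nullOf e0).2.1, (nullOf n').2.1,
      mdot_comm (nullOf n').1]
    ring
  have hV : mdot V V < 0 := by rw [hVV]; linarith
  have hV0 : V 0 = 0 := by simp [hVdef, nullOf]
  have hr : refl V (nullOf n').1 = (nullOf e0).1 := by
    unfold refl
    rw [hVV, hVdef, mdot_sub_right, (nullOf n').2.1, mdot_comm (nullOf n').1]
    rw [show 2 * (0 - mdot (nullOf e0).1 (nullOf n').1) / (-2 * mdot (nullOf e0).1 (nullOf n').1)
      = 1 by field_simp; ring, one_smul]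
    abel
  have hr0 : ∀ x, refl V x 0 = x 0 := by intro x; simp [refl, hV0]
  let G : Spacetime → ENNReal := fun l => ENNReal.ofReal
    (|l 0| * Real.sqrt |l 0| * Real.sqrt (mdot (nullOf n').1 l))⁻¹
  have hm : Measurable G := by
    have := measurable_mdot_right' (nullOf n').1
    fun_prop
  have hh : HomogNegTwo G := by
    intro r hr x
    show ENNReal.ofReal _ = _
    rw [← ENNReal.ofReal_mul (by positivity), mdot_smul_right]
    simp only [Pi.smul_apply, smul_eq_mul, abs_mul, abs_of_pos hr, Real.sqrt_mul hr.le]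
    congr 1
    have : Real.sqrt r * Real.sqrt r = r := Real.mul_self_sqrt hr.le
    rw [← mul_inv]
    congr 1
    calc _ = (r * (Real.sqrt r * Real.sqrt r)) * (|x 0| * Real.sqrt |x 0|
        * Real.sqrt (mdot (nullOf n').1 x)) := by ring
      _ = _ := by rw [this]; ring
  have key := lintegral_refl hV hm hh
  have e1 : ∀ n, G (nullOf n).1
      = ENNReal.ofReal (Real.sqrt (mdot (nullOf n').1 (nullOf n).1))⁻¹ := by
    intro n; simp [G, nullOf]
  have e2 : ∀ n, G (refl V (nullOf n).1)
      = ENNReal.ofReal (Real.sqrt (mdot (nullOf e0).1 (nullOf n).1))⁻¹ := by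
    intro n
    show ENNReal.ofReal _ = _
    rw [hr0, ← hr, ← mdot_refl hV (refl V (nullOf n').1), refl_refl hV]
    simp [nullOf]
  simp only [e1, e2] at key
  exact key.symm

theorem measurable_nullOf : Measurable fun n => (nullOf n).1 :=
  (continuous_subtype_val.comp continuous_nullOf).measurable

theorem measurable_mdot : Measurable fun p : Spacetime × Spacetime => mdot p.1 p.2 := by
  unfold mdot; fun_prop

theorem _root_.Measurable.mdot {X : Type*} [MeasurableSpace X] {f g : X → Spacetime}
    (hf : Measurable f) (hg : Measurable g) : Measurable fun x => AsymptoticQED.mdot (f x) (g x) :=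
  measurable_mdot.comp (hf.prodMk hg)

theorem integrable_inv_sqrt (n' : Metric.sphere (0 : E3) 1) :
    Integrable (fun n => (Real.sqrt (mdot (nullOf n).1 (nullOf n').1))⁻¹) sphereMeasure := by
  obtain ⟨C, -, h⟩ := exists_lintegral_inv_sqrt_le
  have hm : Measurable fun n => (Real.sqrt (mdot (nullOf n).1 (nullOf n').1))⁻¹ :=
    ((measurable_nullOf.mdot measurable_const).sqrt).inv
  refine ⟨hm.aestronglyMeasurable, ?_⟩
  rw [hasFiniteIntegral_iff_ofReal (ae_of_all _ fun n => by positivity)]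
  simp only [mdot_comm _ (nullOf n').1]
  exact (h n').trans_lt ENNReal.ofReal_lt_top

theorem exists_integral_inv_sqrt_le : ∃ C : ℝ, 0 ≤ C ∧ ∀ n' : Metric.sphere (0 : E3) 1,
    ∫ n, (Real.sqrt (mdot (nullOf n).1 (nullOf n').1))⁻¹ ∂sphereMeasure ≤ C := by
  obtain ⟨C, hC, h⟩ := exists_lintegral_inv_sqrt_le
  refine ⟨C, hC, fun n' => ?_⟩
  rw [integral_eq_lintegral_of_nonneg_ae (ae_of_all _ fun n => by positivity)
    (integrable_inv_sqrt n').aestronglyMeasurable]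
  simp only [mdot_comm _ (nullOf n').1]
  exact ENNReal.toReal_le_of_le_ofReal hC (h n')

theorem abs_ratio_le {n n' : Metric.sphere (0 : E3) 1} {w : Spacetime}
    (hw : mdot (nullOf n').1 w = 0) :
    |mdot (nullOf n).1 w / mdot (nullOf n).1 (nullOf n').1|
      ≤ Real.sqrt 2 * ‖spatial w‖ * (Real.sqrt (mdot (nullOf n).1 (nullOf n').1))⁻¹ := by
  have h0 := mdot_nullOf_nonneg n n'
  have h1 : mdot (nullOf n).1 w = -inner ℝ (spatial w) (n.1 - n'.1) := by
    have e : mdot (nullOf n).1 w = mdot (nullOf n).1 w - mdot (nullOf n').1 w := by linarith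
    rw [e]
    simp [mdot, nullOf, spatial, PiLp.inner_apply, Fin.sum_univ_three]; ring
  have h2 : ‖n.1 - n'.1‖ = Real.sqrt 2 * Real.sqrt (mdot (nullOf n).1 (nullOf n').1) := by
    rw [← Real.sqrt_mul (by norm_num), mdot_nullOf, mul_div_cancel₀ _ (two_ne_zero' ℝ),
      Real.sqrt_sq (norm_nonneg _)]
  have h3 : |mdot (nullOf n).1 w| ≤ ‖spatial w‖ * (Real.sqrt 2 *
      Real.sqrt (mdot (nullOf n).1 (nullOf n').1)) := by
    rw [h1, abs_neg, ← h2]; exact abs_real_inner_le_norm _ _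
  rcases h0.eq_or_lt with h | h
  · rw [← h]; simp
  rw [abs_div, abs_of_pos h, div_le_iff₀ h]
  refine h3.trans (le_of_eq ?_)
  have h4 := Real.mul_self_sqrt h0
  have h5 := (Real.sqrt_pos.2 h).ne'
  nth_rewrite 3 [← h4]
  field_simp

theorem exists_pos_le_mdot (v : Hyp) : ∃ c : ℝ, 0 < c ∧ ∀ n, c ≤ mdot v.1 (nullOf n).1 := by
  have : Continuous fun n => mdot v.1 (nullOf n).1 :=
    ((mdotL v.1).continuous).comp (continuous_subtype_val.comp continuous_nullOf)
  obtain ⟨n, -, hn⟩ := isCompact_univ.exists_isMinOn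
    ⟨(⟨EuclideanSpace.single 0 1, by simp⟩ : Metric.sphere (0 : E3) 1), trivial⟩ this.continuousOn
  exact ⟨_, mdot_hyp_null_pos v (nullOf n), fun n' => hn (Set.mem_univ n')⟩

theorem integrable_kernel (v : Hyp) {n' : Metric.sphere (0 : E3) 1} {w : Spacetime}
    (hw : mdot (nullOf n').1 w = 0) :
    Integrable (fun n => mdot (nullOf n).1 w / mdot (nullOf n).1 (nullOf n').1
      / mdot v.1 (nullOf n).1 ^ 2) sphereMeasure := by
  obtain ⟨c, hc, hcb⟩ := exists_pos_le_mdot v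
  refine (((integrable_inv_sqrt n').const_mul (Real.sqrt 2 * ‖spatial w‖)).mul_const
    (c ^ 2)⁻¹).mono' ?_ (ae_of_all _ fun n => ?_)
  · exact (((measurable_nullOf.mdot measurable_const).div
      (measurable_nullOf.mdot measurable_const)).div
      ((measurable_const.mdot measurable_nullOf).pow_const 2)).aestronglyMeasurable
  · rw [Real.norm_eq_abs, abs_div, div_eq_mul_inv, abs_of_nonneg (sq_nonneg (mdot v.1 _))]
    refine mul_le_mul (abs_ratio_le hw) ?_ (by positivity) (by positivity)
    exact inv_anti₀ (by positivity) (by gcongr; exact hcb n)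

theorem integral_inv_sq (v : Hyp) :
    Integrable (fun n => (mdot v.1 (nullOf n).1 ^ 2)⁻¹) sphereMeasure ∧
    ∫ n, (mdot v.1 (nullOf n).1 ^ 2)⁻¹ ∂sphereMeasure = 4 * Real.pi := by
  have hm : Measurable fun n => (mdot v.1 (nullOf n).1 ^ 2)⁻¹ :=
    ((measurable_const.mdot measurable_nullOf).pow_const 2).inv
  have h := lintegral_inv_sq v
  have h0 : ∀ n, 0 ≤ (mdot v.1 (nullOf n).1 ^ 2)⁻¹ := fun n => by positivity
  refine ⟨⟨hm.aestronglyMeasurable, ?_⟩, ?_⟩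
  · rw [hasFiniteIntegral_iff_ofReal (ae_of_all _ h0), h]; exact ENNReal.ofReal_lt_top
  · rw [integral_eq_lintegral_of_nonneg_ae (ae_of_all _ h0) hm.aestronglyMeasurable, h,
      ENNReal.toReal_ofReal (by positivity)]

theorem spacelike_of_orthogonal (v : Hyp) {u : Spacetime} (h : mdot v.1 u = 0) :
    u = 0 ∨ mdot u u < 0 := by
  by_contra! hc
  obtain ⟨h0, h1⟩ := hc
  apply h0
  have hv := v.2.1
  have hv0 := v.2.2
  set v := v.1
  unfold mdot at *
  have a : (v 1 * u 1 + v 2 * u 2 + v 3 * u 3) ^ 2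
      ≤ (v 1 ^ 2 + v 2 ^ 2 + v 3 ^ 2) * (u 1 ^ 2 + u 2 ^ 2 + u 3 ^ 2) := by
    nlinarith [sq_nonneg (v 1 * u 2 - v 2 * u 1), sq_nonneg (v 1 * u 3 - v 3 * u 1),
      sq_nonneg (v 2 * u 3 - v 3 * u 2)]
  have b : v 1 * u 1 + v 2 * u 2 + v 3 * u 3 = v 0 * u 0 := by linarith
  have c : v 1 ^ 2 + v 2 ^ 2 + v 3 ^ 2 = v 0 ^ 2 - 1 := by linarith
  rw [b, c] at a
  have d : u 1 ^ 2 + u 2 ^ 2 + u 3 ^ 2 ≤ u 0 ^ 2 := by linarith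
  have e : 0 ≤ v 0 ^ 2 - 1 := by rw [← c]; positivity
  have f : u 0 ^ 2 ≤ 0 := by nlinarith
  have g1 : u 1 ^ 2 ≤ 0 := by nlinarith [sq_nonneg (u 2), sq_nonneg (u 3)]
  have g2 : u 2 ^ 2 ≤ 0 := by nlinarith [sq_nonneg (u 1), sq_nonneg (u 3)]
  have g3 : u 3 ^ 2 ≤ 0 := by nlinarith [sq_nonneg (u 2), sq_nonneg (u 1)]
  ext i
  fin_cases i <;> simp <;> nlinarith

theorem integral_kernel_zero (v : Hyp) {n' : Metric.sphere (0 : E3) 1} {u : Spacetime}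
    (hu : mdot (nullOf n').1 u = 0) (hv : mdot v.1 u = 0) :
    ∫ n, mdot (nullOf n).1 u / mdot (nullOf n).1 (nullOf n').1
      / mdot v.1 (nullOf n).1 ^ 2 ∂sphereMeasure = 0 := by
  rcases spacelike_of_orthogonal v hv with rfl | hV
  · simp [mdot]
  let F : Spacetime → ℝ := fun l => mdot l u / mdot l (nullOf n').1 / mdot v.1 l ^ 2
  have hm : Measurable F := ((measurable_id.mdot measurable_const).div
      (measurable_id.mdot measurable_const)).div ((measurable_const.mdot measurable_id).pow_const 2)
  have hh : HomogNegTwo fun l => ENNReal.ofReal (F l) := by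
    intro r hr x
    dsimp only
    rw [← ENNReal.ofReal_mul (by positivity)]
    congr 1
    simp only [F, mdot_smul_left, mdot_smul_right]
    rw [mul_div_mul_left _ _ hr.ne', mul_pow, mul_comm (r ^ 2), ← div_div, div_eq_mul_inv _ (r ^ 2),
      mul_comm]
  have hr : ∀ y, mdot y u = 0 → refl u y = y := by
    intro y hy
    simp [refl, hy]
  have hF : ∀ l, F (refl u l) = -F l := by
    intro l
    have h1 : mdot (refl u l) (nullOf n').1 = mdot l (nullOf n').1 := by
      rw [← hr _ hu, mdot_refl hV, hr _ hu]
    have h2 : mdot v.1 (refl u l) = mdot v.1 l := by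
      nth_rewrite 1 [← hr _ hv]
      rw [mdot_refl hV]
    have h3 : mdot (refl u l) u = -mdot l u := by
      have : mdot u u ≠ 0 := hV.ne
      unfold refl
      rw [mdot_sub_left, mdot_smul_left]
      field_simp
      ring
    simp only [F, h1, h2, h3, neg_div]
  have key := lintegral_refl hV (ENNReal.measurable_ofReal.comp hm) hh
  simp only [Function.comp_apply, hF] at key
  have := integral_eq_lintegral_pos_part_sub_lintegral_neg_part (integrable_kernel v hu)
  rw [this]
  show (∫⁻ n, ENNReal.ofReal (F (nullOf n).1) ∂sphereMeasure).toReal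
    - (∫⁻ n, ENNReal.ofReal (-F (nullOf n).1) ∂sphereMeasure).toReal = 0
  rw [key, sub_self]

theorem integral_kernel (v : Hyp) {n' : Metric.sphere (0 : E3) 1} {w : Spacetime}
    (hw : mdot (nullOf n').1 w = 0) :
    ∫ n, mdot (nullOf n).1 w / mdot (nullOf n).1 (nullOf n').1
      / mdot v.1 (nullOf n).1 ^ 2 ∂sphereMeasure
      = 4 * Real.pi * (mdot v.1 w / mdot v.1 (nullOf n').1) := by
  have hp := mdot_hyp_null_pos v (nullOf n')
  set c := mdot v.1 w / mdot v.1 (nullOf n').1 with hc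
  have hu : mdot (nullOf n').1 (w - c • (nullOf n').1) = 0 := by
    rw [mdot_sub_right, mdot_smul_right, (nullOf n').2.1, hw]; ring
  have hv : mdot v.1 (w - c • (nullOf n').1) = 0 := by
    rw [mdot_sub_right, mdot_smul_right, hc]; field_simp; ring
  have e : ∀ᵐ n ∂sphereMeasure, mdot (nullOf n).1 w / mdot (nullOf n).1 (nullOf n').1
      / mdot v.1 (nullOf n).1 ^ 2 = mdot (nullOf n).1 (w - c • (nullOf n').1)
        / mdot (nullOf n).1 (nullOf n').1 / mdot v.1 (nullOf n).1 ^ 2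
        + c * (mdot v.1 (nullOf n).1 ^ 2)⁻¹ := by
    filter_upwards [ae_ne n'] with n hn
    have h1 : mdot (nullOf n).1 (nullOf n').1 ≠ 0 := by
      rw [mdot_nullOf]
      have : n.1 - n'.1 ≠ 0 := fun h => hn (Subtype.ext (sub_eq_zero.1 h))
      have := norm_pos_iff.2 this
      positivity
    have h2 := (mdot_hyp_null_pos v (nullOf n)).ne'
    rw [mdot_sub_right, mdot_smul_right]
    field_simp
    ring
  rw [integral_congr_ae e, integral_add (integrable_kernel v hu)
    ((integral_inv_sq v).1.const_mul c), integral_kernel_zero v hu hv, integral_const_mul,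
    (integral_inv_sq v).2]
  ring

section

variable (V : testFields)

theorem continuous_pastLimit : Continuous fun n => pastLimit V.1 (nullOf n) :=
  continuous_pi fun a => (V.2.smooth_pastLimit a).continuous_nullOf

theorem mdot_pastLimit (l : NullVec) : mdot l.1 (pastLimit V.1 l) = 0 := by
  have h1 : Tendsto (fun s => mdotL l.1 (V.1 s l)) atBot (𝓝 (mdotL l.1 (pastLimit V.1 l))) :=
    ((mdotL l.1).continuous.tendsto _).comp (V.2.tendsto_pastLimit l)
  have h2 : (fun s => mdotL l.1 (V.1 s l)) = fun _ => 0 := funext fun s => V.2.transverse s l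
  rw [h2] at h1
  exact (tendsto_nhds_unique h1 tendsto_const_nhds)

theorem exists_pastLimit_le : ∃ M : ℝ, 0 ≤ M ∧ ∀ n, ‖spatial (pastLimit V.1 (nullOf n))‖ ≤ M := by
  obtain ⟨M, hM⟩ := isCompact_univ.exists_bound_of_continuousOn
    (continuous_spatial.comp (continuous_pastLimit V)).continuousOn
  refine ⟨M, ?_, fun n => hM n trivial⟩
  exact (norm_nonneg _).trans (hM (⟨EuclideanSpace.single 0 1, by simp⟩) trivial)

theorem exists_phi_le : ∃ C : ℝ, 0 ≤ C ∧ ∀ n, |phi V.1 (nullOf n)| ≤ C := by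
  obtain ⟨M, hM, hMb⟩ := exists_pastLimit_le V
  obtain ⟨C, hC, hCb⟩ := exists_integral_inv_sqrt_le
  refine ⟨1 / (4 * Real.pi) * (Real.sqrt 2 * M * C), by positivity, fun n => ?_⟩
  unfold phi
  rw [abs_mul, abs_of_pos (by positivity)]
  gcongr
  unfold nullIntegral
  calc |∫ n', mdot (nullOf n).1 (pastLimit V.1 (nullOf n')) / mdot (nullOf n).1 (nullOf n').1
        ∂sphereMeasure|
      ≤ ∫ n', Real.sqrt 2 * M * (Real.sqrt (mdot (nullOf n').1 (nullOf n).1))⁻¹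
        ∂sphereMeasure := by
        rw [← Real.norm_eq_abs]
        refine norm_integral_le_of_norm_le ((integrable_inv_sqrt n).const_mul _)
          (ae_of_all _ fun n' => ?_)
        rw [Real.norm_eq_abs, mdot_comm (nullOf n').1]
        refine (abs_ratio_le (mdot_pastLimit V (nullOf n'))).trans ?_
        gcongr
        exact hMb n'
    _ ≤ _ := by
        rw [integral_const_mul]
        gcongr
        exact hCb n

theorem exists_coulombPhase_le (e : ℝ) : ∃ C : ℝ, ∀ v, |coulombPhase e V.1 v| ≤ C := by
  obtain ⟨C, hC, hCb⟩ := exists_phi_le V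
  refine ⟨|e / (4 * Real.pi)| * (C * (4 * Real.pi)), fun v => ?_⟩
  unfold coulombPhase nullIntegral
  rw [abs_mul]
  gcongr
  rw [← (integral_inv_sq v).2, ← integral_const_mul, ← Real.norm_eq_abs]
  refine norm_integral_le_of_norm_le ((integral_inv_sq v).1.const_mul C) (ae_of_all _ fun n => ?_)
  rw [Real.norm_eq_abs, abs_div, div_eq_mul_inv, abs_of_nonneg (sq_nonneg (mdot v.1 _))]
  gcongr
  exact hCb n

theorem coulombPhase_eq (e : ℝ) (v : Hyp) : coulombPhase e V.1 v
    = e / (4 * Real.pi) * ∫ n, mdot v.1 (pastLimit V.1 (nullOf n)) / mdot v.1 (nullOf n).1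
      ∂sphereMeasure := by
  unfold coulombPhase
  congr 1
  unfold nullIntegral phi nullIntegral
  obtain ⟨M, hM, hMb⟩ := exists_pastLimit_le V
  obtain ⟨C, hC, hCb⟩ := exists_integral_inv_sqrt_le
  obtain ⟨c, hc, hcb⟩ := exists_pos_le_mdot v
  have e1 : ∀ n, 1 / (4 * Real.pi) * (∫ n', mdot (nullOf n).1 (pastLimit V.1 (nullOf n'))
      / mdot (nullOf n).1 (nullOf n').1 ∂sphereMeasure) / mdot v.1 (nullOf n).1 ^ 2
      = 1 / (4 * Real.pi) * ∫ n', mdot (nullOf n).1 (pastLimit V.1 (nullOf n'))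
      / mdot (nullOf n).1 (nullOf n').1 / mdot v.1 (nullOf n).1 ^ 2 ∂sphereMeasure := by
    intro n
    rw [integral_div]; ring
  have hmeas : Measurable fun p : Metric.sphere (0 : E3) 1 × Metric.sphere (0 : E3) 1 =>
      mdot (nullOf p.1).1 (pastLimit V.1 (nullOf p.2))
      / mdot (nullOf p.1).1 (nullOf p.2).1 / mdot v.1 (nullOf p.1).1 ^ 2 :=
    (((measurable_nullOf.comp measurable_fst).mdot
      ((continuous_pastLimit V).measurable.comp measurable_snd)).div
      ((measurable_nullOf.comp measurable_fst).mdot (measurable_nullOf.comp measurable_snd))).div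
      ((measurable_const.mdot (measurable_nullOf.comp measurable_fst)).pow_const 2)
  have hint : Integrable (Function.uncurry fun n n' => mdot (nullOf n).1 (pastLimit V.1 (nullOf n'))
      / mdot (nullOf n).1 (nullOf n').1 / mdot v.1 (nullOf n).1 ^ 2)
      (sphereMeasure.prod sphereMeasure) := by
    have hg : Integrable (fun p : Metric.sphere (0 : E3) 1 × Metric.sphere (0 : E3) 1 =>
        Real.sqrt 2 * M * (Real.sqrt (mdot (nullOf p.1).1 (nullOf p.2).1))⁻¹ * (c ^ 2)⁻¹)
        (sphereMeasure.prod sphereMeasure) := by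
      refine Integrable.mul_const (Integrable.const_mul ?_ _) _
      have hm : Measurable fun p : Metric.sphere (0 : E3) 1 × Metric.sphere (0 : E3) 1 =>
          (Real.sqrt (mdot (nullOf p.1).1 (nullOf p.2).1))⁻¹ :=
        (((measurable_nullOf.comp measurable_fst).mdot
          (measurable_nullOf.comp measurable_snd)).sqrt).inv
      rw [integrable_prod_iff hm.aestronglyMeasurable]
      constructor
      · refine ae_of_all _ fun n => ?_
        simp only [mdot_comm (nullOf n).1]
        exact integrable_inv_sqrt n
      · refine (integrable_const C).mono'
          (hm.norm.stronglyMeasurable.integral_prod_right').aestronglyMeasurable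
          (ae_of_all _ fun n => ?_)
        rw [Real.norm_eq_abs, abs_of_nonneg (integral_nonneg fun _ => norm_nonneg _)]
        simp only [mdot_comm (nullOf n).1, Real.norm_eq_abs, abs_of_nonneg
          (inv_nonneg.2 (Real.sqrt_nonneg _))]
        exact hCb n
    refine hg.mono' hmeas.aestronglyMeasurable (ae_of_all _ fun p => ?_)
    simp only [Function.uncurry]
    rw [Real.norm_eq_abs, abs_div, div_eq_mul_inv, abs_of_nonneg (sq_nonneg (mdot v.1 _))]
    refine mul_le_mul ((abs_ratio_le (mdot_pastLimit V _)).trans ?_) ?_ (by positivity)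
      (by positivity)
    · gcongr
      exact hMb _
    · exact inv_anti₀ (by positivity) (by gcongr; exact hcb _)
  simp only [e1]
  rw [integral_const_mul, integral_integral_swap hint]
  have e2 : ∀ n', ∫ n, mdot (nullOf n).1 (pastLimit V.1 (nullOf n'))
      / mdot (nullOf n).1 (nullOf n').1 / mdot v.1 (nullOf n).1 ^ 2 ∂sphereMeasure = _ :=
    fun n' => integral_kernel v (mdot_pastLimit V (nullOf n'))
  simp only [e2]
  rw [integral_const_mul, ← mul_assoc]
  have : (1 / (4 * Real.pi)) * (4 * Real.pi) = 1 := by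
    have := Real.pi_pos; field_simp
  rw [this, one_mul]

end

theorem JointSmooth.continuous_nullOf {G : ℝ → NullVec → ℝ} (hG : JointSmooth G) :
    Continuous fun p : Metric.sphere (0 : E3) 1 × ℝ => G p.2 (nullOf p.1) := by
  have h : Continuous fun p : Metric.sphere (0 : E3) 1 × ℝ => ext2 G (p.2, (nullOf p.1).1) :=
    (ContDiffOn.continuousOn hG).comp_continuous
      (continuous_snd.prodMk (continuous_subtype_val.comp
        (AsymptoticQED.continuous_nullOf.comp continuous_fst))) fun p => ⟨trivial, null_mem _⟩
  simpa only [ext2_null] using h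

theorem Decays.exists_bound {G : ℝ → NullVec → ℝ} (hG : Decays G) :
    ∃ g : ℝ → ℝ, Integrable g ∧ (∀ s, 0 ≤ g s) ∧ ∀ s n, |G s (nullOf n)| ≤ g s := by
  obtain ⟨C, ε, hε, h⟩ := hG
  refine ⟨fun s => |C| * (1 + ‖s‖) ^ (-(1 + ε)), ?_, fun s => by positivity, fun s n => ?_⟩
  · refine (integrable_one_add_norm ?_).const_mul _
    simp [hε]
  · refine (h s (nullOf n)).trans ?_
    have h0 : (nullOf n).1 0 = 1 := by simp [nullOf]
    dsimp only
    rw [h0, one_pow, one_mul, div_one, Real.rpow_neg (by positivity), ← div_eq_mul_inv,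
      Real.norm_eq_abs]
    gcongr
    exact le_abs_self C

namespace testFields

variable (V : testFields)

theorem hasDerivAt (s : ℝ) (l : NullVec) : HasDerivAt (fun t => V.1 t l)
    (fun a => sDeriv (fun s l => V.1 s l a) s l) s :=
  hasDerivAt_pi.2 fun a => (V.2.smooth a).hasDerivAt s l

theorem deriv_eq (s : ℝ) (l : NullVec) : deriv (fun t => V.1 t l) s
    = fun a => sDeriv (fun s l => V.1 s l a) s l := (hasDerivAt V s l).deriv

theorem exists_deriv_bound : ∃ g : ℝ → ℝ, Integrable g ∧ (∀ s, 0 ≤ g s) ∧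
    ∀ s n a, |deriv (fun t => V.1 t (nullOf n)) s a| ≤ g s := by
  choose g h1 h2 h3 using fun a => (V.2.decay a []).exists_bound
  refine ⟨fun s => ∑ a, g a s, integrable_finsetSum _ fun a _ => h1 a,
    fun s => Finset.sum_nonneg fun a _ => h2 a s, fun s n a => ?_⟩
  rw [deriv_eq]
  exact (h3 a s n).trans (Finset.single_le_sum (f := fun a => g a s) (fun a _ => h2 a s)
    (Finset.mem_univ a))

theorem exists_bound : ∃ M : ℝ, 0 ≤ M ∧ ∀ s n a, |V.1 s (nullOf n) a| ≤ M := by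
  obtain ⟨g, hg, hg0, hgb⟩ := exists_deriv_bound V
  refine ⟨∫ s, g s, integral_nonneg hg0, fun s n a => ?_⟩
  have hd : ∀ s, HasDerivAt (fun t => V.1 t (nullOf n) a)
      (deriv (fun t => V.1 t (nullOf n)) s a) s := fun s => by
    have := (hasDerivAt V s (nullOf n)).differentiableAt.hasDerivAt
    exact hasDerivAt_pi.1 this a
  have hi : Integrable fun s => deriv (fun t => V.1 t (nullOf n)) s a := by
    refine hg.mono' ?_ (ae_of_all _ fun s => hgb s n a)
    simp only [deriv_eq]
    exact ((V.2.smooth a).sDeriv.continuous_nullOf.comp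
      (Continuous.prodMk_right n)).aestronglyMeasurable
  have h1 := integral_Ioi_of_hasDerivAt_of_tendsto' (a := s) (m := 0) (fun x _ => hd x)
    hi.integrableOn (tendsto_pi_nhds.1 (V.2.future (nullOf n)) a)
  have h2 : V.1 s (nullOf n) a = -∫ x in Set.Ioi s, deriv (fun t => V.1 t (nullOf n)) x a := by
    rw [h1]; ring
  rw [h2, abs_neg]
  calc |∫ x in Set.Ioi s, deriv (fun t => V.1 t (nullOf n)) x a|
      ≤ ∫ x in Set.Ioi s, g x := by
        rw [← Real.norm_eq_abs]
        exact norm_integral_le_of_norm_le hg.integrableOn (ae_of_all _ fun x => hgb x n a)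
    _ ≤ _ := setIntegral_le_integral hg (ae_of_all _ hg0)

theorem continuous_joint : Continuous fun p : Metric.sphere (0 : E3) 1 × ℝ =>
    V.1 p.2 (nullOf p.1) := continuous_pi fun a => (V.2.smooth a).continuous_nullOf

theorem continuous_deriv : Continuous fun p : Metric.sphere (0 : E3) 1 × ℝ =>
    deriv (fun t => V.1 t (nullOf p.1)) p.2 := by
  simp only [deriv_eq]
  exact continuous_pi fun a => (V.2.smooth a).sDeriv.continuous_nullOf

theorem add_deriv (W : testFields) (s : ℝ) (l : NullVec) :
    deriv (fun t => (V + W).1 t l) s = deriv (fun t => V.1 t l) s + deriv (fun t => W.1 t l) s :=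
  deriv_add (hasDerivAt V s l).differentiableAt (hasDerivAt W s l).differentiableAt

theorem add_val (W : testFields) (s : ℝ) (l : NullVec) : (V + W).1 s l = V.1 s l + W.1 s l := rfl

end testFields

theorem integrable_pairing (V W : testFields) :
    Integrable (fun p : Metric.sphere (0 : E3) 1 × ℝ =>
      mdot (deriv (fun t => V.1 t (nullOf p.1)) p.2) (W.1 p.2 (nullOf p.1)))
      (sphereMeasure.prod volume) := by
  obtain ⟨g, hg, hg0, hgb⟩ := testFields.exists_deriv_bound V
  obtain ⟨M, hM, hMb⟩ := testFields.exists_bound W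
  have h1 : Integrable (fun p : Metric.sphere (0 : E3) 1 × ℝ => (1 : ℝ) * (g p.2 * (4 * M)))
      (sphereMeasure.prod volume) :=
    Integrable.mul_prod (integrable_const (1 : ℝ)) (hg.mul_const (4 * M))
  refine h1.mono' ?_ (ae_of_all _ fun p => ?_)
  · exact ((testFields.continuous_deriv V).measurable.mdot
      (testFields.continuous_joint W).measurable).aestronglyMeasurable
  · have h : ∀ a, |deriv (fun t => V.1 t (nullOf p.1)) p.2 a * W.1 p.2 (nullOf p.1) a|
        ≤ g p.2 * M := by
      intro a
      rw [abs_mul]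
      exact mul_le_mul (hgb _ _ _) (hMb _ _ _) (abs_nonneg _) (hg0 _)
    have h0 := abs_le.1 (h 0)
    have h1 := abs_le.1 (h 1)
    have h2 := abs_le.1 (h 2)
    have h3 := abs_le.1 (h 3)
    rw [Real.norm_eq_abs]
    unfold mdot
    rw [abs_le]
    constructor <;> linarith

/-- One half of the symplectic form. -/
def pairing (V W : testFields) : ℝ := ∫ p, mdot (deriv (fun t => V.1 t (nullOf p.1)) p.2)
  (W.1 p.2 (nullOf p.1)) ∂(sphereMeasure.prod volume)

theorem symp_eq (V W : testFields) :
    symp V.1 W.1 = 1 / (4 * Real.pi) * (pairing V W - pairing W V) := by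
  unfold symp pairing nullIntegral
  rw [← integral_sub (integrable_pairing V W) (integrable_pairing W V)]
  congr 1
  exact (integral_prod _ ((integrable_pairing V W).sub (integrable_pairing W V))).symm

theorem pairing_add_left (V V' W : testFields) :
    pairing (V + V') W = pairing V W + pairing V' W := by
  unfold pairing
  rw [← integral_add (integrable_pairing V W) (integrable_pairing V' W)]
  simp only [testFields.add_deriv, mdot_add_left]

theorem pairing_add_right (V W W' : testFields) :
    pairing V (W + W') = pairing V W + pairing V W' := by
  unfold pairing
  rw [← integral_add (integrable_pairing V W) (integrable_pairing V W')]
  simp only [testFields.add_val, mdot_add_right]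

theorem symp_add_left (V V' W : testFields) :
    symp (V + V').1 W.1 = symp V.1 W.1 + symp V'.1 W.1 := by
  rw [symp_eq, symp_eq, symp_eq, pairing_add_left, pairing_add_right]; ring

theorem symp_antisymm (V W : testFields) : symp W.1 V.1 = -symp V.1 W.1 := by
  rw [symp_eq, symp_eq]; ring

theorem symp_add_right (V W W' : testFields) :
    symp V.1 (W + W').1 = symp V.1 W.1 + symp V.1 W'.1 := by
  rw [symp_antisymm, symp_add_left, symp_antisymm V W, symp_antisymm V W']; ring

theorem IsPureGauge.symp_left {V : testFields} (hV : IsPureGauge V) (W : testFields) :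
    symp V.1 W.1 = 0 := by
  have e : ∀ s l, V.1 s l = (V.1 s l 0 / l.1 0) • l.1 := by
    intro s l
    ext a
    have := hV s l a 0
    have h0 := l.2.2.ne'
    simp only [Pi.smul_apply, smul_eq_mul]
    field_simp
    linarith
  have e' : ∀ s l, deriv (fun t => V.1 t l) s = (deriv (fun t => V.1 t l) s 0 / l.1 0) • l.1 := by
    intro s l
    have h1 := testFields.hasDerivAt V s l
    have h2 := hasDerivAt_pi.1 h1 0
    have h3 := (h2.div_const (l.1 0)).smul_const l.1
    have h4 : (fun t => V.1 t l) = fun t => (V.1 t l 0 / l.1 0) • l.1 := funext fun t => e t l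
    rw [h1.deriv]
    rw [← h4] at h3
    exact h1.unique h3
  have w' : ∀ s l, mdot l.1 (deriv (fun t => W.1 t l) s) = 0 := by
    intro s l
    have h1 := (mdotL l.1).hasFDerivAt.comp_hasDerivAt s (testFields.hasDerivAt W s l)
    have h2 : (mdotL l.1) ∘ (fun t => W.1 t l) = fun _ => 0 := funext fun t => W.2.transverse t l
    rw [h2] at h1
    rw [testFields.deriv_eq]
    exact (h1.unique (hasDerivAt_const s 0))
  unfold symp nullIntegral
  have : ∀ s l, mdot (deriv (fun t => V.1 t l) s) (W.1 s l)
      - mdot (deriv (fun t => W.1 t l) s) (V.1 s l) = 0 := by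
    intro s l
    rw [e', e s l, mdot_smul_left, mdot_smul_right, W.2.transverse, mdot_comm _ l.1, w']
    ring
  simp [this]

theorem IsPureGauge.symp_right {V : testFields} (hV : IsPureGauge V) (W : testFields) :
    symp W.1 V.1 = 0 := by rw [symp_antisymm, hV.symp_left, neg_zero]

theorem isPureGauge_of_mem {e : ℝ} {V : testFields} (h : V ∈ trivialFields e) : IsPureGauge V := by
  obtain ⟨α, αm, n, h1, -, -⟩ := h
  intro s l a b
  rw [h1]
  simp only [Pi.smul_apply, smul_eq_mul]
  ring

theorem integrable_past (V : testFields) (v : Hyp) : Integrable (fun n =>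
    mdot v.1 (pastLimit V.1 (nullOf n)) / mdot v.1 (nullOf n).1) sphereMeasure := by
  have h : Continuous fun n => mdot v.1 (pastLimit V.1 (nullOf n)) / mdot v.1 (nullOf n).1 :=
    (((mdotL v.1).continuous).comp (continuous_pastLimit V)).div
      (((mdotL v.1).continuous).comp (continuous_subtype_val.comp continuous_nullOf))
      fun n => (mdot_hyp_null_pos v (nullOf n)).ne'
  exact h.integrable_of_hasCompactSupport (HasCompactSupport.of_compactSpace _)

theorem coulombPhase_add (e : ℝ) (V W : testFields) (v : Hyp) :
    coulombPhase e (V + W).1 v = coulombPhase e V.1 v + coulombPhase e W.1 v := by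
  rw [coulombPhase_eq, coulombPhase_eq, coulombPhase_eq, ← mul_add,
    ← integral_add (integrable_past V v) (integrable_past W v)]
  congr 2
  funext n
  have : pastLimit (V + W).1 (nullOf n) = pastLimit V.1 (nullOf n) + pastLimit W.1 (nullOf n) :=
    ((V.2.tendsto_pastLimit _).add (W.2.tendsto_pastLimit _)).limUnder_eq
  rw [this, mdot_add_right, add_div]

theorem coulombPhase_smul (e c : ℝ) (V : testFields) (v : Hyp) :
    coulombPhase e (c • V).1 v = c * coulombPhase e V.1 v := by
  rw [coulombPhase_eq, coulombPhase_eq, mul_left_comm, ← integral_const_mul c]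
  congr 2
  funext n
  have : pastLimit (c • V).1 (nullOf n) = c • pastLimit V.1 (nullOf n) :=
    ((V.2.tendsto_pastLimit _).const_smul c).limUnder_eq
  rw [this, mdot_smul_right, mul_div_assoc]

theorem coulombPhase_zero (e : ℝ) (v : Hyp) : coulombPhase e (0 : testFields).1 v = 0 := by
  have := coulombPhase_smul e 0 0 v
  rwa [zero_smul, zero_mul] at this

/-- The phase variable in terms of the symplectic form with Coulomb fields. -/
theorem symp_coulomb (e : ℝ) (V : testFields) (v : Hyp) :
    symp V.1 (coulomb e v) = -coulombPhase e V.1 v := by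
  rw [coulombPhase_eq]
  unfold symp nullIntegral
  have h1 : ∀ n, ∫ s, (mdot (deriv (fun t => V.1 t (nullOf n)) s) (coulomb e v s (nullOf n))
      - mdot (deriv (fun t => coulomb e v t (nullOf n)) s) (V.1 s (nullOf n)))
      = -(e * (mdot v.1 (pastLimit V.1 (nullOf n)) / mdot v.1 (nullOf n).1)) := by
    intro n
    have hc : ∀ s, deriv (fun t => coulomb e v t (nullOf n)) s = 0 := fun s =>
      deriv_const s _
    have hd : ∀ s, HasDerivAt (fun t => mdotL v.1 (V.1 t (nullOf n)))
        (mdotL v.1 (deriv (fun t => V.1 t (nullOf n)) s)) s := fun s =>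
      (mdotL v.1).hasFDerivAt.comp_hasDerivAt s
        (testFields.hasDerivAt V s (nullOf n)).differentiableAt.hasDerivAt
    obtain ⟨g, hg, hg0, hgb⟩ := testFields.exists_deriv_bound V
    have hi : ∀ a, Integrable fun s => deriv (fun t => V.1 t (nullOf n)) s a := fun a =>
      hg.mono' (((continuous_apply a).comp ((testFields.continuous_deriv V).comp
        (Continuous.prodMk_right n))).aestronglyMeasurable) (ae_of_all _ fun s => hgb s n a)
    have hI : Integrable fun s => mdotL v.1 (deriv (fun t => V.1 t (nullOf n)) s) := by
      simp only [mdotL_apply, mdot]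
      exact ((((hi 0).const_mul _).sub ((hi 1).const_mul _)).sub ((hi 2).const_mul _)).sub
        ((hi 3).const_mul _)
    have h2 := integral_of_hasDerivAt_of_tendsto hd hI
      (((mdotL v.1).continuous.tendsto _).comp (V.2.tendsto_pastLimit (nullOf n)))
      (((mdotL v.1).continuous.tendsto _).comp (V.2.future (nullOf n)))
    have h3 : ∀ s, mdot (deriv (fun t => V.1 t (nullOf n)) s) (coulomb e v s (nullOf n))
        - mdot (deriv (fun t => coulomb e v t (nullOf n)) s) (V.1 s (nullOf n))
        = e / mdot v.1 (nullOf n).1 * mdotL v.1 (deriv (fun t => V.1 t (nullOf n)) s) := by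
      intro s
      rw [hc, mdotL_apply, coulomb, mdot_smul_right, mdot_comm _ v.1]
      simp [mdot]
    simp only [h3]
    rw [integral_const_mul, h2, _root_.map_zero, mdotL_apply]
    ring
  simp only [h1]
  rw [integral_neg, integral_const_mul]
  ring

theorem exists_int_of_mem_trivialFields {e : ℝ} (he : e ≠ 0) {V : testFields}
    (h : V ∈ trivialFields e) : ∃ n : ℤ, ∀ v, coulombPhase e V.1 v = n * (2 * Real.pi) := by
  obtain ⟨α, αm, n, h1, h2, h3⟩ := h
  refine ⟨n, fun v => ?_⟩
  have e1 : ∀ n, mdot v.1 (pastLimit V.1 (nullOf n)) / mdot v.1 (nullOf n).1 = αm (nullOf n) := by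
    intro n
    have : pastLimit V.1 (nullOf n) = αm (nullOf n) • (nullOf n).1 := by
      refine Tendsto.limUnder_eq ?_
      simp only [h1]
      exact (h2 _).smul_const _
    rw [this, mdot_smul_right, mul_div_assoc, div_self (mdot_hyp_null_pos v _).ne', mul_one]
  rw [coulombPhase_eq]
  simp only [e1]
  unfold nullIntegral at h3
  calc e / (4 * Real.pi) * ∫ n, αm (nullOf n) ∂sphereMeasure
      = e * (1 / (4 * Real.pi) * ∫ n, αm (nullOf n) ∂sphereMeasure) := by ring
    _ = _ := by rw [h3]; field_simp

theorem S_add (e : ℝ) (V W : testFields) (g : K) : S e (V + W) g = S e V (S e W g) := by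
  rw [S_eq, S_eq, S_eq, cop_cop (BddMeas.phase (measurable_coulombPhase e V))
    (BddMeas.phase (measurable_coulombPhase e W))]
  congr 2
  funext v
  rw [coulombPhase_add, ← Complex.exp_add]
  congr 1
  push_cast; ring

theorem S_zero (e : ℝ) (g : K) : S e 0 g = g := by
  rw [S_eq]
  have : (fun v => Complex.exp (I * coulombPhase e (0 : testFields).1 v)) = fun _ => 1 := by
    funext v; rw [coulombPhase_zero]; simp
  rw [this, cop_one]

theorem S_of_mem {e : ℝ} (he : e ≠ 0) {V : testFields} (h : V ∈ trivialFields e) (g : K) :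
    S e V g = g := by
  obtain ⟨n, hn⟩ := exists_int_of_mem_trivialFields he h
  rw [S_eq]
  have : (fun v => Complex.exp (I * coulombPhase e V.1 v)) = fun _ => 1 := by
    funext v; rw [hn]; push_cast
    rw [← Complex.exp_int_mul_two_pi_mul_I n]
    congr 1; ring
  rw [this, cop_one]

theorem S_congr {e : ℝ} (he : e ≠ 0) {V W : testFields} (h : cls e V = cls e W) :
    S e V = S e W := by
  ext1 g
  have h1 : -V + W ∈ trivialFields e := QuotientAddGroup.eq.1 h
  have h2 : W = V + (-V + W) := by abel
  rw [h2, S_add, S_of_mem he h1]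

theorem symp_congr {e : ℝ} {V V' W W' : testFields} (h : cls e V = cls e V')
    (h' : cls e W = cls e W') : symp V.1 W.1 = symp V'.1 W'.1 := by
  have h1 := isPureGauge_of_mem (QuotientAddGroup.eq.1 h)
  have h2 := isPureGauge_of_mem (QuotientAddGroup.eq.1 h')
  rw [show V' = V + (-V + V') by abel, show W' = W + (-W + W') by abel, symp_add_left,
    symp_add_right, h1.symp_left, h2.symp_right]
  ring

/-! ## Representations of the field algebra from generators -/

section

variable {e : ℝ}

namespace FieldAlg

variable {A : Type*} [CStarAlgebra A] {w : GaugeClass e → A} {b : K → A}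

theorem norm_lift_le (h : PreField.Relations w b) (a : PreField e) :
    ‖PreField.lift h a‖ ≤ ‖a‖ := by
  let q : Seminorm ℂ (PreField e) :=
    (normSeminorm ℂ A).comp (PreField.lift h).toAlgHom.toLinearMap
  have hq : PreField.IsCStarSeminorm q := by
    refine ⟨fun a b => ?_, fun a => ?_⟩
    · show ‖PreField.lift h (a * b)‖ ≤ ‖PreField.lift h a‖ * ‖PreField.lift h b‖
      rw [map_mul]; exact norm_mul_le _ _
    · show ‖PreField.lift h (star a * a)‖ = ‖PreField.lift h a‖ ^ 2
      rw [map_mul, map_star, CStarRing.norm_star_mul_self, pow_two]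
  exact PreField.le_maxNorm ⟨q, hq⟩ a

/-- The ring homomorphism underlying `lift`. -/
def liftRing (h : PreField.Relations w b) : FieldAlg e →+* A :=
  UniformSpace.Completion.extensionHom
    ((PreField.lift h : PreField e →ₐ[ℂ] A) : PreField e →+* A)
    (AddMonoidHomClass.continuous_of_bound
      ((PreField.lift h : PreField e →ₐ[ℂ] A) : PreField e →+* A) 1 fun a => by
      rw [one_mul]; exact norm_lift_le h a)

theorem liftRing_coe (h : PreField.Relations w b) (a : PreField e) :
    liftRing h (a : FieldAlg e) = PreField.lift h a :=
  UniformSpace.Completion.extensionHom_coe _ _ a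

theorem continuous_liftRing (h : PreField.Relations w b) : Continuous (liftRing h) :=
  UniformSpace.Completion.continuous_extension

/-- The representation of the field algebra determined by operators satisfying the relations. -/
def lift (h : PreField.Relations w b) : FieldAlg e →⋆ₐ[ℂ] A :=
  { liftRing h with
    commutes' := fun c => by
      show liftRing h ((algebraMap ℂ (PreField e) c : PreField e) : FieldAlg e) = _
      rw [liftRing_coe, AlgHomClass.commutes]
    map_star' := fun a => by
      show liftRing h (star a) = star (liftRing h a)
      induction a using UniformSpace.Completion.induction_on with
      | hp =>
        exact isClosed_eq ((continuous_liftRing h).comp FieldAlg.continuous_star)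
          ((ContinuousStar.continuous_star (R := A)).comp (continuous_liftRing h))
      | ih a => rw [star_coe, liftRing_coe, liftRing_coe, map_star] }

theorem lift_W (h : PreField.Relations w b) (V : testFields) :
    lift h (W e V) = w (cls e V) := by
  show liftRing h _ = _
  unfold W
  rw [liftRing_coe, PreField.lift_w]

theorem lift_B (h : PreField.Relations w b) (g : K) : lift h (B e g) = b g := by
  show liftRing h _ = _
  unfold B
  rw [liftRing_coe, PreField.lift_b]

theorem continuous_hom (φ : FieldAlg e →⋆ₐ[ℂ] A) : Continuous φ :=
  AddMonoidHomClass.continuous_of_bound φ 1 fun a => by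
    rw [one_mul]; exact NonUnitalStarAlgHom.norm_apply_le φ a

theorem hom_ext {φ ψ : FieldAlg e →⋆ₐ[ℂ] A} (hW : ∀ V, φ (W e V) = ψ (W e V))
    (hB : ∀ g, φ (B e g) = ψ (B e g)) : φ = ψ := by
  have key : ∀ a : PreField e, φ (a : FieldAlg e) = ψ (a : FieldAlg e) := by
    intro a
    induction a using PreField.induction with
    | h1 c =>
      have : ((algebraMap ℂ (PreField e) c : PreField e) : FieldAlg e)
        = algebraMap ℂ (FieldAlg e) c := rfl
      rw [this, AlgHomClass.commutes, AlgHomClass.commutes]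
    | hw x =>
      obtain ⟨V, rfl⟩ := QuotientAddGroup.mk_surjective x
      exact hW V
    | hb g => exact hB g
    | hs a h => rw [← star_coe, map_star, map_star, h]
    | h3 a b ha hb => rw [UniformSpace.Completion.coe_mul, map_mul, map_mul, ha, hb]
    | h4 a b ha hb =>
      rw [UniformSpace.Completion.coe_add, _root_.map_add, _root_.map_add, ha, hb]
  ext a
  induction a using UniformSpace.Completion.induction_on with
  | hp => exact isClosed_eq (continuous_hom φ) (continuous_hom ψ)
  | ih a => exact key a

theorem W_star (V : testFields) : star (W e V) = W e (-V) := by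
  unfold W
  rw [star_coe, PreField.relations.W_star]; rfl

theorem W_zero : W e 0 = 1 := by
  unfold W
  have : cls e 0 = 0 := rfl
  rw [this, PreField.relations.W_zero]; rfl

theorem W_mul (V V' : testFields) : W e V * W e V'
    = Complex.exp (-(I / 2) * symp V.1 V'.1) • W e (V + V') := by
  unfold W
  rw [← UniformSpace.Completion.coe_mul, PreField.relations.W_mul]
  exact UniformSpace.Completion.coe_smul _ _

theorem W_mul_star (V : testFields) : W e V * star (W e V) = 1 := by
  rw [W_star, W_mul, add_neg_cancel, W_zero]
  have : symp V.1 (-V : testFields).1 = 0 := by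
    have h1 := symp_add_right V V (-V)
    rw [add_neg_cancel] at h1
    have h2 : symp V.1 V.1 = 0 := by linarith [symp_antisymm V V]
    have h3 : symp V.1 (0 : testFields).1 = 0 := by
      have := symp_add_right V 0 0
      rw [add_zero] at this; linarith
    linarith
  rw [this]; simp

theorem W_star_mul (V : testFields) : star (W e V) * W e V = 1 := by
  have := W_mul_star (e := e) (-V)
  rw [W_star, neg_neg] at this
  rw [W_star]; exact this

theorem W_B (V : testFields) (g : K) : W e V * B e g = B e (S e V g) * W e V := by
  unfold W B
  rw [← UniformSpace.Completion.coe_mul, PreField.relations.W_B]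
  exact UniformSpace.Completion.coe_mul _ _

theorem W_Bs (V : testFields) (g : K) :
    W e V * star (B e g) = star (B e (S e V g)) * W e V := by
  have h := W_B (e := e) (-V) (S e V g)
  rw [← S_add, neg_add_cancel, S_zero] at h
  have h2 := congrArg star h
  rw [star_mul, star_mul, W_star, neg_neg] at h2
  exact h2.symm

end FieldAlg

theorem isCAR_B {H : Type*} [NormedAddCommGroup H] [InnerProductSpace ℂ H] [CompleteSpace H]
    {B' : StarSubalgebra ℂ (FieldAlg e)} (hB : ∀ g, FieldAlg.B e g ∈ B')
    (π : B' →⋆ₐ[ℂ] (H →L[ℂ] H)) :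
    IsCAR fun g => π ⟨FieldAlg.B e g, hB g⟩ where
  add f g := by
    rw [← _root_.map_add]; congr 1
    exact Subtype.ext (FieldAlg.B_add f g)
  smul c g := by
    rw [← map_smul]; congr 1
    exact Subtype.ext (FieldAlg.B_smul c g)
  anti f g := by
    rw [← map_mul, ← map_mul, ← _root_.map_add, ← _root_.map_zero π]; congr 1
    refine Subtype.ext ?_
    show FieldAlg.B e f * FieldAlg.B e g + FieldAlg.B e g * FieldAlg.B e f = 0
    unfold FieldAlg.B
    rw [← UniformSpace.Completion.coe_mul, ← UniformSpace.Completion.coe_mul,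
      ← UniformSpace.Completion.coe_add, PreField.relations.B_B]; rfl
  anti_star f g := by
    rw [← map_star, ← map_mul, ← map_mul, ← _root_.map_add, ← map_one π, ← map_smul]; congr 1
    refine Subtype.ext ?_
    show FieldAlg.B e f * star (FieldAlg.B e g) + star (FieldAlg.B e g) * FieldAlg.B e f
      = (inner ℂ f g : ℂ) • 1
    unfold FieldAlg.B
    rw [FieldAlg.star_coe, ← UniformSpace.Completion.coe_mul, ← UniformSpace.Completion.coe_mul,
      ← UniformSpace.Completion.coe_add, PreField.relations.B_Bs, Algebra.algebraMap_eq_smul_one]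
    exact UniformSpace.Completion.coe_smul _ _

theorem isClosed_CAR : IsClosed (CAR e : Set (FieldAlg e)) :=
  StarSubalgebra.isClosed_topologicalClosure _

theorem isClosed_CCR : IsClosed (CCR e : Set (FieldAlg e)) :=
  StarSubalgebra.isClosed_topologicalClosure _

theorem CAR_continuous {A : Type*} [CStarAlgebra A] (φ : CAR e →⋆ₐ[ℂ] A) : Continuous φ := by
  have := isClosed_CAR (e := e)
  let _ : CStarAlgebra (CAR e) := StarSubalgebra.cstarAlgebra _
  exact AddMonoidHomClass.continuous_of_bound φ 1 fun a => by
    rw [one_mul]; exact NonUnitalStarAlgHom.norm_apply_le φ a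

theorem CCR_continuous {A : Type*} [CStarAlgebra A] (φ : CCR e →⋆ₐ[ℂ] A) : Continuous φ := by
  have := isClosed_CCR (e := e)
  let _ : CStarAlgebra (CCR e) := StarSubalgebra.cstarAlgebra _
  exact AddMonoidHomClass.continuous_of_bound φ 1 fun a => by
    rw [one_mul]; exact NonUnitalStarAlgHom.norm_apply_le φ a

/-- Closed properties of elements of a C*-subalgebra generated by a set. -/
theorem closure_adjoin_induction {s : Set (FieldAlg e)}
    {P : (StarAlgebra.adjoin ℂ s).topologicalClosure → Prop} (hc : IsClosed {a | P a})
    (hs : ∀ a (h : a ∈ StarAlgebra.adjoin ℂ s),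
      P ⟨a, StarSubalgebra.le_topologicalClosure _ h⟩) (a) : P a := by
  have hd : Dense {a : (StarAlgebra.adjoin ℂ s).topologicalClosure | a.1 ∈ StarAlgebra.adjoin ℂ s} := by
    intro a
    rw [Metric.mem_closure_iff]
    intro ε hε
    obtain ⟨b, hb, hab⟩ := Metric.mem_closure_iff.1 a.2 ε hε
    exact ⟨⟨b, StarSubalgebra.le_topologicalClosure _ hb⟩, hb, hab⟩
  have : closure {a : (StarAlgebra.adjoin ℂ s).topologicalClosure | a.1 ∈ StarAlgebra.adjoin ℂ s}
      ⊆ {a | P a} := hc.closure_subset_iff.2 fun a ha => hs a.1 ha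
  rw [hd.closure_eq] at this
  exact this (Set.mem_univ a)

theorem CAR_hom_ext {A : Type*} [CStarAlgebra A] {φ ψ : CAR e →⋆ₐ[ℂ] A}
    (hB : ∀ g, φ ⟨FieldAlg.B e g, B_mem e g⟩ = ψ ⟨FieldAlg.B e g, B_mem e g⟩) : φ = ψ := by
  refine StarAlgHom.ext_topologicalClosure (CAR_continuous φ) (CAR_continuous ψ) ?_
  refine StarAlgHom.ext_adjoin ?_
  rintro ⟨_, _⟩ ⟨g, rfl⟩
  exact hB g

/-- An operator commuting with the generators and their adjoints commutes with the closed
subalgebra. -/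
theorem mem_invariant {H : Type*} [NormedAddCommGroup H] [InnerProductSpace ℂ H] [CompleteSpace H]
    {s : Set (FieldAlg e)} (π : (StarAlgebra.adjoin ℂ s).topologicalClosure →⋆ₐ[ℂ] (H →L[ℂ] H))
    (hπ : Continuous π) {M : Submodule ℂ H} (hM : IsClosed (M : Set H))
    (h : ∀ a (ha : a ∈ s), ∀ ψ ∈ M,
      π ⟨a, StarSubalgebra.le_topologicalClosure _ (StarAlgebra.subset_adjoin ℂ s ha)⟩ ψ ∈ M ∧
      star (π ⟨a, StarSubalgebra.le_topologicalClosure _ (StarAlgebra.subset_adjoin ℂ s ha)⟩) ψ ∈ M)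
    (a) {ψ : H} (hψ : ψ ∈ M) : π a ψ ∈ M := by
  refine closure_adjoin_induction (P := fun a => π a ψ ∈ M)
    (hM.preimage ((ContinuousLinearMap.apply ℂ H ψ).continuous.comp hπ)) (fun a ha => ?_) a
  suffices key : ∀ ψ ∈ M, π ⟨a, StarSubalgebra.le_topologicalClosure _ ha⟩ ψ ∈ M ∧
      star (π ⟨a, StarSubalgebra.le_topologicalClosure _ ha⟩) ψ ∈ M from (key ψ hψ).1
  clear hψ ψ
  induction ha using StarAlgebra.adjoin_induction with
  | mem a ha => exact h a ha
  | algebraMap r =>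
    intro ψ hψ
    have : π ⟨algebraMap ℂ (FieldAlg e) r, StarSubalgebra.le_topologicalClosure _
      (algebraMap_mem _ r)⟩ = r • 1 := by
      rw [← Algebra.algebraMap_eq_smul_one, ← AlgHomClass.commutes π r]; rfl
    rw [this, star_smul, star_one]
    exact ⟨M.smul_mem _ hψ, M.smul_mem _ hψ⟩
  | add a b ha hb h1 h2 =>
    intro ψ hψ
    have : π ⟨a + b, StarSubalgebra.le_topologicalClosure _ (add_mem ha hb)⟩
      = π ⟨a, StarSubalgebra.le_topologicalClosure _ ha⟩
        + π ⟨b, StarSubalgebra.le_topologicalClosure _ hb⟩ := by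
      rw [← _root_.map_add]; rfl
    rw [this, star_add]
    exact ⟨M.add_mem (h1 ψ hψ).1 (h2 ψ hψ).1, M.add_mem (h1 ψ hψ).2 (h2 ψ hψ).2⟩
  | mul a b ha hb h1 h2 =>
    intro ψ hψ
    have : π ⟨a * b, StarSubalgebra.le_topologicalClosure _ (mul_mem ha hb)⟩
      = π ⟨a, StarSubalgebra.le_topologicalClosure _ ha⟩
        * π ⟨b, StarSubalgebra.le_topologicalClosure _ hb⟩ := by
      rw [← map_mul]; rfl
    rw [this, star_mul]
    exact ⟨(h1 _ (h2 ψ hψ).1).1, (h2 _ (h1 ψ hψ).2).2⟩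
  | star a ha h1 =>
    intro ψ hψ
    have : π ⟨star a, StarSubalgebra.le_topologicalClosure _ (star_mem ha)⟩
      = star (π ⟨a, StarSubalgebra.le_topologicalClosure _ ha⟩) := by
      rw [← map_star]; rfl
    rw [this, star_star]
    exact ⟨(h1 ψ hψ).2, (h1 ψ hψ).1⟩

/-- Restriction of a *-representation to a closed invariant subspace. -/
def restrictRep {A : Type*} [Ring A] [StarRing A] [Algebra ℂ A] {H : Type*} [NormedAddCommGroup H]
    [InnerProductSpace ℂ H] [CompleteSpace H] (π : A →⋆ₐ[ℂ] (H →L[ℂ] H)) (M : Submodule ℂ H)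
    [CompleteSpace M] (hM : ∀ a, ∀ ψ ∈ M, π a ψ ∈ M) : A →⋆ₐ[ℂ] (M →L[ℂ] M) where
  toFun a := ((π a).comp M.subtypeL).codRestrict M fun ψ => hM a ψ.1 ψ.2
  map_one' := by ext ψ; simp
  map_zero' := by ext ψ; simp
  map_mul' a b := by
    refine ContinuousLinearMap.ext fun ψ => Subtype.ext ?_
    show π (a * b) ψ.1 = π a (π b ψ.1)
    rw [map_mul]; rfl
  map_add' a b := by
    refine ContinuousLinearMap.ext fun ψ => Subtype.ext ?_
    show π (a + b) ψ.1 = π a ψ.1 + π b ψ.1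
    rw [_root_.map_add]; rfl
  commutes' r := by
    refine ContinuousLinearMap.ext fun ψ => Subtype.ext ?_
    show π (algebraMap ℂ A r) ψ.1 = r • ψ.1
    rw [AlgHomClass.commutes, Algebra.algebraMap_eq_smul_one]; rfl
  map_star' a := by
    refine ContinuousLinearMap.ext fun ψ => ext_inner_left ℂ fun χ => ?_
    rw [ContinuousLinearMap.star_eq_adjoint, ContinuousLinearMap.adjoint_inner_right]
    show inner ℂ χ.1 (π (star a) ψ.1) = inner ℂ (π a χ.1) ψ.1
    rw [map_star, ContinuousLinearMap.star_eq_adjoint, ContinuousLinearMap.adjoint_inner_right]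

theorem restrictRep_apply {A : Type*} [Ring A] [StarRing A] [Algebra ℂ A] {H : Type*}
    [NormedAddCommGroup H] [InnerProductSpace ℂ H] [CompleteSpace H] (π : A →⋆ₐ[ℂ] (H →L[ℂ] H))
    (M : Submodule ℂ H) [CompleteSpace M] (hM : ∀ a, ∀ ψ ∈ M, π a ψ ∈ M) (a : A) (ψ : M) :
    (restrictRep π M hM a ψ : H) = π a ψ.1 := rfl

end

/-! ## Product representations -/

section

variable {e : ℝ}

section Operators

variable {H : Type*} [NormedAddCommGroup H] [InnerProductSpace ℂ H] [CompleteSpace H]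

/-- The representation determined by operators satisfying the relations. -/
def liftRep {w : GaugeClass e → H →L[ℂ] H} {b : K → H →L[ℂ] H} (h : PreField.Relations w b) :
    FieldAlg e →⋆ₐ[ℂ] (H →L[ℂ] H) := FieldAlg.lift (A := H →L[ℂ] H) h

theorem liftRep_W {w : GaugeClass e → H →L[ℂ] H} {b : K → H →L[ℂ] H}
    (h : PreField.Relations w b) (V : testFields) : liftRep h (FieldAlg.W e V) = w (cls e V) :=
  FieldAlg.lift_W (A := H →L[ℂ] H) h V

theorem liftRep_B {w : GaugeClass e → H →L[ℂ] H} {b : K → H →L[ℂ] H}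
    (h : PreField.Relations w b) (g : K) : liftRep h (FieldAlg.B e g) = b g :=
  FieldAlg.lift_B (A := H →L[ℂ] H) h g

theorem rep_ext {π π' : FieldAlg e →⋆ₐ[ℂ] (H →L[ℂ] H)}
    (hW : ∀ V, π (FieldAlg.W e V) = π' (FieldAlg.W e V))
    (hB : ∀ g, π (FieldAlg.B e g) = π' (FieldAlg.B e g)) : π = π' :=
  FieldAlg.hom_ext (A := H →L[ℂ] H) hW hB

theorem CAR_rep_ext {π π' : CAR e →⋆ₐ[ℂ] (H →L[ℂ] H)}
    (h : ∀ g, π ⟨FieldAlg.B e g, B_mem e g⟩ = π' ⟨FieldAlg.B e g, B_mem e g⟩) : π = π' :=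
  CAR_hom_ext (A := H →L[ℂ] H) h

end Operators

/-- Conjugation of a representation with a unitary operator. -/
def conjRep {A : Type*} [Semiring A] [Algebra ℂ A] [Star A]
    {H : Type u} [NormedAddCommGroup H] [InnerProductSpace ℂ H] [CompleteSpace H]
    {H' : Type v} [NormedAddCommGroup H'] [InnerProductSpace ℂ H'] [CompleteSpace H']
    (T : H ≃ₗᵢ[ℂ] H') (π : A →⋆ₐ[ℂ] (H →L[ℂ] H)) : A →⋆ₐ[ℂ] (H' →L[ℂ] H') where
  toFun a := T.conjStarAlgEquiv (π a)
  map_one' := by rw [map_one, map_one]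
  map_mul' a b := by rw [map_mul, map_mul]
  map_zero' := by rw [_root_.map_zero, _root_.map_zero]
  map_add' a b := by rw [_root_.map_add, _root_.map_add]
  commutes' c := by
    rw [AlgHomClass.commutes, Algebra.algebraMap_eq_smul_one, map_smul, map_one,
      Algebra.algebraMap_eq_smul_one]
  map_star' a := by rw [map_star, map_star]

theorem conjRep_apply {A : Type*} [Semiring A] [Algebra ℂ A] [Star A]
    {H : Type u} [NormedAddCommGroup H] [InnerProductSpace ℂ H] [CompleteSpace H]
    {H' : Type v} [NormedAddCommGroup H'] [InnerProductSpace ℂ H'] [CompleteSpace H']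
    (T : H ≃ₗᵢ[ℂ] H') (π : A →⋆ₐ[ℂ] (H →L[ℂ] H)) (a : A) (ψ : H') :
    conjRep T π a ψ = T (π a (T.symm ψ)) := rfl

theorem isBog_S (e : ℝ) (V : testFields) : IsBog (S e V) where
  inner f g := inner_S e V f g
  comm σ g := freqProj_S e V σ g
  surj g := ⟨S e (-V) g, by rw [← S_add, add_neg_cancel, S_zero]⟩

theorem isBog_R (m : ℝ) (x : Spacetime) : IsBog (R m x) where
  inner f g := inner_R m x f g
  comm σ g := freqProj_R m x σ g
  surj g := ⟨R m (-x) g, by rw [← R_add, add_neg_cancel, R_zero]⟩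

theorem W_congr {V V' : testFields} (h : cls e V = cls e V') : FieldAlg.W e V = FieldAlg.W e V' := by
  unfold FieldAlg.W; rw [h]

/-- Weyl systems. -/
structure IsWeyl {H : Type*} [NormedAddCommGroup H] [InnerProductSpace ℂ H] [CompleteSpace H]
    (e : ℝ) (u : testFields → H →L[ℂ] H) : Prop where
  zero : u 0 = 1
  isometry : ∀ V, star (u V) * u V = 1
  mul : ∀ V V', u V * u V' = Complex.exp (-(I / 2) * symp V.1 V'.1) • u (V + V')
  congr : ∀ V V', cls e V = cls e V' → u V = u V'

theorem weylOpCCR_isWeyl {Hr : Type*} [NormedAddCommGroup Hr] [InnerProductSpace ℂ Hr]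
    [CompleteSpace Hr] (πr : CCR e →⋆ₐ[ℂ] (Hr →L[ℂ] Hr)) : IsWeyl e (weylOpCCR πr) where
  zero := by
    unfold weylOpCCR
    rw [← map_one πr]; congr 1; exact Subtype.ext FieldAlg.W_zero
  isometry V := by
    unfold weylOpCCR
    rw [← map_star, ← map_mul, ← map_one πr]; congr 1
    exact Subtype.ext (FieldAlg.W_star_mul V)
  mul V V' := by
    unfold weylOpCCR
    rw [← map_mul, ← map_smul]; congr 1
    exact Subtype.ext (FieldAlg.W_mul V V')
  congr V V' h := by
    unfold weylOpCCR
    congr 1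
    exact Subtype.ext (W_congr h)

theorem weylOp_isWeyl {H : Type*} [NormedAddCommGroup H] [InnerProductSpace ℂ H]
    [CompleteSpace H] (π : FieldAlg e →⋆ₐ[ℂ] (H →L[ℂ] H)) : IsWeyl e (weylOp π) where
  zero := by unfold weylOp; rw [FieldAlg.W_zero, map_one]
  isometry V := by unfold weylOp; rw [← map_star, ← map_mul, FieldAlg.W_star_mul, map_one]
  mul V V' := by unfold weylOp; rw [← map_mul, FieldAlg.W_mul, map_smul]
  congr V V' h := by unfold weylOp; rw [W_congr h]

section Product

variable {HF : Type v} [NormedAddCommGroup HF] [InnerProductSpace ℂ HF] [CompleteSpace HF]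
  {Hr : Type u} [NormedAddCommGroup Hr] [InnerProductSpace ℂ Hr] [CompleteSpace Hr]
  {b : K → HF →L[ℂ] HF} {Ω : HF} {u : testFields → Hr →L[ℂ] Hr}

/-- The Weyl operators `Γ(S_{Φ_V}) ⊗ u(V)`. -/
def productWeyl (hF : IsFock b Ω) (hu : IsWeyl e u) (V : testFields) :
    HTensor HF Hr →L[ℂ] HTensor HF Hr :=
  (tensorIso (hF.Γ (isBog_S e V)) (isoOf (u V) (hu.isometry V))).toContinuousLinearMap

theorem productWeyl_htmul (hF : IsFock b Ω) (hu : IsWeyl e u) (V : testFields) (ψ : HF) (φ : Hr) :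
    productWeyl hF hu V (htmul ψ φ) = htmul (hF.Γ (isBog_S e V) ψ) (u V φ) :=
  tensorIso_htmul _ _ ψ φ

theorem productWeyl_isWeyl (he : e ≠ 0) (hF : IsFock b Ω) (hu : IsWeyl e u) :
    IsWeyl e (productWeyl hF hu) where
  zero := tensor_ext fun ψ φ => by
    rw [productWeyl_htmul, hF.Γ_id _ (S_zero e), hu.zero]; rfl
  isometry V := by
    rw [ContinuousLinearMap.star_eq_adjoint]
    exact (ContinuousLinearMap.norm_map_iff_adjoint_comp_self _).1
      (tensorIso (hF.Γ (isBog_S e V)) (isoOf (u V) (hu.isometry V))).norm_map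
  mul V V' := tensor_ext fun ψ φ => by
    have h := congrArg (fun T => T φ) (hu.mul V V')
    simp only [mul_apply_eq_comp, _root_.smul_apply] at h
    rw [mul_apply_eq_comp, productWeyl_htmul, productWeyl_htmul, _root_.smul_apply,
      productWeyl_htmul, h, htmul_smul_right,
      hF.Γ_comp (isBog_S e V) (isBog_S e V') (isBog_S e (V + V')) fun g => (S_add e V V' g).symm]
  congr V V' h := tensor_ext fun ψ φ => by
    have h1 := S_congr he h
    rw [productWeyl_htmul, productWeyl_htmul, hu.congr V V' h]
    congr 2
    simp only [h1]

theorem relations_of_isWeyl {H : Type*} [NormedAddCommGroup H] [InnerProductSpace ℂ H]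
    [CompleteSpace H] {B : K → H →L[ℂ] H} {w : testFields → H →L[ℂ] H} (hw : IsWeyl e w)
    (hB : IsCAR B) (h : ∀ V g, w V * B g = B (S e V g) * w V) :
    PreField.Relations (e := e) (fun x => w (Quotient.out x)) B := by
  have key : ∀ V, w (Quotient.out (cls e V)) = w V := fun V =>
    hw.congr _ _ (Quotient.out_eq (cls e V))
  have hinv : ∀ V, star (w V) = w (-V) := by
    intro V
    have h1 : w V * w (-V) = 1 := by
      have hs : symp V.1 (-V : testFields).1 = 0 := by
        have h1 := symp_add_right V V (-V)
        rw [add_neg_cancel] at h1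
        have h2 : symp V.1 V.1 = 0 := by linarith [symp_antisymm V V]
        have h3 : symp V.1 (0 : testFields).1 = 0 := by
          have := symp_add_right V 0 0
          rw [add_zero] at this; linarith
        linarith
      rw [hw.mul, add_neg_cancel, hw.zero, hs]; simp
    calc star (w V) = star (w V) * (w V * w (-V)) := by rw [h1, mul_one]
      _ = _ := by rw [← mul_assoc, hw.isometry, one_mul]
  refine ⟨fun x => ?_, ?_, fun V V' => ?_, hB.add, hB.smul, hB.anti, fun f g => ?_, fun V g => ?_⟩
  · obtain ⟨V, rfl⟩ := QuotientAddGroup.mk_surjective x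
    show star (w (Quotient.out (cls e V))) = w (Quotient.out (-cls e V))
    have : -cls e V = cls e (-V) := rfl
    rw [this, key, key, hinv]
  · have : (0 : GaugeClass e) = cls e 0 := rfl
    rw [this, key, hw.zero]
  · rw [key, key, key, hw.mul]
  · rw [hB.anti_star, Algebra.algebraMap_eq_smul_one]
  · rw [key, h]

theorem product_relations (he : e ≠ 0) (hF : IsFock b Ω) (hu : IsWeyl e u) :
    PreField.Relations (e := e) (fun x => productWeyl hF hu (Quotient.out x))
      (fun g => amp Hr (b g)) :=
  relations_of_isWeyl (productWeyl_isWeyl he hF hu) (hF.car.map (amp Hr)) fun V g =>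
    tensor_ext fun ψ φ => by
      rw [mul_apply_eq_comp, mul_apply_eq_comp, amp_htmul, productWeyl_htmul, productWeyl_htmul,
        amp_htmul, hF.Γ_field]

/-- The representation of the field algebra on the tensor product. -/
def productRep (he : e ≠ 0) (hF : IsFock b Ω) (hu : IsWeyl e u) :
    FieldAlg e →⋆ₐ[ℂ] (HTensor HF Hr →L[ℂ] HTensor HF Hr) :=
  liftRep (product_relations he hF hu)

theorem productRep_W (he : e ≠ 0) (hF : IsFock b Ω) (hu : IsWeyl e u) (V : testFields) (ψ : HF)
    (φ : Hr) : productRep he hF hu (FieldAlg.W e V) (htmul ψ φ)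
      = htmul (hF.Γ (isBog_S e V) ψ) (u V φ) := by
  unfold productRep
  rw [liftRep_W, ← productWeyl_htmul hF hu]
  congr 1
  exact (productWeyl_isWeyl he hF hu).congr _ _ (Quotient.out_eq (cls e V))

theorem productRep_B (he : e ≠ 0) (hF : IsFock b Ω) (hu : IsWeyl e u) (g : K) :
    productRep he hF hu (FieldAlg.B e g) = amp Hr (b g) := liftRep_B _ g

end Product

namespace FockRep

variable {HF : Type v} [NormedAddCommGroup HF] [InnerProductSpace ℂ HF] [CompleteSpace HF]
  (F : FockRep e HF)

theorem isCAR : IsCAR F.field := isCAR_B (B_mem e) F.π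

theorem isVac : IsVac F.field F.Ω := isVac_iff.2 ⟨F.annihilate_pos, F.annihilate_neg⟩

theorem isFock : IsFock F.field F.Ω where
  car := F.isCAR
  vac := F.isVac
  norm_vac := F.norm_Ω
  total := by
    have hM : ∀ A : HF →L[ℂ] HF, (∀ ψ ∈ Submodule.span ℂ (Set.range fun w =>
        crWord F.field w F.Ω), A ψ ∈ Submodule.span ℂ (Set.range fun w => crWord F.field w F.Ω)) →
        ∀ ψ ∈ (Submodule.span ℂ (Set.range fun w => crWord F.field w F.Ω)).topologicalClosure,
        A ψ ∈ (Submodule.span ℂ (Set.range fun w => crWord F.field w F.Ω)).topologicalClosure := by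
      intro A hA ψ hψ
      exact Set.MapsTo.closure (s := (Submodule.span ℂ (Set.range fun w =>
        crWord F.field w F.Ω) : Set HF)) hA A.continuous hψ
    have hr : (Set.range fun w => crWord F.field w F.Ω)
        = Set.range fun p : List Mode × Unit => crWord F.field p.1 F.Ω := by
      ext ψ; simp
    have key : ∀ C, F.π C F.Ω ∈ (Submodule.span ℂ (Set.range fun w =>
        crWord F.field w F.Ω)).topologicalClosure := by
      intro C
      refine mem_invariant F.π (CAR_continuous F.π) (Submodule.isClosed_topologicalClosure _) ?_ C
        (Submodule.le_topologicalClosure _ (Submodule.subset_span ⟨[], rfl⟩))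
      rintro _ ⟨g, rfl⟩ ψ hψ
      refine ⟨hM (F.field g) (fun ψ hψ => ?_) ψ hψ, hM (star (F.field g)) (fun ψ hψ => ?_) ψ hψ⟩
      · rw [hr] at hψ ⊢
        exact (field_mem_span (φ := fun _ : Unit => F.Ω) F.isCAR (fun _ => F.isVac) g hψ).1
      · rw [hr] at hψ ⊢
        exact (field_mem_span (φ := fun _ : Unit => F.Ω) F.isCAR (fun _ => F.isVac) g hψ).2
    intro ψ
    have h1 := F.cyclic ψ
    refine (closure_minimal ?_ (Submodule.isClosed_topologicalClosure _)) h1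
    rintro _ ⟨C, rfl⟩
    exact key C

theorem total : Dense (Submodule.span ℂ (Set.range fun C => F.π C F.Ω) : Set HF) :=
  F.cyclic.mono Submodule.subset_span

/-- The unitary implementing `β_{Φ_V}` in the Fock representation. -/
def Γ (V : testFields) : HF →ₗᵢ[ℂ] HF := F.isFock.Γ (isBog_S e V)

theorem Γ_π (V : testFields) (C : CAR e) (ψ : HF) : F.Γ V (F.π C ψ)
    = F.π ⟨beta e V C.1, beta_mem_CAR e V C.2⟩ (F.Γ V ψ) := by
  let T := LinearIsometryEquiv.ofSurjective (F.Γ V) (F.isFock.Γ_surjective _)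
  let ρ₁ : CAR e →⋆ₐ[ℂ] (HF →L[ℂ] HF) := conjRep T F.π
  let ρ₂ : CAR e →⋆ₐ[ℂ] (HF →L[ℂ] HF) := F.π.comp
    (((beta e V).comp (CAR e).subtype).codRestrict (CAR e) fun C => beta_mem_CAR e V C.2)
  have h : ρ₁ = ρ₂ := by
    refine CAR_rep_ext fun g => ContinuousLinearMap.ext fun ψ => ?_
    show T (F.field g (T.symm ψ)) = F.π ⟨beta e V (FieldAlg.B e g), _⟩ ψ
    have h1 : T (F.field g (T.symm ψ)) = F.field (S e V g) (T (T.symm ψ)) :=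
      F.isFock.Γ_field (isBog_S e V) g (T.symm ψ)
    rw [h1, T.apply_symm_apply]
    unfold field
    congr 2
    exact Subtype.ext (beta_B e V g).symm
  have h2 := congrArg (fun ρ => ρ C (T ψ)) h
  have h3 : T (F.π C (T.symm (T ψ))) = F.π ⟨beta e V C.1, beta_mem_CAR e V C.2⟩ (T ψ) := h2
  rwa [T.symm_apply_apply] at h3

theorem Γ_vac (V : testFields) : F.Γ V F.Ω = F.Ω := F.isFock.Γ_vac _

end FockRep

section Product

variable {HF : Type v} [NormedAddCommGroup HF] [InnerProductSpace ℂ HF] [CompleteSpace HF]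
  {Hr : Type u} [NormedAddCommGroup Hr] [InnerProductSpace ℂ Hr] [CompleteSpace Hr]
  {F : FockRep e HF} {πr : CCR e →⋆ₐ[ℂ] (Hr →L[ℂ] Hr)}
  {π : FieldAlg e →⋆ₐ[ℂ] (HTensor HF Hr →L[ℂ] HTensor HF Hr)}

theorem IsProductRep.field (h : IsProductRep F πr π) (g : K) :
    π (FieldAlg.B e g) = amp Hr (F.field g) :=
  tensor_ext fun ψ φ => by rw [amp_htmul]; exact h.car ⟨FieldAlg.B e g, B_mem e g⟩ ψ φ

theorem IsProductRep.weyl_htmul (h : IsProductRep F πr π) (V : testFields) (ψ : HF) (φ : Hr) :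
    weylOp π V (htmul ψ φ) = htmul (F.Γ V ψ) (weylOpCCR πr V φ) := by
  have := clm_ext_of_total F.total (A := weylOp π V ∘L htmulLeft HF φ)
    (B := htmulLeft HF (weylOpCCR πr V φ) ∘L (F.Γ V).toContinuousLinearMap) (fun C => by
      show weylOp π V (htmul _ φ) = htmul (F.Γ V _) _
      rw [h.weyl, F.Γ_π, F.Γ_vac])
  exact congrArg (fun T => T ψ) this

theorem exists_isProductRep (he : e ≠ 0) (F : FockRep e HF) (πr : CCR e →⋆ₐ[ℂ] (Hr →L[ℂ] Hr)) :
    ∃ π, IsProductRep F πr π := by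
  have hu := weylOpCCR_isWeyl πr
  refine ⟨productRep he F.isFock hu, fun C ψ φ => ?_, fun V C φ => ?_⟩
  · have h : (productRep he F.isFock hu).comp (CAR e).subtype = (amp Hr).comp F.π :=
      CAR_rep_ext fun g => productRep_B he F.isFock hu g
    have h2 := congrArg (fun ρ => ρ C (htmul ψ φ)) h
    exact h2.trans (amp_htmul _ _ _)
  · unfold weylOp
    rw [productRep_W]
    congr 1
    have h1 := F.Γ_π V C F.Ω
    rw [F.Γ_vac] at h1
    exact h1

theorem IsProductRep.unique {π' : FieldAlg e →⋆ₐ[ℂ] (HTensor HF Hr →L[ℂ] HTensor HF Hr)}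
    (h : IsProductRep F πr π) (h' : IsProductRep F πr π') : π' = π := by
  refine rep_ext (fun V => tensor_ext fun ψ φ => ?_) fun g => ?_
  · exact (h'.weyl_htmul V ψ φ).trans (h.weyl_htmul V ψ φ).symm
  · rw [h'.field, h.field]

end Product

end

/-! ## Weighted shifts on `ℓ²` -/

section Shift

variable {α : Type*}

theorem summable_norm_sq (ψ : lp (fun _ : α => ℂ) 2) : Summable fun x => ‖ψ x‖ ^ 2 := by
  have := (lp.memℓp ψ).summable (by norm_num)
  simpa using this

theorem norm_sq_eq_tsum (ψ : lp (fun _ : α => ℂ) 2) : ‖ψ‖ ^ 2 = ∑' x, ‖ψ x‖ ^ 2 := by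
  have := lp.norm_rpow_eq_tsum (p := 2) (by norm_num) ψ
  simpa using this

theorem memlp_two {f : α → ℂ} (h : Summable fun x => ‖f x‖ ^ 2) :
    Memℓp (E := fun _ : α => ℂ) f 2 :=
  memℓp_gen (by simpa using h)

theorem summable_shift (σ : Equiv.Perm α) {c : α → ℂ} (hc : ∀ x, ‖c x‖ ≤ 1)
    (ψ : lp (fun _ : α => ℂ) 2) : Summable fun x => ‖c x * ψ (σ x)‖ ^ 2 := by
  refine Summable.of_nonneg_of_le (fun _ => by positivity) (fun x => ?_)
    ((Equiv.summable_iff σ).2 (summable_norm_sq ψ))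
  rw [norm_mul, mul_pow]
  exact mul_le_of_le_one_left (by positivity) (pow_le_one₀ (norm_nonneg _) (hc x))

/-- The operator `(Tψ)(x) = c(x) ψ(σ x)`. -/
def shiftOp (σ : Equiv.Perm α) (c : α → ℂ) (hc : ∀ x, ‖c x‖ ≤ 1) :
    lp (fun _ : α => ℂ) 2 →L[ℂ] lp (fun _ : α => ℂ) 2 :=
  LinearMap.mkContinuous
    { toFun := fun ψ => ⟨fun x => c x * ψ (σ x), memlp_two (summable_shift σ hc ψ)⟩
      map_add' := fun ψ φ => by
        refine lp.ext (funext fun x => ?_)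
        show c x * (ψ (σ x) + φ (σ x)) = c x * ψ (σ x) + c x * φ (σ x)
        ring
      map_smul' := fun a ψ => by
        refine lp.ext (funext fun x => ?_)
        show c x * (a * ψ (σ x)) = a * (c x * ψ (σ x))
        ring } 1 fun ψ => by
    rw [one_mul]
    refine le_of_sq_le_sq ?_ (norm_nonneg _)
    rw [norm_sq_eq_tsum, norm_sq_eq_tsum, ← Equiv.tsum_eq σ fun x => ‖ψ x‖ ^ 2]
    refine Summable.tsum_le_tsum (fun x => ?_) (summable_shift σ hc ψ)
      ((Equiv.summable_iff σ).2 (summable_norm_sq ψ))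
    show ‖c x * ψ (σ x)‖ ^ 2 ≤ _
    rw [norm_mul, mul_pow]
    exact mul_le_of_le_one_left (by positivity) (pow_le_one₀ (norm_nonneg _) (hc x))

theorem shiftOp_apply (σ : Equiv.Perm α) {c : α → ℂ} (hc : ∀ x, ‖c x‖ ≤ 1)
    (ψ : lp (fun _ : α => ℂ) 2) (x : α) : shiftOp σ c hc ψ x = c x * ψ (σ x) := rfl

theorem star_shiftOp_apply (σ : Equiv.Perm α) {c : α → ℂ} (hc : ∀ x, ‖c x‖ ≤ 1)
    (ψ : lp (fun _ : α => ℂ) 2) (x : α) :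
    star (shiftOp σ c hc) ψ x = star (c (σ.symm x)) * ψ (σ.symm x) := by
  have hc' : ∀ x, ‖star (c (σ.symm x))‖ ≤ 1 := fun x => by rw [norm_star]; exact hc _
  have h : star (shiftOp σ c hc) = shiftOp σ.symm (fun x => star (c (σ.symm x))) hc' := by
    rw [ContinuousLinearMap.star_eq_adjoint, eq_comm, ContinuousLinearMap.eq_adjoint_iff]
    intro φ χ
    rw [lp.inner_eq_tsum, lp.inner_eq_tsum, ← Equiv.tsum_eq σ]
    refine tsum_congr fun x => ?_
    rw [shiftOp_apply, shiftOp_apply, σ.symm_apply_apply]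
    simp only [RCLike.inner_apply, map_mul]
    simp
    ring
  rw [h]; rfl

theorem lp_ext {ψ φ : lp (fun _ : α => ℂ) 2} (h : ∀ x, ψ x = φ x) : ψ = φ :=
  lp.ext (funext h)

theorem lp_clm_ext {S T : lp (fun _ : α => ℂ) 2 →L[ℂ] lp (fun _ : α => ℂ) 2}
    (h : ∀ ψ x, S ψ x = T ψ x) : S = T := ContinuousLinearMap.ext fun ψ => lp_ext (h ψ)

end Shift

/-! ## The twisted regular representation of the Weyl relations -/

section Twisted

variable {e : ℝ}

theorem symp_out (V : testFields) (V' : testFields) :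
    symp V.1 (Quotient.out (cls e V') : testFields).1 = symp V.1 V'.1 :=
  symp_congr (e := e) rfl (Quotient.out_eq (cls e V'))

/-- Twisted translations on `ℓ²` of the group of classes. -/
def twistedShift (e : ℝ) (V : testFields) :
    lp (fun _ : GaugeClass e => ℂ) 2 →L[ℂ] lp (fun _ : GaugeClass e => ℂ) 2 :=
  shiftOp (Equiv.subRight (cls e V))
    (fun x => Complex.exp (-(I / 2) * symp V.1 (Quotient.out x : testFields).1)) fun x => by
    rw [show -(I / 2) * (symp V.1 (Quotient.out x : testFields).1 : ℂ)
      = ((-(symp V.1 (Quotient.out x : testFields).1 / 2) : ℝ) : ℂ) * I by push_cast; ring,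
      Complex.norm_exp_ofReal_mul_I]

theorem twistedShift_apply (V V' : testFields) (ψ : lp (fun _ : GaugeClass e => ℂ) 2) :
    twistedShift e V ψ (cls e V')
      = Complex.exp (-(I / 2) * symp V.1 V'.1) * ψ (cls e (V' - V)) := by
  unfold twistedShift
  rw [shiftOp_apply, symp_out]; rfl

theorem symp_zero_left' (V : testFields) : symp (0 : testFields).1 V.1 = 0 := by
  have := symp_add_left 0 0 V
  rw [add_zero] at this; linarith

theorem symp_neg_right' (V W : testFields) : symp V.1 (-W : testFields).1 = -symp V.1 W.1 := by
  have h1 := symp_add_right V W (-W)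
  rw [add_neg_cancel] at h1
  have h3 : symp V.1 (0 : testFields).1 = 0 := by
    have := symp_add_right V 0 0
    rw [add_zero] at this; linarith
  linarith

theorem twistedShift_isWeyl (e : ℝ) : IsWeyl e (twistedShift e) := by
  have hext : ∀ {S T : lp (fun _ : GaugeClass e => ℂ) 2 →L[ℂ] lp (fun _ : GaugeClass e => ℂ) 2},
      (∀ ψ V, S ψ (cls e V) = T ψ (cls e V)) → S = T := fun h => lp_clm_ext fun ψ x => by
    obtain ⟨V, rfl⟩ := QuotientAddGroup.mk_surjective x
    exact h ψ V
  refine ⟨hext fun ψ V => ?_, fun V => hext fun ψ V' => ?_, fun V V' => hext fun ψ V'' => ?_,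
    fun V V' h => hext fun ψ V'' => ?_⟩
  · rw [twistedShift_apply, symp_zero_left', sub_zero]; simp
  · rw [mul_apply_eq_comp]
    unfold twistedShift
    rw [star_shiftOp_apply]
    have : (Equiv.subRight (cls e V)).symm (cls e V') = cls e (V' + V) := rfl
    rw [this, shiftOp_apply, symp_out]
    have h2 : Equiv.subRight (cls e V) (cls e (V' + V)) = cls e (V' + V - V) := rfl
    rw [h2, add_sub_cancel_right, ← mul_assoc, one_apply_eq_self]
    rw [show star (Complex.exp (-(I / 2) * symp V.1 (V' + V).1))
      * Complex.exp (-(I / 2) * symp V.1 (V' + V).1) = 1 from ?_, one_mul]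
    rw [RCLike.star_def, ← Complex.exp_conj, ← Complex.exp_add]
    simp [Complex.conj_ofNat]
    rw [← Complex.exp_zero]; congr 1; ring
  · rw [mul_apply_eq_comp, _root_.smul_apply, twistedShift_apply, twistedShift_apply]
    show _ = Complex.exp _ * (twistedShift e (V + V') ψ (cls e V''))
    rw [twistedShift_apply, ← mul_assoc, ← mul_assoc, ← Complex.exp_add, ← Complex.exp_add,
      sub_sub, add_comm V V']
    have h1 : symp V'.1 (V'' - V).1 = symp V'.1 V''.1 + symp V.1 V'.1 := by
      rw [sub_eq_add_neg, symp_add_right, symp_neg_right', symp_antisymm V' V]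
    rw [h1, add_comm V' V, symp_add_left]
    congr 2
    push_cast; ring
  · rw [twistedShift_apply, twistedShift_apply, symp_congr (e := e) h rfl]
    have : cls e (V'' - V) = cls e (V'' - V') := by
      show cls e V'' - cls e V = cls e V'' - cls e V'
      rw [h]
    rw [this]

end Twisted

/-! ## The Jordan-Wigner representation of the anticommutation relations -/

section JordanWigner

variable {ι : Type*} [LinearOrder ι]

/-- Toggling the occupation of a mode. -/
def toggle (i : ι) (X : Finset ι) : Finset ι := if i ∈ X then X.erase i else insert i X

theorem mem_toggle_self (i : ι) (X : Finset ι) : i ∈ toggle i X ↔ i ∉ X := by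
  unfold toggle; split_ifs with h <;> simp [h]

theorem mem_toggle_of_ne {i j : ι} (h : i ≠ j) (X : Finset ι) : i ∈ toggle j X ↔ i ∈ X := by
  unfold toggle; split_ifs <;> simp [h]

theorem toggle_toggle (i : ι) (X : Finset ι) : toggle i (toggle i X) = X := by
  ext j
  by_cases h : j = i
  · subst h; rw [mem_toggle_self, mem_toggle_self, not_not]
  · rw [mem_toggle_of_ne h, mem_toggle_of_ne h]

theorem toggle_comm (i j : ι) (X : Finset ι) : toggle i (toggle j X) = toggle j (toggle i X) := by
  ext k
  by_cases hi : k = i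
  · subst hi
    by_cases hj : k = j
    · subst hj; rfl
    · rw [mem_toggle_self, mem_toggle_of_ne hj, mem_toggle_of_ne hj, mem_toggle_self]
  · rw [mem_toggle_of_ne hi]
    by_cases hj : k = j
    · subst hj; rw [mem_toggle_self, mem_toggle_self, mem_toggle_of_ne hi]
    · rw [mem_toggle_of_ne hj, mem_toggle_of_ne hj, mem_toggle_of_ne hi]

/-- `toggle` as a permutation. -/
def togglePerm (i : ι) : Equiv.Perm (Finset ι) := 
  Function.Involutive.toPerm (toggle i) (toggle_toggle i)

/-- The Jordan-Wigner sign. -/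
def jwSign (i : ι) (X : Finset ι) : ℂ := ∏ j ∈ X, if j < i then -1 else 1

theorem jwSign_toggle (i j : ι) (X : Finset ι) :
    jwSign i (toggle j X) = (if j < i then -1 else 1) * jwSign i X := by
  unfold toggle jwSign
  split_ifs with h h1 h1
  · rw [← Finset.mul_prod_erase X _ h, if_pos h1]; ring
  · rw [← Finset.mul_prod_erase X _ h, if_neg h1]; ring
  · rw [Finset.prod_insert h, if_pos h1]
  · rw [Finset.prod_insert h, if_neg h1]

theorem jwSign_mul_self (i : ι) (X : Finset ι) : jwSign i X * jwSign i X = 1 := by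
  unfold jwSign
  rw [← Finset.prod_mul_distrib]
  refine Finset.prod_eq_one fun j _ => ?_
  split_ifs <;> norm_num

theorem star_jwSign (i : ι) (X : Finset ι) : star (jwSign i X) = jwSign i X := by
  unfold jwSign
  rw [star_prod]
  refine Finset.prod_congr rfl fun j _ => ?_
  split_ifs <;> simp

theorem norm_jwSign (i : ι) (X : Finset ι) : ‖jwSign i X‖ = 1 := by
  have h := congrArg norm (jwSign_mul_self i X)
  rw [norm_mul, norm_one] at h
  nlinarith [norm_nonneg (jwSign i X)]

/-- The coefficient of the field operator of the mode `i`; `t` tells the filled modes. -/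
def jwCoeff (t : ι → Prop) (i : ι) (X : Finset ι) : ℂ :=
  open Classical in if (i ∈ X ↔ t i) then jwSign i X else 0

theorem jwCoeff_pos {t : ι → Prop} {i : ι} {X : Finset ι} (h : i ∈ X ↔ t i) :
    jwCoeff t i X = jwSign i X := if_pos h

theorem jwCoeff_neg {t : ι → Prop} {i : ι} {X : Finset ι} (h : ¬(i ∈ X ↔ t i)) :
    jwCoeff t i X = 0 := if_neg h

theorem jwCoeff_toggle_self_pos {t : ι → Prop} {i : ι} {X : Finset ι} (h : i ∈ X ↔ t i) :
    jwCoeff t i (toggle i X) = 0 := jwCoeff_neg (by rw [mem_toggle_self]; tauto)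

theorem jwCoeff_toggle_self_neg {t : ι → Prop} {i : ι} {X : Finset ι} (h : ¬(i ∈ X ↔ t i)) :
    jwCoeff t i (toggle i X) = jwSign i X := by
  rw [jwCoeff_pos (by rw [mem_toggle_self]; tauto), jwSign_toggle, if_neg (lt_irrefl i), one_mul]

theorem norm_jwCoeff_le (t : ι → Prop) (i : ι) (X : Finset ι) : ‖jwCoeff t i X‖ ≤ 1 := by
  unfold jwCoeff; split_ifs
  · exact (norm_jwSign i X).le
  · simp

theorem star_jwCoeff (t : ι → Prop) (i : ι) (X : Finset ι) :
    star (jwCoeff t i X) = jwCoeff t i X := by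
  unfold jwCoeff; split_ifs
  · exact star_jwSign i X
  · simp

theorem jwCoeff_toggle_ne (t : ι → Prop) {i j : ι} (h : i ≠ j) (X : Finset ι) :
    jwCoeff t i (toggle j X) = (if j < i then -1 else 1) * jwCoeff t i X := by
  by_cases h1 : i ∈ X ↔ t i
  · rw [jwCoeff_pos h1, jwCoeff_pos (by rwa [mem_toggle_of_ne h]), jwSign_toggle]
  · rw [jwCoeff_neg h1, jwCoeff_neg (by rwa [mem_toggle_of_ne h]), mul_zero]

theorem jwCoeff_anti (t : ι → Prop) (i j : ι) (X : Finset ι) :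
    jwCoeff t i X * jwCoeff t j (toggle i X) + jwCoeff t j X * jwCoeff t i (toggle j X) = 0 := by
  by_cases h : i = j
  · subst h
    by_cases h1 : i ∈ X ↔ t i
    · rw [jwCoeff_toggle_self_pos h1]; simp
    · rw [jwCoeff_neg h1]; simp
  · rw [jwCoeff_toggle_ne t h, jwCoeff_toggle_ne t (Ne.symm h)]
    rcases lt_or_gt_of_ne h with h1 | h1
    · rw [if_pos h1, if_neg h1.not_gt]; ring
    · rw [if_neg h1.not_gt, if_pos h1]; ring

theorem jwCoeff_anti_star (t : ι → Prop) (i j : ι) (X : Finset ι) :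
    jwCoeff t i X * jwCoeff t j (toggle j (toggle i X))
      + jwCoeff t j (toggle j X) * jwCoeff t i (toggle j X) = if i = j then 1 else 0 := by
  by_cases h : i = j
  · subst h
    rw [if_pos rfl, toggle_toggle]
    by_cases h1 : i ∈ X ↔ t i
    · rw [jwCoeff_toggle_self_pos h1, jwCoeff_pos h1, jwSign_mul_self]; simp
    · rw [jwCoeff_toggle_self_neg h1, jwCoeff_neg h1, jwSign_mul_self]; simp
  · rw [if_neg h, toggle_comm, jwCoeff_toggle_ne t (Ne.symm h), jwCoeff_toggle_ne t h]
    rcases lt_or_gt_of_ne h with h1 | h1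
    · rw [if_pos h1, if_neg h1.not_gt]; ring
    · rw [if_neg h1.not_gt, if_pos h1]; ring

/-- The field operators of the modes. -/
def jwOp (t : ι → Prop) (i : ι) :
    lp (fun _ : Finset ι => ℂ) 2 →L[ℂ] lp (fun _ : Finset ι => ℂ) 2 :=
  shiftOp (togglePerm i) (jwCoeff t i) (norm_jwCoeff_le t i)

theorem jwOp_apply (t : ι → Prop) (i : ι) (ψ : lp (fun _ : Finset ι => ℂ) 2) (X : Finset ι) :
    jwOp t i ψ X = jwCoeff t i X * ψ (toggle i X) := rfl

theorem star_jwOp_apply (t : ι → Prop) (i : ι) (ψ : lp (fun _ : Finset ι => ℂ) 2) (X : Finset ι) :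
    star (jwOp t i) ψ X = jwCoeff t i (toggle i X) * ψ (toggle i X) := by
  unfold jwOp
  rw [star_shiftOp_apply, star_jwCoeff]; rfl

theorem jwOp_anti (t : ι → Prop) (i j : ι) : jwOp t i * jwOp t j + jwOp t j * jwOp t i = 0 :=
  lp_clm_ext fun ψ X => by
    show jwOp t i (jwOp t j ψ) X + jwOp t j (jwOp t i ψ) X = 0
    simp only [jwOp_apply]
    rw [toggle_comm j i, ← mul_assoc, ← mul_assoc, ← add_mul, jwCoeff_anti, zero_mul]

theorem jwOp_anti_star (t : ι → Prop) (i j : ι) :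
    jwOp t i * star (jwOp t j) + star (jwOp t j) * jwOp t i = if i = j then 1 else 0 :=
  lp_clm_ext fun ψ X => by
    show jwOp t i (star (jwOp t j) ψ) X + star (jwOp t j) (jwOp t i ψ) X = _
    simp only [jwOp_apply, star_jwOp_apply]
    have h := jwCoeff_anti_star t i j X
    rw [toggle_comm j i X] at h ⊢
    rw [← mul_assoc, ← mul_assoc, ← add_mul, h]
    split_ifs with h1
    · subst h1; rw [toggle_toggle, one_mul]; rfl
    · rw [zero_mul]; rfl

/-- The vacuum. -/
def jwVac (ι : Type*) [LinearOrder ι] : lp (fun _ : Finset ι => ℂ) 2 := lp.single 2 ∅ 1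

theorem single_eq (X Y : Finset ι) :
    (lp.single 2 X (1 : ℂ) : lp (fun _ : Finset ι => ℂ) 2) Y = if Y = X then 1 else 0 := by
  rw [lp.single_apply, Pi.single_apply]

theorem jwOp_vac (t : ι → Prop) {i : ι} (h : ¬ t i) : jwOp t i (jwVac ι) = 0 :=
  lp_ext fun X => by
    rw [jwOp_apply]; unfold jwVac; rw [single_eq]
    split_ifs with h1
    · have : i ∈ X := by
        by_contra h2
        have := (mem_toggle_self i X).2 h2
        rw [h1] at this; simp at this
      unfold jwCoeff
      rw [if_neg (by simp [this, h]), zero_mul]; rfl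
    · rw [mul_zero]; rfl

theorem star_jwOp_vac (t : ι → Prop) {i : ι} (h : t i) : star (jwOp t i) (jwVac ι) = 0 :=
  lp_ext fun X => by
    rw [star_jwOp_apply]; unfold jwVac; rw [single_eq]
    split_ifs with h1
    · unfold jwCoeff
      rw [h1, if_neg (by simp [h]), zero_mul]; rfl
    · rw [mul_zero]; rfl

theorem jwOp_single (t : ι → Prop) {i : ι} (h : t i) {X : Finset ι} (hi : i ∉ X) :
    jwOp t i (lp.single 2 X 1) = jwSign i X • lp.single 2 (insert i X) 1 :=
  lp_ext fun Y => by
    have hi' : toggle i X = insert i X := if_neg hi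
    rw [jwOp_apply]
    show _ = jwSign i X * (lp.single 2 (insert i X) (1 : ℂ) : lp (fun _ : Finset ι => ℂ) 2) Y
    rw [single_eq, single_eq]
    by_cases h1 : Y = insert i X
    · rw [if_pos h1, if_pos (by rw [h1, ← hi', toggle_toggle]), h1, ← hi']
      unfold jwCoeff
      rw [if_pos (by rw [mem_toggle_self]; simp [hi, h]), jwSign_toggle]; simp
    · rw [if_neg h1, if_neg (fun h2 => h1 (by rw [← hi', ← h2, toggle_toggle]))]
      simp

theorem star_jwOp_single (t : ι → Prop) {i : ι} (h : ¬ t i) {X : Finset ι} (hi : i ∉ X) :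
    star (jwOp t i) (lp.single 2 X 1) = jwSign i X • lp.single 2 (insert i X) 1 :=
  lp_ext fun Y => by
    have hi' : toggle i X = insert i X := if_neg hi
    rw [star_jwOp_apply]
    show _ = jwSign i X * (lp.single 2 (insert i X) (1 : ℂ) : lp (fun _ : Finset ι => ℂ) 2) Y
    rw [single_eq, single_eq]
    by_cases h1 : Y = insert i X
    · rw [if_pos h1, if_pos (by rw [h1, ← hi', toggle_toggle]), h1, ← hi', toggle_toggle]
      unfold jwCoeff
      rw [if_pos (by simp [hi, h])]
    · rw [if_neg h1, if_neg (fun h2 => h1 (by rw [← hi', ← h2, toggle_toggle]))]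
      simp

theorem norm_sq_sum_jwOp_le (t : ι → Prop) (c : ι → ℂ) (s : Finset ι) :
    ‖∑ i ∈ s, c i • jwOp t i‖ ^ 2 ≤ ∑ i ∈ s, ‖c i‖ ^ 2 := by
  set A := ∑ i ∈ s, c i • jwOp t i with hA
  have h1 : A * star A + star A * A = ((∑ i ∈ s, ‖c i‖ ^ 2 : ℝ) : ℂ) • 1 := by
    have hs : star A = ∑ j ∈ s, star (c j) • star (jwOp t j) := by
      rw [hA, star_sum]; simp only [star_smul]
    rw [hs, hA, Finset.sum_mul_sum, Finset.sum_mul_sum]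
    rw [Finset.sum_comm (s := s) (t := s) (f := fun i j => star (c i) • star (jwOp t i) *
      c j • jwOp t j), ← Finset.sum_add_distrib]
    simp only [← Finset.sum_add_distrib]
    have : ∀ i j, c i • jwOp t i * star (c j) • star (jwOp t j)
        + star (c j) • star (jwOp t j) * c i • jwOp t i
        = (c i * star (c j)) • (if i = j then 1 else 0) := by
      intro i j
      rw [← jwOp_anti_star t i j, smul_add, smul_mul_smul_comm, smul_mul_smul_comm,
        mul_comm (star (c j))]
    simp only [this]
    push_cast
    rw [Finset.sum_smul]
    refine Finset.sum_congr rfl fun i hi => ?_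
    rw [Finset.sum_eq_single i (fun j _ hj => by rw [if_neg (Ne.symm hj), smul_zero])
      (fun h => absurd hi h), if_pos rfl]
    congr 1
    rw [RCLike.star_def, RCLike.mul_conj]; rfl
  have h0 : (0 : ℝ) ≤ ∑ i ∈ s, ‖c i‖ ^ 2 := Finset.sum_nonneg fun _ _ => by positivity
  have h2 : ‖A‖ ≤ Real.sqrt (∑ i ∈ s, ‖c i‖ ^ 2) := by
    refine ContinuousLinearMap.opNorm_le_bound _ (Real.sqrt_nonneg _) fun ψ => ?_
    refine le_of_sq_le_sq ?_ (by positivity)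
    have h3 := congrArg (fun T => inner ℂ ψ (T ψ)) h1
    simp only [_root_.add_apply, _root_.smul_apply, mul_apply_eq_comp, inner_add_right,
      ContinuousLinearMap.star_eq_adjoint, ContinuousLinearMap.adjoint_inner_right,
      one_apply_eq_self, inner_smul_right] at h3
    rw [← ContinuousLinearMap.adjoint_inner_left, inner_self_eq_norm_sq_to_K,
      inner_self_eq_norm_sq_to_K, inner_self_eq_norm_sq_to_K] at h3
    have h4 : ‖ContinuousLinearMap.adjoint A ψ‖ ^ 2 + ‖A ψ‖ ^ 2
        = (∑ i ∈ s, ‖c i‖ ^ 2) * ‖ψ‖ ^ 2 := by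
      have h5 := congrArg Complex.re h3
      simpa [← Complex.ofReal_pow] using h5
    rw [mul_pow, Real.sq_sqrt h0]
    nlinarith [sq_nonneg ‖ContinuousLinearMap.adjoint A ψ‖]
  calc ‖A‖ ^ 2 ≤ Real.sqrt (∑ i ∈ s, ‖c i‖ ^ 2) ^ 2 := by gcongr
    _ = _ := Real.sq_sqrt h0

theorem summable_jwOp (t : ι → Prop) {c : ι → ℂ} (hc : Summable fun i => ‖c i‖ ^ 2) :
    Summable fun i => c i • jwOp t i := by
  rw [summable_iff_vanishing_norm]
  intro ε hε
  obtain ⟨s, hs⟩ := summable_iff_vanishing_norm.1 hc (ε ^ 2) (by positivity)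
  refine ⟨s, fun t' ht' => ?_⟩
  have h1 := hs t' ht'
  rw [Real.norm_of_nonneg (Finset.sum_nonneg fun _ _ => by positivity)] at h1
  exact lt_of_pow_lt_pow_left₀ 2 hε.le ((norm_sq_sum_jwOp_le t c t').trans_lt h1)

section Field

variable (B : HilbertBasis ι ℂ K) (t : ι → Prop)

/-- The field operators in the Jordan-Wigner representation. -/
def jwField (g : K) : lp (fun _ : Finset ι => ℂ) 2 →L[ℂ] lp (fun _ : Finset ι => ℂ) 2 :=
  ∑' i, inner ℂ g (B i) • jwOp t i

theorem hasSum_jwField (g : K) : HasSum (fun i => inner ℂ g (B i) • jwOp t i) (jwField B t g) := by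
  refine (summable_jwOp t ?_).hasSum
  have := summable_norm_sq (B.repr g)
  refine this.congr fun i => ?_
  rw [B.repr_apply_apply, norm_inner_symm]

theorem jwField_basis (i : ι) : jwField B t (B i) = jwOp t i := by
  refine (hasSum_jwField B t (B i)).unique ?_
  have h := hasSum_single (f := fun j => inner ℂ (B i) (B j) • jwOp t j) i fun j hj => by
    rw [B.orthonormal.inner_eq_zero (Ne.symm hj), zero_smul]
  have h1 : inner ℂ (B i) (B i) = (1 : ℂ) := by
    rw [inner_self_eq_norm_sq_to_K, B.orthonormal.norm_eq_one]; simp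
  rwa [h1, one_smul] at h

theorem isCAR_jwField : IsCAR (jwField B t) where
  add f g := by
    refine (hasSum_jwField B t (f + g)).unique ?_
    simpa only [inner_add_left, add_smul] using (hasSum_jwField B t f).add (hasSum_jwField B t g)
  smul c g := by
    refine (hasSum_jwField B t (c • g)).unique ?_
    simpa only [inner_smul_left, smul_smul, RCLike.star_def] using
      (hasSum_jwField B t g).const_smul (star c)
  anti f g := by
    have h1 : ∀ i, jwOp t i * jwField B t g + jwField B t g * jwOp t i = 0 := fun i => by
      refine (((hasSum_jwField B t g).mul_left (jwOp t i)).add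
        ((hasSum_jwField B t g).mul_right (jwOp t i))).unique ?_
      convert! hasSum_zero using 2 with j
      rw [mul_smul_comm, smul_mul_assoc, ← smul_add, jwOp_anti, smul_zero]
    refine (((hasSum_jwField B t f).mul_right (jwField B t g)).add
        ((hasSum_jwField B t f).mul_left (jwField B t g))).unique ?_
    convert! hasSum_zero using 2 with j
    rw [mul_smul_comm, smul_mul_assoc, ← smul_add, h1, smul_zero]
  anti_star f g := by
    have h1 : ∀ i, jwOp t i * star (jwField B t g) + star (jwField B t g) * jwOp t i
        = (inner ℂ (B i) g : ℂ) • 1 := fun i => by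
      refine (((hasSum_jwField B t g).star.mul_left (jwOp t i)).add
        ((hasSum_jwField B t g).star.mul_right (jwOp t i))).unique ?_
      have h2 : ∀ j, jwOp t i * star (inner ℂ g (B j) • jwOp t j)
          + star (inner ℂ g (B j) • jwOp t j) * jwOp t i
          = if i = j then (inner ℂ (B i) g : ℂ) • 1 else 0 := fun j => by
        rw [star_smul, mul_smul_comm, smul_mul_assoc, ← smul_add, jwOp_anti_star]
        split_ifs with h
        · subst h; rw [RCLike.star_def, inner_conj_symm]
        · rw [smul_zero]
      simp only [h2]
      have := hasSum_single (f := fun j => if i = j then (inner ℂ (B i) g : ℂ) •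
        (1 : lp (fun _ : Finset ι => ℂ) 2 →L[ℂ] lp (fun _ : Finset ι => ℂ) 2) else 0) i
        fun j hj => if_neg (Ne.symm hj)
      simpa using this
    refine (((hasSum_jwField B t f).mul_right (star (jwField B t g))).add
        ((hasSum_jwField B t f).mul_left (star (jwField B t g)))).unique ?_
    have h2 := (B.hasSum_inner_mul_inner f g).smul_const
      (1 : lp (fun _ : Finset ι => ℂ) 2 →L[ℂ] lp (fun _ : Finset ι => ℂ) 2)
    convert! h2 using 2 with i
    rw [mul_smul_comm, smul_mul_assoc, ← smul_add, h1, smul_smul]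

theorem isFock_jwField (hp : ∀ i, ¬ t i → freqProj true (B i) = B i)
    (hn : ∀ i, t i → freqProj false (B i) = B i) : IsFock (jwField B t) (jwVac ι) where
  car := isCAR_jwField B t
  norm_vac := by
    have := norm_sq_eq_tsum (jwVac ι)
    rw [tsum_eq_single ∅ (fun X hX => by unfold jwVac; rw [single_eq, if_neg hX]; simp)] at this
    unfold jwVac at this
    rw [single_eq, if_pos rfl, norm_one, one_pow] at this
    unfold jwVac
    nlinarith [norm_nonneg (lp.single 2 ∅ (1 : ℂ) : lp (fun _ : Finset ι => ℂ) 2)]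
  vac := by
    refine isVac_iff.2 ⟨fun g => ?_, fun g => ?_⟩
    · have h1 := (hasSum_jwField B t (freqProj true g)).mapL
        (ContinuousLinearMap.apply ℂ _ (jwVac ι))
      refine h1.unique ?_
      convert! hasSum_zero using 2 with i
      show inner ℂ (freqProj true g) (B i) • jwOp t i (jwVac ι) = 0
      by_cases h : t i
      · rw [← hn i h]
        have := freqProj_ortho true g (B i)
        rw [Bool.not_true] at this
        rw [this, zero_smul]
      · rw [jwOp_vac t h, smul_zero]
    · have h1 := (hasSum_jwField B t (freqProj false g)).star.mapL
        (ContinuousLinearMap.apply ℂ _ (jwVac ι))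
      refine h1.unique ?_
      convert! hasSum_zero using 2 with i
      show star (inner ℂ (freqProj false g) (B i) • jwOp t i) (jwVac ι) = 0
      rw [star_smul]
      show star (inner ℂ (freqProj false g) (B i)) • star (jwOp t i) (jwVac ι) = 0
      by_cases h : t i
      · rw [star_jwOp_vac t h, smul_zero]
      · rw [← hp i h]
        have := freqProj_ortho false g (B i)
        rw [Bool.not_false] at this
        rw [this, star_zero, zero_smul]
  total := by
    have key : ∀ X : Finset ι, ∃ w, ∃ c : ℂ, c ≠ 0 ∧
        crWord (jwField B t) w (jwVac ι) = c • lp.single 2 X 1 := by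
      intro X
      induction X using Finset.induction_on with
      | empty => exact ⟨[], 1, one_ne_zero, by rw [one_smul]; rfl⟩
      | insert i X hi ih =>
        obtain ⟨w, c, hc, h⟩ := ih
        have hs : jwSign i X ≠ 0 := fun h => by
          have := norm_jwSign i X
          rw [h, norm_zero] at this; norm_num at this
        by_cases h1 : t i
        · refine ⟨(false, B i) :: w, c * jwSign i X, mul_ne_zero hc hs, ?_⟩
          rw [crWord_cons, mul_apply_eq_comp, h, map_smul, mul_smul, ← jwOp_single t h1 hi,
            ← jwField_basis B t i]
          congr 2
          show jwField B t (freqProj false (B i)) = _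
          rw [hn i h1]
        · refine ⟨(true, B i) :: w, c * jwSign i X, mul_ne_zero hc hs, ?_⟩
          rw [crWord_cons, mul_apply_eq_comp, h, map_smul, mul_smul, ← star_jwOp_single t h1 hi,
            ← jwField_basis B t i]
          congr 2
          show star (jwField B t (freqProj true (B i))) = _
          rw [hp i h1]
    refine total_of_orthogonal fun u hu => lp_ext fun X => ?_
    obtain ⟨w, c, hc, h⟩ := key X
    have h1 := hu w
    rw [h, inner_smul_left, lp.inner_single_left] at h1
    have h2 := (mul_eq_zero.1 h1).resolve_left (by simpa using hc)
    simpa using h2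

end Field

end JordanWigner

theorem hilbertBasis_eq_zero {ι E : Type*} [NormedAddCommGroup E] [InnerProductSpace ℂ E]
    (B : HilbertBasis ι ℂ E) {x : E} (h : ∀ i, inner ℂ (B i) x = 0) : x = 0 := by
  have : B.repr x = 0 := lp_ext fun i => by rw [B.repr_apply_apply, h]; rfl
  simpa using this

/-- Existence of Fock representations of the anticommutation relations. -/
theorem exists_isFock : ∃ (α : Type) (b : K → lp (fun _ : α => ℂ) 2 →L[ℂ] lp (fun _ : α => ℂ) 2)
    (Ω : lp (fun _ : α => ℂ) 2), IsFock b Ω := by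
  obtain ⟨wp, bp, -⟩ := exists_hilbertBasis ℂ (freqSpace true)
  obtain ⟨wn, bn, -⟩ := exists_hilbertBasis ℂ (freqSpace false)
  let v : wp ⊕ wn → K := Sum.elim (fun i => (bp i : K)) fun i => (bn i : K)
  have hp : ∀ i, freqProj true (bp i : K) = bp i := fun i => mem_freqSpace.1 (bp i).2
  have hn : ∀ i, freqProj false (bn i : K) = bn i := fun i => mem_freqSpace.1 (bn i).2
  have hpn : ∀ i j, inner ℂ (bp i : K) (bn j : K) = 0 := fun i j => by
    rw [← hp i, ← hn j]; exact freqProj_ortho true _ _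
  have hnp : ∀ i j, inner ℂ (bn i : K) (bp j : K) = 0 := fun i j => by
    rw [← hn i, ← hp j]; exact freqProj_ortho false _ _
  have hv : Orthonormal ℂ v := by
    refine ⟨?_, ?_⟩
    · rintro (i | i)
      · exact bp.orthonormal.norm_eq_one i
      · exact bn.orthonormal.norm_eq_one i
    · rintro (i | i) (j | j) hij
      · exact bp.orthonormal.inner_eq_zero fun h => hij (by rw [h])
      · exact hpn i j
      · exact hnp i j
      · exact bn.orthonormal.inner_eq_zero fun h => hij (by rw [h])
  have ht : Dense (Submodule.span ℂ (Set.range v) : Set K) := by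
    refine total_of_orthogonal fun u hu => ?_
    have h1 : (⟨freqProj true u, freqProj_mem true u⟩ : freqSpace true) = 0 := by
      refine hilbertBasis_eq_zero bp fun i => ?_
      show inner ℂ (bp i : K) (freqProj true u) = 0
      rw [← freqProj_inner_left, hp]; exact hu (Sum.inl i)
    have h2 : (⟨freqProj false u, freqProj_mem false u⟩ : freqSpace false) = 0 := by
      refine hilbertBasis_eq_zero bn fun i => ?_
      show inner ℂ (bn i : K) (freqProj false u) = 0
      rw [← freqProj_inner_left, hn]; exact hu (Sum.inr i)
    have h3 := freqProj_add true u
    have h4 : freqProj true u = 0 := congrArg Subtype.val h1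
    have h5 : freqProj false u = 0 := congrArg Subtype.val h2
    rw [Bool.not_true, h4, h5] at h3
    rw [← h3]; exact add_zero 0
  let _ : LinearOrder (wp ⊕ wn) := IsWellOrder.linearOrder WellOrderingRel
  let B : HilbertBasis (wp ⊕ wn) ℂ K := HilbertBasis.mk hv
    (by rw [Submodule.dense_iff_topologicalClosure_eq_top.1 ht])
  have hB : ∀ i, B i = v i := fun i => congrFun (HilbertBasis.coe_mk hv _) i
  refine ⟨Finset (wp ⊕ wn), jwField B (fun i => i.isRight = true), jwVac _,
    isFock_jwField B _ ?_ ?_⟩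
  · rintro (i | i) h
    · rw [hB]; exact hp i
    · simp at h
  · rintro (i | i) h
    · simp at h
    · rw [hB]; exact hn i

/-- The restriction of a representation of the CAR algebra to the cyclic subspace of a vacuum. -/
theorem exists_fockRep_of_isVac {e : ℝ} {H : Type u} [NormedAddCommGroup H]
    [InnerProductSpace ℂ H] [CompleteSpace H] (π : CAR e →⋆ₐ[ℂ] (H →L[ℂ] H)) {Ω : H}
    (hΩ : ‖Ω‖ = 1) (hv : IsVac (fun g => π ⟨FieldAlg.B e g, B_mem e g⟩) Ω) :
    ∃ (HF : Type u) (_ : NormedAddCommGroup HF) (_ : InnerProductSpace ℂ HF)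
      (_ : CompleteSpace HF), Nonempty (FockRep e HF) := by
  let M : Submodule ℂ H := (LinearMap.range (((LinearMap.applyₗ (R := ℂ) Ω).comp
      (ContinuousLinearMap.coeLM ℂ)).comp π.toAlgHom.toLinearMap)).topologicalClosure
  have hmem : ∀ C, π C Ω ∈ M := fun C => Submodule.le_topologicalClosure _ ⟨C, rfl⟩
  have hM : ∀ C, ∀ ψ ∈ M, π C ψ ∈ M := by
    intro C ψ hψ
    refine Set.MapsTo.closure (f := π C) ?_ (π C).continuous hψ
    rintro _ ⟨D, rfl⟩
    exact ⟨C * D, by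
      show π (C * D) Ω = π C (π D Ω)
      rw [map_mul]; rfl⟩
  have hc : IsClosed (M : Set H) := Submodule.isClosed_topologicalClosure _
  have hM' : CompleteSpace M := hc.completeSpace_coe
  have hΩ' : Ω ∈ M := by
    have := hmem 1
    rwa [map_one] at this
  have hv := isVac_iff.1 hv
  refine ⟨M, inferInstance, inferInstance, hM', ⟨
    { π := restrictRep π M hM
      Ω := ⟨Ω, hΩ'⟩
      norm_Ω := hΩ
      cyclic := ?_
      annihilate_pos := fun g => Subtype.ext (hv.1 g)
      annihilate_neg := fun g => Subtype.ext ?_ }⟩⟩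
  · rintro ⟨ψ, hψ⟩
    rw [closure_subtype]
    refine closure_mono ?_ hψ
    rintro _ ⟨C, rfl⟩
    exact ⟨⟨π C Ω, hmem C⟩, ⟨C, Subtype.ext rfl⟩, rfl⟩
  · rw [← map_star, restrictRep_apply, map_star]; exact hv.2 g

/-- Existence of positive energy Fock representations of the CAR algebra. -/
theorem exists_fockRep {e : ℝ} (he : e ≠ 0) :
    ∃ (HF : Type) (_ : NormedAddCommGroup HF) (_ : InnerProductSpace ℂ HF)
      (_ : CompleteSpace HF), Nonempty (FockRep e HF) := by
  obtain ⟨α, b, Ω, hF⟩ := exists_isFock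
  have hu := twistedShift_isWeyl e
  classical
  let φ : lp (fun _ : GaugeClass e => ℂ) 2 := lp.single 2 0 1
  have hφ : ‖φ‖ = 1 := by
    have := norm_sq_eq_tsum φ
    rw [tsum_eq_single 0 (fun X hX => by
      show ‖(lp.single 2 0 (1 : ℂ) : lp (fun _ : GaugeClass e => ℂ) 2) X‖ ^ 2 = 0
      rw [lp.single_apply, Pi.single_apply, if_neg hX]; simp)] at this
    have h2 : φ 0 = 1 := by
      show (lp.single 2 0 (1 : ℂ) : lp (fun _ : GaugeClass e => ℂ) 2) 0 = 1
      rw [lp.single_apply_self]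
    rw [h2, norm_one, one_pow] at this
    nlinarith [norm_nonneg φ]
  refine exists_fockRep_of_isVac ((productRep he hF hu).comp (CAR e).subtype) (Ω := htmul Ω φ)
    (by rw [norm_htmul, hF.norm_vac, hφ, one_mul]) ?_
  have hB : (fun g => (productRep he hF hu).comp (CAR e).subtype ⟨FieldAlg.B e g, B_mem e g⟩)
    = fun g => amp _ (b g) := funext fun g => productRep_B he hF hu g
  rw [hB]
  exact hF.vac_tensor φ

/-! ## Normal ordered densities -/

section Density

variable {H : Type*} [NormedAddCommGroup H] [InnerProductSpace ℂ H] [CompleteSpace H]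
  {b : K → H →L[ℂ] H} {Ω : H}

theorem IsCAR.cr_cr_anti (h : IsCAR b) (i j : Mode) : cr b i * cr b j + cr b j * cr b i = 0 := by
  rcases i with ⟨σ, f⟩
  rcases j with ⟨τ, g⟩
  have ho : ∀ f g : K, inner ℂ (freqProj false f) (freqProj true g) = 0 := fun f g =>
    freqProj_ortho false f g
  cases σ <;> cases τ
  · simpa [cr] using h.anti (freqProj false f) (freqProj false g)
  · have := h.anti_star (freqProj false f) (freqProj true g)
    rw [ho, zero_smul] at this
    simpa [cr] using this
  · have := h.anti_star (freqProj false g) (freqProj true f)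
    rw [ho, zero_smul, add_comm] at this
    simpa [cr] using this
  · have := congrArg star (h.anti (freqProj true g) (freqProj true f))
    simp only [star_add, star_mul, star_zero] at this
    simpa [cr] using this

theorem IsCAR.cr_cr_apply (h : IsCAR b) (i j : Mode) (ψ : H) :
    cr b i (cr b j ψ) = -cr b j (cr b i ψ) := by
  have := congrArg (fun T => T ψ) (h.cr_cr_anti i j)
  simp only [_root_.add_apply, mul_apply_eq_comp, _root_.zero_apply] at this
  exact eq_neg_of_add_eq_zero_left this

/-- Symmetric operators commuting with the energy projections. -/
structure IsDiag (T : K →L[ℂ] K) : Prop where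
  symm : ∀ f g, inner ℂ (T f) g = inner ℂ f (T g)
  comm : ∀ σ g, freqProj σ (T g) = T (freqProj σ g)

theorem IsDiag.id : IsDiag (ContinuousLinearMap.id ℂ K) := ⟨fun _ _ => rfl, fun _ _ => rfl⟩

variable {T A C A' C' : K →L[ℂ] K} {ι κ : Type*} (ep : HilbertBasis ι ℂ (freqSpace true))
  (en : HilbertBasis κ ℂ (freqSpace false))

theorem freqProj_basis {σ : Bool} {ι : Type*} (B : HilbertBasis ι ℂ (freqSpace σ)) (k : ι) :
    freqProj σ (B k : K) = B k := mem_freqSpace.1 (B k).2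

theorem hasSum_basis {σ : Bool} {ι : Type*} (B : HilbertBasis ι ℂ (freqSpace σ)) (g : K) :
    HasSum (fun k => inner ℂ (B k : K) g • (B k : K)) (freqProj σ g) := by
  have h := (B.hasSum_repr ⟨freqProj σ g, freqProj_mem σ g⟩).mapL (freqSpace σ).subtypeL
  convert! h using 2 with k
  rw [map_smul, B.repr_apply_apply]
  congr 1
  show _ = inner ℂ (B k : K) (freqProj σ g)
  rw [← freqProj_inner_left, freqProj_basis]

theorem hasSum_cr_true (h : IsCAR b) (hT : IsDiag T) (g : K) (ψ : H) :
    HasSum (fun k => inner ℂ (ep k : K) g • cr b (true, T (ep k : K)) ψ) (cr b (true, T g) ψ) := by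
  let f : K →+ H := AddMonoidHom.mk' (fun g => star (b (T g)) ψ) fun g g' => by
    rw [_root_.map_add, h.add, star_add]; rfl
  have hf : Continuous f := ((h.continuous.comp T.continuous).star).clm_apply continuous_const
  have h1 := (hasSum_basis ep g).map f hf
  convert! h1 using 2 with k
  · show _ • star (b (freqProj true _)) ψ = star (b (T (_ • _))) ψ
    rw [hT.comm, freqProj_basis, map_smul, h.smul, star_smul, star_star]; rfl
  · show star (b _) ψ = star (b _) ψ
    rw [hT.comm]

theorem hasSum_cr_false (h : IsCAR b) (hT : IsDiag T) (g : K) (ψ : H) :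
    HasSum (fun k => inner ℂ g (en k : K) • cr b (false, T (en k : K)) ψ)
      (cr b (false, T g) ψ) := by
  let f : K →+ H := AddMonoidHom.mk' (fun g => b (T g) ψ) fun g g' => by
    rw [_root_.map_add, h.add]; rfl
  have hf : Continuous f := (h.continuous.comp T.continuous).clm_apply continuous_const
  have h1 := (hasSum_basis en g).map f hf
  convert! h1 using 2 with k
  · show _ • b (freqProj false _) ψ = b (T (_ • _)) ψ
    rw [hT.comm, freqProj_basis, map_smul, h.smul, RCLike.star_def, inner_conj_symm]; rfl
  · show b _ ψ = b _ ψ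
    rw [hT.comm]

theorem hasSum_pos_cr (h : IsCAR b) (hA : IsDiag A) (hC : IsDiag C) (hT : ∀ g, A (C g) = T g)
    {ψ χ : H} (hs : HasSum (fun k => star (b (A (ep k))) (b (C (ep k)) ψ)) χ) (i : Mode) :
    HasSum (fun k => star (b (A (ep k))) (b (C (ep k)) (cr b i ψ)))
      ((if i.1 then cr b (modeMap T i) ψ else 0) + cr b i χ) := by
  have e1 : ∀ k, star (b (A (ep k))) = cr b (true, A (ep k : K)) := fun k => by
    show _ = star (b (freqProj true _))
    rw [hA.comm, freqProj_basis]
  have e2 : ∀ k, b (C (ep k)) = star (cr b (true, C (ep k : K))) := fun k => by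
    show _ = star (star (b (freqProj true _)))
    rw [hC.comm, freqProj_basis, star_star]
  simp only [e1, e2] at hs ⊢
  have e3 : ∀ k, cr b (true, A (ep k : K)) (star (cr b (true, C (ep k : K))) (cr b i ψ))
      = modeForm (true, C (ep k : K)) i • cr b (true, A (ep k : K)) ψ
        + cr b i (cr b (true, A (ep k : K)) (star (cr b (true, C (ep k : K))) ψ)) := fun k => by
    rw [h.ann_cr_apply, _root_.map_sub, map_smul, h.cr_cr_apply _ i, sub_neg_eq_add]
  simp only [e3]
  refine HasSum.add ?_ (hs.mapL (cr b i))
  rcases i with ⟨σ, g⟩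
  cases σ
  · simp only [modeForm, Bool.true_eq_false, if_false, zero_smul, Bool.false_eq_true]
    exact hasSum_zero
  · simp only [modeForm, if_true, modeMap]
    convert! hasSum_cr_true ep h hA (C g) ψ using 2 with k
    · rw [hC.comm, freqProj_basis, hC.symm, ← hC.comm, ← freqProj_inner_left, freqProj_basis]
    · rw [hT]

theorem hasSum_neg_cr (h : IsCAR b) (hA : IsDiag A) (hC : IsDiag C) (hT : ∀ g, A (C g) = T g)
    {ψ χ : H} (hs : HasSum (fun k => b (A (en k)) (star (b (C (en k))) ψ)) χ) (i : Mode) :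
    HasSum (fun k => b (A (en k)) (star (b (C (en k))) (cr b i ψ)))
      ((if i.1 then 0 else cr b (modeMap T i) ψ) + cr b i χ) := by
  have e1 : ∀ k, star (b (C (en k))) = star (cr b (false, C (en k : K))) := fun k => by
    show _ = star (b (freqProj false _))
    rw [hC.comm, freqProj_basis]
  have e2 : ∀ k, b (A (en k)) = cr b (false, A (en k : K)) := fun k => by
    show _ = b (freqProj false _)
    rw [hA.comm, freqProj_basis]
  simp only [e1, e2] at hs ⊢
  have e3 : ∀ k, cr b (false, A (en k : K)) (star (cr b (false, C (en k : K))) (cr b i ψ))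
      = modeForm (false, C (en k : K)) i • cr b (false, A (en k : K)) ψ
        + cr b i (cr b (false, A (en k : K)) (star (cr b (false, C (en k : K))) ψ)) := fun k => by
    rw [h.ann_cr_apply, _root_.map_sub, map_smul, h.cr_cr_apply _ i, sub_neg_eq_add]
  simp only [e3]
  refine HasSum.add ?_ (hs.mapL (cr b i))
  rcases i with ⟨σ, g⟩
  cases σ
  · simp only [modeForm, if_true, modeMap, Bool.false_eq_true, if_false]
    convert! hasSum_cr_false en h hA (C g) ψ using 2 with k
    · rw [freqProj_inner_left, hC.comm, hC.comm, freqProj_basis, freqProj_basis, hC.symm]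
    · rw [hT]
  · simp only [modeForm, Bool.false_eq_true, if_false, zero_smul, if_true]
    exact hasSum_zero

/-- The span of the vectors created from the vacuum. -/
def wordSpan (b : K → H →L[ℂ] H) (Ω : H) : Submodule ℂ H :=
  Submodule.span ℂ (Set.range fun w => crWord b w Ω)

theorem word_mem (w : List Mode) : crWord b w Ω ∈ wordSpan b Ω := Submodule.subset_span ⟨w, rfl⟩

theorem cr_mem (i : Mode) {ψ : H} (hψ : ψ ∈ wordSpan b Ω) : cr b i ψ ∈ wordSpan b Ω := by
  unfold wordSpan at hψ
  induction hψ using Submodule.span_induction with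
  | mem ψ hψ =>
    obtain ⟨w, rfl⟩ := hψ
    exact word_mem (i :: w)
  | zero => rw [_root_.map_zero]; exact Submodule.zero_mem _
  | add a c _ _ ha hc => rw [_root_.map_add]; exact Submodule.add_mem _ ha hc
  | smul z a _ ha => rw [map_smul]; exact Submodule.smul_mem _ _ ha

/-- The sign of the charge carried by a mode. -/
def chargeSign (i : Mode) : ℂ := if i.1 then 1 else -1

theorem exists_sums (hF : IsFock b Ω) (hA : IsDiag A) (hC : IsDiag C)
    (hT : ∀ g, A (C g) = T g) (hA' : IsDiag A') (hC' : IsDiag C') (hT' : ∀ g, A' (C' g) = T g)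
    {ψ : H} (hψ : ψ ∈ wordSpan b Ω) :
    ∃ χp χn, HasSum (fun k => star (b (A (ep k))) (b (C (ep k)) ψ)) χp ∧
      HasSum (fun k => b (A' (en k)) (star (b (C' (en k))) ψ)) χn ∧ χp - χn ∈ wordSpan b Ω := by
  unfold wordSpan at hψ
  induction hψ using Submodule.span_induction with
  | mem ψ hψ =>
    obtain ⟨w, rfl⟩ := hψ
    induction w with
    | nil =>
      have hv := isVac_iff.1 hF.vac
      have h1 : ∀ k, b (C (ep k)) Ω = 0 := fun k => by
        have := hv.1 (C (ep k))
        rwa [hC.comm, freqProj_basis] at this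
      have h2 : ∀ k, star (b (C' (en k))) Ω = 0 := fun k => by
        have := hv.2 (C' (en k))
        rwa [hC'.comm, freqProj_basis] at this
      refine ⟨0, 0, ?_, ?_, by rw [sub_zero]; exact Submodule.zero_mem _⟩
      · simp only [crWord_nil, one_apply_eq_self, h1, _root_.map_zero]; exact hasSum_zero
      · simp only [crWord_nil, one_apply_eq_self, h2, _root_.map_zero]; exact hasSum_zero
    | cons i w ih =>
      obtain ⟨χp, χn, h1, h2, h3⟩ := ih
      refine ⟨_, _, hasSum_pos_cr ep hF.car hA hC hT h1 i,
        hasSum_neg_cr en hF.car hA' hC' hT' h2 i, ?_⟩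
      have h4 : cr b (modeMap T i) (crWord b w Ω) ∈ wordSpan b Ω := cr_mem _ (word_mem w)
      rw [add_sub_add_comm, ← _root_.map_sub]
      refine Submodule.add_mem _ (Submodule.sub_mem _ ?_ ?_) (cr_mem i h3)
      · split_ifs
        · exact h4
        · exact Submodule.zero_mem _
      · split_ifs
        · exact Submodule.zero_mem _
        · exact h4
  | zero =>
    refine ⟨0, 0, ?_, ?_, by rw [sub_zero]; exact Submodule.zero_mem _⟩ <;>
    · simp only [_root_.map_zero]; exact hasSum_zero
  | add a c _ _ ha hc =>
    obtain ⟨p, n, h1, h2, h3⟩ := ha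
    obtain ⟨p', n', h1', h2', h3'⟩ := hc
    refine ⟨p + p', n + n', ?_, ?_, ?_⟩
    · simp only [_root_.map_add]; exact h1.add h1'
    · simp only [_root_.map_add]; exact h2.add h2'
    · rw [add_sub_add_comm]; exact Submodule.add_mem _ h3 h3'
  | smul z a _ ha =>
    obtain ⟨p, n, h1, h2, h3⟩ := ha
    refine ⟨z • p, z • n, ?_, ?_, ?_⟩
    · simp only [map_smul]; exact h1.const_smul z
    · simp only [map_smul]; exact h2.const_smul z
    · rw [← smul_sub]; exact Submodule.smul_mem _ _ h3

/-- A linear operator on the domain spanned by words acting as a derivation. -/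
structure IsNumber (b : K → H →L[ℂ] H) (Ω : H) (T : K →L[ℂ] K)
    (N : wordSpan b Ω →ₗ[ℂ] wordSpan b Ω) : Prop where
  vac : (N ⟨Ω, word_mem []⟩ : H) = 0
  cr : ∀ i (ψ : wordSpan b Ω), (N ⟨cr b i ψ, cr_mem i ψ.2⟩ : H)
    = chargeSign i • cr b (modeMap T i) ψ + cr b i (N ψ)

theorem sums_unique (hF : IsFock b Ω) (hA : IsDiag A) (hC : IsDiag C)
    (hT : ∀ g, A (C g) = T g) (hA' : IsDiag A') (hC' : IsDiag C') (hT' : ∀ g, A' (C' g) = T g)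
    {N : wordSpan b Ω →ₗ[ℂ] wordSpan b Ω}
    (hN : IsNumber b Ω T N) (ψ : wordSpan b Ω) {χp χn : H}
    (h1 : HasSum (fun k => star (b (A (ep k))) (b (C (ep k)) ψ)) χp)
    (h2 : HasSum (fun k => b (A' (en k)) (star (b (C' (en k))) ψ)) χn) : (N ψ : H) = χp - χn := by
  suffices hs : ∃ χp χn, HasSum (fun k => star (b (A (ep k))) (b (C (ep k)) (ψ : H))) χp ∧
      HasSum (fun k => b (A' (en k)) (star (b (C' (en k))) (ψ : H))) χn ∧ (N ψ : H) = χp - χn by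
    obtain ⟨p, n, h3, h4, h5⟩ := hs
    rw [h5, h3.unique h1, h4.unique h2]
  clear h1 h2
  obtain ⟨ψ, hψ⟩ := ψ
  have hψ' := hψ
  unfold wordSpan at hψ'
  induction hψ' using Submodule.span_induction with
  | mem ψ hψ' =>
    obtain ⟨w, rfl⟩ := hψ'
    induction w with
    | nil =>
      have hv := isVac_iff.1 hF.vac
      have h1 : ∀ k, b (C (ep k)) Ω = 0 := fun k => by
        have := hv.1 (C (ep k))
        rwa [hC.comm, freqProj_basis] at this
      have h2 : ∀ k, star (b (C' (en k))) Ω = 0 := fun k => by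
        have := hv.2 (C' (en k))
        rwa [hC'.comm, freqProj_basis] at this
      refine ⟨0, 0, ?_, ?_, by rw [sub_zero]; exact hN.vac⟩
      · simp only [crWord_nil, one_apply_eq_self, h1, _root_.map_zero]; exact hasSum_zero
      · simp only [crWord_nil, one_apply_eq_self, h2, _root_.map_zero]; exact hasSum_zero
    | cons i w ih =>
      obtain ⟨χp, χn, h1, h2, h3⟩ := ih (word_mem w)
      refine ⟨_, _, hasSum_pos_cr ep hF.car hA hC hT h1 i,
        hasSum_neg_cr en hF.car hA' hC' hT' h2 i, ?_⟩
      refine (hN.cr i ⟨crWord b w Ω, word_mem w⟩).trans ?_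
      rw [h3, add_sub_add_comm, ← _root_.map_sub]
      congr 1
      unfold chargeSign
      split_ifs <;> simp
  | zero =>
    refine ⟨0, 0, ?_, ?_, ?_⟩
    · simp only [_root_.map_zero]; exact hasSum_zero
    · simp only [_root_.map_zero]; exact hasSum_zero
    · rw [sub_zero]; exact congrArg Subtype.val (_root_.map_zero N)
  | add a c ha' hc' ha hc =>
    obtain ⟨p, n, h1, h2, h3⟩ := ha ha'
    obtain ⟨p', n', h1', h2', h3'⟩ := hc hc'
    refine ⟨p + p', n + n', ?_, ?_, ?_⟩
    · simp only [_root_.map_add]; exact h1.add h1'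
    · simp only [_root_.map_add]; exact h2.add h2'
    · rw [add_sub_add_comm, ← h3, ← h3']
      exact congrArg Subtype.val (_root_.map_add N ⟨a, ha'⟩ ⟨c, hc'⟩)
  | smul z a ha' ha =>
    obtain ⟨p, n, h1, h2, h3⟩ := ha ha'
    refine ⟨z • p, z • n, ?_, ?_, ?_⟩
    · simp only [map_smul]; exact h1.const_smul z
    · simp only [map_smul]; exact h2.const_smul z
    · rw [← smul_sub, ← h3]
      exact congrArg Subtype.val (map_smul N z ⟨a, ha'⟩)

theorem exists_isNumber (hF : IsFock b Ω) (hT : IsDiag T) :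
    ∃ N : wordSpan b Ω →ₗ[ℂ] wordSpan b Ω, IsNumber b Ω T N := by
  obtain ⟨wp, ep, -⟩ := exists_hilbertBasis ℂ (freqSpace true)
  obtain ⟨wn, en, -⟩ := exists_hilbertBasis ℂ (freqSpace false)
  have key := fun ψ : wordSpan b Ω => exists_sums (T := T) ep en hF hT IsDiag.id (fun _ => rfl) hT
    IsDiag.id (fun _ => rfl) ψ.2
  choose p n hp hn hm using key
  refine ⟨{ toFun := fun ψ => ⟨p ψ - n ψ, hm ψ⟩, map_add' := fun ψ φ => Subtype.ext ?_,
            map_smul' := fun z ψ => Subtype.ext ?_ }, ?_, fun i ψ => ?_⟩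
  · have h1 : p (ψ + φ) = p ψ + p φ := (hp (ψ + φ)).unique (by
      simp only [Submodule.coe_add, _root_.map_add]; exact (hp ψ).add (hp φ))
    have h2 : n (ψ + φ) = n ψ + n φ := (hn (ψ + φ)).unique (by
      simp only [Submodule.coe_add, _root_.map_add]; exact (hn ψ).add (hn φ))
    show p (ψ + φ) - n (ψ + φ) = (p ψ - n ψ) + (p φ - n φ)
    rw [h1, h2]; abel
  · have h1 : p (z • ψ) = z • p ψ := (hp (z • ψ)).unique (by
      simp only [Submodule.coe_smul, map_smul]; exact (hp ψ).const_smul z)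
    have h2 : n (z • ψ) = z • n ψ := (hn (z • ψ)).unique (by
      simp only [Submodule.coe_smul, map_smul]; exact (hn ψ).const_smul z)
    show p (z • ψ) - n (z • ψ) = z • (p ψ - n ψ)
    rw [h1, h2, smul_sub]
  · have hv := isVac_iff.1 hF.vac
    have h1 : p ⟨Ω, word_mem []⟩ = 0 := (hp _).unique (by
      have h1 : ∀ k, b (ContinuousLinearMap.id ℂ K (ep k)) Ω = 0 := fun k => by
        have := hv.1 (ep k)
        rwa [freqProj_basis] at this
      simp only [h1, _root_.map_zero]; exact hasSum_zero)
    have h2 : n ⟨Ω, word_mem []⟩ = 0 := (hn _).unique (by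
      have h2 : ∀ k, star (b (ContinuousLinearMap.id ℂ K (en k))) Ω = 0 := fun k => by
        have := hv.2 (en k)
        rwa [freqProj_basis] at this
      simp only [h2, _root_.map_zero]; exact hasSum_zero)
    show p _ - n _ = 0
    rw [h1, h2, sub_zero]
  · have h1 : p ⟨cr b i ψ, cr_mem i ψ.2⟩ = _ := (hp ⟨cr b i ψ, cr_mem i ψ.2⟩).unique
      (hasSum_pos_cr (T := T) ep hF.car hT IsDiag.id (fun _ => rfl) (hp ψ) i)
    have h2 : n ⟨cr b i ψ, cr_mem i ψ.2⟩ = _ := (hn ⟨cr b i ψ, cr_mem i ψ.2⟩).unique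
      (hasSum_neg_cr (T := T) en hF.car hT IsDiag.id (fun _ => rfl) (hn ψ) i)
    show p _ - n _ = _ + cr b i (p ψ - n ψ)
    rw [h1, h2, add_sub_add_comm, ← _root_.map_sub]
    congr 1
    unfold chargeSign
    split_ifs <;> simp

/-! ### The exponential series -/

/-- The coefficients of the exponential series of a mode. -/
def expMode (b : K → H →L[ℂ] H) (T : K →L[ℂ] K) (i : Mode) (k : ℕ) : H →L[ℂ] H :=
  ((-I * chargeSign i) ^ k / (k.factorial : ℂ)) • cr b (i.1, (T ^ k) i.2)

/-- The coefficients of the exponential series of a product of creation operators. -/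
def expWord (b : K → H →L[ℂ] H) (T : K →L[ℂ] K) : List Mode → ℕ → H →L[ℂ] H
  | [], n => if n = 0 then 1 else 0
  | i :: w, n => ∑ p ∈ Finset.HasAntidiagonal.antidiagonal n, expMode b T i p.1 * expWord b T w p.2

theorem norm_pow_apply_le (T : K →L[ℂ] K) (k : ℕ) (g : K) : ‖(T ^ k) g‖ ≤ ‖T‖ ^ k * ‖g‖ := by
  induction k with
  | zero => simp
  | succ k ih =>
    rw [pow_succ']
    refine (T.le_opNorm _).trans ?_
    rw [pow_succ', mul_assoc]
    exact mul_le_mul_of_nonneg_left ih (norm_nonneg _)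

theorem norm_cr_le (h : IsCAR b) (i : Mode) : ‖cr b i‖ ≤ ‖freqProj i.1 i.2‖ := by
  rcases i with ⟨σ, g⟩
  cases σ
  · exact h.norm_le _
  · show ‖star (b (freqProj true g))‖ ≤ _
    rw [norm_star]; exact h.norm_le _

theorem summable_expMode (h : IsCAR b) (T : K →L[ℂ] K) (i : Mode) :
    Summable fun k => ‖expMode b T i k‖ := by
  refine Summable.of_nonneg_of_le (fun _ => norm_nonneg _) (fun k => ?_)
    ((Real.summable_pow_div_factorial ‖T‖).mul_left (‖freqProj i.1‖ * ‖i.2‖))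
  unfold expMode
  rw [norm_smul, norm_div, norm_pow, norm_mul, norm_neg, norm_I, one_mul, Complex.norm_natCast]
  have h1 : ‖chargeSign i‖ = 1 := by unfold chargeSign; split_ifs <;> simp
  rw [h1, one_pow]
  have h2 : ‖cr b (i.1, (T ^ k) i.2)‖ ≤ ‖freqProj i.1‖ * (‖T‖ ^ k * ‖i.2‖) := by
    refine (norm_cr_le h _).trans ((ContinuousLinearMap.le_opNorm _ _).trans ?_)
    gcongr
    exact norm_pow_apply_le T k i.2
  calc 1 / (k.factorial : ℝ) * ‖cr b (i.1, (T ^ k) i.2)‖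
      ≤ 1 / (k.factorial : ℝ) * (‖freqProj i.1‖ * (‖T‖ ^ k * ‖i.2‖)) := by gcongr
    _ = _ := by ring

theorem summable_expWord (h : IsCAR b) (T : K →L[ℂ] K) (w : List Mode) :
    Summable fun k => ‖expWord b T w k‖ := by
  induction w with
  | nil =>
    refine summable_of_ne_finset_zero (s := {0}) fun n hn => ?_
    simp only [expWord]
    rw [if_neg (by simpa using hn), norm_zero]
  | cons i w ih =>
    exact summable_norm_sum_mul_antidiagonal_of_summable_norm (summable_expMode h T i) ih

theorem tsum_expWord (h : IsCAR b) {T Q : K →L[ℂ] K}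
    (hQ : ∀ i, ∑' k, expMode b T i k = cr b (modeMap Q i)) (w : List Mode) :
    ∑' n, expWord b T w n = crWord b (w.map (modeMap Q)) := by
  induction w with
  | nil =>
    simp only [expWord]
    rw [tsum_eq_single 0 fun n hn => if_neg hn, if_pos rfl]; rfl
  | cons i w ih =>
    rw [List.map_cons, crWord_cons, ← ih, ← hQ]
    exact (tsum_mul_tsum_eq_tsum_sum_antidiagonal_of_summable_norm (summable_expMode h T i)
      (summable_expWord h T w)).symm

theorem expMode_mem (T : K →L[ℂ] K) (i : Mode) (k : ℕ) {ψ : H} (hψ : ψ ∈ wordSpan b Ω) :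
    expMode b T i k ψ ∈ wordSpan b Ω :=
  Submodule.smul_mem _ _ (cr_mem _ hψ)

theorem expWord_mem (T : K →L[ℂ] K) (w : List Mode) : ∀ n,
    expWord b T w n Ω ∈ wordSpan b Ω := by
  induction w with
  | nil =>
    intro n
    simp only [expWord]
    split_ifs
    · exact word_mem []
    · exact Submodule.zero_mem _
  | cons i w ih =>
    intro n
    simp only [expWord, sum_apply]
    exact Submodule.sum_mem _ fun p _ => expMode_mem T i p.1 (ih p.2)

theorem IsNumber.expMode {N : wordSpan b Ω →ₗ[ℂ] wordSpan b Ω} (hN : IsNumber b Ω T N) (i : Mode)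
    (k : ℕ) (ψ : wordSpan b Ω) :
    -I • (N ⟨expMode b T i k ψ, expMode_mem T i k ψ.2⟩ : H)
      = ((k + 1 : ℕ) : ℂ) • AsymptoticQED.expMode b T i (k + 1) ψ
        + AsymptoticQED.expMode b T i k (-I • (N ψ : H)) := by
  have h1 : (⟨AsymptoticQED.expMode b T i k ψ, expMode_mem T i k ψ.2⟩ : wordSpan b Ω)
      = ((-I * chargeSign i) ^ k / (k.factorial : ℂ)) • ⟨AsymptoticQED.cr b (i.1, (T ^ k) i.2) ψ, cr_mem _ ψ.2⟩ := rfl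
  rw [h1, map_smul, Submodule.coe_smul, hN.cr]
  unfold AsymptoticQED.expMode
  simp only [_root_.smul_apply, map_smul, smul_add, smul_smul]
  have h2 : modeMap T (i.1, (T ^ k) i.2) = (i.1, (T ^ (k + 1)) i.2) := by
    show (i.1, T ((T ^ k) i.2)) = _
    rw [pow_succ']; rfl
  have h3 : chargeSign (i.1, (T ^ k) i.2) = chargeSign i := rfl
  have h4 : (k.factorial : ℂ) ≠ 0 := Nat.cast_ne_zero.2 (Nat.factorial_ne_zero k)
  have h5 : ((k + 1 : ℕ) : ℂ) ≠ 0 := Nat.cast_ne_zero.2 (Nat.succ_ne_zero k)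
  rw [h2, h3]
  congr 2
  rw [Nat.factorial_succ, Nat.cast_mul]
  field_simp
  ring

theorem IsNumber.expWord {N : wordSpan b Ω →ₗ[ℂ] wordSpan b Ω} (hN : IsNumber b Ω T N)
    (w : List Mode) : ∀ n, -I • (N ⟨expWord b T w n Ω, expWord_mem T w n⟩ : H)
      = ((n + 1 : ℕ) : ℂ) • AsymptoticQED.expWord b T w (n + 1) Ω := by
  induction w with
  | nil =>
    intro n
    have h2 : AsymptoticQED.expWord b T [] (n + 1) = 0 := by
      simp only [AsymptoticQED.expWord]; rw [if_neg (Nat.succ_ne_zero n)]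
    rw [h2, _root_.zero_apply, smul_zero]
    by_cases hn : n = 0
    · subst hn
      exact smul_eq_zero_of_right _ hN.vac
    · have h1 : (⟨AsymptoticQED.expWord b T [] n Ω, expWord_mem T [] n⟩ : wordSpan b Ω) = 0 :=
        Subtype.ext (by
          show AsymptoticQED.expWord b T [] n Ω = 0
          simp only [AsymptoticQED.expWord]; rw [if_neg hn]; rfl)
      rw [h1, _root_.map_zero]; simp
  | cons i w ih =>
    intro n
    have h1 : (⟨AsymptoticQED.expWord b T (i :: w) n Ω, expWord_mem T _ n⟩ : wordSpan b Ω)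
        = ∑ p ∈ Finset.HasAntidiagonal.antidiagonal n, ⟨AsymptoticQED.expMode b T i p.1
          (AsymptoticQED.expWord b T w p.2 Ω), expMode_mem T i p.1 (expWord_mem T w p.2)⟩ :=
      Subtype.ext (by
        rw [Submodule.coe_sum]
        simp only [AsymptoticQED.expWord, sum_apply]; rfl)
    rw [h1, map_sum, Submodule.coe_sum, Finset.smul_sum]
    have h2 : ∀ p : ℕ × ℕ, -I • (N ⟨AsymptoticQED.expMode b T i p.1
        (AsymptoticQED.expWord b T w p.2 Ω), expMode_mem T i p.1 (expWord_mem T w p.2)⟩ : H)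
        = ((p.1 + 1 : ℕ) : ℂ) • AsymptoticQED.expMode b T i (p.1 + 1) (AsymptoticQED.expWord b T w p.2 Ω)
          + ((p.2 + 1 : ℕ) : ℂ) • AsymptoticQED.expMode b T i p.1
            (AsymptoticQED.expWord b T w (p.2 + 1) Ω) := fun p => by
      rw [hN.expMode i p.1 ⟨AsymptoticQED.expWord b T w p.2 Ω, expWord_mem T w p.2⟩, ih, map_smul]
    simp only [h2]
    let f : ℕ → ℕ → H := fun k l =>
      AsymptoticQED.expMode b T i k (AsymptoticQED.expWord b T w l Ω)
    have h3 : AsymptoticQED.expWord b T (i :: w) (n + 1) Ω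
        = ∑ p ∈ Finset.HasAntidiagonal.antidiagonal (n + 1), f p.1 p.2 := by
      simp only [AsymptoticQED.expWord, sum_apply]; rfl
    rw [h3, Finset.smul_sum, Finset.sum_add_distrib]
    have h4 : ∀ p ∈ Finset.HasAntidiagonal.antidiagonal (n + 1), ((n + 1 : ℕ) : ℂ) • f p.1 p.2
        = (p.1 : ℂ) • f p.1 p.2 + (p.2 : ℂ) • f p.1 p.2 := fun p hp => by
      rw [← add_smul, ← Finset.HasAntidiagonal.mem_antidiagonal.1 hp]; push_cast; rfl
    rw [Finset.sum_congr rfl h4, Finset.sum_add_distrib, Finset.Nat.sum_antidiagonal_succ,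
      Finset.Nat.sum_antidiagonal_succ']
    simp only [Nat.cast_zero, zero_smul, zero_add]
    rfl

theorem IsNumber.pow_word {N : wordSpan b Ω →ₗ[ℂ] wordSpan b Ω} (hN : IsNumber b Ω T N)
    (w : List Mode) (n : ℕ) : ((-I) ^ n / (n.factorial : ℂ)) •
      ((N ^ n) ⟨crWord b w Ω, word_mem w⟩ : H) = AsymptoticQED.expWord b T w n Ω := by
  induction n with
  | zero =>
    rw [pow_zero, pow_zero, Nat.factorial_zero, Nat.cast_one, div_one, one_smul]
    show crWord b w Ω = _
    congr 1
    induction w with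
    | nil => simp [AsymptoticQED.expWord]
    | cons i w ih =>
      simp only [AsymptoticQED.expWord, Finset.Nat.antidiagonal_zero, Finset.sum_singleton]
      rw [← ih, crWord_cons]
      congr 1
      simp [AsymptoticQED.expMode]
  | succ n ih =>
    have h5 : ((n + 1 : ℕ) : ℂ) ≠ 0 := Nat.cast_ne_zero.2 (Nat.succ_ne_zero n)
    have h := hN.expWord w n
    have h1 : (⟨AsymptoticQED.expWord b T w n Ω, expWord_mem T w n⟩ : wordSpan b Ω)
        = ((-I) ^ n / (n.factorial : ℂ)) • (N ^ n) ⟨crWord b w Ω, word_mem w⟩ :=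
      Subtype.ext ih.symm
    rw [h1, map_smul, Submodule.coe_smul, smul_smul] at h
    have h2 : AsymptoticQED.expWord b T w (n + 1) Ω
        = ((n + 1 : ℕ) : ℂ)⁻¹ • ((n + 1 : ℕ) : ℂ) • AsymptoticQED.expWord b T w (n + 1) Ω := by
      rw [smul_smul, inv_mul_cancel₀ h5, one_smul]
    rw [h2, ← h, smul_smul, pow_succ' N]
    show _ • ((N ((N ^ n) _) : wordSpan b Ω) : H) = _
    congr 1
    have h4 : (n.factorial : ℂ) ≠ 0 := Nat.cast_ne_zero.2 (Nat.factorial_ne_zero n)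
    rw [Nat.factorial_succ, Nat.cast_mul]
    field_simp
    ring

theorem IsNumber.hasSum_exp (hF : IsFock b Ω) {N : wordSpan b Ω →ₗ[ℂ] wordSpan b Ω}
    (hN : IsNumber b Ω T N) {Q : K →L[ℂ] K} (hB : IsBog Q)
    (hQ : ∀ i, ∑' k, AsymptoticQED.expMode b T i k = AsymptoticQED.cr b (modeMap Q i))
    (ψ : wordSpan b Ω) :
    HasSum (fun n : ℕ => ((-I) ^ n / (n.factorial : ℂ)) • ((N ^ n) ψ : H)) (hF.Γ hB ψ) := by
  obtain ⟨ψ, hψ⟩ := ψ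
  have hψ' := hψ
  unfold wordSpan at hψ'
  induction hψ' using Submodule.span_induction with
  | mem ψ hψ' =>
    obtain ⟨w, rfl⟩ := hψ'
    simp only [hN.pow_word w]
    rw [hF.Γ_word, ← tsum_expWord hF.car hQ]
    exact (summable_expWord hF.car T w).of_norm.hasSum.mapL (ContinuousLinearMap.apply ℂ H Ω)
  | zero =>
    have h1 : (⟨0, hψ⟩ : wordSpan b Ω) = 0 := rfl
    simp only [h1, _root_.map_zero, Submodule.coe_zero, smul_zero]
    exact hasSum_zero
  | add a c ha' hc' ha hc =>
    have h1 : (⟨a + c, hψ⟩ : wordSpan b Ω) = ⟨a, ha'⟩ + ⟨c, hc'⟩ := rfl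
    simp only [h1, _root_.map_add, Submodule.coe_add, smul_add]
    exact (ha ha').add (hc hc')
  | smul z a ha' ha =>
    have h1 : (⟨z • a, hψ⟩ : wordSpan b Ω) = z • ⟨a, ha'⟩ := rfl
    simp only [h1, map_smul, Submodule.coe_smul, smul_comm _ z]
    exact (ha ha').const_smul z

end Density

/-! ## The charge densities of the Gauss constraint -/

section Gauss

variable {e : ℝ}

theorem symp_coulomb_bddMeas (e : ℝ) (V : testFields) :
    BddMeas fun v => ((symp V.1 (coulomb e v) : ℝ) : ℂ) := by
  obtain ⟨C, hC⟩ := exists_coulombPhase_le V e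
  refine ⟨?_, C, fun v => ?_⟩
  · simp only [symp_coulomb]
    exact Complex.measurable_ofReal.comp (measurable_coulombPhase e V).neg
  · rw [Complex.norm_real, Real.norm_eq_abs, symp_coulomb, abs_neg]; exact hC v

/-- The one-particle operator of the charge density. -/
def chargeOp (e : ℝ) (V : testFields) : K →L[ℂ] K := scalarOp fun v => symp V.1 (coulomb e v)

theorem chargeOp_eq (e : ℝ) (V : testFields) :
    chargeOp e V = cop fun v => ((symp V.1 (coulomb e v) : ℝ) : ℂ) := rfl

theorem isDiag_chargeOp (e : ℝ) (V : testFields) : IsDiag (chargeOp e V) where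
  symm f g := by
    rw [chargeOp_eq, cop_inner_left (symp_coulomb_bddMeas e V)]
    simp
  comm σ g := freqProj_cop σ (symp_coulomb_bddMeas e V) g

theorem cop_pow {θ : Hyp → ℂ} (h : BddMeas θ) (n : ℕ) (g : K) :
    (cop θ ^ n) g = cop (fun v => θ v ^ n) g := by
  induction n with
  | zero => simp only [pow_zero]; exact (cop_one g).symm
  | succ n ih =>
    rw [pow_succ', mul_apply_eq_comp, ih, cop_cop h (h.pow n)]
    simp only [pow_succ']

theorem cop_sum {ι : Type*} (t : Finset ι) {θ : ι → Hyp → ℂ} (h : ∀ i, BddMeas (θ i)) (g : K) :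
    BddMeas (fun v => ∑ i ∈ t, θ i v) ∧ cop (fun v => ∑ i ∈ t, θ i v) g = ∑ i ∈ t, cop (θ i) g := by
  classical
  induction t using Finset.induction_on with
  | empty =>
    refine ⟨by simpa using BddMeas.const 0, ?_⟩
    simpa using cop_const 0 g
  | insert i t hi ih =>
    simp only [Finset.sum_insert hi]
    exact ⟨(h i).add ih.1, by rw [cop_add (h i) ih.1, ih.2]⟩

theorem hasSum_exp_cop {θ : Hyp → ℂ} (h : BddMeas θ) (g : K) :
    HasSum (fun n : ℕ => (1 / (n.factorial : ℂ)) • (cop θ ^ n) g)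
      (cop (fun v => Complex.exp (θ v)) g) := by
  have hs : Summable fun n : ℕ => ‖(1 / (n.factorial : ℂ)) • (cop θ ^ n) g‖ := by
    refine Summable.of_nonneg_of_le (fun _ => norm_nonneg _) (fun n => ?_)
      ((Real.summable_pow_div_factorial ‖cop θ‖).mul_left ‖g‖)
    rw [norm_smul, norm_div, norm_one, Complex.norm_natCast]
    calc 1 / (n.factorial : ℝ) * ‖(cop θ ^ n) g‖
        ≤ 1 / (n.factorial : ℝ) * (‖cop θ‖ ^ n * ‖g‖) := by
          gcongr; exact norm_pow_apply_le _ n g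
      _ = _ := by ring
  rw [hasSum_iff_tendsto_nat_of_summable_norm hs]
  obtain ⟨hm, C, hC⟩ := h
  have hb : ∀ n : ℕ, BddMeas fun v => 1 / (n.factorial : ℂ) * θ v ^ n := fun n =>
    (BddMeas.const _).mul (BddMeas.pow ⟨hm, C, hC⟩ n)
  have h1 : ∀ n : ℕ, (1 / (n.factorial : ℂ)) • (cop θ ^ n) g
      = cop (fun v => 1 / (n.factorial : ℂ) * θ v ^ n) g := fun n => by
    rw [cop_pow ⟨hm, C, hC⟩, ← cop_smul (BddMeas.pow ⟨hm, C, hC⟩ n)]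
  simp only [h1, ← (cop_sum _ hb g).2]
  have hE : ∀ v, HasSum (fun n : ℕ => 1 / (n.factorial : ℂ) * θ v ^ n) (Complex.exp (θ v)) :=
    fun v => by
      have := NormedSpace.expSeries_div_hasSum_exp (θ v)
      rw [← Complex.exp_eq_exp_ℂ] at this
      convert! this using 2 with n
      ring
  have hN : ∀ N v, ‖∑ n ∈ Finset.range N, 1 / (n.factorial : ℂ) * θ v ^ n‖ ≤ Real.exp C := by
    intro N v
    refine (norm_sum_le _ _).trans ?_
    have hC0 : 0 ≤ C := (norm_nonneg _).trans (hC v)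
    refine le_trans (Finset.sum_le_sum fun n _ => ?_) (Real.sum_le_exp_of_nonneg hC0 N)
    rw [norm_mul, norm_div, norm_one, Complex.norm_natCast, norm_pow, one_div, inv_mul_eq_div]
    gcongr
    exact hC v
  refine tendsto_cop (C := Real.exp C) (fun N => (cop_sum (Finset.range N) hb g).1.1) hm.cexp (fun N v => hN N v)
    (fun v => ?_) (fun v => (hE v).tendsto_sum_nat) g
  exact le_of_tendsto ((hE v).tendsto_sum_nat.norm) (Eventually.of_forall fun N => hN N v)

theorem tsum_expMode_chargeOp {H : Type*} [NormedAddCommGroup H] [InnerProductSpace ℂ H]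
    [CompleteSpace H] {b : K → H →L[ℂ] H} (h : IsCAR b) (V : testFields) (i : Mode) :
    ∑' k, expMode b (chargeOp e V) i k = cr b (modeMap (S e V) i) := by
  have hb := symp_coulomb_bddMeas e V
  have hb' : BddMeas fun v => -I * ((symp V.1 (coulomb e v) : ℝ) : ℂ) := (BddMeas.const (-I)).mul hb
  rcases i with ⟨σ, g⟩
  have h1 : HasSum (fun n : ℕ => ((-I) ^ n / (n.factorial : ℂ)) • (chargeOp e V ^ n) g) (S e V g) := by
    have h2 := hasSum_exp_cop hb' g
    rw [S_eq]
    convert! h2 using 2 with n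
    · rw [cop_pow hb', chargeOp_eq, cop_pow hb]
      simp only [mul_pow]
      rw [cop_smul (hb.pow n), smul_smul]
      congr 1; ring
    · congr 1
      funext v
      rw [symp_coulomb]; push_cast
      congr 1; ring
  cases σ
  · let f : K →+ H →L[ℂ] H := AddMonoidHom.mk' (fun g => cr b (false, g)) fun g g' => by
      show b _ = b _ + b _
      rw [_root_.map_add, h.add]
    have h3 := h1.map f (h.continuous_cr false)
    refine HasSum.tsum_eq ?_
    convert! h3 using 3
    refine funext fun n => ?_
    show expMode b _ (false, g) n = b (freqProj false (_ • _))
    rw [map_smul, h.smul]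
    unfold expMode chargeSign
    simp [cr]
  · let f : K →+ H →L[ℂ] H := AddMonoidHom.mk' (fun g => cr b (true, g)) fun g g' => by
      show star (b _) = star (b _) + star (b _)
      rw [_root_.map_add, h.add, star_add]
    have h3 := h1.map f (h.continuous_cr true)
    refine HasSum.tsum_eq ?_
    convert! h3 using 3
    refine funext fun n => ?_
    show expMode b _ (true, g) n = star (b (freqProj true (_ • _)))
    rw [map_smul, h.smul]
    unfold expMode chargeSign
    simp [cr]

namespace FockRep

variable {HF : Type v} [NormedAddCommGroup HF] [InnerProductSpace ℂ HF] [CompleteSpace HF]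
  (F : FockRep e HF)

theorem domain_eq : F.domain = wordSpan F.field F.Ω := by
  have hr : (Set.range fun w => crWord F.field w F.Ω)
      = Set.range fun p : List Mode × Unit => crWord F.field p.1 F.Ω := by
    ext ψ; simp
  have hB : ∀ g, ∀ ψ ∈ wordSpan F.field F.Ω, F.field g ψ ∈ wordSpan F.field F.Ω ∧
      star (F.field g) ψ ∈ wordSpan F.field F.Ω := fun g ψ hψ => by
    unfold wordSpan at hψ ⊢
    rw [hr] at hψ ⊢
    exact field_mem_span (φ := fun _ : Unit => F.Ω) F.isCAR (fun _ => F.isVac) g hψ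
  refine le_antisymm ?_ ?_
  · rintro _ ⟨⟨C, hC⟩, rfl⟩
    suffices h : ∀ ψ ∈ wordSpan F.field F.Ω,
        F.π ⟨C, starCAR_le e hC⟩ ψ ∈ wordSpan F.field F.Ω ∧
        star (F.π ⟨C, starCAR_le e hC⟩) ψ ∈ wordSpan F.field F.Ω from (h _ (word_mem [])).1
    have hC' := hC
    unfold starCAR at hC'
    induction hC' using StarAlgebra.adjoin_induction with
    | mem x hx =>
      obtain ⟨g, rfl⟩ := hx
      exact fun ψ hψ => hB g ψ hψ
    | algebraMap r =>
      intro ψ hψ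
      have : (⟨algebraMap ℂ (FieldAlg e) r, starCAR_le e hC⟩ : CAR e) = algebraMap ℂ (CAR e) r := rfl
      rw [this, AlgHomClass.commutes, Algebra.algebraMap_eq_smul_one, star_smul, star_one]
      exact ⟨Submodule.smul_mem _ _ hψ, Submodule.smul_mem _ _ hψ⟩
    | add x y hx hy h1 h2 =>
      intro ψ hψ
      have : (⟨x + y, starCAR_le e hC⟩ : CAR e) = ⟨x, starCAR_le e hx⟩ + ⟨y, starCAR_le e hy⟩ := rfl
      rw [this, _root_.map_add, star_add]
      exact ⟨Submodule.add_mem _ (h1 hx ψ hψ).1 (h2 hy ψ hψ).1,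
        Submodule.add_mem _ (h1 hx ψ hψ).2 (h2 hy ψ hψ).2⟩
    | mul x y hx hy h1 h2 =>
      intro ψ hψ
      have : (⟨x * y, starCAR_le e hC⟩ : CAR e) = ⟨x, starCAR_le e hx⟩ * ⟨y, starCAR_le e hy⟩ := rfl
      rw [this, map_mul, star_mul]
      exact ⟨(h1 hx _ (h2 hy ψ hψ).1).1, (h2 hy _ (h1 hx ψ hψ).2).2⟩
    | star x hx h1 =>
      intro ψ hψ
      have : (⟨star x, starCAR_le e hC⟩ : CAR e) = star ⟨x, starCAR_le e hx⟩ := rfl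
      rw [this, map_star, star_star]
      exact ⟨(h1 hx ψ hψ).2, (h1 hx ψ hψ).1⟩
  · unfold wordSpan
    rw [Submodule.span_le]
    rintro _ ⟨w, rfl⟩
    suffices h : ∃ C : starCAR e, F.π ⟨C.1, starCAR_le e C.2⟩ = crWord F.field w by
      obtain ⟨C, hC⟩ := h
      exact ⟨C, by rw [hC]⟩
    induction w with
    | nil => exact ⟨1, map_one F.π⟩
    | cons i w ih =>
      obtain ⟨C, hC⟩ := ih
      have h1 : ∃ D : starCAR e, F.π ⟨D.1, starCAR_le e D.2⟩ = cr F.field i := by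
        rcases i with ⟨σ, g⟩
        cases σ
        · exact ⟨⟨_, B_mem_starCAR e (freqProj false g)⟩, rfl⟩
        · exact ⟨star ⟨_, B_mem_starCAR e (freqProj true g)⟩,
            map_star F.π ⟨_, B_mem e (freqProj true g)⟩⟩
      obtain ⟨D, hD⟩ := h1
      refine ⟨D * C, ?_⟩
      rw [crWord_cons, ← hC, ← hD, ← map_mul]; rfl

/-- The charge operator in the exponent of the Gauss constraint. -/
theorem exists_density (V : testFields) : ∃ N : wordSpan F.field F.Ω →ₗ[ℂ] wordSpan F.field F.Ω,
    IsNumber F.field F.Ω (chargeOp e V) N ∧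
    ∀ ψ, HasSum (fun n : ℕ => ((-I) ^ n / (n.factorial : ℂ)) • ((N ^ n) ψ : HF)) (F.Γ V ψ) := by
  obtain ⟨N, hN⟩ := exists_isNumber F.isFock (isDiag_chargeOp e V)
  exact ⟨N, hN, fun ψ => hN.hasSum_exp F.isFock (isBog_S e V) (tsum_expMode_chargeOp F.isCAR V) ψ⟩

theorem exists_normalOrderedDensity (V : testFields) : ∃ N : F.domain →ₗ[ℂ] F.domain,
    F.IsNormalOrderedDensity (fun v => symp V.1 (coulomb e v)) N ∧
    F.IsExpNegI N (F.Γ V).toContinuousLinearMap := by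
  obtain ⟨N, hN, hE⟩ := F.exists_density V
  have hd := F.domain_eq
  have hT := isDiag_chargeOp e V
  have hu : (F.Γ V).toContinuousLinearMap ∈ unitary (HF →L[ℂ] HF) := by
    have h1 : star (F.Γ V).toContinuousLinearMap * (F.Γ V).toContinuousLinearMap = 1 :=
      (ContinuousLinearMap.norm_map_iff_adjoint_comp_self _).1 (F.Γ V).norm_map
    refine Unitary.mem_iff.2 ⟨h1, ContinuousLinearMap.ext fun ψ => ?_⟩
    obtain ⟨φ, rfl⟩ := F.isFock.Γ_surjective (isBog_S e V) ψ
    have h2 := congrArg (fun T => T φ) h1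
    exact congrArg (F.Γ V) h2
  have hd' : ∃ N : F.domain →ₗ[ℂ] F.domain, 
      F.IsNormalOrderedDensity (fun v => symp V.1 (coulomb e v)) N ∧
      ∀ ψ : F.domain, HasSum (fun n : ℕ => ((-I) ^ n / (n.factorial : ℂ)) • ((N ^ n) ψ : HF))
        (F.Γ V ψ) := by
    unfold IsNormalOrderedDensity
    rw [hd]
    refine ⟨N, fun ι κ ep en ψ => ?_, hE⟩
    obtain ⟨χp, χn, h1, h2, -⟩ := exists_sums ep en F.isFock IsDiag.id hT (fun _ => rfl) hT
      IsDiag.id (fun _ => rfl) ψ.2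
    exact ⟨χp, χn, h1, h2, sums_unique ep en F.isFock IsDiag.id hT (fun _ => rfl) hT
      IsDiag.id (fun _ => rfl) hN ψ h1 h2⟩
  obtain ⟨N', h1, h2⟩ := hd'
  exact ⟨N', h1, hu, h2⟩

end FockRep

end Gauss

/-! ## The Gauss constraint -/

section Neutral

variable {e : ℝ}

theorem IsPureGauge.coulombPhase_const {V : testFields} (hV : IsPureGauge V) (e : ℝ) :
    ∃ c : ℝ, ∀ v, coulombPhase e V.1 v = c := by
  refine ⟨e / (4 * Real.pi) * ∫ n, pastLimit V.1 (nullOf n) 0 / (nullOf n).1 0 ∂sphereMeasure,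
    fun v => ?_⟩
  rw [coulombPhase_eq]
  congr 2
  funext n
  set l := nullOf n
  have h0 : l.1 0 ≠ 0 := l.2.2.ne'
  have h1 : pastLimit V.1 l = (pastLimit V.1 l 0 / l.1 0) • l.1 := by
    ext a
    have h2 : ∀ s, l.1 0 * V.1 s l a = l.1 a * V.1 s l 0 := fun s => hV s l 0 a
    have h3 := V.2.tendsto_pastLimit l
    have h4 := ((tendsto_pi_nhds.1 h3 a).const_mul (l.1 0))
    simp only [h2] at h4
    have h5 := tendsto_nhds_unique h4 ((tendsto_pi_nhds.1 h3 0).const_mul (l.1 a))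
    rw [Pi.smul_apply, smul_eq_mul]
    field_simp
    linarith
  rw [h1, mdot_smul_right]
  have h2 := (mdot_hyp_null_pos v l).ne'
  rw [Pi.smul_apply, smul_eq_mul]
  field_simp

theorem IsPureGauge.S_eq_smul {V : testFields} (hV : IsPureGauge V) (e : ℝ) :
    ∃ z : ℂ, star z * z = 1 ∧ ∀ g, S e V g = z • g := by
  obtain ⟨c, hc⟩ := hV.coulombPhase_const e
  refine ⟨Complex.exp (I * c), ?_, fun g => ?_⟩
  · rw [RCLike.star_def, ← Complex.exp_conj, ← Complex.exp_add]
    simp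
  · rw [S_eq]
    simp only [hc]
    exact cop_const _ g

theorem W_comm_of_isPureGauge {V₀ : testFields} (h : IsPureGauge V₀) (V : testFields) :
    FieldAlg.W e V₀ * FieldAlg.W e V = FieldAlg.W e V * FieldAlg.W e V₀ := by
  rw [FieldAlg.W_mul, FieldAlg.W_mul, h.symp_left, h.symp_right, add_comm]

theorem W_mem_observables (V : testFields) : FieldAlg.W e V ∈ observables e := fun V₀ h => by
  rw [W_comm_of_isPureGauge h, mul_assoc, FieldAlg.W_mul_star, mul_one]

theorem star_B_mul_B_mem_observables (f g : K) :
    star (FieldAlg.B e f) * FieldAlg.B e g ∈ observables e := fun V₀ h => by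
  obtain ⟨z, hz, hS⟩ := h.S_eq_smul e
  rw [← mul_assoc, FieldAlg.W_Bs, mul_assoc (star _), FieldAlg.W_B, mul_assoc, mul_assoc,
    FieldAlg.W_mul_star, mul_one, hS, hS, FieldAlg.B_smul, FieldAlg.B_smul, star_smul, star_star,
    smul_mul_smul_comm, mul_comm z, hz, one_smul]

theorem B_mul_star_B_mem_observables (f g : K) :
    FieldAlg.B e f * star (FieldAlg.B e g) ∈ observables e := fun V₀ h => by
  obtain ⟨z, hz, hS⟩ := h.S_eq_smul e
  rw [← mul_assoc, FieldAlg.W_B, mul_assoc (FieldAlg.B e _), FieldAlg.W_Bs, mul_assoc, mul_assoc,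
    FieldAlg.W_mul_star, mul_one, hS, hS, FieldAlg.B_smul, FieldAlg.B_smul, star_smul, star_star,
    smul_mul_smul_comm, hz, one_smul]

theorem IsNumber.neg {H : Type*} [NormedAddCommGroup H] [InnerProductSpace ℂ H] [CompleteSpace H]
    {b : K → H →L[ℂ] H} {Ω : H} (h : IsCAR b) {T T' : K →L[ℂ] K} (hT : ∀ g, T' g = -T g)
    {N : wordSpan b Ω →ₗ[ℂ] wordSpan b Ω} (hN : IsNumber b Ω T N) : IsNumber b Ω T' (-N) where
  vac := by
    rw [LinearMap.neg_apply, Submodule.coe_neg, hN.vac, neg_zero]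
  cr i ψ := by
    rw [LinearMap.neg_apply, Submodule.coe_neg, hN.cr, LinearMap.neg_apply, Submodule.coe_neg,
      _root_.map_neg, neg_add, ← smul_neg]
    congr 2
    rcases i with ⟨σ, g⟩
    cases σ
    · show -b (freqProj false (T g)) ψ = b (freqProj false (T' g)) ψ
      rw [hT, _root_.map_neg, h.neg]; rfl
    · show -star (b (freqProj true (T g))) ψ = star (b (freqProj true (T' g))) ψ
      rw [hT, _root_.map_neg, h.neg, star_neg]; rfl

theorem chargeOp_neg (e : ℝ) (V : testFields) (g : K) : chargeOp e (-V) g = -chargeOp e V g := by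
  have h : ∀ v, coulombPhase e (-V : testFields).1 v = -coulombPhase e V.1 v := fun v => by
    have := coulombPhase_smul e (-1) V v
    have h0 : (-1 : ℝ) • V = -V := neg_one_smul ℝ V
    rwa [h0, neg_one_mul] at this
  have h1 : (fun v => ((symp (-V : testFields).1 (coulomb e v) : ℝ) : ℂ))
      = fun v => (-1 : ℂ) * ((symp V.1 (coulomb e v) : ℝ) : ℂ) := by
    funext v
    rw [symp_coulomb, symp_coulomb, h]; push_cast; ring
  rw [chargeOp_eq, chargeOp_eq, h1, cop_smul (symp_coulomb_bddMeas e V), neg_one_smul]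

end Neutral

section Gauss

variable {e : ℝ} {HF : Type v} [NormedAddCommGroup HF] [InnerProductSpace ℂ HF] [CompleteSpace HF]
  {Hr : Type u} [NormedAddCommGroup Hr] [InnerProductSpace ℂ Hr] [CompleteSpace Hr]
  {F : FockRep e HF} {πr : CCR e →⋆ₐ[ℂ] (Hr →L[ℂ] Hr)}
  {π : FieldAlg e →⋆ₐ[ℂ] (HTensor HF Hr →L[ℂ] HTensor HF Hr)}

theorem HasSum.of_eq {α E : Type*} [AddCommMonoid E] [TopologicalSpace E] {f g : α → E} {a : E}
    (hg : HasSum g a) (h : ∀ k, f k = g k) : HasSum f a := (funext h : f = g) ▸ hg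

theorem inner_htmul_hasSum {ι : Type*} {X : HTensor HF Hr →L[ℂ] HTensor HF Hr} {ψ χ p p' : HF}
    {φ η : Hr} {f g : ι → HF} (hf : HasSum f p) (hg : HasSum g p')
    (h : ∀ k, inner ℂ (htmul χ η) (X (htmul (f k) φ)) = inner ℂ (htmul (g k) η) (X (htmul ψ φ))) :
    inner ℂ (htmul χ η) (X (htmul p φ)) = inner ℂ (htmul p' η) (X (htmul ψ φ)) := by
  have c1 : HasSum (fun k => inner ℂ (htmul χ η) (X (htmul (f k) φ)))
      (inner ℂ (htmul χ η) (X (htmul p φ))) :=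
    hf.mapL ((innerSL ℂ (htmul χ η)).comp (X.comp (htmulLeft HF φ)))
  have c2 : HasSum (fun k => star (inner ℂ (X (htmul ψ φ)) (htmul (g k) η)))
      (star (inner ℂ (X (htmul ψ φ)) (htmul p' η))) :=
    (hg.mapL ((innerSL ℂ (X (htmul ψ φ))).comp (htmulLeft HF η))).star
  simp only [RCLike.star_def, inner_conj_symm] at c2
  exact c1.unique (HasSum.of_eq c2 h)

theorem inner_htmul_amp (A : HF →L[ℂ] HF) (x : HF) (η : Hr) (Ψ : HTensor HF Hr) :
    inner ℂ (htmul x η) (amp Hr A Ψ) = inner ℂ (htmul (star A x) η) Ψ := by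
  rw [← amp_htmul, map_star, ContinuousLinearMap.star_eq_adjoint,
    ContinuousLinearMap.adjoint_inner_left]

theorem inner_comm_amp {X : HTensor HF Hr →L[ℂ] HTensor HF Hr} {A B : HF →L[ℂ] HF}
    (h : ∀ Ψ, X (amp Hr (A * B) Ψ) = amp Hr (A * B) (X Ψ)) (ψ χ : HF) (φ η : Hr) :
    inner ℂ (htmul χ η) (X (htmul (A (B ψ)) φ))
      = inner ℂ (htmul (star B (star A χ)) η) (X (htmul ψ φ)) := by
  have e1 : htmul (A (B ψ)) φ = amp Hr (A * B) (htmul ψ φ) := (amp_htmul (A * B) ψ φ).symm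
  rw [e1, h, inner_htmul_amp, star_mul]; rfl

/-- Operators commuting with the neutral quadratic expressions commute with the charge density in
the weak sense. -/
theorem inner_comm_density {b : K → HF →L[ℂ] HF} {Ω : HF} (hF : IsFock b Ω) {T : K →L[ℂ] K}
    (hT : IsDiag T) {N : wordSpan b Ω →ₗ[ℂ] wordSpan b Ω} (hN : IsNumber b Ω T N)
    {X : HTensor HF Hr →L[ℂ] HTensor HF Hr}
    (h1 : ∀ f g Ψ, X (amp Hr (star (b f) * b g) Ψ) = amp Hr (star (b f) * b g) (X Ψ))
    (h2 : ∀ f g Ψ, X (amp Hr (b f * star (b g)) Ψ) = amp Hr (b f * star (b g)) (X Ψ))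
    (ψ χ : wordSpan b Ω) (φ η : Hr) :
    inner ℂ (htmul (χ : HF) η) (X (htmul (N ψ : HF) φ))
      = inner ℂ (htmul (N χ : HF) η) (X (htmul (ψ : HF) φ)) := by
  obtain ⟨wp, ep, -⟩ := exists_hilbertBasis ℂ (freqSpace true)
  obtain ⟨wn, en, -⟩ := exists_hilbertBasis ℂ (freqSpace false)
  obtain ⟨p, n, a1, a2, -⟩ := exists_sums (T := T) ep en hF IsDiag.id hT (fun _ => rfl) hT
    IsDiag.id (fun _ => rfl) ψ.2
  obtain ⟨p', n', b1, b2, -⟩ := exists_sums (T := T) ep en hF hT IsDiag.id (fun _ => rfl) IsDiag.id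
    hT (fun _ => rfl) χ.2
  have ea := sums_unique (T := T) ep en hF IsDiag.id hT (fun _ => rfl) hT
    IsDiag.id (fun _ => rfl) hN ψ a1 a2
  have eb := sums_unique (T := T) ep en hF hT IsDiag.id (fun _ => rfl) IsDiag.id
    hT (fun _ => rfl) hN χ b1 b2
  have c1 := inner_htmul_hasSum (X := X) (φ := φ) (η := η) a1 b1 fun k => by
    have := inner_comm_amp (h1 (ep k) (T (ep k))) ψ χ φ η
    rwa [star_star] at this
  have c2 := inner_htmul_hasSum (X := X) (φ := φ) (η := η) a2 b2 fun k => by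
    have := inner_comm_amp (h2 (T (en k)) (en k)) ψ χ φ η
    rwa [star_star] at this
  rw [ea, eb, htmul_sub_left, htmul_sub_left, _root_.map_sub, inner_sub_right, inner_sub_left, c1, c2]

theorem inner_comm_density_pow {b : K → HF →L[ℂ] HF} {Ω : HF}
    {N : wordSpan b Ω →ₗ[ℂ] wordSpan b Ω}
    {X : HTensor HF Hr →L[ℂ] HTensor HF Hr}
    (h : ∀ (ψ χ : wordSpan b Ω) (φ η : Hr), inner ℂ (htmul (χ : HF) η) (X (htmul (N ψ : HF) φ))
      = inner ℂ (htmul (N χ : HF) η) (X (htmul (ψ : HF) φ)))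
    (n : ℕ) : ∀ (ψ χ : wordSpan b Ω) (φ η : Hr),
    inner ℂ (htmul (χ : HF) η) (X (htmul ((N ^ n) ψ : HF) φ))
      = inner ℂ (htmul ((N ^ n) χ : HF) η) (X (htmul (ψ : HF) φ)) := by
  induction n with
  | zero => intro ψ χ φ η; rfl
  | succ n ih =>
    intro ψ χ φ η
    rw [pow_succ' N]
    show inner ℂ _ (X (htmul ((N ((N ^ n) ψ) : wordSpan b Ω) : HF) φ)) = _
    rw [h, ih, ← pow_succ' N, pow_succ N]; rfl

theorem Γ_Γ_neg (V : testFields) (ψ : HF) : F.Γ V (F.Γ (-V) ψ) = ψ := by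
  have h3 := F.isFock.Γ_comp (isBog_S e V) (isBog_S e (-V)) (isBog_S e 0) (fun g => by
    rw [← S_add, add_neg_cancel]) ψ
  exact h3.trans (F.isFock.Γ_id _ (S_zero e) ψ)

theorem inner_htmul_Γ (V : testFields) (x : HF) (η : Hr) (Ψ : HTensor HF Hr) :
    inner ℂ (htmul (F.Γ (-V) x) η) Ψ
      = inner ℂ (htmul x η) (amp Hr (F.Γ V).toContinuousLinearMap Ψ) := by
  have e4 : amp Hr (F.Γ V).toContinuousLinearMap
      = (tensorIso (F.Γ V) (LinearIsometry.id (E := Hr) (R := ℂ))).toContinuousLinearMap :=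
    tensor_ext fun ψ φ => by
      rw [amp_htmul]
      exact (tensorIso_htmul (F.Γ V) (LinearIsometry.id (E := Hr) (R := ℂ)) ψ φ).symm
  have e3 : htmul x η
      = tensorIso (F.Γ V) (LinearIsometry.id (E := Hr) (R := ℂ)) (htmul (F.Γ (-V) x) η) := by
    rw [tensorIso_htmul, Γ_Γ_neg]; rfl
  rw [e4, e3]
  exact (LinearIsometry.inner_map_map _ _ _).symm

theorem inner_comm_Γ (V : testFields) {X : HTensor HF Hr →L[ℂ] HTensor HF Hr}
    {N : wordSpan F.field F.Ω →ₗ[ℂ] wordSpan F.field F.Ω}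
    (hN : IsNumber F.field F.Ω (chargeOp e V) N)
    (h : ∀ (n : ℕ) (ψ χ : wordSpan F.field F.Ω) (φ η : Hr),
      inner ℂ (htmul (χ : HF) η) (X (htmul ((N ^ n) ψ : HF) φ))
      = inner ℂ (htmul ((N ^ n) χ : HF) η) (X (htmul (ψ : HF) φ)))
    (ψ χ : wordSpan F.field F.Ω) (φ η : Hr) :
    inner ℂ (htmul (χ : HF) η) (X (htmul (F.Γ V ψ) φ))
      = inner ℂ (htmul (F.Γ (-V) χ) η) (X (htmul (ψ : HF) φ)) := by
  have hN' : IsNumber F.field F.Ω (chargeOp e (-V)) (-N) := hN.neg F.isCAR (chargeOp_neg e V)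
  have a1 := hN.hasSum_exp F.isFock (isBog_S e V) (tsum_expMode_chargeOp F.isCAR V) ψ
  have a2 := hN'.hasSum_exp F.isFock (isBog_S e (-V)) (tsum_expMode_chargeOp F.isCAR (-V)) χ
  refine inner_htmul_hasSum (X := X) a1 a2 fun n => ?_
  have e2 : (-N) ^ n = ((-1 : ℂ) ^ n) • N ^ n := by
    rw [← neg_one_smul ℂ N, smul_pow]
  rw [e2, LinearMap.smul_apply, Submodule.coe_smul, htmul_smul_left, htmul_smul_left,
    htmul_smul_left, map_smul, inner_smul_right, inner_smul_left, inner_smul_left, h n, ← mul_assoc]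
  congr 1
  rw [map_div₀, map_pow, map_pow, map_neg, map_neg, Complex.conj_I, map_one, Complex.conj_natCast,
    div_mul_eq_mul_div, ← mul_pow]
  ring_nf

theorem comm_amp_Γ (V : testFields) {X : HTensor HF Hr →L[ℂ] HTensor HF Hr}
    (h1 : ∀ f g Ψ, X (amp Hr (star (F.field f) * F.field g) Ψ)
      = amp Hr (star (F.field f) * F.field g) (X Ψ))
    (h2 : ∀ f g Ψ, X (amp Hr (F.field f * star (F.field g)) Ψ)
      = amp Hr (F.field f * star (F.field g)) (X Ψ)) :
    X * amp Hr (F.Γ V).toContinuousLinearMap = amp Hr (F.Γ V).toContinuousLinearMap * X := by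
  obtain ⟨N, hN⟩ := exists_isNumber F.isFock (isDiag_chargeOp e V)
  have key := inner_comm_density_pow
    (inner_comm_density F.isFock (isDiag_chargeOp e V) hN h1 h2)
  have ht := htmul_total_of_total (Hr := Hr) (x := fun w => crWord F.field w F.Ω) F.isFock.total
  refine clm_ext_of_total (A := X * amp Hr (F.Γ V).toContinuousLinearMap)
    (B := amp Hr (F.Γ V).toContinuousLinearMap * X) ht fun p => ?_
  refine eq_of_inner_total ht fun q => ?_
  have h := inner_comm_Γ V hN key ⟨_, word_mem p.1⟩ ⟨_, word_mem q.1⟩ p.2 q.2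
  rw [mul_apply_eq_comp, mul_apply_eq_comp, amp_htmul, ← inner_htmul_Γ]
  exact h

theorem IsProductRep.gaussConstraint (h : IsProductRep F πr π) : GaussConstraint F πr π := by
  intro V
  have hsub : ∀ A ∈ observables e, π A ∈ observableVN π := fun A hA =>
    Set.subset_centralizer_centralizer ⟨A, hA, rfl⟩
  obtain ⟨N, hN, hE⟩ := F.exists_normalOrderedDensity V
  refine ⟨hsub _ (W_mem_observables V), N, _, hN, hE, fun ψ φ => h.weyl_htmul V ψ φ,
    amp Hr (F.Γ V).toContinuousLinearMap, ?_, fun ψ φ => amp_htmul _ _ _⟩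
  intro X hX
  have hX' : ∀ A ∈ observables e, ∀ Ψ, X (π A Ψ) = π A (X Ψ) := fun A hA Ψ => by
    have := hX (π A) ⟨A, hA, rfl⟩
    exact (congrArg (fun T => T Ψ) this).symm
  refine comm_amp_Γ V (fun f g Ψ => ?_) fun f g Ψ => ?_
  · have e1 : amp Hr (star (F.field f) * F.field g) = π (star (FieldAlg.B e f) * FieldAlg.B e g) := by
      rw [map_mul, map_mul, map_star, map_star, h.field, h.field]
    rw [e1]; exact hX' _ (star_B_mul_B_mem_observables f g) Ψ
  · have e1 : amp Hr (F.field f * star (F.field g)) = π (FieldAlg.B e f * star (FieldAlg.B e g)) := by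
      rw [map_mul, map_mul, map_star, map_star, h.field, h.field]
    rw [e1]; exact hX' _ (B_mul_star_B_mem_observables f g) Ψ

end Gauss

/-! ## Irreducibility and regularity -/

section Rep

variable {e : ℝ} {H : Type w} [NormedAddCommGroup H] [InnerProductSpace ℂ H] [CompleteSpace H]

/-- A closed subspace invariant under the generators and their adjoints is invariant. -/
theorem field_mem_invariant (π : FieldAlg e →⋆ₐ[ℂ] (H →L[ℂ] H)) {M : Submodule ℂ H}
    (hM : IsClosed (M : Set H)) (hW : ∀ V, ∀ ψ ∈ M, weylOp π V ψ ∈ M)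
    (hB : ∀ g, ∀ ψ ∈ M, π (FieldAlg.B e g) ψ ∈ M ∧ star (π (FieldAlg.B e g)) ψ ∈ M) (a : FieldAlg e)
    {ψ : H} (hψ : ψ ∈ M) : π a ψ ∈ M := by
  have hπ : Continuous π := FieldAlg.continuous_hom (A := H →L[ℂ] H) π
  induction a using UniformSpace.Completion.induction_on with
  | hp => exact hM.preimage ((ContinuousLinearMap.apply ℂ H ψ).continuous.comp hπ)
  | ih a =>
    suffices key : ∀ ψ ∈ M, π (a : FieldAlg e) ψ ∈ M ∧ star (π (a : FieldAlg e)) ψ ∈ M from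
      (key ψ hψ).1
    clear hψ ψ
    induction a using PreField.induction with
    | h1 c =>
      intro ψ hψ
      have : ((algebraMap ℂ (PreField e) c : PreField e) : FieldAlg e)
        = algebraMap ℂ (FieldAlg e) c := rfl
      rw [this, AlgHomClass.commutes, Algebra.algebraMap_eq_smul_one, star_smul, star_one]
      exact ⟨M.smul_mem _ hψ, M.smul_mem _ hψ⟩
    | hw x =>
      obtain ⟨V, rfl⟩ := QuotientAddGroup.mk_surjective x
      intro ψ hψ
      refine ⟨hW V ψ hψ, ?_⟩
      show star (π (FieldAlg.W e V)) ψ ∈ M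
      rw [← map_star, FieldAlg.W_star]
      exact hW (-V) ψ hψ
    | hb g => exact hB g
    | hs a h =>
      intro ψ hψ
      rw [← FieldAlg.star_coe, map_star, star_star]
      exact ⟨(h ψ hψ).2, (h ψ hψ).1⟩
    | h3 a b ha hb =>
      intro ψ hψ
      rw [UniformSpace.Completion.coe_mul, map_mul, star_mul]
      exact ⟨(ha _ (hb ψ hψ).1).1, (hb _ (ha ψ hψ).2).2⟩
    | h4 a b ha hb =>
      intro ψ hψ
      rw [UniformSpace.Completion.coe_add, _root_.map_add, star_add]
      exact ⟨M.add_mem (ha ψ hψ).1 (hb ψ hψ).1, M.add_mem (ha ψ hψ).2 (hb ψ hψ).2⟩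

theorem CCR_mem_invariant (π : CCR e →⋆ₐ[ℂ] (H →L[ℂ] H)) {M : Submodule ℂ H}
    (hM : IsClosed (M : Set H)) (hW : ∀ V, ∀ ψ ∈ M, weylOpCCR π V ψ ∈ M) (a : CCR e)
    {ψ : H} (hψ : ψ ∈ M) : π a ψ ∈ M := by
  refine mem_invariant π (CCR_continuous (A := H →L[ℂ] H) π) hM ?_ a hψ
  rintro _ ⟨V, rfl⟩ ψ hψ
  refine ⟨hW V ψ hψ, ?_⟩
  have h1 : star (weylOpCCR π V) = weylOpCCR π (-V) := by
    unfold weylOpCCR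
    rw [← map_star]
    congr 1
    exact Subtype.ext (FieldAlg.W_star V)
  show star (weylOpCCR π V) ψ ∈ M
  rw [h1]
  exact hW (-V) ψ hψ

theorem orthogonal_invariant (π : FieldAlg e →⋆ₐ[ℂ] (H →L[ℂ] H)) {M : Submodule ℂ H}
    (h : ∀ a, ∀ ψ ∈ M, π a ψ ∈ M) (a : FieldAlg e) {ψ : H} (hψ : ψ ∈ Mᗮ) : π a ψ ∈ Mᗮ := by
  intro χ hχ
  rw [← ContinuousLinearMap.adjoint_inner_left, ← ContinuousLinearMap.star_eq_adjoint, ← map_star]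
  exact hψ _ (h _ χ hχ)

theorem UnitarilyEquiv.symm {H' : Type v} [NormedAddCommGroup H'] [InnerProductSpace ℂ H']
    [CompleteSpace H'] {π : FieldAlg e →⋆ₐ[ℂ] (H →L[ℂ] H)} {π' : FieldAlg e →⋆ₐ[ℂ] (H' →L[ℂ] H')}
    (h : UnitarilyEquiv π π') : UnitarilyEquiv π' π := by
  obtain ⟨T, hT⟩ := h
  refine ⟨T.symm, fun A ψ => ?_⟩
  rw [LinearIsometryEquiv.symm_apply_eq, hT, T.apply_symm_apply]

theorem UnitarilyEquiv.irreducible {H' : Type v} [NormedAddCommGroup H'] [InnerProductSpace ℂ H']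
    [CompleteSpace H'] {π : FieldAlg e →⋆ₐ[ℂ] (H →L[ℂ] H)} {π' : FieldAlg e →⋆ₐ[ℂ] (H' →L[ℂ] H')}
    (h : UnitarilyEquiv π π') (hi : IsIrreducibleRep π) : IsIrreducibleRep π' := by
  obtain ⟨T, hT⟩ := h
  obtain ⟨hn, hi⟩ := hi
  refine ⟨T.symm.toEquiv.nontrivial, fun M hM hinv => ?_⟩
  have h1 := hi (M.comap T.toLinearEquiv.toLinearMap) (hM.preimage T.continuous) fun a ψ hψ => by
    show T (π a ψ) ∈ M
    rw [hT]; exact hinv a _ hψ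
  rcases h1 with h1 | h1
  · left
    rw [eq_bot_iff]
    intro ψ hψ
    have h2 : T.symm ψ ∈ M.comap T.toLinearEquiv.toLinearMap := by
      show T (T.symm ψ) ∈ M
      rwa [T.apply_symm_apply]
    rw [h1, Submodule.mem_bot] at h2
    rw [Submodule.mem_bot, ← T.apply_symm_apply ψ, h2, _root_.map_zero]
  · right
    rw [eq_top_iff]
    intro ψ _
    have h2 : T.symm ψ ∈ M.comap T.toLinearEquiv.toLinearMap := by rw [h1]; trivial
    have h3 : T (T.symm ψ) ∈ M := h2
    rwa [T.apply_symm_apply] at h3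

theorem UnitarilyEquiv.regular {H' : Type v} [NormedAddCommGroup H'] [InnerProductSpace ℂ H']
    [CompleteSpace H'] {π : FieldAlg e →⋆ₐ[ℂ] (H →L[ℂ] H)} {π' : FieldAlg e →⋆ₐ[ℂ] (H' →L[ℂ] H')}
    (h : UnitarilyEquiv π π') (hr : IsRegularRep (weylOp π)) : IsRegularRep (weylOp π') := by
  obtain ⟨T, hT⟩ := h
  intro V ψ
  have h1 := T.continuous.comp (hr V (T.symm ψ))
  convert! h1 using 2 with t
  show _ = T (π _ _)
  rw [hT, T.apply_symm_apply]; rfl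

end Rep

section Product

variable {e : ℝ} {HF : Type v} [NormedAddCommGroup HF] [InnerProductSpace ℂ HF] [CompleteSpace HF]
  {Hr : Type u} [NormedAddCommGroup Hr] [InnerProductSpace ℂ Hr] [CompleteSpace Hr]
  {F : FockRep e HF} {πr : CCR e →⋆ₐ[ℂ] (Hr →L[ℂ] Hr)}
  {π : FieldAlg e →⋆ₐ[ℂ] (HTensor HF Hr →L[ℂ] HTensor HF Hr)}

theorem IsProductRep.weyl_vac (h : IsProductRep F πr π) (V : testFields) (φ : Hr) :
    weylOp π V (htmul F.Ω φ) = htmul F.Ω (weylOpCCR πr V φ) := by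
  rw [h.weyl_htmul, F.Γ_vac]

theorem IsProductRep.vac_total (h : IsProductRep F πr π) {M : Submodule ℂ (HTensor HF Hr)}
    (hM : IsClosed (M : Set (HTensor HF Hr))) (hinv : ∀ a, ∀ ψ ∈ M, π a ψ ∈ M)
    (hv : ∀ φ, htmul F.Ω φ ∈ M) : M = ⊤ := by
  have ht := htmul_total_of_total (Hr := Hr) F.total
  rw [eq_top_iff]
  intro ψ _
  refine closure_minimal ?_ hM (ht ψ)
  show Submodule.span ℂ _ ≤ M
  rw [Submodule.span_le]
  rintro _ ⟨⟨C, φ⟩, rfl⟩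
  show htmul (F.π C F.Ω) φ ∈ M
  rw [← h.car]
  exact hinv _ _ (hv φ)

theorem IsProductRep.irreducible_of (h : IsProductRep F πr π) (hi : IsIrreducibleRep πr) :
    IsIrreducibleRep π := by
  obtain ⟨hn, hi⟩ := hi
  refine ⟨?_, fun M hM hinv => ?_⟩
  · obtain ⟨φ, hφ⟩ := exists_ne (0 : Hr)
    refine ⟨htmul F.Ω φ, 0, fun h0 => hφ ?_⟩
    have := norm_htmul F.Ω φ
    rw [h0, norm_zero, F.norm_Ω, one_mul] at this
    exact norm_eq_zero.1 this.symm
  let M₀ : Submodule ℂ Hr := M.comap (htmulR Hr F.Ω).toLinearMap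
  have h1 := hi M₀ (hM.preimage (htmulR Hr F.Ω).continuous) fun a φ hφ =>
    CCR_mem_invariant πr (hM.preimage (htmulR Hr F.Ω).continuous) (fun V φ hφ => by
      show htmul F.Ω (weylOpCCR πr V φ) ∈ M
      rw [← h.weyl_vac]
      exact hinv _ _ hφ) a hφ
  rcases h1 with h1 | h1
  · left
    have : CompleteSpace M := hM.completeSpace_coe
    have h2 : ∀ φ, htmul F.Ω φ ∈ Mᗮ := by
      intro φ
      obtain ⟨x, hx, y, hy, hxy⟩ := Submodule.exists_add_mem_mem_orthogonal (K := M) (htmul F.Ω φ)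
      have hvac : ∀ i, star (cr (fun g => amp Hr (F.field g)) i) x = 0 := by
        intro i
        have h0 : star (cr (fun g => amp Hr (F.field g)) i) (htmul F.Ω φ) = 0 :=
          F.isFock.vac_tensor φ i
        have hA : ∃ a, star (cr (fun g => amp Hr (F.field g)) i) = π a := by
          rcases i with ⟨σ, g⟩
          cases σ
          · refine ⟨star (FieldAlg.B e (freqProj false g)), ?_⟩
            rw [map_star, h.field]; rfl
          · refine ⟨FieldAlg.B e (freqProj true g), ?_⟩
            rw [h.field]; exact star_star _
        obtain ⟨a, ha⟩ := hA
        rw [ha] at h0 ⊢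
        rw [hxy, _root_.map_add] at h0
        have h3 := hinv a x hx
        have h4 := orthogonal_invariant π hinv a hy
        rw [add_eq_zero_iff_eq_neg] at h0
        have h5 : π a x ∈ Mᗮ := by rw [h0]; exact Mᗮ.neg_mem h4
        have h6 := h5 _ h3
        exact inner_self_eq_zero.1 h6
      obtain ⟨φ', rfl⟩ := F.isFock.eq_of_vac_tensor hvac
      have h7 : φ' ∈ M₀ := hx
      rw [h1, Submodule.mem_bot] at h7
      rw [hxy, h7, htmul_zero_right, zero_add]
      exact hy
    have h3 := h.vac_total (Submodule.isClosed_orthogonal M)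
      (fun a ψ hψ => orthogonal_invariant π hinv a hψ) h2
    exact (Submodule.orthogonal_eq_top_iff M).1 h3
  · right
    refine h.vac_total hM hinv fun φ => ?_
    have : φ ∈ M₀ := by rw [h1]; trivial
    exact this

theorem IsProductRep.of_irreducible (h : IsProductRep F πr π) (hi : IsIrreducibleRep π) :
    IsIrreducibleRep πr := by
  obtain ⟨hn, hi⟩ := hi
  refine ⟨?_, fun M₀ hM₀ hinv => ?_⟩
  · by_contra hc
    rw [not_nontrivial_iff_subsingleton] at hc
    have h1 : (⊥ : Submodule ℂ (HTensor HF Hr)) = ⊤ := by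
      rw [eq_top_iff]
      intro ψ _
      have := htmul_total (HF := HF) (Hr := Hr) ψ
      refine closure_minimal ?_ (isClosed_singleton (x := (0 : HTensor HF Hr))) this
      show Submodule.span ℂ _ ≤ (⊥ : Submodule ℂ (HTensor HF Hr))
      rw [Submodule.span_le]
      rintro _ ⟨⟨ψ, φ⟩, rfl⟩
      rw [Subsingleton.elim φ 0]
      exact htmul_zero_right ψ
    exact bot_ne_top h1
  let s : Submodule ℂ (HTensor HF Hr) :=
    Submodule.span ℂ (Set.range fun p : HF × M₀ => htmul p.1 (p.2 : Hr))
  let M := s.topologicalClosure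
  have hM : IsClosed (M : Set (HTensor HF Hr)) := Submodule.isClosed_topologicalClosure _
  have hmem : ∀ ψ, ∀ φ ∈ M₀, htmul ψ φ ∈ M := fun ψ φ hφ =>
    Submodule.le_topologicalClosure _ (Submodule.subset_span ⟨(ψ, ⟨φ, hφ⟩), rfl⟩)
  have hop : ∀ A : HTensor HF Hr →L[ℂ] HTensor HF Hr,
      (∀ ψ, ∀ φ ∈ M₀, A (htmul ψ φ) ∈ M) → ∀ Ψ ∈ M, A Ψ ∈ M := by
    intro A hA Ψ hΨ
    have h1 : M ≤ M.comap A.toLinearMap := by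
      refine Submodule.topologicalClosure_minimal _ ?_ (hM.preimage A.continuous)
      rw [Submodule.span_le]
      rintro _ ⟨⟨ψ, φ⟩, rfl⟩
      exact hA ψ φ φ.2
    exact h1 hΨ
  have hinvM : ∀ a, ∀ Ψ ∈ M, π a Ψ ∈ M := fun a Ψ hΨ => by
    refine field_mem_invariant π hM (fun V => hop _ fun ψ φ hφ => ?_) (fun g Ψ hΨ =>
      ⟨hop _ (fun ψ φ hφ => ?_) Ψ hΨ, hop _ (fun ψ φ hφ => ?_) Ψ hΨ⟩) a hΨ
    · rw [h.weyl_htmul]; exact hmem _ _ (hinv _ φ hφ)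
    · rw [h.field, amp_htmul]; exact hmem _ _ hφ
    · rw [h.field, ← map_star, amp_htmul]; exact hmem _ _ hφ
  have hc : CompleteSpace M₀ := hM₀.completeSpace_coe
  rcases hi M hM hinvM with h1 | h1
  · left
    rw [eq_bot_iff]
    intro φ hφ
    have h2 := hmem F.Ω φ hφ
    rw [h1, Submodule.mem_bot] at h2
    have := norm_htmul F.Ω φ
    rw [h2, norm_zero, F.norm_Ω, one_mul] at this
    exact norm_eq_zero.1 this.symm
  · right
    rw [← Submodule.orthogonal_eq_bot_iff, eq_bot_iff]
    intro φ hφ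
    have h2 : M ≤ (Submodule.span ℂ {htmul F.Ω φ})ᗮ := by
      refine Submodule.topologicalClosure_minimal _ ?_ (Submodule.isClosed_orthogonal _)
      rw [Submodule.span_le]
      rintro _ ⟨⟨ψ, φ'⟩, rfl⟩
      rw [SetLike.mem_coe, Submodule.mem_orthogonal_singleton_iff_inner_left]
      rw [inner_htmul, hφ φ'.1 φ'.2, mul_zero]
    rw [h1] at h2
    have h3 : htmul F.Ω φ ∈ (Submodule.span ℂ {htmul F.Ω φ})ᗮ := h2 trivial
    rw [Submodule.mem_orthogonal_singleton_iff_inner_left, inner_self_eq_zero] at h3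
    have := norm_htmul F.Ω φ
    rw [h3, norm_zero, F.norm_Ω, one_mul] at this
    exact norm_eq_zero.1 this.symm

theorem continuous_htmul : Continuous fun p : HF × Hr => htmul p.1 p.2 :=
  ((htmulL HF Hr).mkContinuous₂ 1 fun ψ φ => by
    rw [one_mul]; exact (norm_htmul ψ φ).le).continuous₂

theorem continuous_of_total {X E : Type*} [TopologicalSpace X] [NormedAddCommGroup E]
    [NormedSpace ℂ E] {ι : Type*} {x : ι → E}
    (hx : Dense (Submodule.span ℂ (Set.range x) : Set E)) {T : X → E →L[ℂ] E}
    (hT : ∀ t ψ, ‖T t ψ‖ ≤ ‖ψ‖) (h : ∀ i, Continuous fun t => T t (x i)) (ψ : E) :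
    Continuous fun t => T t ψ := by
  refine continuous_iff_continuousAt.2 fun t₀ => ?_
  refine tendsto_of_dense_of_bounded (C := 1) (fun t ψ => by rw [one_mul]; exact hT t ψ) hx ?_ ψ
  intro ψ hψ
  induction hψ using Submodule.span_induction with
  | mem ψ hψ =>
    obtain ⟨i, rfl⟩ := hψ
    exact (h i).tendsto t₀
  | zero => simp
  | add a b _ _ ha hb => simpa using ha.add hb
  | smul c a _ ha => simpa using ha.const_smul c

theorem IsWeyl.norm_le {H : Type*} [NormedAddCommGroup H] [InnerProductSpace ℂ H] [CompleteSpace H]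
    {u : testFields → H →L[ℂ] H} (hu : IsWeyl e u) (V : testFields) (ψ : H) : ‖u V ψ‖ ≤ ‖ψ‖ :=
  ((isoOf (u V) (hu.isometry V)).norm_map ψ).le

theorem continuous_S_smul (V : testFields) (g : K) : Continuous fun t : ℝ => S e (t • V) g := by
  simp only [S_eq]
  refine continuous_iff_continuousAt.2 fun t₀ => ?_
  have hn : ∀ (r : ℝ), ‖Complex.exp (I * r)‖ ≤ 1 := fun r => by
    rw [mul_comm, Complex.norm_exp_ofReal_mul_I]
  refine tendsto_cop (C := 1) (fun t => (BddMeas.phase (measurable_coulombPhase e (t • V))).1)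
    (BddMeas.phase (measurable_coulombPhase e (t₀ • V))).1 (fun t v => hn _) (fun v => hn _)
    (fun v => ?_) g
  simp only [coulombPhase_smul]
  have : Continuous fun t : ℝ => Complex.exp (I * ((t * coulombPhase e V.1 v : ℝ) : ℂ)) := by
    fun_prop
  exact this.tendsto t₀

theorem IsProductRep.regular_iff (h : IsProductRep F πr π) :
    IsRegularRep (weylOp π) ↔ IsRegularRep (weylOpCCR πr) := by
  refine ⟨fun hr V φ => ?_, fun hr V Ψ => ?_⟩
  · have h1 := hr V (htmul F.Ω φ)
    simp only [h.weyl_vac] at h1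
    have hi : Isometry (htmulR Hr F.Ω) := AddMonoidHomClass.isometry_of_norm _ fun φ => by
      rw [htmulR_apply, norm_htmul, F.norm_Ω, one_mul]
    exact hi.isEmbedding.continuous_iff.2 h1
  · refine continuous_of_total (htmul_total (HF := HF) (Hr := Hr))
      (fun t Ψ => (weylOp_isWeyl π).norm_le _ Ψ) (fun p => ?_) Ψ
    simp only [h.weyl_htmul]
    exact continuous_htmul.comp ((F.isFock.continuous_Γ (fun t : ℝ => isBog_S e (t • V))
      (continuous_S_smul V) p.1).prodMk (hr V p.2))

end Product

/-! ### Test functions on Minkowski space -/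

open scoped FourierTransform Convolution

/-- The transform `∫ f(x) exp(i x·p) d⁴x`. -/
def mink (f : SchwartzMap Spacetime ℂ) (p : Spacetime) : ℂ :=
  ∫ x, f x * Complex.exp (I * mdot x p)

/-- Minkowski space with its Euclidean norm. -/
def euclid : EuclideanSpace ℝ (Fin 4) ≃L[ℝ] Spacetime := EuclideanSpace.equiv (Fin 4) ℝ

theorem measurePreserving_euclid : MeasurePreserving euclid :=
  PiLp.volume_preserving_ofLp (Fin 4)

theorem lower_lower (p : Spacetime) : lower (lower p) = p := by
  funext i
  fin_cases i <;> simp [lower]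

/-- Momenta in terms of the dual variable of the Fourier transform. -/
def momentum : EuclideanSpace ℝ (Fin 4) ≃L[ℝ] Spacetime :=
  LinearEquiv.toContinuousLinearEquiv
    { toFun := fun ξ => (2 * Real.pi) • lower (euclid ξ)
      map_add' := fun ξ η => by
        funext i; simp [lower]; split_ifs <;> ring
      map_smul' := fun c ξ => by
        funext i; simp [lower]; split_ifs <;> ring
      invFun := fun p => euclid.symm ((2 * Real.pi)⁻¹ • lower p)
      left_inv := fun ξ => by
        have h1 : lower ((2 * Real.pi) • lower (euclid ξ)) = (2 * Real.pi) • euclid ξ := by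
          conv_rhs => rw [← lower_lower (euclid ξ)]
          funext i; simp [lower]
        show euclid.symm _ = ξ
        rw [h1, smul_smul, inv_mul_cancel₀ (by positivity), one_smul, euclid.symm_apply_apply]
      right_inv := fun p => by
        have h1 : lower ((2 * Real.pi)⁻¹ • lower p) = (2 * Real.pi)⁻¹ • p := by
          conv_rhs => rw [← lower_lower p]
          funext i; simp [lower]
        show (2 * Real.pi) • lower (euclid (euclid.symm _)) = p
        rw [euclid.apply_symm_apply, h1, smul_smul, mul_inv_cancel₀ (by positivity), one_smul] }

theorem mdot_momentum (y ξ : EuclideanSpace ℝ (Fin 4)) :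
    mdot (euclid y) (momentum ξ) = 2 * Real.pi * inner ℝ y ξ := by
  have h : momentum ξ = (2 * Real.pi) • lower (euclid ξ) := rfl
  have h1 : ∀ (z : EuclideanSpace ℝ (Fin 4)) i, euclid z i = z i := fun _ _ => rfl
  rw [h, PiLp.inner_apply]
  simp [mdot, lower, h1, Fin.sum_univ_four]
  ring

/-- Pullback of a test function to the Euclidean space. -/
def pullback (T : EuclideanSpace ℝ (Fin 4) ≃L[ℝ] Spacetime) (f : SchwartzMap Spacetime ℂ) :
    SchwartzMap (EuclideanSpace ℝ (Fin 4)) ℂ :=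
  SchwartzMap.compCLMOfContinuousLinearEquiv ℂ T f

theorem pullback_apply (T : EuclideanSpace ℝ (Fin 4) ≃L[ℝ] Spacetime) (f : SchwartzMap Spacetime ℂ)
    (y : EuclideanSpace ℝ (Fin 4)) : pullback T f y = f (T y) := rfl

theorem integral_euclid {E : Type*} [NormedAddCommGroup E] [NormedSpace ℝ E] (g : Spacetime → E) :
    ∫ y, g (euclid y) = ∫ x, g x :=
  measurePreserving_euclid.integral_comp euclid.toHomeomorph.measurableEmbedding g

theorem mink_momentum (f : SchwartzMap Spacetime ℂ) (ξ : EuclideanSpace ℝ (Fin 4)) :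
    mink f (momentum ξ) = 𝓕⁻ (pullback euclid f) ξ := by
  rw [SchwartzMap.fourierInv_coe, Real.fourierInv_eq', mink, ← integral_euclid]
  refine integral_congr_ae (.of_forall fun y => ?_)
  show f (euclid y) * _ = _ • f (euclid y)
  rw [mdot_momentum, smul_eq_mul, mul_comm, mul_comm I]

theorem exists_mink_eq (h : SchwartzMap Spacetime ℂ) : ∃ k, ∀ p, mink k p = h p := by
  refine ⟨SchwartzMap.compCLMOfContinuousLinearEquiv ℂ euclid.symm (𝓕 (pullback momentum h)),
    fun p => ?_⟩
  obtain ⟨ξ, rfl⟩ := momentum.surjective p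
  rw [mink_momentum]
  have : pullback euclid (SchwartzMap.compCLMOfContinuousLinearEquiv ℂ euclid.symm
      (𝓕 (pullback momentum h))) = 𝓕 (pullback momentum h) := by
    ext y
    rw [pullback_apply]
    simp
  rw [this, FourierTransform.fourierInv_fourier_eq, pullback_apply]

theorem convolution_eq_zero (f g : SchwartzMap Spacetime ℂ) (h : ∀ p, mink f p * mink g p = 0)
    (z : Spacetime) : ∫ x, f x * g (z - x) = 0 := by
  set B := ContinuousLinearMap.mul ℂ ℂ
  have h1 : ∀ (f : SchwartzMap Spacetime ℂ) (ξ : EuclideanSpace ℝ (Fin 4)),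
      𝓕 (pullback euclid f) ξ = mink f (momentum (-ξ)) := by
    intro f ξ
    rw [mink_momentum, SchwartzMap.fourierInv_coe, SchwartzMap.fourier_coe,
      Real.fourierInv_eq_fourier_neg, neg_neg]
  have h2 : SchwartzMap.convolution B (pullback euclid f) (pullback euclid g) = 0 := by
    have h3 : 𝓕⁻ (𝓕 (SchwartzMap.convolution B (pullback euclid f) (pullback euclid g)))
        = SchwartzMap.convolution B (pullback euclid f) (pullback euclid g) :=
      FourierTransform.fourierInv_fourier_eq _
    rw [← h3]
    have : 𝓕 (SchwartzMap.convolution B (pullback euclid f) (pullback euclid g)) = 0 := by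
      ext ξ
      rw [SchwartzMap.fourier_convolution]
      show B (𝓕 (pullback euclid f) ξ) (𝓕 (pullback euclid g) ξ) = 0
      rw [h1, h1]
      exact h _
    rw [this]
    exact FourierTransform.fourierInv_zero
  have h3 := SchwartzMap.convolution_apply B (pullback euclid f) (pullback euclid g) (euclid.symm z)
  rw [h2] at h3
  rw [← integral_euclid]
  refine Eq.trans ?_ h3.symm
  refine integral_congr_ae (.of_forall fun y => ?_)
  show _ = f (euclid y) * g (euclid (euclid.symm z - y))
  rw [map_sub, euclid.apply_symm_apply]

theorem hasTemperateGrowth_exp_I :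
    Function.HasTemperateGrowth fun t : ℝ => Complex.exp (I * t) := by
  have h0 : ∀ n : ℕ, iteratedDeriv n (fun t : ℝ => Complex.exp (I * t))
      = fun t : ℝ => I ^ n * Complex.exp (I * t) := by
    intro n
    induction n with
    | zero => simp
    | succ n ih =>
      rw [iteratedDeriv_succ, ih]
      funext t
      have h1 : HasDerivAt (fun t : ℝ => I * (t : ℂ)) (I * 1) t :=
        (Complex.ofRealCLM.hasDerivAt (x := t)).const_mul I
      have h2 := (h1.cexp).const_mul (I ^ n)
      rw [h2.deriv]; ring
  refine ⟨?_, fun n => ⟨0, 1, fun t => ?_⟩⟩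
  · have : ContDiff ℝ ∞ fun t : ℝ => I * (t : ℂ) := contDiff_const.mul Complex.ofRealCLM.contDiff
    exact this.cexp
  · rw [norm_iteratedFDeriv_eq_norm_iteratedDeriv, h0]
    rw [norm_mul, norm_pow, Complex.norm_I, one_pow, one_mul, pow_zero, mul_one, mul_comm I,
      Complex.norm_exp_ofReal_mul_I]

/-- Pairing with a fixed vector on the right. -/
def mdotR (q : Spacetime) : Spacetime →L[ℝ] ℝ :=
  LinearMap.toContinuousLinearMap
    { toFun := fun x => mdot x q
      map_add' := fun x y => by simp [mdot]; ring
      map_smul' := fun c x => by simp [mdot]; ring }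

theorem continuous_mdot_left (q : Spacetime) : Continuous fun x => mdot x q := (mdotR q).continuous

/-- Multiplication of a test function by a plane wave. -/
def modulate (q : Spacetime) (f : SchwartzMap Spacetime ℂ) : SchwartzMap Spacetime ℂ :=
  SchwartzMap.smulLeftCLM ℂ ((fun t : ℝ => Complex.exp (I * t)) ∘ mdotR q) f

theorem modulate_apply (q : Spacetime) (f : SchwartzMap Spacetime ℂ) (x : Spacetime) :
    modulate q f x = Complex.exp (I * mdot x q) * f x :=
  SchwartzMap.smulLeftCLM_apply_apply
    (hasTemperateGrowth_exp_I.comp (mdotR q).hasTemperateGrowth) f x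

theorem mink_modulate (q : Spacetime) (f : SchwartzMap Spacetime ℂ) (p : Spacetime) :
    mink (modulate q f) p = mink f (p + q) := by
  refine integral_congr_ae (.of_forall fun x => ?_)
  show modulate q f x * _ = f x * _
  have : mdot x (p + q) = mdot x p + mdot x q := (show _ by unfold mdot; simp only [Pi.add_apply]; ring)
  rw [modulate_apply, this, Complex.ofReal_add, mul_add, Complex.exp_add]
  ring

theorem exists_dilate (k : SchwartzMap Spacetime ℂ) {r : ℝ} (hr : 0 < r) :
    ∃ f : SchwartzMap Spacetime ℂ, (∀ p, mink f p = mink k (r⁻¹ • p)) ∧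
      ∀ {E : Type u} [NormedAddCommGroup E] [NormedSpace ℂ E] (c : Spacetime → E),
        ∫ x, f x • c x = ∫ x, k x • c (r⁻¹ • x) := by
  let T : Spacetime ≃L[ℝ] Spacetime := ContinuousLinearEquiv.smulLeft (Units.mk0 r hr.ne')
  have hT : ∀ x, T x = r • x := fun _ => rfl
  let f : SchwartzMap Spacetime ℂ :=
    (((r ^ 4 : ℝ)) : ℂ) • SchwartzMap.compCLMOfContinuousLinearEquiv ℂ T k
  have hf : ∀ x, f x = ((r ^ 4 : ℝ) : ℂ) * k (r • x) := fun _ => rfl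
  have key : ∀ {E : Type u} [NormedAddCommGroup E] [NormedSpace ℂ E] (c : Spacetime → E),
      ∫ x, f x • c x = ∫ x, k x • c (r⁻¹ • x) := by
    intro E _ _ c
    have h1 := Measure.integral_comp_smul (volume : Measure Spacetime)
      (fun x => k x • c (r⁻¹ • x)) r
    have h2 : ∀ x, f x • c x = (r ^ 4 : ℝ) • (k (r • x) • c (r⁻¹ • r • x)) := by
      intro x
      rw [hf, smul_smul r⁻¹, inv_mul_cancel₀ hr.ne', one_smul, mul_smul, Complex.coe_smul]
    simp_rw [h2]
    rw [integral_smul, h1, smul_smul]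
    rw [Module.finrank_fin_fun, abs_of_pos (by positivity), mul_inv_cancel₀ (by positivity),
      one_smul]
  refine ⟨f, fun p => ?_, key⟩
  have h2 := Measure.integral_comp_smul (volume : Measure Spacetime)
      (fun x => k x * Complex.exp (I * mdot x (r⁻¹ • p))) r
  have h3 : ∀ x, f x * Complex.exp (I * mdot x p)
      = (r ^ 4 : ℝ) • (k (r • x) * Complex.exp (I * mdot (r • x) (r⁻¹ • p))) := by
    intro x
    have : mdot (r • x) (r⁻¹ • p) = mdot x p := by
      simp only [mdot, Pi.smul_apply, smul_eq_mul]; field_simp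
    rw [hf, this, Complex.real_smul, mul_assoc]
  unfold mink
  simp_rw [h3]
  rw [integral_smul, h2, smul_smul, Module.finrank_fin_fun, abs_of_pos (by positivity),
    mul_inv_cancel₀ (by positivity), one_smul]

/-- Approximate identities with transforms of compact support. -/
theorem exists_approx_identity :
    ∃ (h : Spacetime → ℝ) (k : ℕ → SchwartzMap Spacetime ℂ), ContDiff ℝ ∞ h ∧
      (∀ p, 2 < ‖p‖ → h p = 0) ∧ (∀ n p, mink (k n) p = h (((n : ℝ) + 1)⁻¹ • p)) ∧
      ∀ {E : Type u} [NormedAddCommGroup E] [NormedSpace ℂ E] [CompleteSpace E] (c : Spacetime → E)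
        (C : ℝ), Continuous c → (∀ x, ‖c x‖ ≤ C) →
        Tendsto (fun n => ∫ x, k n x • c x) atTop (𝓝 (c 0)) := by
  let β : ContDiffBump (0 : Spacetime) := ⟨1, 2, one_pos, one_lt_two⟩
  have hβ : HasCompactSupport fun p => ((β p : ℝ) : ℂ) :=
    β.hasCompactSupport.comp_left (g := fun t : ℝ => (t : ℂ)) (by simp)
  have hβ' : ContDiff ℝ ∞ fun p => ((β p : ℝ) : ℂ) := Complex.ofRealCLM.contDiff.comp β.contDiff
  obtain ⟨k, hk⟩ := exists_mink_eq (hβ.toSchwartzMap hβ')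
  replace hk : ∀ p, mink k p = β p := hk
  have hpos : ∀ n : ℕ, (0 : ℝ) < n + 1 := fun n => by positivity
  choose f hf1 hf2 using fun n : ℕ => exists_dilate.{u} k (hpos n)
  refine ⟨β, f, β.contDiff, fun p hp => β.zero_of_le_dist ?_, fun n p => by rw [hf1, hk], ?_⟩
  · rw [dist_zero_right]; exact hp.le
  · intro E _ _ _ c C hc hC
    simp_rw [hf2]
    have h0 : ∫ x, k x • c 0 = c 0 := by
      have h1 : (∫ x, k x) = 1 := by
        have := hk 0
        rw [mink, β.one_of_mem_closedBall (by simp [β])] at this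
        simpa [mdot] using this
      rw [integral_smul_const, h1, one_smul]
    rw [← h0]
    refine tendsto_integral_of_dominated_convergence (fun x => ‖k x‖ * C)
      (fun n => ?_) (k.integrable.norm.mul_const C) (fun n => ?_) (.of_forall fun x => ?_)
    · exact (k.continuous.smul (hc.comp (continuous_const_smul _))).aestronglyMeasurable
    · refine .of_forall fun x => ?_
      rw [norm_smul]
      gcongr
      exact hC _
    · refine Tendsto.const_smul ?_ _
      have h1 : Tendsto (fun n : ℕ => ((n : ℝ) + 1)⁻¹ • x) atTop (𝓝 ((0 : ℝ) • x)) :=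
        (tendsto_inv_atTop_zero.comp
          (tendsto_natCast_atTop_atTop.atTop_add tendsto_const_nhds)).smul_const x
      rw [zero_smul] at h1
      exact (hc.tendsto _).comp h1

/-- Splitting a transform at an energy below zero. -/
theorem exists_split (k : SchwartzMap Spacetime ℂ) {h : Spacetime → ℝ} (hh : ContDiff ℝ ∞ h)
    {C E : ℝ} (hE : E < 0) (hC : ∀ p, C < ‖p‖ → h p = 0) (hk : ∀ p, mink k p = h p) :
    ∃ k₁ k₂ : SchwartzMap Spacetime ℂ, k = k₁ + k₂ ∧ (∀ p, p 0 ≤ E → mink k₁ p = 0) ∧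
      ∀ p, 0 ≤ p 0 → mink k₂ p = 0 := by
  let χ : Spacetime → ℝ := fun p => Real.smoothTransition (1 - E⁻¹ * p 0)
  have hχ : ContDiff ℝ ∞ χ := Real.smoothTransition.contDiff.comp
    (contDiff_const.sub (contDiff_const.mul (contDiff_apply ℝ ℝ 0)))
  have hs : HasCompactSupport fun p => (((χ p * h p : ℝ)) : ℂ) := by
    refine HasCompactSupport.intro (isCompact_closedBall (0 : Spacetime) C) fun p hp => ?_
    rw [hC p (by simpa using hp)]; simp
  obtain ⟨k₁, hk₁⟩ := exists_mink_eq (hs.toSchwartzMap (Complex.ofRealCLM.contDiff.comp (hχ.mul hh)))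
  replace hk₁ : ∀ p, mink k₁ p = (χ p * h p : ℝ) := hk₁
  refine ⟨k₁, k - k₁, by abel, fun p hp => ?_, fun p hp => ?_⟩
  · have : χ p = 0 := by
      refine Real.smoothTransition.zero_of_nonpos ?_
      have : 1 ≤ E⁻¹ * p 0 := by
        rw [inv_mul_eq_div, le_div_iff_of_neg hE]; linarith
      linarith
    rw [hk₁, this]; simp
  · have : χ p = 1 := by
      refine Real.smoothTransition.one_of_one_le ?_
      have : E⁻¹ * p 0 ≤ 0 := mul_nonpos_of_nonpos_of_nonneg (inv_nonpos.2 hE.le) hp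
      linarith
    have h1 : mink (k - k₁) p = mink k p - mink k₁ p := by
      have hi : ∀ f : SchwartzMap Spacetime ℂ,
          Integrable fun x => f x * Complex.exp (I * mdot x p) := by
        intro f
        have := (modulate p f).integrable (μ := volume)
        refine this.congr (.of_forall fun x => ?_)
        show modulate p f x = _
        rw [modulate_apply, mul_comm]
      unfold mink
      rw [← integral_sub (hi k) (hi k₁)]
      refine integral_congr_ae (.of_forall fun x => ?_)
      exact sub_mul _ _ _
    rw [h1, hk, hk₁, this, one_mul, sub_self]

/-! ### Spectral supports -/

namespace TranslationRep

variable {H : Type u} [NormedAddCommGroup H] [InnerProductSpace ℂ H] [CompleteSpace H]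
  (U : TranslationRep H)

theorem neg_mul_self (x : Spacetime) : U.U (-x) * U.U x = 1 := by
  rw [← U.map_add, neg_add_cancel, U.map_zero]

theorem star_eq (x : Spacetime) : star (U.U x) = U.U (-x) := by
  have h1 := Unitary.mul_star_self_of_mem (U.unitary x)
  calc star (U.U x) = U.U (-x) * U.U x * star (U.U x) := by rw [U.neg_mul_self, one_mul]
    _ = _ := by rw [mul_assoc, h1, mul_one]

theorem norm_map (x : Spacetime) (ψ : H) : ‖U.U x ψ‖ = ‖ψ‖ :=
  (isoOf (U.U x) (Unitary.star_mul_self_of_mem (U.unitary x))).norm_map ψ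

theorem integrable_smul (f : SchwartzMap Spacetime ℂ) (ψ : H) :
    Integrable fun x => f x • U.U x ψ := by
  refine (f.integrable.norm.mul_const ‖ψ‖).mono'
    (f.continuous.smul (U.continuous ψ)).aestronglyMeasurable (.of_forall fun x => ?_)
  rw [norm_smul, U.norm_map]

/-- The operators `∫ f(x) U(x) d⁴x`. -/
def smear (f : SchwartzMap Spacetime ℂ) : H →L[ℂ] H :=
  LinearMap.mkContinuous
    { toFun := fun ψ => ∫ x, f x • U.U x ψ
      map_add' := fun ψ χ => by
        rw [← integral_add (U.integrable_smul f ψ) (U.integrable_smul f χ)]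
        simp only [_root_.map_add, smul_add]
      map_smul' := fun c ψ => by
        rw [RingHom.id_apply, ← integral_smul]
        simp only [_root_.map_smul, smul_comm c] }
    (∫ x, ‖f x‖) fun ψ => by
      refine (norm_integral_le_integral_norm _).trans ?_
      simp only [norm_smul, U.norm_map]
      rw [integral_mul_const]

theorem smear_apply (f : SchwartzMap Spacetime ℂ) (ψ : H) :
    U.smear f ψ = ∫ x, f x • U.U x ψ := rfl

theorem smear_mem {M : Submodule ℂ H} (hM : IsClosed (M : Set H)) (hU : ∀ x, ∀ ψ ∈ M, U.U x ψ ∈ M)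
    (f : SchwartzMap Spacetime ℂ) {ψ : H} (hψ : ψ ∈ M) : U.smear f ψ ∈ M := by
  have : CompleteSpace M := hM.completeSpace_coe
  have h1 := M.subtypeₗᵢ.integral_comp_comm (fun x => f x • (⟨U.U x ψ, hU x ψ hψ⟩ : M))
    (μ := volume)
  have h2 : U.smear f ψ = M.subtypeₗᵢ (∫ x, f x • (⟨U.U x ψ, hU x ψ hψ⟩ : M)) := h1 ▸ rfl
  rw [h2]
  exact Subtype.property _

/-- The spectral support of `ψ` is contained in `S`. -/
def SpecIn (S : Set Spacetime) (ψ : H) : Prop :=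
  ∀ f : SchwartzMap Spacetime ℂ, (∀ p ∈ S, mink f p = 0) → U.smear f ψ = 0

theorem specIn_smear {S : Set Spacetime} (k : SchwartzMap Spacetime ℂ)
    (hk : ∀ p, p ∉ S → mink k p = 0) (ψ : H) : U.SpecIn S (U.smear k ψ) := by
  intro f hf
  have hz : ∀ p, mink f p * mink k p = 0 := by
    intro p
    by_cases hp : p ∈ S
    · rw [hf p hp, zero_mul]
    · rw [hk p hp, mul_zero]
  have hi : Integrable (fun q : Spacetime × Spacetime => (f q.1 * k (q.2 - q.1)) • U.U q.2 ψ)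
      (volume.prod volume) := by
    have h1 : Integrable (fun q : Spacetime × Spacetime => f q.2 * k (q.1 - q.2))
        (volume.prod volume) :=
      Integrable.convolution_integrand (ContinuousLinearMap.mul ℂ ℂ) f.integrable k.integrable
    have h2 := h1.swap
    refine (h2.norm.mul_const ‖ψ‖).mono' ?_ (.of_forall fun q => ?_)
    · exact (((f.continuous.comp continuous_fst).mul (k.continuous.comp
        (continuous_snd.sub continuous_fst))).smul
        ((U.continuous ψ).comp continuous_snd)).aestronglyMeasurable
    · rw [norm_smul, U.norm_map]; rfl
  have h1 : ∀ x, f x • U.U x (U.smear k ψ) = ∫ z, (f x * k (z - x)) • U.U z ψ := by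
    intro x
    rw [smear_apply, ← ContinuousLinearMap.integral_comp_comm _ (U.integrable_smul k ψ),
      ← integral_smul, ← integral_sub_right_eq_self _ x]
    refine integral_congr_ae (.of_forall fun z => ?_)
    show f x • U.U x (k (z - x) • U.U (z - x) ψ) = _
    rw [_root_.map_smul, smul_smul]
    congr 1
    rw [show U.U z = U.U x * U.U (z - x) by rw [← U.map_add, add_sub_cancel]]
    rfl
  rw [smear_apply]
  simp_rw [h1]
  rw [integral_integral_swap hi]
  refine integral_eq_zero_of_ae (.of_forall fun z => ?_)
  show ∫ x, (f x * k (z - x)) • U.U z ψ = 0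
  rw [integral_smul_const, convolution_eq_zero f k hz, zero_smul]

/-- A vector of positive energy with energies below `E < 0` vanishes. -/
theorem eq_zero_of_specIn (hU : U.SpectrumInForwardCone) {E : ℝ} (hE : E < 0) {ψ : H}
    (h : U.SpecIn {p | p 0 ≤ E} ψ) : ψ = 0 := by
  obtain ⟨β, k, hβ, hβ2, hk, hlim⟩ := exists_approx_identity.{u}
  have h1 := hlim (fun x => U.U x ψ) ‖ψ‖ (U.continuous ψ) fun x => (U.norm_map x ψ).le
  have h2 : ∀ n, ∫ x, k n x • U.U x ψ = 0 := by
    intro n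
    have hn : (0 : ℝ) < n + 1 := by positivity
    obtain ⟨k₁, k₂, hkk, hk₁, hk₂⟩ := exists_split (k n)
      (h := fun p => β (((n : ℝ) + 1)⁻¹ • p)) (C := 2 * ((n : ℝ) + 1))
      (hβ.comp (contDiff_const_smul _)) hE (fun p hp => hβ2 _ (by
        rw [norm_smul, Real.norm_of_nonneg (by positivity), inv_mul_eq_div, lt_div_iff₀ hn]
        exact hp)) (hk n)
    have e1 : ∫ x, k₁ x • U.U x ψ = 0 := h k₁ hk₁
    have e2 : ∫ x, k₂ x • U.U x ψ = 0 := hU k₂ (fun p hp => hk₂ p hp.2) ψ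
    rw [hkk]
    have : ∀ x, (k₁ + k₂) x • U.U x ψ = k₁ x • U.U x ψ + k₂ x • U.U x ψ := fun x => add_smul _ _ _
    simp_rw [this]
    rw [integral_add (U.integrable_smul k₁ ψ) (U.integrable_smul k₂ ψ), e1, e2, add_zero]
  simp only [h2] at h1
  have h3 := tendsto_nhds_unique h1 tendsto_const_nhds
  simpa [U.map_zero] using h3

/-- Vectors of bounded energy approximate all vectors. -/
theorem exists_bounded_energy (ψ : H) : ∃ ψ' : ℕ → H, Tendsto ψ' atTop (𝓝 ψ) ∧
    ∀ n, ∃ f, ψ' n = U.smear f ψ ∧ ∃ N : ℕ, U.SpecIn {p | p 0 ≤ N} (ψ' n) := by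
  obtain ⟨β, k, -, hβ2, hk, hlim⟩ := exists_approx_identity.{u}
  have h1 := hlim (fun x => U.U x ψ) ‖ψ‖ (U.continuous ψ) fun x => (U.norm_map x ψ).le
  refine ⟨fun n => U.smear (k n) ψ, ?_, fun n => ⟨k n, rfl,
    2 * (n + 1), U.specIn_smear (k n) (fun p hp => ?_) ψ⟩⟩
  · have h2 : Tendsto (fun n => U.smear (k n) ψ) atTop (𝓝 (U.U 0 ψ)) := h1
    rw [U.map_zero] at h2
    exact h2
  rw [hk, hβ2, Complex.ofReal_zero]
  have hn : (0 : ℝ) < n + 1 := by positivity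
  have hp' : 2 * ((n : ℝ) + 1) < p 0 := by simpa using hp
  rw [norm_smul, Real.norm_of_nonneg (by positivity), inv_mul_eq_div, lt_div_iff₀ hn]
  exact hp'.trans_le ((le_abs_self _).trans (norm_le_pi_norm p 0))

end TranslationRep

/-! ### Momentum transfer -/

theorem cop_comp_simpleFunc (s : SimpleFunc Hyp Hyp) (θ : Hyp → ℂ) (g : K) :
    cop (fun v => θ (s v)) g
      = ∑ y ∈ s.range, θ y • cop ((s ⁻¹' {y}).indicator fun _ => 1) g := by
  classical
  have hb : ∀ y, BddMeas ((s ⁻¹' {y}).indicator fun _ => (1 : ℂ)) := fun y =>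
    ⟨measurable_const.indicator (s.measurableSet_fiber y), 1, fun v => by
      by_cases h : v ∈ s ⁻¹' {y} <;> simp [h]⟩
  have h1 : (fun v => θ (s v))
      = fun v => ∑ y ∈ s.range, θ y * (s ⁻¹' {y}).indicator (fun _ => (1 : ℂ)) v := by
    funext v
    rw [Finset.sum_eq_single (s v)]
    · simp
    · intro y _ hy
      rw [Set.indicator_of_notMem (fun h => hy h.symm), mul_zero]
    · intro h
      exact absurd (s.mem_range_self v) h
  rw [h1, (cop_sum _ (fun y => (BddMeas.const (θ y)).mul (hb y)) g).2]
  exact Finset.sum_congr rfl fun y _ => cop_smul (hb y) _ _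

section Shift

variable {H : Type u} [NormedAddCommGroup H] [InnerProductSpace ℂ H] [CompleteSpace H]
  {A : K → H →L[ℂ] H} {τ : ℂ →+* ℂ}

theorem integral_phase_eq_zero (hadd : ∀ f g, A (f + g) = A f + A g)
    (hs : ∀ c g, A (c • g) = τ c • A g) (hn : ∀ g, ‖A g‖ ≤ ‖g‖) (hτ : Continuous τ)
    (hτ1 : ∀ z, ‖τ z‖ = ‖z‖) {w : Spacetime → Hyp → ℝ} (hw : ∀ x, Continuous (w x))
    (hw' : ∀ v, Continuous fun x => w x v) (f : SchwartzMap Spacetime ℂ) {c : Spacetime → H}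
    (hc : Continuous c) {C : ℝ} (hC : ∀ x, ‖c x‖ ≤ C)
    (h0 : ∀ v, ∫ x, f x • τ (Complex.exp (I * w x v)) • c x = 0) (g : K) :
    ∫ x, f x • A (cop (fun v => Complex.exp (I * w x v)) g) (c x) = 0 := by
  have hphase : ∀ r : ℝ, ‖Complex.exp (I * r)‖ = 1 := fun r => by
    rw [mul_comm, Complex.norm_exp_ofReal_mul_I]
  let s : ℕ → SimpleFunc Hyp Hyp := fun n =>
    SimpleFunc.approxOn id measurable_id Set.univ (hypOf 0) trivial n
  have hs' : ∀ v, Tendsto (fun n => s n v) atTop (𝓝 v) := fun v =>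
    SimpleFunc.tendsto_approxOn (s := Set.univ) measurable_id trivial (by simp)
  have hA : ∀ {ι : Type} (t : Finset ι) (F : ι → K), A (∑ i ∈ t, F i) = ∑ i ∈ t, A (F i) :=
    fun t F => map_sum (AddMonoidHom.mk' A hadd) F t
  have hAc : Continuous A := by
    have : LipschitzWith 1 A := LipschitzWith.of_dist_le_mul fun g g' => by
      have h1 : A g - A g' = A (g - g') := ((AddMonoidHom.mk' A hadd).map_sub g g').symm
      rw [dist_eq_norm, dist_eq_norm, h1, NNReal.coe_one, one_mul]
      exact hn _
    exact this.continuous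
  have hτc : ∀ y, Continuous fun x => τ (Complex.exp (I * w x y)) := fun y =>
    hτ.comp (Complex.continuous_exp.comp
      (continuous_const.mul (Complex.continuous_ofReal.comp (hw' y))))
  have hint : ∀ y, Integrable fun x => f x • τ (Complex.exp (I * w x y)) • c x := by
    intro y
    refine (f.integrable.norm.mul_const C).mono'
      (f.continuous.smul ((hτc y).smul hc)).aestronglyMeasurable (.of_forall fun x => ?_)
    rw [norm_smul, norm_smul, hτ1, hphase, one_mul]
    gcongr
    exact hC x
  have hsum : ∀ n x, f x • A (cop (fun v => Complex.exp (I * w x (s n v))) g) (c x)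
      = ∑ y ∈ (s n).range, A (cop ((s n ⁻¹' {y}).indicator fun _ => 1) g)
          (f x • τ (Complex.exp (I * w x y)) • c x) := by
    intro n x
    rw [cop_comp_simpleFunc (s n) (fun v => Complex.exp (I * w x v)), hA, _root_.sum_apply,
      Finset.smul_sum]
    refine Finset.sum_congr rfl fun y _ => ?_
    rw [hs, _root_.smul_apply, _root_.map_smul, _root_.map_smul]
  have hzero : ∀ n, ∫ x, f x • A (cop (fun v => Complex.exp (I * w x (s n v))) g) (c x) = 0 := by
    intro n
    simp_rw [hsum]
    rw [integral_finsetSum _ fun y _ => ContinuousLinearMap.integrable_comp _ (hint y)]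
    refine Finset.sum_eq_zero fun y _ => ?_
    rw [ContinuousLinearMap.integral_comp_comm _ (hint y), h0, _root_.map_zero]
  have hlim : Tendsto
      (fun n => ∫ x, f x • A (cop (fun v => Complex.exp (I * w x (s n v))) g) (c x)) atTop
      (𝓝 (∫ x, f x • A (cop (fun v => Complex.exp (I * w x v)) g) (c x))) := by
    have hmeas : ∀ n x, Measurable fun v => Complex.exp (I * w x (s n v)) := fun n x =>
      (((Complex.continuous_exp.comp (continuous_const.mul
        (Complex.continuous_ofReal.comp (hw x))))).measurable).comp (s n).measurable
    have hmeas' : ∀ x, Measurable fun v => Complex.exp (I * w x v) := fun x =>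
      (Complex.continuous_exp.comp (continuous_const.mul
        (Complex.continuous_ofReal.comp (hw x)))).measurable
    refine tendsto_integral_of_dominated_convergence (fun x => ‖f x‖ * (‖g‖ * C)) (fun n => ?_)
      (f.integrable.norm.mul_const _) (fun n => .of_forall fun x => ?_) (.of_forall fun x => ?_)
    · simp_rw [hsum]
      refine Continuous.aestronglyMeasurable ?_
      refine continuous_finsetSum _ fun y _ => ?_
      exact (ContinuousLinearMap.continuous _).comp (f.continuous.smul ((hτc y).smul hc))
    · rw [norm_smul]
      gcongr
      refine (ContinuousLinearMap.le_opNorm _ _).trans ?_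
      refine mul_le_mul ((hn _).trans ?_) (hC x) (norm_nonneg _) (norm_nonneg _)
      have := norm_cop_le (hmeas n x) (C := 1) (fun v => (hphase _).le) g
      rwa [one_mul] at this
    · have h1 := tendsto_cop (fun n => hmeas n x) (hmeas' x) (C := 1) (fun n v => (hphase _).le)
        (fun v => (hphase _).le) (l := atTop) (fun v => ?_) g
      · have h2 := (hAc.tendsto _).comp h1
        exact ((((ContinuousLinearMap.apply ℂ H (c x)).continuous).tendsto _).comp h2).const_smul _
      · exact ((Complex.continuous_exp.comp (continuous_const.mul
          (Complex.continuous_ofReal.comp (hw x)))).tendsto v).comp (hs' v)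
  simp only [hzero] at hlim
  exact (tendsto_nhds_unique hlim tendsto_const_nhds)

theorem TranslationRep.SpecIn.shift {U : TranslationRep H} (hadd : ∀ f g, A (f + g) = A f + A g)
    (hs : ∀ c g, A (c • g) = τ c • A g) (hn : ∀ g, ‖A g‖ ≤ ‖g‖) (hτ : Continuous τ)
    (hτ1 : ∀ z, ‖τ z‖ = ‖z‖) {δ : ℝ} (hδ : ∀ r : ℝ, τ (Complex.exp (I * r)) = Complex.exp (I * (δ * r : ℝ)))
    {m : ℝ} (hcov : ∀ x g ψ, U.U x (A g ψ) = A (R m x g) (U.U x ψ)) {σ : Bool}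
    {S S' : Set Spacetime} (hS : ∀ p ∈ S, ∀ v : Hyp, p + (δ * (freqSign σ * m)) • v.1 ∈ S') {ψ : H}
    (h : U.SpecIn S ψ) (g : K) : U.SpecIn S' (A (freqProj σ g) ψ) := by
  intro f hf
  rw [TranslationRep.smear_apply]
  simp_rw [hcov, R_freqProj]
  refine integral_phase_eq_zero hadd hs hn hτ hτ1 (w := fun x v => freqSign σ * (m * mdot x v.1))
    (fun x => ?_) (fun v => ?_) f (U.continuous ψ) (fun x => (U.norm_map x ψ).le) (fun v => ?_) _
  · exact continuous_const.mul (continuous_const.mul ((mdotL x).continuous.comp continuous_subtype_val))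
  · exact continuous_const.mul (continuous_const.mul (continuous_mdot_left v.1))
  · have h1 := h (modulate ((δ * (freqSign σ * m)) • v.1) f) fun p hp => by
      rw [mink_modulate]; exact hf _ (hS p hp v)
    rw [TranslationRep.smear_apply] at h1
    rw [← h1]
    refine integral_congr_ae (.of_forall fun x => ?_)
    show f x • τ _ • U.U x ψ = modulate _ f x • _
    rw [hδ, modulate_apply, smul_smul, mdot_smul_right, mul_comm (f x),
      show δ * (freqSign σ * (m * mdot x v.1)) = δ * (freqSign σ * m) * mdot x v.1 by ring]

end Shift

/-! ### Covariant fields -/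

section Covariant

variable {H : Type u} [NormedAddCommGroup H] [InnerProductSpace ℂ H] [CompleteSpace H]
  {b : K → H →L[ℂ] H} {U : TranslationRep H} {m : ℝ}

theorem TranslationRep.covariant_star (hcov : ∀ x g ψ, U.U x (b g ψ) = b (R m x g) (U.U x ψ))
    (x : Spacetime) (g : K) (ψ : H) : U.U x (star (b g) ψ) = star (b (R m x g)) (U.U x ψ) := by
  have h1 : U.U (-x) * b (R m x g) = b g * U.U (-x) := by
    refine ContinuousLinearMap.ext fun χ => ?_
    have := hcov (-x) (R m x g) χ
    rw [← R_add, neg_add_cancel, R_zero] at this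
    exact this
  have h2 := congrArg star h1
  rw [star_mul, star_mul, U.star_eq, neg_neg] at h2
  exact (congrArg (fun T => T ψ) h2).symm

theorem TranslationRep.SpecIn.field (hb : IsCAR b)
    (hcov : ∀ x g ψ, U.U x (b g ψ) = b (R m x g) (U.U x ψ)) {σ : Bool} {S S' : Set Spacetime}
    (hS : ∀ p ∈ S, ∀ v : Hyp, p + ((-1) * (freqSign σ * m)) • v.1 ∈ S') {ψ : H}
    (h : U.SpecIn S ψ) (g : K) : U.SpecIn S' (b (freqProj σ g) ψ) := by
  refine h.shift (τ := starRingEnd ℂ) hb.add hb.smul hb.norm_le Complex.continuous_conj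
    (fun z => norm_star z) (δ := -1) (fun r => ?_) hcov hS g
  rw [← Complex.exp_conj, _root_.map_mul, Complex.conj_I, Complex.conj_ofReal]
  congr 1
  push_cast
  ring

theorem TranslationRep.SpecIn.star_field (hb : IsCAR b)
    (hcov : ∀ x g ψ, U.U x (b g ψ) = b (R m x g) (U.U x ψ)) {σ : Bool} {S S' : Set Spacetime}
    (hS : ∀ p ∈ S, ∀ v : Hyp, p + (1 * (freqSign σ * m)) • v.1 ∈ S') {ψ : H}
    (h : U.SpecIn S ψ) (g : K) : U.SpecIn S' (star (b (freqProj σ g)) ψ) := by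
  refine h.shift (A := fun g => star (b g)) (τ := RingHom.id ℂ)
    (fun f g => by rw [hb.add, star_add]) (fun c g => by rw [hb.smul, star_smul, star_star]; rfl)
    (fun g => by rw [norm_star]; exact hb.norm_le g) continuous_id (fun z => rfl) (δ := 1)
    (fun r => by rw [one_mul]; rfl) (U.covariant_star hcov) hS g

theorem TranslationRep.SpecIn.cr (hb : IsCAR b)
    (hcov : ∀ x g ψ, U.U x (b g ψ) = b (R m x g) (U.U x ψ)) {S S' : Set Spacetime}
    (hS : ∀ p ∈ S, ∀ v : Hyp, p + m • v.1 ∈ S') {ψ : H} (h : U.SpecIn S ψ) (i : Mode) :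
    U.SpecIn S' (AsymptoticQED.cr b i ψ) := by
  rcases i with ⟨σ, g⟩
  cases σ
  · refine h.field hb hcov (σ := false) (fun p hp v => ?_) g
    simpa [freqSign] using hS p hp v
  · refine h.star_field hb hcov (σ := true) (fun p hp v => ?_) g
    simpa [freqSign] using hS p hp v

theorem TranslationRep.SpecIn.ann (hb : IsCAR b)
    (hcov : ∀ x g ψ, U.U x (b g ψ) = b (R m x g) (U.U x ψ)) {S S' : Set Spacetime}
    (hS : ∀ p ∈ S, ∀ v : Hyp, p + (-m) • v.1 ∈ S') {ψ : H} (h : U.SpecIn S ψ) (i : Mode) :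
    U.SpecIn S' (star (AsymptoticQED.cr b i) ψ) := by
  rcases i with ⟨σ, g⟩
  cases σ
  · refine h.star_field hb hcov (σ := false) (fun p hp v => ?_) g
    have h1 := hS p hp v
    rwa [show (-m) = 1 * (freqSign false * m) by simp [freqSign]] at h1
  · have h1 : U.SpecIn S' (b (freqProj true g) ψ) := by
      refine h.field hb hcov (σ := true) (fun p hp v => ?_) g
      have h1 := hS p hp v
      rwa [show (-m) = (-1) * (freqSign true * m) by simp [freqSign]] at h1
    have h2 : star (AsymptoticQED.cr b (true, g)) = b (freqProj true g) := star_star _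
    rw [h2]
    exact h1

end Covariant

/-! ### Construction of translation representations -/

section Construct

variable {H : Type u} [NormedAddCommGroup H] [InnerProductSpace ℂ H] [CompleteSpace H]

/-- A representation of translations from isometries. -/
def TranslationRep.ofIsometry (T : Spacetime → H →ₗᵢ[ℂ] H) (h0 : ∀ ψ, T 0 ψ = ψ)
    (hadd : ∀ x y ψ, T (x + y) ψ = T x (T y ψ)) (hc : ∀ ψ, Continuous fun x => T x ψ) :
    TranslationRep H where
  U x := (T x).toContinuousLinearMap
  unitary x := by
    have h1 : star (T x).toContinuousLinearMap * (T x).toContinuousLinearMap = 1 :=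
      (ContinuousLinearMap.norm_map_iff_adjoint_comp_self _).1 (T x).norm_map
    have h2 : (T x).toContinuousLinearMap * (T (-x)).toContinuousLinearMap = 1 := by
      refine ContinuousLinearMap.ext fun ψ => ?_
      show T x (T (-x) ψ) = ψ
      rw [← hadd, add_neg_cancel, h0]
    have h3 : star (T x).toContinuousLinearMap = (T (-x)).toContinuousLinearMap := by
      rw [← mul_one (star _), ← h2, ← mul_assoc, h1, one_mul]
    exact Unitary.mem_iff.2 ⟨h1, by rw [h3, h2]⟩
  map_zero := ContinuousLinearMap.ext h0
  map_add x y := ContinuousLinearMap.ext (hadd x y)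
  continuous := hc

/-- The isometries of a representation of translations. -/
def TranslationRep.iso (U : TranslationRep H) (x : Spacetime) : H →ₗᵢ[ℂ] H :=
  isoOf (U.U x) (Unitary.star_mul_self_of_mem (U.unitary x))

theorem TranslationRep.iso_apply (U : TranslationRep H) (x : Spacetime) (ψ : H) :
    U.iso x ψ = U.U x ψ := rfl

theorem TranslationRep.add_apply (U : TranslationRep H) (x y : Spacetime) (ψ : H) :
    U.U (x + y) ψ = U.U x (U.U y ψ) := by rw [U.map_add]; rfl

theorem TranslationRep.zero_apply (U : TranslationRep H) (ψ : H) : U.U 0 ψ = ψ := by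
  rw [U.map_zero]; rfl

theorem TranslationRep.neg_apply (U : TranslationRep H) (x : Spacetime) (ψ : H) :
    U.U x (U.U (-x) ψ) = ψ := by rw [← U.add_apply, add_neg_cancel, U.zero_apply]

/-- The unitary equivalence given by a translation. -/
def TranslationRep.equiv (U : TranslationRep H) (x : Spacetime) : H ≃ₗᵢ[ℂ] H :=
  LinearIsometryEquiv.ofSurjective (U.iso x) fun ψ => ⟨U.U (-x) ψ, U.neg_apply x ψ⟩

theorem TranslationRep.equiv_symm (U : TranslationRep H) (x : Spacetime) (ψ : H) :
    (U.equiv x).symm ψ = U.U (-x) ψ := by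
  rw [LinearIsometryEquiv.symm_apply_eq]
  exact (U.neg_apply x ψ).symm

variable {e m : ℝ}

theorem TranslationRep.covariant_of_generators (U : TranslationRep H)
    (π : FieldAlg e →⋆ₐ[ℂ] (H →L[ℂ] H))
    (hW : ∀ x V ψ, weylOp π (translateHom x V) (U.U x ψ) = U.U x (weylOp π V ψ))
    (hB : ∀ x g ψ, π (FieldAlg.B e (R m x g)) (U.U x ψ) = U.U x (π (FieldAlg.B e g) ψ))
    (x : Spacetime) (A : FieldAlg e) : π (alpha e m x A) = U.U x * π A * U.U (-x) := by
  have h1 : π.comp (alpha e m x) = conjRep (U.equiv x) π := by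
    refine rep_ext (fun V => ?_) fun g => ?_
    · refine ContinuousLinearMap.ext fun ψ => ?_
      show π (alpha e m x (FieldAlg.W e V)) ψ = _
      rw [alpha_W, conjRep_apply, U.equiv_symm]
      have := hW x V (U.U (-x) ψ)
      rw [U.neg_apply] at this
      exact this
    · refine ContinuousLinearMap.ext fun ψ => ?_
      show π (alpha e m x (FieldAlg.B e g)) ψ = _
      rw [alpha_B, conjRep_apply, U.equiv_symm]
      have := hB x g (U.U (-x) ψ)
      rw [U.neg_apply] at this
      exact this
  have h2 := congrArg (fun ρ => ρ A) h1
  refine ContinuousLinearMap.ext fun ψ => ?_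
  have h3 := congrArg (fun T => T ψ) h2
  refine Eq.trans h3 ?_
  show conjRep (U.equiv x) π A ψ = _
  rw [conjRep_apply, U.equiv_symm]
  rfl

theorem Borchers.of_equiv {H' : Type v} [NormedAddCommGroup H'] [InnerProductSpace ℂ H']
    [CompleteSpace H'] {π : FieldAlg e →⋆ₐ[ℂ] (H →L[ℂ] H)} {π' : FieldAlg e →⋆ₐ[ℂ] (H' →L[ℂ] H')}
    (h : UnitarilyEquiv π π') (hb : Borchers m π') : Borchers m π := by
  obtain ⟨T, hT⟩ := h
  obtain ⟨U, hU, hcov⟩ := hb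
  refine ⟨.ofIsometry (fun x => (T.symm.toLinearIsometry.comp (U.iso x)).comp T.toLinearIsometry)
    (fun ψ => ?_) (fun x y ψ => ?_) (fun ψ => ?_), fun f hf ψ => ?_, fun x A => ?_⟩
  · show T.symm (U.U 0 (T ψ)) = ψ
    rw [U.zero_apply, T.symm_apply_apply]
  · show T.symm (U.U (x + y) (T ψ)) = T.symm (U.U x (T (T.symm (U.U y (T ψ)))))
    rw [T.apply_symm_apply, U.add_apply]
  · exact T.symm.continuous.comp (U.continuous (T ψ))
  · have h1 := T.symm.toLinearIsometry.integral_comp_comm (fun x => f x • U.U x (T ψ)) (μ := volume)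
    rw [hU f hf, _root_.map_zero] at h1
    refine Eq.trans (integral_congr_ae (.of_forall fun x => ?_)) h1
    exact (T.symm.map_smul (f x) (U.U x (T ψ))).symm
  · refine ContinuousLinearMap.ext fun ψ => T.injective ?_
    show _ = T (T.symm (U.U x (T (π A (T.symm (U.U (-x) (T ψ)))))))
    rw [T.apply_symm_apply, hT, hT, T.apply_symm_apply, hcov]
    rfl

end Construct

/-! ### The product of a Fock representation with a positive energy representation -/

theorem add_mem_forwardCone {m : ℝ} (hm : 0 < m) {p : Spacetime} (hp : p ∈ forwardCone) (v : Hyp) :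
    p + m • v.1 ∈ forwardCone := by
  obtain ⟨h1, h2⟩ := hp
  obtain ⟨h3, h4⟩ := v.2
  set q := v.1
  have key : 0 ≤ mdot p q := by
    have hq : 0 ≤ p 0 * q 0 := mul_nonneg h2 h4.le
    have h5 : (p 1 * q 1 + p 2 * q 2 + p 3 * q 3) ^ 2 ≤ (p 0 * q 0) ^ 2 := by
      have e1 : p 1 ^ 2 + p 2 ^ 2 + p 3 ^ 2 ≤ p 0 ^ 2 := by unfold mdot at h1; nlinarith
      have e2 : q 1 ^ 2 + q 2 ^ 2 + q 3 ^ 2 ≤ q 0 ^ 2 := by unfold mdot at h3; nlinarith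
      calc (p 1 * q 1 + p 2 * q 2 + p 3 * q 3) ^ 2
          ≤ (p 1 ^ 2 + p 2 ^ 2 + p 3 ^ 2) * (q 1 ^ 2 + q 2 ^ 2 + q 3 ^ 2) := by
            nlinarith [sq_nonneg (p 1 * q 2 - p 2 * q 1), sq_nonneg (p 1 * q 3 - p 3 * q 1),
              sq_nonneg (p 2 * q 3 - p 3 * q 2)]
        _ ≤ p 0 ^ 2 * q 0 ^ 2 := mul_le_mul e1 e2 (by positivity) (by positivity)
        _ = _ := by ring
    have h6 := (abs_le.1 (abs_le_of_sq_le_sq h5 hq)).2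
    unfold mdot
    linarith
  refine ⟨?_, ?_⟩
  · have : mdot (p + m • q) (p + m • q) = mdot p p + 2 * m * mdot p q + m ^ 2 * mdot q q := by
      simp only [mdot, Pi.add_apply, Pi.smul_apply, smul_eq_mul]; ring
    rw [this, h3]
    positivity
  · show 0 ≤ p 0 + m * q 0
    positivity

section Product

variable {e m : ℝ} {HF : Type v} [NormedAddCommGroup HF] [InnerProductSpace ℂ HF] [CompleteSpace HF]
  {Hr : Type u} [NormedAddCommGroup Hr] [InnerProductSpace ℂ Hr] [CompleteSpace Hr]

/-- Translations on the tensor product. -/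
def productTranslation (m : ℝ) (F : FockRep e HF) (U : TranslationRep Hr) :
    TranslationRep (HTensor HF Hr) :=
  .ofIsometry (fun x => tensorIso (F.isFock.Γ (isBog_R m x)) (U.iso x))
    (fun ξ => by
      have := tensor_ext (A := (tensorIso (F.isFock.Γ (isBog_R m 0)) (U.iso 0)).toContinuousLinearMap)
        (B := .id ℂ _) (fun ψ φ => by
          show tensorIso _ _ _ = htmul ψ φ
          rw [tensorIso_htmul, F.isFock.Γ_id _ (R_zero m), U.iso_apply, U.zero_apply])
      exact congrArg (fun T => T ξ) this)
    (fun x y ξ => by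
      have := tensor_ext
        (A := (tensorIso (F.isFock.Γ (isBog_R m (x + y))) (U.iso (x + y))).toContinuousLinearMap)
        (B := (tensorIso (F.isFock.Γ (isBog_R m x)) (U.iso x)).toContinuousLinearMap ∘L
          (tensorIso (F.isFock.Γ (isBog_R m y)) (U.iso y)).toContinuousLinearMap) (fun ψ φ => by
          show tensorIso _ _ _ = tensorIso _ _ (tensorIso _ _ _)
          rw [tensorIso_htmul, tensorIso_htmul, tensorIso_htmul,
            F.isFock.Γ_comp (isBog_R m x) (isBog_R m y) (isBog_R m (x + y))
              (fun g => (R_add m x y g).symm), U.iso_apply, U.add_apply]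
          rfl)
      exact congrArg (fun T => T ξ) this)
    (fun ξ => by
      refine continuous_of_total (htmul_total (HF := HF) (Hr := Hr))
        (T := fun x => (tensorIso (F.isFock.Γ (isBog_R m x)) (U.iso x)).toContinuousLinearMap)
        (fun x ξ => ((tensorIso (F.isFock.Γ (isBog_R m x)) (U.iso x)).norm_map ξ).le) (fun p => ?_) ξ
      show Continuous fun x => tensorIso (F.isFock.Γ (isBog_R m x)) (U.iso x) (htmul p.1 p.2)
      simp only [tensorIso_htmul]
      exact continuous_htmul.comp ((F.isFock.continuous_Γ (fun x => isBog_R m x)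
        (continuous_R m) p.1).prodMk (U.continuous p.2)))

theorem productTranslation_htmul (F : FockRep e HF) (U : TranslationRep Hr) (x : Spacetime)
    (ψ : HF) (φ : Hr) : (productTranslation m F U).U x (htmul ψ φ)
      = htmul (F.isFock.Γ (isBog_R m x) ψ) (U.U x φ) := tensorIso_htmul _ _ _ _

theorem productTranslation_amp (F : FockRep e HF) (U : TranslationRep Hr) (x : Spacetime) (g : K)
    (ξ : HTensor HF Hr) : (productTranslation m F U).U x (amp Hr (F.field g) ξ)
      = amp Hr (F.field (R m x g)) ((productTranslation m F U).U x ξ) := by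
  have := tensor_ext (A := (productTranslation m F U).U x ∘L amp Hr (F.field g))
    (B := amp Hr (F.field (R m x g)) ∘L (productTranslation m F U).U x) (fun ψ φ => by
      show (productTranslation m F U).U x (amp Hr (F.field g) _)
        = amp Hr (F.field (R m x g)) ((productTranslation m F U).U x _)
      rw [amp_htmul, productTranslation_htmul, productTranslation_htmul, amp_htmul,
        F.isFock.Γ_field])
  exact congrArg (fun T => T ξ) this

theorem productTranslation_spectrum (hm : 0 < m) (F : FockRep e HF) {U : TranslationRep Hr}
    (hU : U.SpectrumInForwardCone) : (productTranslation m F U).SpectrumInForwardCone := by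
  have h1 : ∀ (w : List Mode) (φ : Hr), (productTranslation m F U).SpecIn forwardCone
      (crWord (fun g => amp Hr (F.field g)) w (htmul F.Ω φ)) := by
    intro w φ
    induction w with
    | nil =>
      intro f hf
      rw [crWord_nil, one_apply_eq_self, TranslationRep.smear_apply]
      simp_rw [productTranslation_htmul, F.isFock.Γ_vac, ← htmul_smul_right]
      have h2 := (htmulR Hr F.Ω).integral_comp_comm (U.integrable_smul f φ)
      refine Eq.trans h2 ?_
      rw [hU f hf, _root_.map_zero]
    | cons i w ih =>
      rw [crWord_cons]
      exact ih.cr (F.isCAR.map (amp Hr)) (productTranslation_amp F U)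
        (fun p hp v => add_mem_forwardCone hm hp v) i
  intro f hf ξ
  have h2 := clm_ext_of_total F.isFock.total_tensor (A := (productTranslation m F U).smear f)
    (B := 0) (fun p => h1 p.1 p.2 f hf)
  exact congrArg (fun T => T ξ) h2

theorem IsProductRep.borchers (hm : 0 < m) {F : FockRep e HF} {πr : CCR e →⋆ₐ[ℂ] (Hr →L[ℂ] Hr)}
    {π : FieldAlg e →⋆ₐ[ℂ] (HTensor HF Hr →L[ℂ] HTensor HF Hr)} (h : IsProductRep F πr π)
    (hr : BorchersCCR m πr) : Borchers m π := by
  obtain ⟨U, hU, hcov⟩ := hr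
  have hW : ∀ x V φ, weylOpCCR πr (translateHom x V) (U.U x φ) = U.U x (weylOpCCR πr V φ) := by
    intro x V φ
    have h1 := hcov x ⟨FieldAlg.W e V, W_mem e V⟩
    have h2 : (⟨alpha e m x (FieldAlg.W e V), alpha_mem_CCR e m x (W_mem e V)⟩ : CCR e)
        = ⟨FieldAlg.W e (translateHom x V), W_mem e _⟩ := Subtype.ext (alpha_W e m x V)
    rw [h2] at h1
    have h3 := congrArg (fun T => T (U.U x φ)) h1
    refine Eq.trans h3 ?_
    show U.U x (πr _ (U.U (-x) (U.U x φ))) = _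
    rw [← U.add_apply, neg_add_cancel, U.zero_apply]
    rfl
  refine ⟨productTranslation m F U, productTranslation_spectrum hm F hU,
    (productTranslation m F U).covariant_of_generators π (fun x V ξ => ?_) fun x g ξ => ?_⟩
  · have := tensor_ext (A := weylOp π (translateHom x V) ∘L (productTranslation m F U).U x)
      (B := (productTranslation m F U).U x ∘L weylOp π V) (fun ψ φ => by
        show weylOp π (translateHom x V) ((productTranslation m F U).U x _)
          = (productTranslation m F U).U x (weylOp π V _)
        rw [productTranslation_htmul, h.weyl_htmul, h.weyl_htmul, productTranslation_htmul, hW]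
        congr 1
        have hc := (isBog_R m x).comp (isBog_S e V)
        refine Eq.trans (F.isFock.Γ_comp (isBog_S e _) (isBog_R m x) hc (fun g => ?_) ψ)
          (F.isFock.Γ_comp (isBog_R m x) (isBog_S e V) hc (fun g => rfl) ψ).symm
        exact (R_S m x e V g).symm)
    exact congrArg (fun T => T ξ) this
  · rw [h.field, h.field]
    exact (productTranslation_amp F U x g ξ).symm

end Product

/-! ### The structure of positive energy representations -/

section Covariance

variable {H : Type u} [NormedAddCommGroup H] [InnerProductSpace ℂ H] [CompleteSpace H]
  {b : K → H →L[ℂ] H} {Q : K →L[ℂ] K} {T : H →L[ℂ] H}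

theorem IsBog.apply_cr (hQ : IsBog Q) (h : ∀ g ψ, T (b g ψ) = b (Q g) (T ψ))
    (h' : ∀ g ψ, T (star (b g) ψ) = star (b (Q g)) (T ψ)) (i : Mode) (ψ : H) :
    T (cr b i ψ) = cr b (modeMap Q i) (T ψ) := by
  rcases i with ⟨σ, g⟩
  cases σ
  · show T (b (freqProj false g) ψ) = b (freqProj false (Q g)) (T ψ)
    rw [h, hQ.comm]
  · show T (star (b (freqProj true g)) ψ) = star (b (freqProj true (Q g))) (T ψ)
    rw [h', hQ.comm]

theorem IsBog.apply_ann (hQ : IsBog Q) (h : ∀ g ψ, T (b g ψ) = b (Q g) (T ψ))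
    (h' : ∀ g ψ, T (star (b g) ψ) = star (b (Q g)) (T ψ)) (i : Mode) (ψ : H) :
    T (star (cr b i) ψ) = star (cr b (modeMap Q i)) (T ψ) := by
  rcases i with ⟨σ, g⟩
  cases σ
  · show T (star (b (freqProj false g)) ψ) = star (b (freqProj false (Q g))) (T ψ)
    rw [h', hQ.comm]
  · show T (star (star (b (freqProj true g))) ψ) = star (star (b (freqProj true (Q g)))) (T ψ)
    rw [star_star, star_star, h, hQ.comm]

theorem IsBog.apply_crWord (hQ : IsBog Q) (h : ∀ g ψ, T (b g ψ) = b (Q g) (T ψ))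
    (h' : ∀ g ψ, T (star (b g) ψ) = star (b (Q g)) (T ψ)) (w : List Mode) (ψ : H) :
    T (crWord b w ψ) = crWord b (w.map (modeMap Q)) (T ψ) := by
  induction w with
  | nil => simp
  | cons i w ih =>
    rw [crWord_cons, List.map_cons, crWord_cons]
    rw [mul_apply_eq_comp, mul_apply_eq_comp, hQ.apply_cr h h', ih]

theorem IsBog.apply_isVac (hQ : IsBog Q) (h : ∀ g ψ, T (b g ψ) = b (Q g) (T ψ))
    (h' : ∀ g ψ, T (star (b g) ψ) = star (b (Q g)) (T ψ)) {φ : H} (hφ : IsVac b φ) :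
    IsVac b (T φ) := by
  rintro ⟨σ, g⟩
  obtain ⟨g', rfl⟩ := hQ.surj g
  have := hQ.apply_ann h h' (σ, g') φ
  rw [hφ, _root_.map_zero] at this
  exact this.symm

end Covariance

/-- The vectors annihilated by all annihilation operators. -/
def vacSpace {H : Type u} [NormedAddCommGroup H] [InnerProductSpace ℂ H] [CompleteSpace H]
    (b : K → H →L[ℂ] H) : Submodule ℂ H where
  carrier := {φ | IsVac b φ}
  zero_mem' i := _root_.map_zero _
  add_mem' h h' i := by rw [_root_.map_add, h i, h' i, add_zero]
  smul_mem' c φ h i := by rw [_root_.map_smul, h i, smul_zero]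

theorem isClosed_vacSpace {H : Type u} [NormedAddCommGroup H] [InnerProductSpace ℂ H]
    [CompleteSpace H] (b : K → H →L[ℂ] H) : IsClosed (vacSpace b : Set H) := by
  show IsClosed {φ | ∀ i, star (cr b i) φ = 0}
  rw [Set.ofPred_forall]
  exact isClosed_iInter fun i => isClosed_eq (star (cr b i)).continuous continuous_const

theorem one_le_energy (v : Hyp) : 1 ≤ v.1 0 := by
  obtain ⟨h1, h2⟩ := v.2
  unfold mdot at h1
  nlinarith [sq_nonneg (v.1 1), sq_nonneg (v.1 2), sq_nonneg (v.1 3)]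

section Positive

variable {H : Type u} [NormedAddCommGroup H] [InnerProductSpace ℂ H] [CompleteSpace H]
  {b : K → H →L[ℂ] H} {U : TranslationRep H} {m : ℝ}

/-- The vectors orthogonal to all vectors created from vacuum vectors. -/
def vacComplement (b : K → H →L[ℂ] H) : Submodule ℂ H where
  carrier := {u | ∀ p : List Mode × vacSpace b, inner ℂ (crWord b p.1 p.2.1) u = 0}
  zero_mem' p := inner_zero_right _
  add_mem' h h' p := by rw [inner_add_right, h p, h' p, add_zero]
  smul_mem' c u h p := by rw [inner_smul_right, h p, mul_zero]

theorem isClosed_vacComplement (b : K → H →L[ℂ] H) : IsClosed (vacComplement b : Set H) := by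
  show IsClosed {u | ∀ p : List Mode × vacSpace b, inner ℂ (crWord b p.1 p.2.1) u = 0}
  rw [Set.ofPred_forall]
  exact isClosed_iInter fun p => isClosed_eq (by fun_prop) continuous_const

theorem ann_mem_vacComplement (i : Mode) {u : H} (hu : u ∈ vacComplement b) :
    star (cr b i) u ∈ vacComplement b := by
  intro p
  rw [ContinuousLinearMap.star_eq_adjoint, ContinuousLinearMap.adjoint_inner_right]
  have := hu (i :: p.1, p.2)
  rwa [crWord_cons] at this

theorem TranslationRep.mem_vacComplement
    (hcov : ∀ x g ψ, U.U x (b g ψ) = b (R m x g) (U.U x ψ)) (x : Spacetime) {u : H}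
    (hu : u ∈ vacComplement b) : U.U x u ∈ vacComplement b := by
  intro p
  have h1 : U.U x = ContinuousLinearMap.adjoint (U.U (-x)) := by
    rw [← ContinuousLinearMap.star_eq_adjoint, U.star_eq, neg_neg]
  rw [h1, ContinuousLinearMap.adjoint_inner_right,
    (isBog_R m (-x)).apply_crWord (hcov (-x)) (U.covariant_star hcov (-x))]
  exact hu (p.1.map (modeMap (R m (-x))), ⟨U.U (-x) p.2.1,
    (isBog_R m (-x)).apply_isVac (hcov (-x)) (U.covariant_star hcov (-x)) p.2.2⟩)

theorem eq_zero_of_energy_lt (hm : 0 < m) (hb : IsCAR b) (hU : U.SpectrumInForwardCone)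
    (hcov : ∀ x g ψ, U.U x (b g ψ) = b (R m x g) (U.U x ψ)) (n : ℕ) :
    ∀ (E : ℝ), E < n * m → ∀ u ∈ vacComplement b, U.SpecIn {p | p 0 ≤ E} u → u = 0 := by
  induction n with
  | zero =>
    intro E hE u _ hs
    exact U.eq_zero_of_specIn hU (by simpa using hE) hs
  | succ n ih =>
    intro E hE u hu hs
    have hv : IsVac b u := by
      intro i
      refine ih (E - m) (by push_cast at hE; linarith) _ (ann_mem_vacComplement i hu) ?_
      refine hs.ann hb hcov (fun p hp v => ?_) i
      have h1 : p 0 ≤ E := hp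
      have h2 := one_le_energy v
      show p 0 + (-m) * v.1 0 ≤ E - m
      nlinarith
    have h1 := hu ([], ⟨u, hv⟩)
    rw [crWord_nil, one_apply_eq_self] at h1
    exact inner_self_eq_zero.1 h1

theorem total_of_positive_energy (hm : 0 < m) (hb : IsCAR b) (hU : U.SpectrumInForwardCone)
    (hcov : ∀ x g ψ, U.U x (b g ψ) = b (R m x g) (U.U x ψ)) :
    Dense (Submodule.span ℂ (Set.range fun p : List Mode × vacSpace b =>
      crWord b p.1 p.2.1) : Set H) := by
  refine total_of_orthogonal fun u hu => ?_
  replace hu : u ∈ vacComplement b := hu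
  obtain ⟨ψ, hψ, h⟩ := U.exists_bounded_energy u
  have h0 : ∀ n, ψ n = 0 := by
    intro n
    obtain ⟨f, hf, N, hN⟩ := h n
    obtain ⟨k, hk⟩ := exists_nat_gt ((N : ℝ) / m)
    refine eq_zero_of_energy_lt hm hb hU hcov k N ((div_lt_iff₀ hm).1 hk) _ ?_ hN
    rw [hf]
    exact U.smear_mem (isClosed_vacComplement b) (fun x ψ hψ => U.mem_vacComplement hcov x hψ) f hu
  rw [funext h0] at hψ
  exact tendsto_nhds_unique hψ tendsto_const_nhds

/-- Restriction of translations to an invariant subspace. -/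
def TranslationRep.restrict (U : TranslationRep H) (M : Submodule ℂ H) [CompleteSpace M]
    (hM : ∀ x, ∀ ψ ∈ M, U.U x ψ ∈ M) : TranslationRep M :=
  .ofIsometry (fun x => ⟨(U.U x).toLinearMap.restrict (hM x), fun ψ => U.norm_map x ψ.1⟩)
    (fun ψ => Subtype.ext (U.zero_apply ψ.1)) (fun x y ψ => Subtype.ext (U.add_apply x y ψ.1))
    (fun ψ => (U.continuous ψ.1).subtype_mk _)

theorem TranslationRep.restrict_spectrum (hU : U.SpectrumInForwardCone) (M : Submodule ℂ H)
    [CompleteSpace M] (hM : ∀ x, ∀ ψ ∈ M, U.U x ψ ∈ M) :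
    (U.restrict M hM).SpectrumInForwardCone := by
  intro f hf ψ
  refine Subtype.ext ?_
  have h1 := M.subtypeₗᵢ.integral_comp_comm (fun x => f x • (U.restrict M hM).U x ψ) (μ := volume)
  exact h1.symm.trans (hU f hf ψ.1)

end Positive

theorem intertwine_of_total {H : Type u} [NormedAddCommGroup H] [InnerProductSpace ℂ H] {H' : Type v}
    [NormedAddCommGroup H'] [InnerProductSpace ℂ H'] {X : Type*} {x : X → H}
    (hx : Dense (Submodule.span ℂ (Set.range x) : Set H)) (T : H ≃ₗᵢ[ℂ] H') {A : H →L[ℂ] H}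
    {A' : H' →L[ℂ] H'} (h : ∀ i, T (A (x i)) = A' (T (x i))) (ξ : H) : T (A ξ) = A' (T ξ) :=
  congrArg (fun S => S ξ) (clm_ext_of_total hx
    (A := (T.toLinearIsometry.toContinuousLinearMap : H →L[ℂ] H') ∘L A)
    (B := A' ∘L (T.toLinearIsometry.toContinuousLinearMap : H →L[ℂ] H')) h)

section Intertwine

variable {H : Type u} [NormedAddCommGroup H] [InnerProductSpace ℂ H] [CompleteSpace H]
  {H' : Type v} [NormedAddCommGroup H'] [InnerProductSpace ℂ H'] [CompleteSpace H']

theorem intertwine_star (T : H ≃ₗᵢ[ℂ] H') {A : H →L[ℂ] H} {A' : H' →L[ℂ] H'}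
    (h : ∀ ξ, T (A ξ) = A' (T ξ)) (ξ : H) : T (star A ξ) = star A' (T ξ) := by
  refine ext_inner_left ℂ fun v => ?_
  obtain ⟨u, rfl⟩ := T.surjective v
  rw [LinearIsometryEquiv.inner_map_map, ContinuousLinearMap.star_eq_adjoint,
    ContinuousLinearMap.star_eq_adjoint, ContinuousLinearMap.adjoint_inner_right,
    ContinuousLinearMap.adjoint_inner_right, ← h, LinearIsometryEquiv.inner_map_map]

theorem intertwine_field {b : K → H →L[ℂ] H} {b' : K → H' →L[ℂ] H'} (hb : IsCAR b)
    (hb' : IsCAR b') {X : Type*} {φ : X → H} {φ' : X → H'}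
    (hx : Dense (Submodule.span ℂ
      (Set.range fun p : List Mode × X => crWord b p.1 (φ p.2)) : Set H))
    (T : H ≃ₗᵢ[ℂ] H') (h : ∀ w x, T (crWord b w (φ x)) = crWord b' w (φ' x)) (g : K) (ξ : H) :
    T (b g ξ) = b' g (T ξ) := by
  have hcr : ∀ i ξ, T (cr b i ξ) = cr b' i (T ξ) := fun i =>
    intertwine_of_total hx T fun p => by
      have h1 := h (i :: p.1) p.2
      rw [crWord_cons, crWord_cons] at h1
      rw [h]
      exact h1
  rw [hb.eq_cr g, hb'.eq_cr g, _root_.add_apply, _root_.add_apply, _root_.map_add,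
    intertwine_star T (hcr _), hcr]

theorem unitarilyEquiv_of_generators {e : ℝ} {π : FieldAlg e →⋆ₐ[ℂ] (H →L[ℂ] H)}
    {π' : FieldAlg e →⋆ₐ[ℂ] (H' →L[ℂ] H')} (T : H ≃ₗᵢ[ℂ] H')
    (hW : ∀ V ξ, T (weylOp π V ξ) = weylOp π' V (T ξ))
    (hB : ∀ g ξ, T (π (FieldAlg.B e g) ξ) = π' (FieldAlg.B e g) (T ξ)) : UnitarilyEquiv π π' := by
  have h3 : conjRep T π = π' := by
    refine rep_ext (fun V => ?_) fun g => ?_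
    · refine ContinuousLinearMap.ext fun ψ => ?_
      rw [conjRep_apply]
      refine (hW V (T.symm ψ)).trans ?_
      rw [T.apply_symm_apply]
      rfl
    · refine ContinuousLinearMap.ext fun ψ => ?_
      rw [conjRep_apply, hB, T.apply_symm_apply]
  refine ⟨T, fun A ξ => ?_⟩
  have h4 := conjRep_apply T π A (T ξ)
  rw [T.symm_apply_apply, h3] at h4
  exact h4.symm

end Intertwine

section Structure

variable {e m : ℝ} {H : Type u} [NormedAddCommGroup H] [InnerProductSpace ℂ H] [CompleteSpace H]
  (π : FieldAlg e →⋆ₐ[ℂ] (H →L[ℂ] H))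

theorem isCAR_rep : IsCAR fun g => π (FieldAlg.B e g) :=
  isCAR_B (B_mem e) (π.comp (CAR e).subtype)

theorem weylOp_field (V : testFields) (g : K) (ψ : H) :
    weylOp π V (π (FieldAlg.B e g) ψ) = π (FieldAlg.B e (S e V g)) (weylOp π V ψ) := by
  have := congrArg (fun a => π a ψ) (FieldAlg.W_B V g)
  simp only [map_mul] at this
  exact this

theorem weylOp_star_field (V : testFields) (g : K) (ψ : H) :
    weylOp π V (star (π (FieldAlg.B e g)) ψ) = star (π (FieldAlg.B e (S e V g))) (weylOp π V ψ) := by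
  have := congrArg (fun a => π a ψ) (FieldAlg.W_Bs V g)
  simp only [map_mul, map_star] at this
  exact this

/-- The subspace of vacuum vectors of a representation of the field algebra. -/
abbrev repVac : Submodule ℂ H := vacSpace fun g => π (FieldAlg.B e g)

instance : CompleteSpace (repVac π) := (isClosed_vacSpace _).completeSpace_coe

theorem weylOp_mem_repVac (V : testFields) {φ : H} (hφ : φ ∈ repVac π) :
    weylOp π V φ ∈ repVac π :=
  (isBog_S e V).apply_isVac (weylOp_field π V) (weylOp_star_field π V) hφ

theorem CCR_mem_repVac (a : CCR e) {φ : H} (hφ : φ ∈ repVac π) : π a.1 φ ∈ repVac π :=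
  CCR_mem_invariant (π.comp (CCR e).subtype) (isClosed_vacSpace _)
    (fun V _ hψ => weylOp_mem_repVac π V hψ) a hφ

/-- The representation of the Weyl algebra on the vacuum vectors. -/
def vacRep : CCR e →⋆ₐ[ℂ] (repVac π →L[ℂ] repVac π) :=
  restrictRep (π.comp (CCR e).subtype) (repVac π) fun a _ hψ => CCR_mem_repVac π a hψ

variable {π}

theorem covariant_field {U : TranslationRep H}
    (hcov : ∀ x A, π (alpha e m x A) = U.U x * π A * U.U (-x)) (x : Spacetime) (g : K) (ψ : H) :
    U.U x (π (FieldAlg.B e g) ψ) = π (FieldAlg.B e (R m x g)) (U.U x ψ) := by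
  have h1 := congrArg (fun T => T (U.U x ψ)) (hcov x (FieldAlg.B e g))
  simp only [alpha_B] at h1
  refine Eq.trans ?_ h1.symm
  show _ = U.U x (π _ (U.U (-x) (U.U x ψ)))
  rw [← U.add_apply, neg_add_cancel, U.zero_apply]

theorem vacRep_borchers (h : Borchers m π) : BorchersCCR m (vacRep π) := by
  obtain ⟨U, hU, hcov⟩ := h
  have hM : ∀ x, ∀ ψ ∈ repVac π, U.U x ψ ∈ repVac π := fun x ψ hψ =>
    (isBog_R m x).apply_isVac (covariant_field hcov x) (U.covariant_star (covariant_field hcov) x) hψ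
  refine ⟨U.restrict _ hM, U.restrict_spectrum hU _ hM, fun x A => ?_⟩
  refine ContinuousLinearMap.ext fun φ => Subtype.ext ?_
  exact congrArg (fun T => T φ.1) (hcov x A.1)

variable {HF : Type v} [NormedAddCommGroup HF] [InnerProductSpace ℂ HF] [CompleteSpace HF]

theorem exists_repVac_isometry (F : FockRep e HF) : ∃ T : HTensor HF (repVac π) →ₗᵢ[ℂ] H,
    ∀ (w : List Mode) (φ : repVac π),
      T (crWord (fun g => amp (repVac π) (F.field g)) w (htmul F.Ω φ))
        = crWord (fun g => π (FieldAlg.B e g)) w φ.1 := by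
  obtain ⟨T, hT⟩ := exists_isometry_of_gram
    (fun p : List Mode × repVac π => crWord (fun g => amp (repVac π) (F.field g)) p.1 (htmul F.Ω p.2))
    (fun p : List Mode × repVac π => crWord (fun g => π (FieldAlg.B e g)) p.1 p.2.1)
    (fun p q => by
      have h1 : inner ℂ (htmul F.Ω p.2) (htmul F.Ω q.2) = inner ℂ p.2.1 q.2.1 := by
        rw [inner_htmul, inner_self_eq_norm_sq_to_K, F.norm_Ω]
        simp
      have h2 := gram_eq (F.isCAR.map (amp (repVac π))) (isCAR_rep π) id (fun _ _ => rfl)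
        (F.isFock.vac_tensor p.2) (F.isFock.vac_tensor q.2) p.2.2 q.2.2 h1 p.1 q.1
      rwa [List.map_id, List.map_id] at h2)
    F.isFock.total_tensor
  exact ⟨T, fun w φ => hT (w, φ)⟩

theorem exists_repVac_equiv (hm : 0 < m) (hb : Borchers m π) (F : FockRep e HF) :
    ∃ T : HTensor HF (repVac π) ≃ₗᵢ[ℂ] H, ∀ (w : List Mode) (φ : repVac π),
      T (crWord (fun g => amp (repVac π) (F.field g)) w (htmul F.Ω φ))
        = crWord (fun g => π (FieldAlg.B e g)) w φ.1 := by
  obtain ⟨U, hU, hcov⟩ := hb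
  obtain ⟨T, hT⟩ := exists_repVac_isometry (π := π) F
  have h1 := total_of_positive_energy hm (isCAR_rep π) hU (covariant_field hcov)
  have hs : Function.Surjective T := by
    have h2 : IsClosed (Set.range T) := T.isometry.isClosedEmbedding.isClosed_range
    have h3 : (Submodule.span ℂ (Set.range fun p : List Mode × repVac π =>
        crWord (fun g => π (FieldAlg.B e g)) p.1 p.2.1) : Set H) ⊆ Set.range T := by
      have : Submodule.span ℂ (Set.range fun p : List Mode × repVac π =>
          crWord (fun g => π (FieldAlg.B e g)) p.1 p.2.1) ≤ LinearMap.range T.toLinearMap := by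
        rw [Submodule.span_le]
        rintro _ ⟨p, rfl⟩
        exact ⟨_, hT p.1 p.2⟩
      exact this
    rw [← Set.range_eq_univ, ← h2.closure_eq]
    exact (h1.mono h3).closure_eq
  exact ⟨LinearIsometryEquiv.ofSurjective T hs, hT⟩

theorem weylOp_vacWord {F : FockRep e HF}
    {π' : FieldAlg e →⋆ₐ[ℂ] (HTensor HF (repVac π) →L[ℂ] HTensor HF (repVac π))}
    (h : IsProductRep F (vacRep π) π') (V : testFields) (w : List Mode) (φ : repVac π) :
    weylOp π' V (crWord (fun g => amp (repVac π) (F.field g)) w (htmul F.Ω φ))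
      = crWord (fun g => amp (repVac π) (F.field g)) (w.map (modeMap (S e V)))
          (htmul F.Ω (weylOpCCR (vacRep π) V φ)) := by
  rw [crWord_map, amp_htmul, h.weyl_htmul, crWord_map, amp_htmul]
  exact congrArg (fun ψ => htmul ψ (weylOpCCR (vacRep π) V φ)) (F.isFock.Γ_word (isBog_S e V) w)

theorem weylOp_repWord (V : testFields) (w : List Mode) (φ : repVac π) :
    weylOp π V (crWord (fun g => π (FieldAlg.B e g)) w φ.1)
      = crWord (fun g => π (FieldAlg.B e g)) (w.map (modeMap (S e V)))
          (weylOpCCR (vacRep π) V φ).1 := by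
  rw [(isBog_S e V).apply_crWord (weylOp_field π V) (weylOp_star_field π V)]
  rfl

theorem IsProductRep.of_borchers (hm : 0 < m) (hb : Borchers m π) {F : FockRep e HF}
    {π' : FieldAlg e →⋆ₐ[ℂ] (HTensor HF (repVac π) →L[ℂ] HTensor HF (repVac π))}
    (h : IsProductRep F (vacRep π) π') : UnitarilyEquiv π' π := by
  obtain ⟨T, hT⟩ := exists_repVac_equiv hm hb F
  refine unitarilyEquiv_of_generators T (fun V => ?_) fun g => ?_
  · exact intertwine_of_total (x := fun p : List Mode × repVac π =>
      crWord (fun g => amp (repVac π) (F.field g)) p.1 (htmul F.Ω p.2)) F.isFock.total_tensor T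
      fun p => by rw [weylOp_vacWord h, hT, hT, weylOp_repWord]
  · rw [h.field]
    exact intertwine_field (F.isCAR.map (amp (repVac π))) (isCAR_rep π)
      (φ := fun φ => htmul F.Ω φ) (φ' := fun φ : repVac π => φ.1) F.isFock.total_tensor T hT g

end Structure

end

end AsymptoticQED

theorem mainTheorem1 (e m : ℝ) (he : e ≠ 0) (hm : 0 < m) :
    (∃ (HF : Type) (_ : NormedAddCommGroup HF) (_ : InnerProductSpace ℂ HF)
        (_ : CompleteSpace HF), Nonempty (FockRep e HF)) ∧
    ∀ (HF : Type v) [NormedAddCommGroup HF] [InnerProductSpace ℂ HF] [CompleteSpace HF]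
      (F : FockRep e HF),
      (∀ (H : Type u) [NormedAddCommGroup H] [InnerProductSpace ℂ H] [CompleteSpace H]
        (π : FieldAlg e →⋆ₐ[ℂ] (H →L[ℂ] H)),
        Borchers m π ↔
          ∃ (Hr : Type u) (_ : NormedAddCommGroup Hr) (_ : InnerProductSpace ℂ Hr)
            (_ : CompleteSpace Hr) (πr : CCR e →⋆ₐ[ℂ] (Hr →L[ℂ] Hr))
            (π' : FieldAlg e →⋆ₐ[ℂ] (HTensor HF Hr →L[ℂ] HTensor HF Hr)),
            BorchersCCR m πr ∧ IsProductRep F πr π' ∧ UnitarilyEquiv π π') ∧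
      (∀ (Hr : Type u) [NormedAddCommGroup Hr] [InnerProductSpace ℂ Hr] [CompleteSpace Hr]
        (πr : CCR e →⋆ₐ[ℂ] (Hr →L[ℂ] Hr)), BorchersCCR m πr →
        (∃! π', IsProductRep F πr π') ∧
        ∀ π', IsProductRep F πr π' →
          GaussConstraint F πr π' ∧
          ∀ (H : Type w) [NormedAddCommGroup H] [InnerProductSpace ℂ H] [CompleteSpace H]
            (π : FieldAlg e →⋆ₐ[ℂ] (H →L[ℂ] H)), UnitarilyEquiv π π' →
            (IsIrreducibleRep π ↔ IsIrreducibleRep πr) ∧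
            (IsRegularRep (weylOp π) ↔ IsRegularRep (weylOpCCR πr))) := by
  refine ⟨exists_fockRep he, fun HF _ _ _ F => ⟨fun H _ _ _ π => ⟨fun hb => ?_, ?_⟩,
    fun Hr _ _ _ πr hb => ⟨?_, fun π' h => ⟨h.gaussConstraint, fun H _ _ _ π hU => ⟨⟨fun hi => ?_,
      fun hi => ?_⟩, ⟨fun hi => ?_, fun hi => ?_⟩⟩⟩⟩⟩⟩
  · obtain ⟨π', h⟩ := exists_isProductRep he F (vacRep π)
    exact ⟨repVac π, inferInstance, inferInstance, inferInstance, vacRep π, π', vacRep_borchers hb, h,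
      (h.of_borchers hm hb).symm⟩
  · rintro ⟨Hr, _, _, _, πr, π', hb, h, hU⟩
    exact (h.borchers hm hb).of_equiv hU
  · obtain ⟨π', h⟩ := exists_isProductRep he F πr
    exact ⟨π', h, fun π'' h' => h.unique h'⟩
  · exact h.of_irreducible (hU.irreducible hi)
  · exact hU.symm.irreducible (h.irreducible_of hi)
  · exact h.regular_iff.1 (hU.regular hi)
  · exact hU.symm.regular (h.regular_iff.2 hi)
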